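/- **Setting.** Let $T>0$ and let $I=\bigcup_{t\in[0,T]}I_t\times\{t\}$ be a smoothly evolving simple closed curve in $\mathbb R^2$ moving by curve-shortening flow (its normal velocity equals its curvature vector). Let $U_t$ be the bounded domain enclosed by $I_t$, $d_I(\cdot,t)$ the signed distance to $I_t$, positive in $U_t$, and $I_t(\delta)=\{|d_I(\cdot,t)|<\delta\}$. Let $\delta_0\in(0,1)$ be such that for every $t\in[0,T]$ the nearest-point projection $P_I(\cdot,t)$ onto $I_t$ is well defined and smooth on $I_t(4\delta_0)$. Let $\phi\ge 0$ be a smooth even function on $\mathbb R$, non-increasing on $[0,1]$, with $\phi>0$ on $(-1,1)$, $\phi=0$ outside $(-1,1)$ and $1-4r^2\le\phi(r)\le 1-\tfrac12 r^2$ for $|r|\le\tfrac12$; let $\eta_0:[0,T]\times\mathbb R^2\to[0,1]$ be smooth with $\eta_0(t,\cdot)$ compactly supported in $I_t(2\delta_0)$ and equal to $1$ in $I_t(\delta_0)$. Put $$\boldsymbol\xi=\phi\big(d_I/\delta_0\big)\nabla d_I,\qquad \mathbf H(x,t)=-\Delta d_I(P_I(x,t),t)\,\eta_0(x,t)\,\nabla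 d_I(x,t).$$ Let $F(\mathbf u)=f(|\mathbf u|)=\tfrac12 g(|\mathbf u|)^2$, where $g\ge0$ is locally Lipschitz on $[0,\infty)$, $g(0)=g(1)=0$, $\int_0^1 g\,ds=1$; $f\in C^\infty([0,\infty))$, $f>0$ on $(0,\infty)\setminus\{1\}$; there is $s_0\in(0,1)$ with $f'>0$ on $(0,s_0)$ and $f'<0$ on $(s_0,1)$; $f'(0)=f'(1)=0$, $f''(0),f''(1)>0$; and there is $c_0>0$ with $f(s)\ge 2c_0^2s^2$ for $s\ge2$. Let $\mu>0$ and $c_1>0$. For a smooth bounded domain $\Omega\subset\mathbb R^2$ containing all $I_t$, with $\operatorname{dist}(I_t,\partial\Omega)\ge4\delta_0$ for $t\in[0,T]$, for $\varepsilon>0$ and $\mathbf v\in H^1(\Omega;\mathbb R^2)$ set $\psi[\mathbf v]=\int_0^{|\mathbf v|}g(s)\,ds$ and $$A_\varepsilon(\mathbf v)=\int_\Omega\Big(\tfrac\varepsilon2\mu|\operatorname{div}\mathbf v|^2+\tfrac\varepsilon2|\nabla\mathbf v|^2+\tfrac1\varepsilon F(\mathbf v)\Big)dx,$$ $$E_\varepsilon[\mathbf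 v|I](t)=\int_\Omega\Big(\tfrac\varepsilon2\mu|\operatorname{div}\mathbf v|^2+\tfrac\varepsilon2|\nabla\mathbf v|^2+\tfrac1\varepsilon F(\mathbf v)-\boldsymbol\xi(\cdot,t)\cdot\nabla\psi[\mathbf v]\Big)dx .$$ Call $\mathbf u_\varepsilon^{in}\in H^1(\Omega;\mathbb R^2)$ *well prepared* (for $\varepsilon$, with constant $c_1$) if: for some $\mathbf u^{in}\in H^1(\Omega;\mathbb S^1)$, $\mathbf u_\varepsilon^{in}=\mathbf u^{in}$ in $(\Omega\cap U_0)\setminus I_0(\delta_0)$ and $\mathbf u_\varepsilon^{in}=0$ in $\Omega\setminus(\overline{U_0}\cup I_0(\delta_0))$; $A_\varepsilon(\mathbf u_\varepsilon^{in})\le c_1$; $\|\mathbf u_\varepsilon^{in}\|_{L^\infty(\Omega)}\le1$; and $$E_\varepsilon[\mathbf u_\varepsilon^{in}|I](0)+\int_{I_0(\delta_0)}\big|\psi[\mathbf u_\varepsilon^{in}]-\mathbf 1_{U_0}\big|\,|d_I(\cdot,0)|\,dx\le c_1\varepsilon .$$ A *strong solution* on $[0,S]$ is $\mathbf u_\varepsilon\in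 C([0,S];H^1_0(\Omega))\cap L^2(0,S;H^2(\Omega))\cap H^1(0,S;L^2(\Omega))$ with $$\partial_t\mathbf u_\varepsilon-\mu\nabla\operatorname{div}\mathbf u_\varepsilon=\Delta\mathbf u_\varepsilon-\tfrac1{\varepsilon^2}\partial F(\mathbf u_\varepsilon)\ \text{ a.e. in }\Omega\times(0,S),\qquad \mathbf u_\varepsilon(\cdot,0)=\mathbf u_\varepsilon^{in}.$$ Write $\Pi_{\mathbf u}\mathbf w=\big(\mathbf w\cdot\tfrac{\mathbf u}{|\mathbf u|}\big)\tfrac{\mathbf u}{|\mathbf u|}$ if $\mathbf u\ne0$, and $\Pi_{\mathbf u}\mathbf w=0$ if $\mathbf u=0$. **Theorem.** There is a constant $C>0$, depending only on the evolving curve $I$ (with the choice of $\delta_0,\phi,\eta_0$), on $F$, $\mu$ and $c_1$, but not on $\varepsilon$, $\Omega$, $S$ or the data, such that for every such $\Omega$, every $\varepsilon>0$, every $S\in(0,T]$, and every strong solution $\mathbf u_\varepsilon$ on $[0,S]$ with well-prepared initial data, the integrand of $E_\varepsilon[\mathbf u_\varepsilon(\cdot,t)|I](t)$ is integrable for each $t\in[0,S]$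 and $$\sup_{t\in[0,S]}\varepsilon^{-1}E_\varepsilon[\mathbf u_\varepsilon(\cdot,t)|I](t)+\int_0^S\!\!\int_\Omega\big|\partial_t\mathbf u_\varepsilon+(\mathbf H\cdot\nabla)\mathbf u_\varepsilon\big|^2+\big|\partial_t\mathbf u_\varepsilon-\Pi_{\mathbf u_\varepsilon}\partial_t\mathbf u_\varepsilon\big|^2\,dx\,dt\le e^{(1+S)C}.$$ In particular this holds with $S=T$. -/

import Mathlib

open MeasureTheory Set Filter Topology Metric
open scoped ContDiff

namespace AnisoGL

/-- The Euclidean plane. -/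
abbrev Plane : Type := EuclideanSpace ℝ (Fin 2)

/-- Standard basis vectors of the plane. -/
noncomputable def stdVec (i : Fin 2) : Plane := EuclideanSpace.single i 1

/-- Counterclockwise rotation by a right angle. -/
noncomputable def perp (v : Plane) : Plane := !₂[-v 1, v 0]

/-! ### Domains and weak derivatives -/

/-- Bounded domain (open connected non-empty set) of the plane with smooth boundary. -/
structure IsSmoothBoundedDomain (Ω : Set Plane) : Prop where
  isOpen : IsOpen Ω
  isConnected : IsConnected Ω
  isBounded : Bornology.IsBounded Ω
  smooth_boundary : ∀ p ∈ frontier Ω, ∃ (V : Set Plane) (ρ : Plane → ℝ),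
    IsOpen V ∧ p ∈ V ∧ ContDiffOn ℝ ∞ ρ V ∧ (∀ x ∈ V, fderiv ℝ ρ x ≠ 0) ∧
      ∀ x ∈ V, x ∈ Ω ↔ ρ x < 0

section Weak

variable {F : Type*} [NormedAddCommGroup F] [NormedSpace ℝ F]

/-- `G` is the weak gradient (differential) of `v` on the open set `Ω`; thus `G x e` is the weak
derivative of `v` in the direction `e`. -/
structure IsWeakGrad (Ω : Set Plane) (v : Plane → F) (G : Plane → Plane →L[ℝ] F) : Prop where
  locallyIntegrable : LocallyIntegrableOn v Ω
  locallyIntegrable_grad : LocallyIntegrableOn G Ω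
  integral_eq : ∀ ζ : Plane → ℝ, ContDiff ℝ ∞ ζ → HasCompactSupport ζ → tsupport ζ ⊆ Ω →
    ∀ e : Plane, ∫ x in Ω, (fderiv ℝ ζ x e) • v x = - ∫ x in Ω, ζ x • G x e

open Classical in
/-- The weak gradient of `v` on `Ω` (unique up to null sets), and `0` if there is none. -/
noncomputable def weakGrad (Ω : Set Plane) (v : Plane → F) : Plane → Plane →L[ℝ] F :=
  if h : ∃ G, IsWeakGrad Ω v G then h.choose else 0

/-- The Sobolev space `H¹(Ω; F)`. -/
structure MemH1 (Ω : Set Plane) (v : Plane → F) : Prop where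
  memLp : MemLp v 2 (volume.restrict Ω)
  hasWeakGrad : IsWeakGrad Ω v (weakGrad Ω v)
  memLp_grad : MemLp (weakGrad Ω v) 2 (volume.restrict Ω)

/-- The Sobolev space `H¹₀(Ω; F)`: the closure of the smooth compactly supported functions
in `H¹(Ω; F)`. -/
structure MemH10 (Ω : Set Plane) (v : Plane → F) : Prop where
  memH1 : MemH1 Ω v
  approx : ∃ ζ : ℕ → Plane → F,
    (∀ n, ContDiff ℝ ∞ (ζ n) ∧ HasCompactSupport (ζ n) ∧ tsupport (ζ n) ⊆ Ω) ∧
    Tendsto (fun n => eLpNorm (ζ n - v) 2 (volume.restrict Ω)) atTop (𝓝 0) ∧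
    Tendsto (fun n => eLpNorm (fderiv ℝ (ζ n) - weakGrad Ω v) 2 (volume.restrict Ω)) atTop (𝓝 0)

/-- Lebesgue measure on the space-time cylinder `(0, S) × Ω`. -/
noncomputable def cylinderMeasure (Ω : Set Plane) (S : ℝ) : Measure (ℝ × Plane) :=
  (volume.restrict (Ioo 0 S)).prod (volume.restrict Ω)

/-- `ut` is the weak time derivative of `u` on `(0, S) × Ω`, both being square integrable. -/
structure IsWeakTimeDeriv (Ω : Set Plane) (S : ℝ) (u ut : ℝ → Plane → F) : Prop where
  memLp : MemLp (Function.uncurry u) 2 (cylinderMeasure Ω S)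
  memLp_deriv : MemLp (Function.uncurry ut) 2 (cylinderMeasure Ω S)
  integral_eq : ∀ ζ : ℝ × Plane → ℝ, ContDiff ℝ ∞ ζ → HasCompactSupport ζ →
    tsupport ζ ⊆ Ioo 0 S ×ˢ Ω →
    ∫ p, (fderiv ℝ ζ p (1, 0)) • u p.1 p.2 ∂(cylinderMeasure Ω S)
      = - ∫ p, ζ p • ut p.1 p.2 ∂(cylinderMeasure Ω S)

end Weak

/-- Squared Frobenius norm of a `2 × 2` matrix. -/
noncomputable def frobSq (A : Plane →L[ℝ] Plane) : ℝ := ∑ i, ‖A (stdVec i)‖ ^ 2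

/-- Divergence, as a function of the gradient `A = ∇v` (so that `A eᵢ = ∂ᵢ v`). -/
noncomputable def divOf (A : Plane →L[ℝ] Plane) : ℝ := ∑ i, A (stdVec i) i

/-- Laplacian `∑ᵢ ∂ᵢ∂ᵢ v`, as a function of the second derivative `B` (`B eₖ eᵢ = ∂ₖ∂ᵢ v`). -/
noncomputable def lapOf (B : Plane →L[ℝ] Plane →L[ℝ] Plane) : Plane :=
  ∑ i, B (stdVec i) (stdVec i)

/-- `∇ div v`, as a function of the second derivative `B` (`B eₖ eᵢ = ∂ₖ∂ᵢ v`). -/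
noncomputable def gradDivOf (B : Plane →L[ℝ] Plane →L[ℝ] Plane) : Plane :=
  ∑ k, divOf (B (stdVec k)) • stdVec k

/-! ### The potential -/

/-- Structural assumptions on `F(u) = f(|u|) = g(|u|)² / 2`; `f` and `g` are functions on
`[0, ∞)` and only their values there matter. -/
structure IsAdmissiblePotential (f g : ℝ → ℝ) : Prop where
  f_eq : ∀ s, 0 ≤ s → f s = g s ^ 2 / 2
  g_nonneg : ∀ s, 0 ≤ s → 0 ≤ g s
  g_lipschitz : LocallyLipschitzOn (Ici 0) g
  g_zero : g 0 = 0
  g_one : g 1 = 0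
  f_smooth : ContDiffOn ℝ ∞ f (Ici 0)
  f_pos : ∀ s, 0 < s → s ≠ 1 → 0 < f s
  f_monotone : ∃ s₀ ∈ Ioo (0 : ℝ) 1, (∀ s ∈ Ioo 0 s₀, 0 < derivWithin f (Ici 0) s) ∧
    ∀ s ∈ Ioo s₀ 1, derivWithin f (Ici 0) s < 0
  f_deriv_zero : derivWithin f (Ici 0) 0 = 0
  f_deriv_one : derivWithin f (Ici 0) 1 = 0
  f_deriv2_zero : 0 < iteratedDerivWithin 2 f (Ici 0) 0
  f_deriv2_one : 0 < iteratedDerivWithin 2 f (Ici 0) 1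
  f_growth : ∃ c₀ : ℝ, 0 < c₀ ∧ ∀ s, 2 ≤ s → 2 * c₀ ^ 2 * s ^ 2 ≤ f s
  g_normalized : ∫ s in (0 : ℝ)..1, g s = 1

/-- `F(v) = f(|v|)`. -/
noncomputable def potential (f : ℝ → ℝ) (v : Plane) : ℝ := f ‖v‖

/-- `ψ = ∫₀^{|v|} g(s) ds`. -/
noncomputable def psi (g : ℝ → ℝ) (v : Plane → Plane) (x : Plane) : ℝ :=
  ∫ s in (0 : ℝ)..‖v x‖, g s

/-! ### The moving curve -/

/-- A smoothly evolving simple closed curve on the time interval `[0, T]`, parametrized by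
`γ t : ℝ → Plane` with period `1`. -/
structure IsEvolvingCurve (T : ℝ) (γ : ℝ → ℝ → Plane) : Prop where
  smooth : ContDiffOn ℝ ∞ (Function.uncurry γ) (Icc 0 T ×ˢ univ)
  periodic : ∀ t ∈ Icc 0 T, Function.Periodic (γ t) 1
  immersed : ∀ t ∈ Icc 0 T, ∀ s, deriv (γ t) s ≠ 0
  simple : ∀ t ∈ Icc 0 T, InjOn (γ t) (Ico 0 1)

/-- Curve-shortening flow: the normal velocity is the normal component of the curvature vector
`∂²γ/∂σ²` (`σ` the arc length), whose normal component in a general parametrization is that of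
`∂ₛ²γ / |∂ₛγ|²`. -/
def IsCurveShortening (T : ℝ) (γ : ℝ → ℝ → Plane) : Prop :=
  ∀ t ∈ Icc 0 T, ∀ s,
    inner ℝ (derivWithin (fun τ => γ τ s) (Icc 0 T) t) (perp (deriv (γ t) s))
      = inner ℝ ((‖deriv (γ t) s‖ ^ 2)⁻¹ • deriv (deriv (γ t)) s) (perp (deriv (γ t) s))

/-- `U` is the domain enclosed by the closed curve `J`: the bounded domain with boundary `J`
(there is exactly one for a simple closed curve `J`). -/
structure IsEnclosedDomain (U J : Set Plane) : Prop where
  isOpen : IsOpen U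
  isConnected : IsConnected U
  isBounded : Bornology.IsBounded U
  frontier_eq : frontier U = J

open Classical in
/-- Signed distance to `J`, positive in the enclosed domain `U` and negative outside. -/
noncomputable def sdist (J U : Set Plane) (x : Plane) : ℝ :=
  if x ∈ U then infDist x J else -infDist x J

open Classical in
/-- Nearest-point projection onto `J` (meaningful where there is a unique nearest point). -/
noncomputable def nearestPt (J : Set Plane) (x : Plane) : Plane :=
  if h : ∃ y ∈ J, dist x y = infDist x J then h.choose else x

/-- The nearest-point projection onto `J` is well defined and smooth in the open
`r`-neighbourhood of `J`. -/
structure HasSmoothProjection (J : Set Plane) (r : ℝ) : Prop where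
  unique : ∀ x ∈ thickening r J, ∃! y, y ∈ J ∧ dist x y = infDist x J
  smooth : ContDiffOn ℝ ∞ (nearestPt J) (thickening r J)

/-- The cut-off profile `φ`. -/
structure IsProfile (φ : ℝ → ℝ) : Prop where
  smooth : ContDiff ℝ ∞ φ
  even : ∀ r, φ (-r) = φ r
  antitone : AntitoneOn φ (Icc 0 1)
  pos : ∀ r, |r| < 1 → 0 < φ r
  zero : ∀ r, 1 ≤ |r| → φ r = 0
  bounds : ∀ r, |r| ≤ 1 / 2 → 1 - 4 * r ^ 2 ≤ φ r ∧ φ r ≤ 1 - r ^ 2 / 2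

/-- The cut-off function `η₀`: for each `t ∈ [0, T]`, `η₀(t, ·)` is compactly supported in the
`2δ₀`-neighbourhood of `I_t` and equal to `1` in the `δ₀`-neighbourhood. -/
structure IsCutoff (T δ₀ : ℝ) (γ : ℝ → ℝ → Plane) (η : ℝ → Plane → ℝ) : Prop where
  smooth : ContDiffOn ℝ ∞ (Function.uncurry η) (Icc 0 T ×ˢ univ)
  mem_Icc : ∀ t ∈ Icc 0 T, ∀ x, η t x ∈ Icc (0 : ℝ) 1
  support : ∀ t ∈ Icc 0 T, tsupport (η t) ⊆ thickening (2 * δ₀) (range (γ t))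
  one : ∀ t ∈ Icc 0 T, ∀ x ∈ thickening δ₀ (range (γ t)), η t x = 1

/-- `ξ = φ(d_I / δ₀) ∇d_I`. -/
noncomputable def xiField (φ : ℝ → ℝ) (δ₀ : ℝ) (J U : Set Plane) (x : Plane) : Plane :=
  φ (sdist J U x / δ₀) • gradient (sdist J U) x

/-- The extended curvature vector `H = κ ∇d_I`, `κ(x) = -Δd_I(P_I(x)) η₀(x)`. -/
noncomputable def curvField (η : Plane → ℝ) (J U : Set Plane) (x : Plane) : Plane :=
  (-(Laplacian.laplacian (sdist J U) (nearestPt J x)) * η x) • gradient (sdist J U) x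

/-! ### Energies, initial data, solutions -/

/-- The integrand of the Ginzburg--Landau energy `A_ε`. -/
noncomputable def glDensity (Ω : Set Plane) (μ ε : ℝ) (f : ℝ → ℝ) (v : Plane → Plane)
    (x : Plane) : ℝ :=
  ε / 2 * μ * divOf (weakGrad Ω v x) ^ 2 + ε / 2 * frobSq (weakGrad Ω v x)
    + ε⁻¹ * potential f (v x)

/-- The Ginzburg--Landau energy `A_ε(v)`. -/
noncomputable def glEnergy (Ω : Set Plane) (μ ε : ℝ) (f : ℝ → ℝ) (v : Plane → Plane) : ℝ :=
  ∫ x in Ω, glDensity Ω μ ε f v x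

/-- The integrand of the modulated energy: that of `A_ε` minus `ξ · ∇ψ`. -/
noncomputable def modDensity (Ω : Set Plane) (μ ε : ℝ) (f g : ℝ → ℝ) (ξ : Plane → Plane)
    (v : Plane → Plane) (x : Plane) : ℝ :=
  glDensity Ω μ ε f v x - weakGrad Ω (psi g v) x (ξ x)

/-- The modulated energy `E_ε[v | I]` at one time. -/
noncomputable def modEnergy (Ω : Set Plane) (μ ε : ℝ) (f g : ℝ → ℝ) (ξ : Plane → Plane)
    (v : Plane → Plane) : ℝ :=
  ∫ x in Ω, modDensity Ω μ ε f g ξ v x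

/-- Well-prepared initial data relative to the initial curve `J` enclosing `U`. -/
structure IsWellPrepared (Ω : Set Plane) (μ ε c₁ δ₀ : ℝ) (f g φ : ℝ → ℝ) (J U : Set Plane)
    (uin : Plane → Plane) : Prop where
  memH1 : MemH1 Ω uin
  outer : ∃ v : Plane → Plane, MemH1 Ω v ∧ (∀ᵐ x ∂(volume.restrict Ω), ‖v x‖ = 1) ∧
    (∀ᵐ x ∂(volume.restrict Ω), x ∈ U → x ∉ thickening δ₀ J → uin x = v x) ∧
    (∀ᵐ x ∂(volume.restrict Ω), x ∉ closure U → x ∉ thickening δ₀ J → uin x = 0)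
  energy_le : glEnergy Ω μ ε f uin ≤ c₁
  norm_le : ∀ᵐ x ∂(volume.restrict Ω), ‖uin x‖ ≤ 1
  modEnergy_le : modEnergy Ω μ ε f g (xiField φ δ₀ J U) uin
    + ∫ x in thickening δ₀ J, |psi g uin x - U.indicator 1 x| * |sdist J U x| ≤ c₁ * ε

/-- `u` is a strong solution on `[0, S]`, with time derivative `ut`, of
`∂ₜu - μ ∇ div u = Δu - ε⁻² ∂F(u)` in `Ω`, `u = 0` on `∂Ω`, `u(0) = uin`, in the class
`C([0,S]; H¹₀) ∩ L²(0,S; H²) ∩ H¹(0,S; L²)`. -/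
structure IsStrongSolution (Ω : Set Plane) (S μ ε : ℝ) (f : ℝ → ℝ) (uin : Plane → Plane)
    (u ut : ℝ → Plane → Plane) : Prop where
  memH10 : ∀ t ∈ Icc 0 S, MemH10 Ω (u t)
  continuous_L2 : ∀ t₀ ∈ Icc 0 S,
    Tendsto (fun t => eLpNorm (u t - u t₀) 2 (volume.restrict Ω)) (𝓝[Icc 0 S] t₀) (𝓝 0)
  continuous_grad : ∀ t₀ ∈ Icc 0 S,
    Tendsto (fun t => eLpNorm (weakGrad Ω (u t) - weakGrad Ω (u t₀)) 2 (volume.restrict Ω))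
      (𝓝[Icc 0 S] t₀) (𝓝 0)
  timeDeriv : IsWeakTimeDeriv Ω S u ut
  equation : ∃ (Du : ℝ → Plane → Plane →L[ℝ] Plane)
      (D2u : ℝ → Plane → Plane →L[ℝ] Plane →L[ℝ] Plane),
    MemLp (Function.uncurry Du) 2 (cylinderMeasure Ω S) ∧
    MemLp (Function.uncurry D2u) 2 (cylinderMeasure Ω S) ∧
    (∀ᵐ t ∂(volume.restrict (Ioo 0 S)),
      IsWeakGrad Ω (u t) (Du t) ∧ IsWeakGrad Ω (Du t) (D2u t)) ∧
    ∀ᵐ p ∂(cylinderMeasure Ω S),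
      ut p.1 p.2 - μ • gradDivOf (D2u p.1 p.2)
        = lapOf (D2u p.1 p.2) - (ε ^ 2)⁻¹ • gradient (potential f) (u p.1 p.2)
  initial : u 0 =ᵐ[volume.restrict Ω] uin

/-- `Π_v w`: the orthogonal projection of `w` onto the line spanned by `v`, `0` if `v = 0`. -/
noncomputable def projOnto (v w : Plane) : Plane :=
  inner ℝ w (‖v‖⁻¹ • v) • (‖v‖⁻¹ • v)

/-- `∫₀^S ∫_Ω |∂ₜu + (H·∇)u|² + |∂ₜu - Π_u ∂ₜu|² dx dt`, as an extended non-negative number. -/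
noncomputable def dissipation (Ω : Set Plane) (S : ℝ) (H : ℝ → Plane → Plane)
    (u ut : ℝ → Plane → Plane) : ENNReal :=
  ∫⁻ t in Ioo 0 S, ∫⁻ x in Ω,
    (‖ut t x + weakGrad Ω (u t) x (H t x)‖ₑ ^ 2 + ‖ut t x - projOnto (u t x) (ut t x)‖ₑ ^ 2)

end AnisoGL

namespace AnisoGL

noncomputable section

open Function (uncurry)

variable {t : ℝ} {Ω : Set Plane}

/-- Lebesgue measure on a subset of the plane. -/
local notation:max "vol(" Ω ")" => Measure.restrict (volume : Measure Plane) Ω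

/-! ### Linear algebra in the plane -/

theorem plane_inner (v w : Plane) : inner ℝ v w = v 0 * w 0 + v 1 * w 1 := by
  simp [PiLp.inner_apply, Fin.sum_univ_two, mul_comm]

theorem plane_norm_sq (v : Plane) : ‖v‖ ^ 2 = v 0 ^ 2 + v 1 ^ 2 := by
  rw [← real_inner_self_eq_norm_sq, plane_inner]; ring

@[simp] theorem perp_zero_apply (v : Plane) : perp v 0 = -v 1 := by simp [perp]
@[simp] theorem perp_one_apply (v : Plane) : perp v 1 = v 0 := by simp [perp]
@[simp] theorem stdVec_zero_zero : stdVec 0 0 = 1 := by simp [stdVec]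
@[simp] theorem stdVec_zero_one : stdVec 0 1 = 0 := by simp [stdVec]
@[simp] theorem stdVec_one_zero : stdVec 1 0 = 0 := by simp [stdVec]
@[simp] theorem stdVec_one_one : stdVec 1 1 = 1 := by simp [stdVec]

theorem plane_ext {v w : Plane} (h0 : v 0 = w 0) (h1 : v 1 = w 1) : v = w := by
  ext i; fin_cases i <;> assumption

/-- Rotation by a right angle as a continuous linear map. -/
def perpL : Plane →L[ℝ] Plane :=
  LinearMap.toContinuousLinearMap
    { toFun := perp
      map_add' := fun v w => plane_ext (by simp [add_comm]) (by simp)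
      map_smul' := fun c v => plane_ext (by simp) (by simp) }

@[simp] theorem perpL_apply (v : Plane) : perpL v = perp v := rfl

theorem norm_perp (v : Plane) : ‖perp v‖ = ‖v‖ := by
  have h : ‖perp v‖ ^ 2 = ‖v‖ ^ 2 := by rw [plane_norm_sq, plane_norm_sq]; simp; ring
  exact (sq_eq_sq₀ (norm_nonneg _) (norm_nonneg _)).1 h

theorem perp_perp (v : Plane) : perp (perp v) = -v := plane_ext (by simp) (by simp)

theorem inner_perp_self (v : Plane) : inner ℝ v (perp v) = 0 := by
  rw [plane_inner]; simp [mul_comm]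

theorem inner_perp_self_left (v : Plane) : inner ℝ (perp v) v = 0 := by
  rw [real_inner_comm, inner_perp_self]

theorem inner_perp_left (v w : Plane) : inner ℝ (perp v) w = -inner ℝ v (perp w) := by
  rw [plane_inner, plane_inner]; simp

theorem inner_perp_perp (v w : Plane) : inner ℝ (perp v) (perp w) = inner ℝ v w := by
  rw [plane_inner, plane_inner]; simp; ring

theorem perp_smul (c : ℝ) (v : Plane) : perp (c • v) = c • perp v := perpL.map_smul c v

theorem unit_coords {n : Plane} (hn : ‖n‖ = 1) : n 0 ^ 2 + n 1 ^ 2 = 1 := by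
  rw [← plane_norm_sq, hn, one_pow]

theorem frame_expand {n : Plane} (hn : ‖n‖ = 1) (v : Plane) :
    v = inner ℝ n v • n + inner ℝ (perp n) v • perp n := by
  have h := unit_coords hn
  apply plane_ext
  · simp [plane_inner]; linear_combination (-v 0) * h
  · simp [plane_inner]; linear_combination (-v 1) * h

theorem frame_norm_sq {n : Plane} (hn : ‖n‖ = 1) (v : Plane) :
    ‖v‖ ^ 2 = (inner ℝ n v) ^ 2 + (inner ℝ (perp n) v) ^ 2 := by
  have h := unit_coords hn
  rw [plane_norm_sq, plane_inner, plane_inner]; simp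
  linear_combination (-(v 0 ^ 2 + v 1 ^ 2)) * h

theorem frame_inner {n : Plane} (hn : ‖n‖ = 1) (v w : Plane) :
    inner ℝ v w = inner ℝ n v * inner ℝ n w + inner ℝ (perp n) v * inner ℝ (perp n) w := by
  have h := unit_coords hn
  simp only [plane_inner]; simp
  linear_combination (-(v 0 * w 0 + v 1 * w 1)) * h

theorem stdVec_zero_eq {n : Plane} (hn : ‖n‖ = 1) : stdVec 0 = n 0 • n - n 1 • perp n := by
  have h := unit_coords hn
  apply plane_ext
  · simp; linear_combination -h
  · simp; ring

theorem stdVec_one_eq {n : Plane} (hn : ‖n‖ = 1) : stdVec 1 = n 1 • n + n 0 • perp n := by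
  have h := unit_coords hn
  apply plane_ext
  · simp; ring
  · simp; linear_combination -h

theorem plane_expand (v : Plane) : v = v 0 • stdVec 0 + v 1 • stdVec 1 :=
  plane_ext (by simp) (by simp)

theorem sum_stdVec_inner {n : Plane} (hn : ‖n‖ = 1) (A B : Plane →L[ℝ] Plane) :
    ∑ i, inner ℝ (A (stdVec i)) (B (stdVec i))
      = inner ℝ (A n) (B n) + inner ℝ (A (perp n)) (B (perp n)) := by
  have h := unit_coords hn
  rw [Fin.sum_univ_two, stdVec_zero_eq hn, stdVec_one_eq hn]
  simp only [map_add, map_sub, map_smul, plane_inner]; simp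
  linear_combination ((A n) 0 * (B n) 0 + (A n) 1 * (B n) 1 + (A (perp n)) 0 * (B (perp n)) 0
    + (A (perp n)) 1 * (B (perp n)) 1) * h

theorem frobSq_eq_inner (A : Plane →L[ℝ] Plane) :
    frobSq A = ∑ i, inner ℝ (A (stdVec i)) (A (stdVec i)) := by
  simp [frobSq]

theorem frobSq_frame {n : Plane} (hn : ‖n‖ = 1) (A : Plane →L[ℝ] Plane) :
    frobSq A = ‖A n‖ ^ 2 + ‖A (perp n)‖ ^ 2 := by
  rw [frobSq_eq_inner, sum_stdVec_inner hn, real_inner_self_eq_norm_sq, real_inner_self_eq_norm_sq]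

theorem divOf_eq_inner (A : Plane →L[ℝ] Plane) :
    divOf A = ∑ i, inner ℝ (A (stdVec i)) (ContinuousLinearMap.id ℝ Plane (stdVec i)) := by
  simp [divOf, Fin.sum_univ_two, plane_inner]

theorem divOf_frame {n : Plane} (hn : ‖n‖ = 1) (A : Plane →L[ℝ] Plane) :
    divOf A = inner ℝ n (A n) + inner ℝ (perp n) (A (perp n)) := by
  rw [divOf_eq_inner, sum_stdVec_inner hn]
  simp [real_inner_comm]

theorem frobSq_nonneg (A : Plane →L[ℝ] Plane) : 0 ≤ frobSq A :=
  Finset.sum_nonneg fun _ _ => sq_nonneg _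

theorem norm_stdVec (i : Fin 2) : ‖stdVec i‖ = 1 := by simp [stdVec]

theorem norm_apply_sq_le (A : Plane →L[ℝ] Plane) (v : Plane) :
    ‖A v‖ ^ 2 ≤ frobSq A * ‖v‖ ^ 2 := by
  conv_lhs => rw [plane_expand v]
  rw [plane_norm_sq v, frobSq, Fin.sum_univ_two, plane_norm_sq, plane_norm_sq, plane_norm_sq]
  simp only [map_add, map_smul, PiLp.add_apply, PiLp.smul_apply, smul_eq_mul]
  nlinarith [sq_nonneg (v 0 * A (stdVec 1) 0 - v 1 * A (stdVec 0) 0),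
    sq_nonneg (v 0 * A (stdVec 1) 1 - v 1 * A (stdVec 0) 1)]

theorem divOf_sq_le (A : Plane →L[ℝ] Plane) : divOf A ^ 2 ≤ 2 * frobSq A := by
  rw [divOf, frobSq, Fin.sum_univ_two, Fin.sum_univ_two, plane_norm_sq, plane_norm_sq]
  nlinarith [sq_nonneg (A (stdVec 0) 0 - A (stdVec 1) 1), sq_nonneg (A (stdVec 0) 1),
    sq_nonneg (A (stdVec 1) 0)]

/-- The energy-stress tensor of the Ginzburg--Landau functional, for the gradient `q` and twice the
potential energy `P`, contracted with the gradient `B` of a vector field. -/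
def stress (μ : ℝ) (B q : Plane →L[ℝ] Plane) (P : ℝ) : ℝ :=
  divOf B * (μ / 2 * divOf q ^ 2 + frobSq q / 2 + P / 2)
    - ∑ j, inner ℝ (q (B (stdVec j))) (q (stdVec j)) - μ * divOf q * divOf (q ∘L B)

/-- The modulated energy density for the (scaled) gradient `q`, potential `G ^ 2 / 2` and
direction `e` of the order parameter. -/
def modForm (μ : ℝ) (q : Plane →L[ℝ] Plane) (G : ℝ) (e ξ : Plane) : ℝ :=
  μ / 2 * divOf q ^ 2 + frobSq q / 2 + G ^ 2 / 2 - G * inner ℝ e (q ξ)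

theorem modForm_angular {μ : ℝ} (q : Plane →L[ℝ] Plane) {G : ℝ} {e ξ : Plane}
    (he : ‖e‖ = 1) (hξ : ‖ξ‖ ≤ 1) :
    μ / 2 * divOf q ^ 2 + (∑ j, (inner ℝ (perp e) (q (stdVec j))) ^ 2) / 2
      ≤ modForm μ q G e ξ := by
  have h1 : frobSq q = (∑ j, (inner ℝ e (q (stdVec j))) ^ 2)
      + ∑ j, (inner ℝ (perp e) (q (stdVec j))) ^ 2 := by
    rw [frobSq, ← Finset.sum_add_distrib]
    exact Finset.sum_congr rfl fun j _ => frame_norm_sq he _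
  have h2 : (inner ℝ e (q ξ)) ^ 2 ≤ ∑ j, (inner ℝ e (q (stdVec j))) ^ 2 := by
    have h3 : inner ℝ e (q ξ) = ξ 0 * inner ℝ e (q (stdVec 0)) + ξ 1 * inner ℝ e (q (stdVec 1)) := by
      conv_lhs => rw [plane_expand ξ]
      simp [inner_add_right, inner_smul_right]
    have h4 : ξ 0 ^ 2 + ξ 1 ^ 2 ≤ 1 := by
      rw [← plane_norm_sq]; exact pow_le_one₀ (norm_nonneg _) hξ
    rw [h3, Fin.sum_univ_two]
    generalize inner ℝ e (q (stdVec 0)) = a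
    generalize inner ℝ e (q (stdVec 1)) = b
    nlinarith [sq_nonneg (ξ 0 * b - ξ 1 * a), mul_le_mul_of_nonneg_right h4 (by positivity : 0 ≤ a ^ 2 + b ^ 2)]
  rw [modForm, h1]
  nlinarith [sq_nonneg (G - inner ℝ e (q ξ))]

theorem modForm_nonneg {μ : ℝ} (hμ : 0 < μ) (q : Plane →L[ℝ] Plane) {G : ℝ} {e ξ : Plane}
    (he : ‖e‖ ≤ 1) (hξ : ‖ξ‖ ≤ 1) : 0 ≤ modForm μ q G e ξ := by
  have h1 : |inner ℝ e (q ξ)| ≤ ‖q ξ‖ :=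
    (abs_real_inner_le_norm _ _).trans (mul_le_of_le_one_left (norm_nonneg _) he)
  have h2 : ‖q ξ‖ ^ 2 ≤ frobSq q :=
    (norm_apply_sq_le q ξ).trans (mul_le_of_le_one_right (frobSq_nonneg q)
      (pow_le_one₀ (norm_nonneg _) hξ))
  have h3 : (inner ℝ e (q ξ)) ^ 2 ≤ ‖q ξ‖ ^ 2 := sq_le_sq' (abs_le.1 h1).1 (abs_le.1 h1).2
  rw [modForm]
  nlinarith [sq_nonneg (G - inner ℝ e (q ξ)), sq_nonneg (divOf q)]

theorem add_add_sq_le (x y z : ℝ) : (x + y + z) ^ 2 ≤ 3 * (x ^ 2 + y ^ 2 + z ^ 2) := by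
  nlinarith [sq_nonneg (x - y), sq_nonneg (x - z), sq_nonneg (y - z)]

theorem add_sq_le_two (x y : ℝ) : (x + y) ^ 2 ≤ 2 * (x ^ 2 + y ^ 2) := by
  nlinarith [sq_nonneg (x - y)]

theorem mul_le_half_sq (x y : ℝ) : x * y ≤ x ^ 2 / 2 + y ^ 2 / 2 := by
  nlinarith [sq_nonneg (x - y)]

theorem abs_mul_le_half_sq (x y : ℝ) : |x * y| ≤ x ^ 2 / 2 + y ^ 2 / 2 := by
  rw [abs_le]; constructor <;> nlinarith [sq_nonneg (x - y), sq_nonneg (x + y)]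

theorem cauchy_two (a b x y : ℝ) : (a * x + b * y) ^ 2 ≤ (a ^ 2 + b ^ 2) * (x ^ 2 + y ^ 2) := by
  nlinarith [sq_nonneg (a * y - b * x)]

theorem near_scalar_bound {μ K β a11 a12 a21 a22 u1 u2 G φ φ1 κ L κt α s m : ℝ} (hμ : 0 < μ)
    (hK : 1 ≤ K) (hφ : φ = 1 - β) (hβ0 : 0 ≤ β) (hβ1 : β ≤ 1) (hsβ : s ^ 2 ≤ β)
    (hu : u1 ^ 2 + u2 ^ 2 ≤ 1) (hGu : G * (u1 ^ 2 + u2 ^ 2) = G)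
    (hκ : |κ| ≤ K) (hL : |L| ≤ K) (hκt : |κt| ≤ K) (hα : |α| ≤ K)
    (hκL : |κ + L| ≤ K * s) (hφ1 : |φ1| ≤ K * s) (hκα : |κt - α| ≤ K * s)
    (hm : m = μ / 2 * (a11 + a22) ^ 2 + (a11 ^ 2 + a12 ^ 2 + (a21 ^ 2 + a22 ^ 2)) / 2 + G ^ 2 / 2
      - G * (φ * (u1 * a11 + u2 * a12))) :
    1 / 2 * (φ1 + φ * L) ^ 2 * G ^ 2 + 1 / 2 * (κ ^ 2 * (a11 ^ 2 + a12 ^ 2))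
      + G * (φ1 * κ * (u1 * a11 + u2 * a12) + φ * κt * (u1 * a21 + u2 * a22))
      + (κ * L * (μ / 2 * (a11 + a22) ^ 2 + (a11 ^ 2 + a12 ^ 2 + (a21 ^ 2 + a22 ^ 2)) / 2 + G ^ 2 / 2)
        - (κt * (a11 * a21 + a12 * a22) + κ * L * (a21 ^ 2 + a22 ^ 2))
        - μ * (a11 + a22) * (κt * a12 + κ * L * a22))
      - μ * α * (a11 + a22) * (a21 - a12) ≤ 100 * K ^ 2 * (1 + μ) * m := by
  obtain ⟨D, hD⟩ : ∃ D, D = a11 + a22 := ⟨_, rfl⟩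
  obtain ⟨W, hW⟩ : ∃ W, W = (a11 - G * u1) ^ 2 + (a12 - G * u2) ^ 2 := ⟨_, rfl⟩
  obtain ⟨T2, hT2⟩ : ∃ T2, T2 = a21 ^ 2 + a22 ^ 2 := ⟨_, rfl⟩
  obtain ⟨Nn, hNn⟩ : ∃ Nn, Nn = a11 ^ 2 + a12 ^ 2 := ⟨_, rfl⟩
  obtain ⟨Δ, hΔ⟩ : ∃ Δ, Δ = u1 * (a11 - G * u1) + u2 * (a12 - G * u2) := ⟨_, rfl⟩
  rw [← hD, ← hT2, ← hNn] at hm ⊢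
  have hGG : G ^ 2 * (u1 ^ 2 + u2 ^ 2) = G ^ 2 := by linear_combination G * hGu
  have hm2 : m = μ / 2 * D ^ 2 + T2 / 2 + φ / 2 * W + β / 2 * (Nn + G ^ 2) := by
    rw [hm, hW, hNn, hφ]; linear_combination (-(1 - β) / 2) * hGG
  have hφ0 : 0 ≤ φ := by linarith
  have hW0 : 0 ≤ W := by rw [hW]; positivity
  have hT0 : 0 ≤ T2 := by rw [hT2]; positivity
  have hN0 : 0 ≤ Nn := by rw [hNn]; positivity
  have hG0 : 0 ≤ G ^ 2 := by positivity
  have hD0 : 0 ≤ μ * D ^ 2 := by positivity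
  have p1 : 0 ≤ φ * W := by positivity
  have p2 : 0 ≤ β * Nn := by positivity
  have p3 : 0 ≤ β * G ^ 2 := by positivity
  have bD : μ * D ^ 2 ≤ 2 * m := by rw [hm2]; linarith
  have bT : T2 ≤ 2 * m := by rw [hm2]; linarith
  have bN : β * Nn ≤ 2 * m := by rw [hm2]; linarith
  have bG : β * G ^ 2 ≤ 2 * m := by rw [hm2]; linarith
  have bφW : φ * W ≤ 2 * m := by rw [hm2]; linarith
  have bNG : β * (Nn + G ^ 2) ≤ 2 * m := by rw [hm2]; linarith
  have hWN : W ≤ 2 * (Nn + G ^ 2) := by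
    have : W = 2 * (Nn + G ^ 2) - ((a11 + G * u1) ^ 2 + (a12 + G * u2) ^ 2) := by
      rw [hW, hNn]; linear_combination 2 * hGG
    linarith [sq_nonneg (a11 + G * u1), sq_nonneg (a12 + G * u2)]
  have bW : W ≤ 6 * m := by
    have h1 : W = φ * W + β * W := by rw [hφ]; ring
    have h2 : β * W ≤ β * (2 * (Nn + G ^ 2)) := by gcongr
    linarith
  have hm0 : 0 ≤ m := by linarith
  have hΔW : Δ ^ 2 ≤ W := by
    have h1 : Δ ^ 2 ≤ (u1 ^ 2 + u2 ^ 2) * W := by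
      rw [hΔ, hW]; exact cauchy_two _ _ _ _
    exact h1.trans (mul_le_of_le_one_left hW0 hu)
  have hK0 : 0 ≤ K := by linarith
  have hs2 : (K * s) ^ 2 ≤ K ^ 2 * β := by rw [mul_pow]; gcongr
  -- coefficient bounds
  have q1 : (κ + L) ^ 2 ≤ K ^ 2 * β := (sq_le_sq' (abs_le.1 hκL).1 (abs_le.1 hκL).2).trans hs2
  have q2 : φ1 ^ 2 ≤ K ^ 2 * β := (sq_le_sq' (abs_le.1 hφ1).1 (abs_le.1 hφ1).2).trans hs2
  have q3 : (κt - α) ^ 2 ≤ K ^ 2 * β := (sq_le_sq' (abs_le.1 hκα).1 (abs_le.1 hκα).2).trans hs2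
  have q4 : L ^ 2 ≤ K ^ 2 := sq_le_sq' (abs_le.1 hL).1 (abs_le.1 hL).2
  have q5 : κ ^ 2 ≤ K ^ 2 := sq_le_sq' (abs_le.1 hκ).1 (abs_le.1 hκ).2
  have q6 : κt ^ 2 ≤ K ^ 2 := sq_le_sq' (abs_le.1 hκt).1 (abs_le.1 hκt).2
  have q7 : α ^ 2 ≤ K ^ 2 := sq_le_sq' (abs_le.1 hα).1 (abs_le.1 hα).2
  have q8 : |κ * L| ≤ K ^ 2 := by rw [abs_mul, sq]; gcongr
  have q9 : |κ * (κ + L)| ≤ 2 * K ^ 2 := by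
    have : |κ + L| ≤ K + K := (abs_add_le _ _).trans (add_le_add hκ hL)
    calc |κ * (κ + L)| = |κ| * |κ + L| := abs_mul _ _
      _ ≤ K * (K + K) := by gcongr
      _ = _ := by ring
  -- term bounds
  have hββ : β ^ 2 ≤ β := by rw [sq]; exact mul_le_of_le_one_left hβ0 hβ1
  have t1 : 1 / 2 * (φ1 + φ * L + κ) ^ 2 * G ^ 2 ≤ 9 * K ^ 2 * m := by
    have h1 : (φ1 + φ * L + κ) ^ 2 ≤ 3 * (φ1 ^ 2 + (κ + L) ^ 2 + β ^ 2 * L ^ 2) := by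
      have := add_add_sq_le φ1 (κ + L) (-(β * L))
      rw [neg_sq, mul_pow] at this
      rwa [hφ, show φ1 + (1 - β) * L + κ = φ1 + (κ + L) + -(β * L) by ring]
    have h2 : β ^ 2 * L ^ 2 ≤ β * K ^ 2 := by gcongr
    have h3 : (φ1 + φ * L + κ) ^ 2 ≤ 9 * K ^ 2 * β := by linarith
    calc 1 / 2 * (φ1 + φ * L + κ) ^ 2 * G ^ 2 ≤ 1 / 2 * (9 * K ^ 2 * β) * G ^ 2 := by gcongr
      _ = 9 / 2 * K ^ 2 * (β * G ^ 2) := by ring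
      _ ≤ 9 / 2 * K ^ 2 * (2 * m) := by gcongr
      _ = _ := by ring
  have t2 : κ * L * β * G ^ 2 ≤ 2 * K ^ 2 * m := by
    calc κ * L * β * G ^ 2 = κ * L * (β * G ^ 2) := by ring
      _ ≤ K ^ 2 * (β * G ^ 2) := mul_le_mul_of_nonneg_right ((le_abs_self _).trans q8) p3
      _ ≤ K ^ 2 * (2 * m) := by gcongr
      _ = _ := by ring
  have t3 : G * Δ * (κ * (κ + L) + φ1 * κ) ≤ 20 * K ^ 2 * m := by
    have h1 : G * Δ * (κ * (κ + L) + φ1 * κ)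
        ≤ (κ + L) ^ 2 * G ^ 2 / 2 + φ1 ^ 2 * G ^ 2 / 2 + κ ^ 2 * Δ ^ 2 := by
      linarith [mul_le_half_sq ((κ + L) * G) (κ * Δ), mul_le_half_sq (φ1 * G) (κ * Δ),
        mul_pow (κ + L) G 2, mul_pow κ Δ 2, mul_pow φ1 G 2]
    have h2 : (κ + L) ^ 2 * G ^ 2 ≤ K ^ 2 * β * G ^ 2 := by gcongr
    have h3 : φ1 ^ 2 * G ^ 2 ≤ K ^ 2 * β * G ^ 2 := by gcongr
    have h4 : κ ^ 2 * Δ ^ 2 ≤ K ^ 2 * W := by gcongr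
    have h5 : K ^ 2 * (β * G ^ 2) ≤ K ^ 2 * (2 * m) := by gcongr
    have h6 : K ^ 2 * W ≤ K ^ 2 * (6 * m) := by gcongr
    have h7 : 0 ≤ K ^ 2 * m := by positivity
    linarith
  have t4 : 1 / 2 * (κ * (κ + L)) * W ≤ 6 * K ^ 2 * m := by
    calc 1 / 2 * (κ * (κ + L)) * W ≤ K ^ 2 * W :=
          mul_le_mul_of_nonneg_right (by linarith [(le_abs_self _).trans q9]) hW0
      _ ≤ K ^ 2 * (6 * m) := by gcongr
      _ = _ := by ring
  have t5 : -κt * ((a11 - φ * G * u1) * a21 + (a12 - φ * G * u2) * a22) ≤ 20 * K ^ 2 * m := by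
    have h1 : (a11 - φ * G * u1) ^ 2 + (a12 - φ * G * u2) ^ 2 ≤ 2 * W + 2 * (β ^ 2 * G ^ 2) := by
      have : (a11 - φ * G * u1) ^ 2 + (a12 - φ * G * u2) ^ 2 = 2 * W + 2 * (β ^ 2 * G ^ 2)
        - ((a11 - G * u1 - β * (G * u1)) ^ 2 + (a12 - G * u2 - β * (G * u2)) ^ 2) := by
        rw [hW, hφ]; linear_combination 2 * β ^ 2 * hGG
      linarith [sq_nonneg (a11 - G * u1 - β * (G * u1)), sq_nonneg (a12 - G * u2 - β * (G * u2))]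
    have h2 : β ^ 2 * G ^ 2 ≤ β * G ^ 2 := by gcongr
    have h3 : -κt * ((a11 - φ * G * u1) * a21 + (a12 - φ * G * u2) * a22)
        ≤ ((a11 - φ * G * u1) ^ 2 + (a12 - φ * G * u2) ^ 2) / 2 + κt ^ 2 * T2 / 2 := by
      rw [hT2]
      linarith [mul_le_half_sq (a11 - φ * G * u1) (-κt * a21), mul_le_half_sq (a12 - φ * G * u2) (-κt * a22)]
    have h4 : κt ^ 2 * T2 ≤ K ^ 2 * (2 * m) := by gcongr
    have h5 : m ≤ K ^ 2 * m := le_mul_of_one_le_left hm0 (one_le_pow₀ hK)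
    linarith
  have t6 : κ * L * (μ / 2 * D ^ 2) ≤ K ^ 2 * m := by
    calc κ * L * (μ / 2 * D ^ 2) ≤ K ^ 2 * (μ / 2 * D ^ 2) :=
          mul_le_mul_of_nonneg_right ((le_abs_self _).trans q8) (by positivity)
      _ ≤ K ^ 2 * m := by gcongr; linarith
  have t7 : -(κ * L) * (T2 / 2) ≤ K ^ 2 * m := by
    calc -(κ * L) * (T2 / 2) ≤ K ^ 2 * (T2 / 2) :=
          mul_le_mul_of_nonneg_right ((neg_le_abs _).trans q8) (by positivity)
      _ ≤ K ^ 2 * m := by gcongr; linarith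
  have hμm : 0 ≤ μ * m := by positivity
  have hKm : 0 ≤ K ^ 2 * m := by positivity
  have hKμm : 0 ≤ K ^ 2 * (μ * m) := by positivity
  have a22T : a22 ^ 2 ≤ T2 := by rw [hT2]; linarith [sq_nonneg a21]
  have a21T : a21 ^ 2 ≤ T2 := by rw [hT2]; linarith [sq_nonneg a22]
  have a12N : a12 ^ 2 ≤ Nn := by rw [hNn]; linarith [sq_nonneg a11]
  have young : ∀ x y : ℝ, -μ * D * (x * y) ≤ μ * D ^ 2 / 2 + μ * (x ^ 2 * y ^ 2) / 2 := fun x y => by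
    have := mul_le_mul_of_nonneg_left (mul_le_half_sq (-D) (x * y)) hμ.le
    linarith
  have t8 : -μ * D * (κ * L * a22) ≤ K ^ 2 * m + μ * K ^ 2 * m := by
    have hx : -μ * D * (κ * L * a22) ≤ K ^ 2 * (μ * D ^ 2 / 2 + μ * a22 ^ 2 / 2) := by
      have h1 : |D * a22| ≤ D ^ 2 / 2 + a22 ^ 2 / 2 := abs_mul_le_half_sq _ _
      have h2 : |κ * L| * |D * a22| ≤ K ^ 2 * (D ^ 2 / 2 + a22 ^ 2 / 2) := by gcongr
      rw [← abs_mul] at h2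
      have h3 := (neg_le_abs (κ * L * (D * a22))).trans h2
      calc -μ * D * (κ * L * a22) = μ * (-(κ * L * (D * a22))) := by ring
        _ ≤ μ * (K ^ 2 * (D ^ 2 / 2 + a22 ^ 2 / 2)) := by gcongr
        _ = _ := by ring
    have h4 : K ^ 2 * (μ * D ^ 2 / 2) ≤ K ^ 2 * m := by gcongr; linarith
    have h5 : K ^ 2 * (μ * a22 ^ 2 / 2) ≤ K ^ 2 * (μ * m) := by
      gcongr K ^ 2 * ?_
      have : μ * a22 ^ 2 ≤ μ * (2 * m) := by gcongr; linarith
      linarith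
    linarith
  have t9 : -μ * D * ((κt - α) * a12) ≤ K ^ 2 * m + μ * K ^ 2 * m := by
    have h1 : (κt - α) ^ 2 * a12 ^ 2 ≤ K ^ 2 * β * Nn :=
      mul_le_mul q3 a12N (sq_nonneg _) (by positivity)
    have h2 : K ^ 2 * (β * Nn) ≤ K ^ 2 * (2 * m) := by gcongr
    have h3 : μ * ((κt - α) ^ 2 * a12 ^ 2) ≤ μ * (K ^ 2 * (2 * m)) :=
      mul_le_mul_of_nonneg_left (by linarith) hμ.le
    have h5 : m ≤ K ^ 2 * m := le_mul_of_one_le_left hm0 (one_le_pow₀ hK)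
    linarith [young (κt - α) a12]
  have t10 : -μ * D * (α * a21) ≤ K ^ 2 * m + μ * K ^ 2 * m := by
    have h1 : α ^ 2 * a21 ^ 2 ≤ K ^ 2 * (2 * m) :=
      mul_le_mul q7 (a21T.trans bT) (sq_nonneg _) (by positivity)
    have h3 : μ * (α ^ 2 * a21 ^ 2) ≤ μ * (K ^ 2 * (2 * m)) := by gcongr
    have h5 : m ≤ K ^ 2 * m := le_mul_of_one_le_left hm0 (one_le_pow₀ hK)
    linarith [young α a21]
  have key : 1 / 2 * (φ1 + φ * L) ^ 2 * G ^ 2 + 1 / 2 * (κ ^ 2 * Nn)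
      + G * (φ1 * κ * (u1 * a11 + u2 * a12) + φ * κt * (u1 * a21 + u2 * a22))
      + (κ * L * (μ / 2 * D ^ 2 + (Nn + T2) / 2 + G ^ 2 / 2)
        - (κt * (a11 * a21 + a12 * a22) + κ * L * T2)
        - μ * D * (κt * a12 + κ * L * a22))
      - μ * α * D * (a21 - a12)
    = 1 / 2 * (φ1 + φ * L + κ) ^ 2 * G ^ 2 + κ * L * β * G ^ 2
      + G * Δ * (κ * (κ + L) + φ1 * κ) + 1 / 2 * (κ * (κ + L)) * W
      + -κt * ((a11 - φ * G * u1) * a21 + (a12 - φ * G * u2) * a22)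
      + κ * L * (μ / 2 * D ^ 2) + -(κ * L) * (T2 / 2) + -μ * D * (κ * L * a22)
      + -μ * D * ((κt - α) * a12) + -μ * D * (α * a21) := by
    have e1 : Nn = W + G ^ 2 + 2 * (G * Δ) := by
      rw [hNn, hW, hΔ]; linear_combination (1 : ℝ) * hGG
    have e2 : G * (u1 * a11 + u2 * a12) = G ^ 2 + G * Δ := by
      rw [hΔ]; linear_combination hGG
    have e3 : 1 / 2 * (κ * (κ + L)) * Nn = 1 / 2 * (κ * (κ + L)) * (W + G ^ 2 + 2 * (G * Δ)) := by
      rw [← e1]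
    rw [hT2, hφ]
    linear_combination e3 + φ1 * κ * e2
  have h0 : 100 * K ^ 2 * (1 + μ) * m = 100 * (K ^ 2 * m) + 100 * (K ^ 2 * (μ * m)) := by ring
  rw [key, h0]
  linarith

theorem divOf_perpL_comp {n : Plane} (hn : ‖n‖ = 1) (q : Plane →L[ℝ] Plane) :
    divOf (perpL ∘L q) = inner ℝ n (q (perp n)) - inner ℝ (perp n) (q n) := by
  rw [divOf_frame hn]
  simp only [ContinuousLinearMap.comp_apply, perpL_apply, inner_perp_perp]
  have := inner_perp_left n (q n)
  linarith

theorem near_pointwise {μ K β φ φ1 κ L κt α s G : ℝ} {n e : Plane} (q : Plane →L[ℝ] Plane)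
    (hμ : 0 < μ) (hK : 1 ≤ K) (hφ : φ = 1 - β) (hβ0 : 0 ≤ β) (hβ1 : β ≤ 1) (hsβ : s ^ 2 ≤ β)
    (hn : ‖n‖ = 1) (he : ‖e‖ ≤ 1) (hGe : G * ‖e‖ ^ 2 = G)
    (hκ : |κ| ≤ K) (hL : |L| ≤ K) (hκt : |κt| ≤ K) (hα : |α| ≤ K)
    (hκL : |κ + L| ≤ K * s) (hφ1 : |φ1| ≤ K * s) (hκα : |κt - α| ≤ K * s)
    {B : Plane →L[ℝ] Plane} (hB : ∀ v, B v = inner ℝ (perp n) v • (κt • n + (κ * L) • perp n)) :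
    1 / 2 * (φ1 + φ * L) ^ 2 * G ^ 2 + ‖q (κ • n)‖ ^ 2 / 2
      - G * inner ℝ e (q (-(φ1 * κ) • n - (φ * κt) • perp n)) + stress μ B q (G ^ 2)
      - μ * α * divOf q * divOf (perpL ∘L q)
      ≤ 100 * K ^ 2 * (1 + μ) * modForm μ q G e (φ • n) := by
  have hnn : inner ℝ n n = 1 := by rw [real_inner_self_eq_norm_sq, hn]; norm_num
  have hpp : inner ℝ (perp n) (perp n) = 1 := by rw [inner_perp_perp, hnn]
  have hpn : inner ℝ (perp n) n = 0 := by rw [real_inner_comm, inner_perp_self]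
  have hBn : B n = 0 := by rw [hB, hpn, zero_smul]
  have hBp : B (perp n) = κt • n + (κ * L) • perp n := by rw [hB, hpp, one_smul]
  have hnorm := fun v => frame_norm_sq hn v
  have hfi := fun v w => frame_inner hn v w
  have hu := hnorm e
  have key := near_scalar_bound (a11 := inner ℝ n (q n)) (a12 := inner ℝ (perp n) (q n))
    (a21 := inner ℝ n (q (perp n))) (a22 := inner ℝ (perp n) (q (perp n)))
    (u1 := inner ℝ n e) (u2 := inner ℝ (perp n) e) (G := G) hμ hK hφ hβ0 hβ1 hsβ
    (by rw [← hu]; exact pow_le_one₀ (norm_nonneg _) he) (by rw [← hu]; exact hGe)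
    hκ hL hκt hα hκL hφ1 hκα rfl
  refine le_trans (le_of_eq ?_) (key.trans (le_of_eq ?_))
  · have hsum : ∑ j, inner ℝ (q (B (stdVec j))) (q (stdVec j)) = _ :=
      sum_stdVec_inner hn (q ∘L B) q
    rw [stress, hsum, divOf_frame hn B, divOf_frame hn (q ∘L B), divOf_frame hn q,
      frobSq_frame hn, divOf_perpL_comp hn]
    simp only [ContinuousLinearMap.comp_apply, hBn, hBp, map_add, map_sub, map_smul, map_zero,
      inner_zero_right, inner_zero_left, inner_add_left, inner_add_right, inner_sub_right,
      inner_smul_left, inner_smul_right, norm_smul, mul_pow, hpn, hpp, RCLike.conj_to_real,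
      Real.norm_eq_abs, sq_abs]
    rw [hnorm (q n), hnorm (q (perp n)), hfi e (q n), hfi e (q (perp n)), hfi (q n) (q (perp n)),
      hfi (q (perp n)) (q (perp n))]
    ring
  · rw [modForm, divOf_frame hn q, frobSq_frame hn]
    simp only [map_smul, inner_smul_right]
    rw [hnorm (q n), hnorm (q (perp n)), hfi e (q n)]

theorem far_pointwise {μ K G : ℝ} {H e : Plane} (B q : Plane →L[ℝ] Plane)
    (hμ : 0 < μ) (hK : 1 ≤ K) (hH : ‖H‖ ≤ K) (hB : ‖B‖ ≤ K) :
    ‖q H‖ ^ 2 / 2 + stress μ B q (G ^ 2) ≤ 100 * K ^ 2 * (1 + μ) * modForm μ q G e 0 := by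
  have hm : modForm μ q G e 0 = μ / 2 * divOf q ^ 2 + frobSq q / 2 + G ^ 2 / 2 := by simp [modForm]
  have hK0 : 0 ≤ K := by linarith
  have hf := frobSq_nonneg q
  have hBe : ∀ j, ‖B (stdVec j)‖ ≤ K := fun j => by
    have := B.le_opNorm (stdVec j); rw [norm_stdVec, mul_one] at this; exact this.trans hB
  have h1 : ‖q H‖ ^ 2 ≤ frobSq q * K ^ 2 := (norm_apply_sq_le q H).trans (by gcongr)
  have hdB : divOf B ≤ 2 * K := by
    rw [divOf, Fin.sum_univ_two]
    have := fun j => (PiLp.norm_apply_le (B (stdVec j)) j).trans (hBe j)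
    have h0 := (le_abs_self _).trans (this 0)
    have h1 := (le_abs_self _).trans (this 1)
    linarith
  have hqB : ∀ j, ‖q (B (stdVec j))‖ ^ 2 ≤ frobSq q * K ^ 2 := fun j =>
    (norm_apply_sq_le q _).trans (by gcongr; exact hBe j)
  have hqj : ∀ j, -inner ℝ (q (B (stdVec j))) (q (stdVec j)) ≤ frobSq q * K ^ 2 := fun j => by
    have h1 : ‖q (stdVec j)‖ ^ 2 ≤ frobSq q * K ^ 2 := by
      have := norm_apply_sq_le q (stdVec j)
      rw [norm_stdVec] at this
      nlinarith [one_le_pow₀ hK (n := 2)]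
    have h2 := (neg_le_abs _).trans (abs_real_inner_le_norm (q (B (stdVec j))) (q (stdVec j)))
    linarith [mul_le_half_sq ‖q (B (stdVec j))‖ ‖q (stdVec j)‖, hqB j]
  have hfB : frobSq (q ∘L B) ≤ 2 * (frobSq q * K ^ 2) := by
    rw [frobSq, Fin.sum_univ_two]
    simp only [ContinuousLinearMap.comp_apply]
    linarith [hqB 0, hqB 1]
  have hd : -(divOf q * divOf (q ∘L B)) ≤ divOf q ^ 2 / 2 + 2 * (frobSq q * K ^ 2) := by
    have := (neg_le_abs _).trans (abs_mul_le_half_sq (divOf q) (divOf (q ∘L B)))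
    linarith [divOf_sq_le (q ∘L B)]
  have hE : 0 ≤ μ / 2 * divOf q ^ 2 + frobSq q / 2 + G ^ 2 / 2 := by positivity
  rw [hm, stress, Fin.sum_univ_two]
  have h3 := mul_le_mul_of_nonneg_right hdB hE
  have h4 := mul_le_mul_of_nonneg_left hd hμ.le
  have hKK : K ≤ K ^ 2 := by nlinarith
  have h1K : 1 ≤ K ^ 2 := by nlinarith
  set X := frobSq q with hX
  set D := divOf q ^ 2
  have hD : 0 ≤ D := sq_nonneg _
  have hG : 0 ≤ G ^ 2 := sq_nonneg _
  have e1 : 2 * K * (μ / 2 * D + X / 2 + G ^ 2 / 2) ≤ 2 * (K ^ 2 * (μ / 2 * D + X / 2 + G ^ 2 / 2)) := by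
    nlinarith
  have e2 : μ * D ≤ K ^ 2 * (μ * D) := le_mul_of_one_le_left (by positivity) h1K
  have p1 : 0 ≤ K ^ 2 * (μ * D) := by positivity
  have p2 : 0 ≤ K ^ 2 * X := by positivity
  have p3 : 0 ≤ K ^ 2 * (μ * X) := by positivity
  have p4 : 0 ≤ K ^ 2 * G ^ 2 := by positivity
  have p5 : 0 ≤ K ^ 2 * (μ * G ^ 2) := by positivity
  have p6 : 0 ≤ K ^ 2 * (μ * (μ * D)) := by positivity
  linarith [hqj 0, hqj 1]

/-! ### Translations in `L²` -/

section Translation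

set_option linter.unusedSectionVars false

variable {E : Type*} [NormedAddCommGroup E] [NormedSpace ℝ E] [FiniteDimensional ℝ E]
  [MeasurableSpace E] [BorelSpace E] (μ : Measure E) [μ.IsAddHaarMeasure]
  {F : Type*} [NormedAddCommGroup F] [InnerProductSpace ℝ F]

/-- Translation by `v` on `L²`. -/
def translate (v : E) (f : Lp F 2 μ) : Lp F 2 μ :=
  Lp.compMeasurePreserving (fun x => x + v) (measurePreserving_add_right μ v) f

theorem coeFn_translate (v : E) (f : Lp F 2 μ) :
    translate μ v f =ᵐ[μ] fun x => f (x + v) :=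
  Lp.coeFn_compMeasurePreserving f (measurePreserving_add_right μ v)

theorem translate_zero (f : Lp F 2 μ) : translate μ (0 : E) f = f := by
  apply Lp.ext
  filter_upwards [coeFn_translate μ 0 f] with x hx
  rw [hx, add_zero]

theorem continuous_translate (f : Lp F 2 μ) : Continuous fun v : E => translate μ v f := by
  let g : C(E × E, E) := ⟨fun p => p.2 + p.1, by fun_prop⟩
  have hg : Continuous fun v : E => (g.curry v : C(E, E)) := g.curry.continuous
  exact continuous_const.compMeasurePreservingLp hg
    (fun v => measurePreserving_add_right μ v) (by simp)

theorem inner_translate_translate (v : E) (f g : Lp F 2 μ) :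
    inner ℝ (translate μ v f) (translate μ v g) = inner ℝ f g := by
  rw [L2.inner_def, L2.inner_def,
    ← (measurePreserving_add_right μ v).integral_comp (measurableEmbedding_addRight v)
      (fun x => inner ℝ (f x) (g x))]
  refine integral_congr_ae ?_
  filter_upwards [coeFn_translate μ v f, coeFn_translate μ v g] with x h1 h2
  rw [h1, h2]

theorem hasDerivAt_inner_translate {A A' : E → ℝ} (hA : MemLp A 2 μ) {e : E}
    (hw : ∀ ζ : E → ℝ, ContDiff ℝ ∞ ζ → HasCompactSupport ζ →
      ∫ x, fderiv ℝ ζ x e * A x ∂μ = -∫ x, ζ x * A' x ∂μ)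
    {φ : E → ℝ} (hφ : ContDiff ℝ ∞ φ) (hφc : HasCompactSupport φ) (h₀ : ℝ) :
    HasDerivAt (fun h : ℝ => ∫ x, φ (x - h • e) * A x ∂μ)
      (∫ x, φ (x - h₀ • e) * A' x ∂μ) h₀ := by
  have hd := hφ.differentiable (by simp)
  have hshift : ∀ h : ℝ, ContDiff ℝ ∞ (fun x => φ (x - h • e)) := fun h =>
    hφ.comp (contDiff_id.sub contDiff_const)
  have hcs : ∀ h : ℝ, HasCompactSupport (fun x => φ (x - h • e)) := fun h =>
    hφc.comp_homeomorph (Homeomorph.subRight (h • e))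
  have hfd : ∀ h : ℝ, ∀ x, fderiv ℝ (fun x => φ (x - h • e)) x = fderiv ℝ φ (x - h • e) :=
    fun h x => fderiv_comp_sub (h • e)
  have hcd : Continuous (fun x => fderiv ℝ φ x e) :=
    (hφ.continuous_fderiv (by simp)).clm_apply continuous_const
  obtain ⟨C, hC⟩ := (hφc.fderiv_apply (𝕜 := ℝ) e).exists_bound_of_continuous hcd
  have hC0 : 0 ≤ C := (norm_nonneg _).trans (hC 0)
  set K : Set E := (fun p : E × ℝ => p.1 + p.2 • e) '' (tsupport φ ×ˢ closedBall h₀ 1) with hK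
  have hKc : IsCompact K := (hφc.isCompact.prod (isCompact_closedBall _ _)).image (by fun_prop)
  have hval := hw _ (hshift h₀) (hcs h₀)
  have hres := hasDerivAt_integral_of_dominated_loc_of_deriv_le (μ := μ) (x₀ := h₀)
    (F := fun h x => φ (x - h • e) * A x) (s := ball h₀ 1)
    (F' := fun h x => (-(fderiv ℝ φ (x - h • e) e)) * A x)
    (bound := K.indicator fun x => C * ‖A x‖) (ball_mem_nhds _ one_pos)
    (.of_forall fun h => ((hshift h).continuous.aestronglyMeasurable).mul hA.1)
    (((hshift h₀).continuous.memLp_of_hasCompactSupport (p := 2) (μ := μ) (hcs h₀)).integrable_mul hA)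
    ((((hcd.comp (continuous_id.sub continuous_const)).neg).aestronglyMeasurable).mul hA.1)
    ?_ ?_ ?_
  · refine hres.2.congr_deriv ?_
    simp_rw [hfd] at hval
    rw [← neg_eq_iff_eq_neg] at hval
    rw [← hval, ← integral_neg]
    exact integral_congr_ae (.of_forall fun x => by simp)
  · refine Eventually.of_forall fun x h hh => ?_
    by_cases hx : x ∈ K
    · rw [indicator_of_mem hx, norm_mul, norm_neg]
      exact mul_le_mul_of_nonneg_right (hC _) (norm_nonneg _)
    · rw [indicator_of_notMem hx]
      have : fderiv ℝ φ (x - h • e) = 0 := by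
        by_contra hne
        refine hx ⟨(x - h • e, h), ⟨?_, ball_subset_closedBall hh⟩, by simp⟩
        exact support_fderiv_subset ℝ hne
      simp [this]
  · refine IntegrableOn.integrable_indicator ?_ hKc.measurableSet
    have : IsFiniteMeasure (μ.restrict K) := ⟨by simpa using hKc.measure_lt_top⟩
    exact (((hA.restrict K).integrable (by norm_num)).norm).const_mul C
  · refine Eventually.of_forall fun x h _ => ?_
    have h1 : HasDerivAt (fun h : ℝ => x - h • e) (-e) h := by
      simpa using ((hasDerivAt_id h).smul_const e).const_sub x
    have h2 := ((hd (x - h • e)).hasFDerivAt.comp_hasDerivAt h h1).mul_const (A x)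
    simpa using h2

theorem hasDerivAt_translate {A A' : E → ℝ} (hA : MemLp A 2 μ) (hA' : MemLp A' 2 μ) {e : E}
    (hw : ∀ ζ : E → ℝ, ContDiff ℝ ∞ ζ → HasCompactSupport ζ →
      ∫ x, fderiv ℝ ζ x e * A x ∂μ = -∫ x, ζ x * A' x ∂μ) :
    HasDerivAt (fun h : ℝ => translate μ (h • e) hA.toLp) hA'.toLp 0 := by
  have hinner : ∀ {φ : E → ℝ} (hφ : MemLp φ 2 μ) {B : E → ℝ} (hB : MemLp B 2 μ) (h : ℝ),
      inner ℝ hφ.toLp (translate μ (h • e) hB.toLp) = ∫ x, φ (x - h • e) * B x ∂μ := by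
    intro φ hφ B hB h
    rw [L2.inner_def, ← (measurePreserving_add_right μ (h • e)).integral_comp
      (measurableEmbedding_addRight (h • e)) (fun x => φ (x - h • e) * B x)]
    refine integral_congr_ae ?_
    filter_upwards [coeFn_translate μ (h • e) hB.toLp, hφ.coeFn_toLp,
      (measurePreserving_add_right μ (h • e)).quasiMeasurePreserving.ae hB.coeFn_toLp]
      with x h1 h2 h3
    rw [h1, h2, h3]; simp [mul_comm]
  have hbound : ∀ δ C : ℝ, 0 < δ → (∀ σ : ℝ, |σ| < δ → ‖translate μ (σ • e) hA'.toLp - hA'.toLp‖ ≤ C) →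
      ∀ h : ℝ, |h| < δ →
        ‖translate μ (h • e) hA.toLp - hA.toLp - h • hA'.toLp‖ ≤ C * |h| := by
    intro δ C hδ hC h hh
    have hC0 : 0 ≤ C := (norm_nonneg _).trans (hC 0 (by simpa using hδ))
    set w := translate μ (h • e) hA.toLp - hA.toLp - h • hA'.toLp with hw'
    have htest : ∀ φ : Lp ℝ 2 μ, |inner ℝ φ w| ≤ ‖φ‖ * (C * |h|) := by
      intro φ
      refine (Lp.dense_hasCompactSupport_contDiff (F := ℝ) (μ := μ) (p := 2) (by simp)).induction
        (P := fun φ => |inner ℝ φ w| ≤ ‖φ‖ * (C * |h|)) ?_ ?_ φ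
      · rintro φ ⟨f, hf, hfc, hfs⟩
        have hfm : MemLp f 2 μ := hfs.continuous.memLp_of_hasCompactSupport hfc
        have hφf : φ = hfm.toLp := Lp.ext (hf.trans hfm.coeFn_toLp.symm)
        have hder : ∀ x ∈ ball (0 : ℝ) δ, HasDerivWithinAt
            (fun σ : ℝ => inner ℝ φ (translate μ (σ • e) hA.toLp) - σ * inner ℝ φ hA'.toLp)
            (inner ℝ φ (translate μ (x • e) hA'.toLp) - inner ℝ φ hA'.toLp) (ball 0 δ) x := by
          intro x _
          simp_rw [hφf, hinner hfm]
          refine HasDerivAt.hasDerivWithinAt ?_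
          exact (hasDerivAt_inner_translate μ hA hw hfs hfc x).sub
            (by simpa using (hasDerivAt_id x).mul_const (inner ℝ hfm.toLp hA'.toLp))
        have hmv := (convex_ball (0 : ℝ) δ).norm_image_sub_le_of_norm_hasDerivWithin_le
          (C := ‖φ‖ * C) hder (fun x hx => ?_) (mem_ball_self hδ) (by simpa using hh : h ∈ ball (0:ℝ) δ)
        · simp only [zero_smul, translate_zero, zero_mul, sub_zero, Real.norm_eq_abs] at hmv
          rw [hw', inner_sub_right, inner_sub_right, inner_smul_right]
          calc _ = _ := by congr 1; ring
            _ ≤ _ := hmv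
            _ = _ := by ring
        · rw [← inner_sub_right]
          exact (abs_real_inner_le_norm _ _).trans
            (mul_le_mul_of_nonneg_left (hC x (by simpa using hx)) (norm_nonneg _))
      · exact isClosed_le (by fun_prop) (by fun_prop)
    have h1 := htest w
    rw [real_inner_self_eq_norm_sq, abs_of_nonneg (sq_nonneg _), sq] at h1
    by_cases hw0 : ‖w‖ = 0
    · rw [hw0]; positivity
    · exact le_of_mul_le_mul_left h1 (lt_of_le_of_ne (norm_nonneg _) (Ne.symm hw0))
  rw [hasDerivAt_iff_isLittleO_nhds_zero, Asymptotics.isLittleO_iff]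
  intro c hc
  have hcont : Continuous fun σ : ℝ => translate μ (σ • e) hA'.toLp :=
    (continuous_translate μ hA'.toLp).comp (continuous_id.smul continuous_const)
  obtain ⟨δ, hδ, hδc⟩ := Metric.continuous_iff.1 hcont 0 c hc
  have := hbound δ c hδ fun σ hσ => by
    have := hδc σ (by simpa using hσ)
    rw [zero_smul, translate_zero, dist_eq_norm] at this
    exact this.le
  filter_upwards [ball_mem_nhds (0 : ℝ) hδ] with h hh
  simpa [translate_zero] using this h (by simpa using hh)

/-- Integration by parts for two square integrable weakly differentiable functions. -/
theorem integral_mul_weakDeriv {A A' B B' : E → ℝ} (hA : MemLp A 2 μ) (hA' : MemLp A' 2 μ)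
    (hB : MemLp B 2 μ) (hB' : MemLp B' 2 μ) {e : E}
    (hwA : ∀ ζ : E → ℝ, ContDiff ℝ ∞ ζ → HasCompactSupport ζ →
      ∫ x, fderiv ℝ ζ x e * A x ∂μ = -∫ x, ζ x * A' x ∂μ)
    (hwB : ∀ ζ : E → ℝ, ContDiff ℝ ∞ ζ → HasCompactSupport ζ →
      ∫ x, fderiv ℝ ζ x e * B x ∂μ = -∫ x, ζ x * B' x ∂μ) :
    ∫ x, A' x * B x ∂μ = -∫ x, A x * B' x ∂μ := by
  have h1 := (hasDerivAt_translate μ hA hA' hwA).inner ℝ (hasDerivAt_translate μ hB hB' hwB)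
  simp only [zero_smul, translate_zero, inner_translate_translate] at h1
  have h2 := h1.unique (hasDerivAt_const (0 : ℝ) (inner ℝ hA.toLp hB.toLp))
  have hI : ∀ {X Y : E → ℝ} (hX : MemLp X 2 μ) (hY : MemLp Y 2 μ),
      inner ℝ hX.toLp hY.toLp = ∫ x, X x * Y x ∂μ := by
    intro X Y hX hY
    rw [L2.inner_def]
    refine integral_congr_ae ?_
    filter_upwards [hX.coeFn_toLp, hY.coeFn_toLp] with x hx hy
    rw [hx, hy]; simp [mul_comm]
  rw [hI, hI] at h2
  linarith

end Translation

/-! ### Weak derivatives -/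

section Weak

variable {F : Type*} [NormedAddCommGroup F] [NormedSpace ℝ F]

theorem clm_plane_ext {A B : Plane →L[ℝ] F} (h0 : A (stdVec 0) = B (stdVec 0))
    (h1 : A (stdVec 1) = B (stdVec 1)) : A = B := by
  ext v
  rw [plane_expand v]
  simp [h0, h1]

theorem integrableOn_test_smul {v : Plane → F} (hv : LocallyIntegrableOn v Ω)
    {ζ : Plane → ℝ} (hζ : Continuous ζ) (hc : HasCompactSupport ζ) (hs : tsupport ζ ⊆ Ω) :
    IntegrableOn (fun x => ζ x • v x) Ω := by
  have h1 : IntegrableOn v (tsupport ζ) := hv.integrableOn_compact_subset hs hc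
  have h2 : IntegrableOn (fun x => ζ x • v x) (tsupport ζ) :=
    h1.continuousOn_smul hζ.continuousOn hc
  have h3 : Integrable (fun x => ζ x • v x) volume := by
    refine (integrableOn_iff_integrable_of_support_subset ?_).1 h2
    exact fun x hx => subset_tsupport ζ fun h0 => hx (by simp [h0])
  exact h3.integrableOn

theorem tsupport_fderiv_apply_subset {ζ : Plane → ℝ} (e : Plane) :
    tsupport (fun x => fderiv ℝ ζ x e) ⊆ tsupport ζ := by
  refine closure_minimal (fun x hx => ?_) (isClosed_tsupport ζ)
  exact support_fderiv_subset ℝ fun h => hx (by simp [h])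

theorem continuous_fderiv_apply {ζ : Plane → ℝ} (hζ : ContDiff ℝ ∞ ζ) (e : Plane) :
    Continuous fun x => fderiv ℝ ζ x e :=
  (hζ.continuous_fderiv (by simp)).clm_apply continuous_const

theorem IsWeakGrad.ae_eq (hΩ : IsOpen Ω) {v : Plane → F}
    {G G' : Plane → Plane →L[ℝ] F} (hG : IsWeakGrad Ω v G) (hG' : IsWeakGrad Ω v G')
    [CompleteSpace F] : G =ᵐ[vol(Ω)] G' := by
  have key : ∀ e : Plane, ∀ᵐ x ∂volume, x ∈ Ω → (G x - G' x) e = 0 := by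
    intro e
    have hap : ∀ {G : Plane → Plane →L[ℝ] F}, LocallyIntegrableOn G Ω →
        LocallyIntegrableOn (fun x => G x e) Ω := by
      intro G hG x hx
      obtain ⟨s, hs, hi⟩ := hG x hx
      exact ⟨s, hs, (ContinuousLinearMap.apply ℝ F e).integrable_comp hi⟩
    refine hΩ.ae_eq_zero_of_integral_contDiff_smul_eq_zero (f := fun x => (G x - G' x) e) ?_ ?_
    · exact (hap hG.locallyIntegrable_grad).sub (hap hG'.locallyIntegrable_grad)
    · intro ζ hζ hc hs
      have h1 := hG.integral_eq ζ hζ hc hs e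
      have h2 := hG'.integral_eq ζ hζ hc hs e
      have i1 := integrableOn_test_smul (hap hG.locallyIntegrable_grad) hζ.continuous hc hs
      have i2 := integrableOn_test_smul (hap hG'.locallyIntegrable_grad) hζ.continuous hc hs
      have h3 : ∫ x in Ω, ζ x • (G x - G' x) e = 0 := by
        simp only [sub_apply, smul_sub]
        rw [integral_sub i1 i2]
        rw [h1] at h2
        rw [sub_eq_zero]; exact neg_injective h2
      rw [← setIntegral_eq_integral_of_forall_compl_eq_zero (s := Ω), h3]
      intro x hx
      rw [image_eq_zero_of_notMem_tsupport fun h => hx (hs h), zero_smul]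
  have h0 := key (stdVec 0)
  have h1 := key (stdVec 1)
  rw [Filter.EventuallyEq, ae_restrict_iff' hΩ.measurableSet]
  filter_upwards [h0, h1] with x h0 h1 hx
  exact clm_plane_ext (sub_eq_zero.1 (h0 hx)) (sub_eq_zero.1 (h1 hx))

theorem LocallyIntegrableOn.congr_ae_restrict {E : Type*} [NormedAddCommGroup E]
    (hΩ : IsOpen Ω) {v v' : Plane → E}
    (h : v =ᵐ[vol(Ω)] v') (hv : LocallyIntegrableOn v Ω) : LocallyIntegrableOn v' Ω := by
  rw [locallyIntegrableOn_iff hΩ.isLocallyClosed] at hv ⊢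
  · intro k hk hkc
    exact (hv k hk hkc).congr (ae_mono (Measure.restrict_mono hk le_rfl) h)

theorem IsWeakGrad.congr (hΩ : IsOpen Ω) {v v' : Plane → F}
    {G G' : Plane → Plane →L[ℝ] F} (hv : v =ᵐ[vol(Ω)] v')
    (hGG : G =ᵐ[vol(Ω)] G') (hG : IsWeakGrad Ω v G) : IsWeakGrad Ω v' G' where
  locallyIntegrable := LocallyIntegrableOn.congr_ae_restrict hΩ hv hG.locallyIntegrable
  locallyIntegrable_grad := LocallyIntegrableOn.congr_ae_restrict hΩ hGG hG.locallyIntegrable_grad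
  integral_eq := fun ζ hζ hc hs e => by
    have h1 : ∫ x in Ω, (fderiv ℝ ζ x e) • v' x = ∫ x in Ω, (fderiv ℝ ζ x e) • v x :=
      integral_congr_ae (hv.mono fun x hx => by simp only [hx])
    have h2 : ∫ x in Ω, ζ x • G' x e = ∫ x in Ω, ζ x • G x e :=
      integral_congr_ae (hGG.mono fun x hx => by simp only [hx])
    rw [h1, h2, hG.integral_eq ζ hζ hc hs e]

theorem weakGrad_congr (hΩ : IsOpen Ω) {v v' : Plane → F}
    (hv : v =ᵐ[vol(Ω)] v') : weakGrad Ω v = weakGrad Ω v' := by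
  have : IsWeakGrad Ω v = IsWeakGrad Ω v' := by
    funext G
    exact propext ⟨fun h => h.congr hΩ hv (ae_eq_refl _), fun h => h.congr hΩ hv.symm (ae_eq_refl _)⟩
  unfold weakGrad
  generalize IsWeakGrad Ω v = P at this
  subst this
  rfl

theorem IsWeakGrad.weakGrad {v : Plane → F} {G : Plane → Plane →L[ℝ] F}
    (h : IsWeakGrad Ω v G) : IsWeakGrad Ω v (weakGrad Ω v) := by
  have hex : ∃ G, IsWeakGrad Ω v G := ⟨G, h⟩
  unfold AnisoGL.weakGrad
  rw [dif_pos hex]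
  exact hex.choose_spec

theorem IsWeakGrad.weakGrad_ae_eq [CompleteSpace F] (hΩ : IsOpen Ω) {v : Plane → F}
    {G : Plane → Plane →L[ℝ] F} (h : IsWeakGrad Ω v G) :
    AnisoGL.weakGrad Ω v =ᵐ[vol(Ω)] G :=
  h.weakGrad.ae_eq hΩ h

end Weak

/-- `a'` is the weak derivative of `a` in the direction `e` on `Ω`, both being square integrable. -/
structure IsWeakDir (Ω : Set Plane) (e : Plane) (a a' : Plane → ℝ) : Prop where
  memLp : MemLp a 2 vol(Ω)
  memLp' : MemLp a' 2 vol(Ω)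
  integral_eq : ∀ ζ : Plane → ℝ, ContDiff ℝ ∞ ζ → HasCompactSupport ζ → tsupport ζ ⊆ Ω →
    ∫ x in Ω, fderiv ℝ ζ x e * a x = - ∫ x in Ω, ζ x * a' x

theorem IsWeakGrad.isWeakDir {F : Type*} [NormedAddCommGroup F] [NormedSpace ℝ F] [CompleteSpace F]
    {v : Plane → F}
    {G : Plane → Plane →L[ℝ] F} (h : IsWeakGrad Ω v G) (hv : MemLp v 2 vol(Ω))
    (hG : MemLp G 2 vol(Ω)) (e : Plane) (L : F →L[ℝ] ℝ) :
    IsWeakDir Ω e (fun x => L (v x)) (fun x => L (G x e)) where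
  memLp := L.comp_memLp' hv
  memLp' := (L.comp (ContinuousLinearMap.apply ℝ F e)).comp_memLp' hG
  integral_eq := fun ζ hζ hc hs => by
    have hap : LocallyIntegrableOn (fun x => G x e) Ω := by
      intro x hx
      obtain ⟨s, hs, hi⟩ := h.locallyIntegrable_grad x hx
      exact ⟨s, hs, (ContinuousLinearMap.apply ℝ F e).integrable_comp hi⟩
    have i1 := integrableOn_test_smul h.locallyIntegrable (continuous_fderiv_apply hζ e)
      (hc.fderiv_apply (𝕜 := ℝ) e) ((tsupport_fderiv_apply_subset e).trans hs)
    have i2 := integrableOn_test_smul hap hζ.continuous hc hs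
    have h1 := congrArg L (h.integral_eq ζ hζ hc hs e)
    rw [map_neg, ← L.integral_comp_comm i1, ← L.integral_comp_comm i2] at h1
    simpa using h1

theorem MemLp.bounded_mul {X : Type*} [MeasurableSpace X] {ν : Measure X} {a b : X → ℝ} {C : ℝ}
    (ha : MemLp a 2 ν) (hb : AEStronglyMeasurable b ν) (hC : ∀ x, ‖b x‖ ≤ C) :
    MemLp (fun x => b x * a x) 2 ν :=
  ha.of_le_mul (c := C) (hb.mul ha.1) (.of_forall fun x => by
    rw [norm_mul]; exact mul_le_mul_of_nonneg_right (hC x) (norm_nonneg _))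

theorem IsWeakDir.mul_test (hΩ : IsOpen Ω) {e : Plane} {a a' : Plane → ℝ}
    (h : IsWeakDir Ω e a a') {χ : Plane → ℝ} (hχ : ContDiff ℝ ∞ χ) (hc : HasCompactSupport χ)
    (hs : tsupport χ ⊆ Ω) :
    MemLp (Ω.indicator fun x => χ x * a x) 2 volume ∧
    MemLp (Ω.indicator fun x => χ x * a' x + fderiv ℝ χ x e * a x) 2 volume ∧
    ∀ ζ : Plane → ℝ, ContDiff ℝ ∞ ζ → HasCompactSupport ζ →
      ∫ x, fderiv ℝ ζ x e * Ω.indicator (fun x => χ x * a x) x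
        = -∫ x, ζ x * Ω.indicator (fun x => χ x * a' x + fderiv ℝ χ x e * a x) x := by
  obtain ⟨C, hC⟩ := hc.exists_bound_of_continuous hχ.continuous
  have hχc := continuous_fderiv_apply hχ e
  obtain ⟨C', hC'⟩ := (hc.fderiv_apply (𝕜 := ℝ) e).exists_bound_of_continuous hχc
  have m1 := MemLp.bounded_mul h.memLp hχ.continuous.aestronglyMeasurable hC
  have m2 := MemLp.bounded_mul h.memLp' hχ.continuous.aestronglyMeasurable hC
  have m3 := MemLp.bounded_mul h.memLp hχc.aestronglyMeasurable hC'
  refine ⟨(memLp_indicator_iff_restrict hΩ.measurableSet).2 m1,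
    (memLp_indicator_iff_restrict hΩ.measurableSet).2 (m2.add m3), fun ζ hζ hζc => ?_⟩
  have e1 : ∀ f k : Plane → ℝ, ∫ x, f x * Ω.indicator k x = ∫ x in Ω, f x * k x := by
    intro f k
    rw [← integral_indicator hΩ.measurableSet]
    congr 1; ext x; by_cases hx : x ∈ Ω <;> simp [hx]
  rw [e1, e1]
  have hζm : ∀ {k : Plane → ℝ}, MemLp k 2 vol(Ω) → Integrable (fun x => ζ x * k x) vol(Ω) := by
    intro k hk
    exact (hζ.continuous.memLp_of_hasCompactSupport (p := 2) hζc).restrict Ω |>.integrable_mul hk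
  have hint := h.integral_eq (fun x => ζ x * χ x) (hζ.mul hχ) (hc.mul_left)
    ((tsupport_mul_subset_right).trans hs)
  have hder : ∀ x, fderiv ℝ (fun x => ζ x * χ x) x e = ζ x * fderiv ℝ χ x e + χ x * fderiv ℝ ζ x e := by
    intro x
    rw [fderiv_fun_mul (hζ.differentiable (by simp) x) (hχ.differentiable (by simp) x)]
    simp
  simp_rw [hder] at hint
  have hζ' : MemLp (fun x => fderiv ℝ ζ x e) 2 vol(Ω) :=
    ((continuous_fderiv_apply hζ e).memLp_of_hasCompactSupport (p := 2)
      (hζc.fderiv_apply (𝕜 := ℝ) e)).restrict Ω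
  have j1 : Integrable (fun x => fderiv ℝ ζ x e * (χ x * a x)) vol(Ω) :=
    hζ'.integrable_mul m1
  have j2 := hζm m3
  have j3 := hζm m2
  have s1 : ∫ x in Ω, (ζ x * fderiv ℝ χ x e + χ x * fderiv ℝ ζ x e) * a x
      = (∫ x in Ω, ζ x * (fderiv ℝ χ x e * a x)) + ∫ x in Ω, fderiv ℝ ζ x e * (χ x * a x) := by
    rw [← integral_add j2 j1]; congr 1; ext x; ring
  have s2 : ∫ x in Ω, ζ x * (χ x * a' x + fderiv ℝ χ x e * a x)
      = (∫ x in Ω, ζ x * (χ x * a' x)) + ∫ x in Ω, ζ x * (fderiv ℝ χ x e * a x) := by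
    rw [← integral_add j3 j2]; congr 1; ext x; ring
  have s3 : ∫ x in Ω, ζ x * χ x * a' x = ∫ x in Ω, ζ x * (χ x * a' x) := by
    congr 1; ext x; ring
  rw [s1, s3] at hint
  rw [s2]
  linarith

/-- A smooth cutoff function equal to one near the compact set `K`, with compact support in `Ω`. -/
theorem exists_cutoff_eq_one {Ω K : Set Plane} (hΩ : IsOpen Ω) (hK : IsCompact K) (hKΩ : K ⊆ Ω) :
    ∃ χ : Plane → ℝ, ContDiff ℝ ∞ χ ∧ HasCompactSupport χ ∧ tsupport χ ⊆ Ω ∧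
      ∀ x ∈ K, χ =ᶠ[𝓝 x] 1 := by
  obtain ⟨t, htc, hKt, htΩ⟩ := exists_compact_between hK hΩ hKΩ
  obtain ⟨f, hf1, hf0, -⟩ := exists_contMDiffMap_one_nhds_of_subset_interior
    (modelWithCornersSelf ℝ Plane) (n := ⊤) hK.isClosed hKt
  have hsub : tsupport f ⊆ t :=
    closure_minimal (fun x hx => by by_contra h; exact hx (hf0 x h)) htc.isClosed
  refine ⟨f, f.contMDiff.contDiff, htc.of_isClosed_subset (isClosed_tsupport _) hsub,
    hsub.trans htΩ, fun x hx => ?_⟩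
  exact (mem_nhdsSet_iff_forall.1 hf1) x hx

/-- The weak product rule, tested against a smooth compactly supported function. -/
theorem IsWeakDir.integral_product (hΩ : IsOpen Ω) {e : Plane}
    {a a' b b' : Plane → ℝ} (ha : IsWeakDir Ω e a a') (hb : IsWeakDir Ω e b b') {χ : Plane → ℝ}
    (hχ : ContDiff ℝ ∞ χ) (hc : HasCompactSupport χ) (hs : tsupport χ ⊆ Ω) :
    ∫ x in Ω, χ x * (a' x * b x + a x * b' x) = -∫ x in Ω, fderiv ℝ χ x e * (a x * b x) := by
  obtain ⟨χ₂, h2, h2c, h2s, h21⟩ := exists_cutoff_eq_one hΩ hc hs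
  obtain ⟨mA, mA', wA⟩ := ha.mul_test hΩ hχ hc hs
  obtain ⟨mB, mB', wB⟩ := hb.mul_test hΩ h2 h2c h2s
  have key := integral_mul_weakDeriv volume mA mA' mB mB' wA wB
  obtain ⟨C, hC⟩ := hc.exists_bound_of_continuous hχ.continuous
  have hχc := continuous_fderiv_apply hχ e
  obtain ⟨C', hC'⟩ := (hc.fderiv_apply (𝕜 := ℝ) e).exists_bound_of_continuous hχc
  have i1 : Integrable (fun x => χ x * (a' x * b x)) vol(Ω) := by
    have := (MemLp.bounded_mul ha.memLp' hχ.continuous.aestronglyMeasurable hC).integrable_mul hb.memLp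
    exact this.congr (.of_forall fun x => by simp [mul_assoc])
  have i2 : Integrable (fun x => χ x * (a x * b' x)) vol(Ω) := by
    have := (MemLp.bounded_mul ha.memLp hχ.continuous.aestronglyMeasurable hC).integrable_mul hb.memLp'
    exact this.congr (.of_forall fun x => by simp [mul_assoc])
  have i3 : Integrable (fun x => fderiv ℝ χ x e * (a x * b x)) vol(Ω) := by
    have := (MemLp.bounded_mul ha.memLp hχc.aestronglyMeasurable hC').integrable_mul hb.memLp
    exact this.congr (.of_forall fun x => by simp [mul_assoc])
  have hχ2 : ∀ x, χ x * χ₂ x = χ x ∧ fderiv ℝ χ x e * χ₂ x = fderiv ℝ χ x e ∧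
      χ x * fderiv ℝ χ₂ x e = 0 := by
    intro x
    by_cases hx : x ∈ tsupport χ
    · have h1 : χ₂ x = 1 := (h21 x hx).self_of_nhds
      have h3 : fderiv ℝ χ₂ x = 0 := by
        rw [(h21 x hx).fderiv_eq]; exact fderiv_const_apply (1 : ℝ)
      simp [h1, h3]
    · have h1 := image_eq_zero_of_notMem_tsupport hx
      have h3 : fderiv ℝ χ x e = 0 :=
        image_eq_zero_of_notMem_tsupport (f := fun x => fderiv ℝ χ x e) fun h => hx (tsupport_fderiv_apply_subset (ζ := χ) e h)
      simp [h1, h3]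
  have e1 : ∫ x, Ω.indicator (fun x => χ x * a' x + fderiv ℝ χ x e * a x) x
      * Ω.indicator (fun x => χ₂ x * b x) x
      = ∫ x in Ω, (χ x * (a' x * b x) + fderiv ℝ χ x e * (a x * b x)) := by
    rw [← integral_indicator hΩ.measurableSet]
    congr 1; ext x
    by_cases hx : x ∈ Ω
    · simp only [indicator_of_mem hx]
      linear_combination (a' x * b x) * (hχ2 x).1 + (a x * b x) * (hχ2 x).2.1
    · simp [hx]
  have e2 : ∫ x, Ω.indicator (fun x => χ x * a x) x
      * Ω.indicator (fun x => χ₂ x * b' x + fderiv ℝ χ₂ x e * b x) x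
      = ∫ x in Ω, χ x * (a x * b' x) := by
    rw [← integral_indicator hΩ.measurableSet]
    congr 1; ext x
    by_cases hx : x ∈ Ω
    · simp only [indicator_of_mem hx]
      linear_combination (a x * b' x) * (hχ2 x).1 + (a x * b x) * (hχ2 x).2.2
    · simp [hx]
  rw [e1, e2, integral_add i1 i3] at key
  have e3 : ∫ x in Ω, χ x * (a' x * b x + a x * b' x)
      = (∫ x in Ω, χ x * (a' x * b x)) + ∫ x in Ω, χ x * (a x * b' x) := by
    rw [← integral_add i1 i2]; congr 1; ext x; ring
  rw [e3]
  linarith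

/-- The integral of a product is continuous in `L² × L²`. -/
theorem tendsto_integral_mul_of_eLpNorm {X ι : Type*} [MeasurableSpace X] {ν : Measure X}
    {l : Filter ι} {f g : ι → X → ℝ} {f₀ g₀ : X → ℝ} (hf : ∀ᶠ n in l, MemLp (f n) 2 ν)
    (hg : ∀ᶠ n in l, MemLp (g n) 2 ν) (hf₀ : MemLp f₀ 2 ν) (hg₀ : MemLp g₀ 2 ν)
    (hfl : Tendsto (fun n => eLpNorm (f n - f₀) 2 ν) l (𝓝 0))
    (hgl : Tendsto (fun n => eLpNorm (g n - g₀) 2 ν) l (𝓝 0)) :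
    Tendsto (fun n => ∫ x, f n x * g n x ∂ν) l (𝓝 (∫ x, f₀ x * g₀ x ∂ν)) := by
  classical
  have main : ∀ {h : ι → X → ℝ} {h₀ : X → ℝ} (hh : ∀ᶠ n in l, MemLp (h n) 2 ν) (hh₀ : MemLp h₀ 2 ν),
      Tendsto (fun n => eLpNorm (h n - h₀) 2 ν) l (𝓝 0) →
      Tendsto (fun n => if H : MemLp (h n) 2 ν then H.toLp else 0) l (𝓝 hh₀.toLp) := by
    intro h h₀ hh hh₀ hl
    rw [tendsto_iff_edist_tendsto_0]
    refine hl.congr' ?_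
    filter_upwards [hh] with n hn
    rw [dif_pos hn, Lp.edist_toLp_toLp]
  have h1 := (main hf hf₀ hfl).inner (𝕜 := ℝ) (main hg hg₀ hgl)
  have hI : ∀ {X' Y : X → ℝ} (hX : MemLp X' 2 ν) (hY : MemLp Y 2 ν),
      inner ℝ hX.toLp hY.toLp = ∫ x, X' x * Y x ∂ν := by
    intro X' Y hX hY
    rw [L2.inner_def]
    refine integral_congr_ae ?_
    filter_upwards [hX.coeFn_toLp, hY.coeFn_toLp] with x hx hy
    rw [hx, hy]; simp [mul_comm]
  rw [hI] at h1
  refine h1.congr' ?_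
  filter_upwards [hf, hg] with n h1 h2
  rw [dif_pos h1, dif_pos h2, hI]

theorem tendsto_eLpNorm_clm_comp {X ι : Type*} [MeasurableSpace X] {ν : Measure X} {l : Filter ι}
    {V : Type*} [NormedAddCommGroup V] [NormedSpace ℝ V] (L : V →L[ℝ] ℝ)
    {f : ι → X → V} {f₀ : X → V}
    (h : Tendsto (fun n => eLpNorm (f n - f₀) 2 ν) l (𝓝 0)) :
    Tendsto (fun n => eLpNorm ((fun x => L (f n x)) - fun x => L (f₀ x)) 2 ν) l (𝓝 0) := by
  have h2 : Tendsto (fun n => ENNReal.ofReal ‖L‖ * eLpNorm (f n - f₀) 2 ν) l (𝓝 0) := by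
    have := ENNReal.Tendsto.const_mul (a := ENNReal.ofReal ‖L‖) h (Or.inr ENNReal.ofReal_ne_top)
    rwa [mul_zero] at this
  refine tendsto_of_tendsto_of_tendsto_of_le_of_le tendsto_const_nhds h2 (fun _ => zero_le) fun n => ?_
  refine eLpNorm_le_mul_eLpNorm_of_ae_le_mul (.of_forall fun x => ?_) 2
  simp only [Pi.sub_apply, ← map_sub]
  exact L.le_opNorm _

/-- Integration by parts against functions in `H¹₀`. -/
theorem IsWeakDir.integral_mul_H10 {F : Type*} [NormedAddCommGroup F] [NormedSpace ℝ F]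
    {e : Plane} {a a' : Plane → ℝ}
    (ha : IsWeakDir Ω e a a') {z : Plane → F} (hz : MemH10 Ω z) (L : F →L[ℝ] ℝ) :
    ∫ x in Ω, a' x * L (z x) = -∫ x in Ω, a x * L (weakGrad Ω z x e) := by
  obtain ⟨ζ, hζ, h0, h1⟩ := hz.approx
  have hm : ∀ n, MemLp (ζ n) 2 vol(Ω) := fun n =>
    ((hζ n).1.continuous.memLp_of_hasCompactSupport (hζ n).2.1).restrict Ω
  have hm' : ∀ n, MemLp (fderiv ℝ (ζ n)) 2 vol(Ω) := fun n =>
    (((hζ n).1.continuous_fderiv (by simp)).memLp_of_hasCompactSupport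
      ((hζ n).2.1.fderiv (𝕜 := ℝ))).restrict Ω
  have hc : ∀ f : Plane → ℝ, Tendsto (fun _ : ℕ => eLpNorm (f - f) 2 vol(Ω)) atTop (𝓝 0) := by
    intro f; simp
  have t1 := tendsto_integral_mul_of_eLpNorm (.of_forall fun _ => ha.memLp')
    (.of_forall fun n => L.comp_memLp' (hm n)) ha.memLp' (L.comp_memLp' hz.memH1.memLp)
    (hc a') (tendsto_eLpNorm_clm_comp L h0)
  set L' : (Plane →L[ℝ] F) →L[ℝ] ℝ := L.comp (ContinuousLinearMap.apply ℝ F e) with hL'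
  have t2 := tendsto_integral_mul_of_eLpNorm (.of_forall fun _ => ha.memLp)
    (.of_forall fun n => L'.comp_memLp' (hm' n)) ha.memLp (L'.comp_memLp' hz.memH1.memLp_grad)
    (hc a) (tendsto_eLpNorm_clm_comp L' h1)
  have heq : ∀ n, ∫ x in Ω, a' x * L (ζ n x) = -∫ x in Ω, a x * L' (fderiv ℝ (ζ n) x) := by
    intro n
    have := ha.integral_eq (fun x => L (ζ n x)) (L.contDiff.comp (hζ n).1)
      ((hζ n).2.1.comp_left (map_zero L)) ((tsupport_comp_subset (map_zero L) _).trans (hζ n).2.2)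
    have hd : ∀ x, fderiv ℝ (fun x => L (ζ n x)) x e = L' (fderiv ℝ (ζ n) x) := fun x => by
      have := (L.hasFDerivAt.comp x ((hζ n).1.differentiable (by simp) x).hasFDerivAt).fderiv
      rw [Function.comp_def] at this
      rw [this]; rfl
    simp_rw [hd] at this
    rw [← neg_eq_iff_eq_neg] at this
    rw [show (∫ x in Ω, a' x * L (ζ n x)) = ∫ x in Ω, L (ζ n x) * a' x by simp_rw [mul_comm],
      ← this]
    simp_rw [mul_comm]
  exact tendsto_nhds_unique t1 ((t2.neg).congr fun n => (heq n).symm)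

/-! ### Radial functions -/

section Radial

variable {h h' : ℝ → ℝ}

theorem hasFDerivAt_radial (hd : ∀ s, 0 ≤ s → HasDerivWithinAt h (h' s) (Ici 0) s) (h0 : h' 0 = 0)
    (v : Plane) :
    HasFDerivAt (fun v : Plane => h ‖v‖) (innerSL ℝ (h' ‖v‖ • (‖v‖⁻¹ • v))) v := by
  by_cases hv : v = 0
  · subst hv
    have h1 := hd 0 le_rfl
    rw [h0, hasDerivWithinAt_iff_isLittleO] at h1
    rw [hasFDerivAt_iff_isLittleO]
    have h2 : Tendsto (fun v : Plane => ‖v‖) (𝓝 0) (𝓝[Ici 0] 0) := by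
      rw [tendsto_nhdsWithin_iff]
      exact ⟨by simpa using (continuous_norm (E := Plane)).tendsto 0,
        Eventually.of_forall fun v => norm_nonneg v⟩
    have h3 := h1.comp_tendsto h2
    have h4 : (fun v : Plane => h ‖v‖ - h 0) =o[𝓝 0] fun v : Plane => ‖v‖ := by
      simpa [Function.comp_def] using h3
    simpa using h4.of_norm_right
  · have hn : 0 < ‖v‖ := norm_pos_iff.2 hv
    have h1 : HasDerivAt h (h' ‖v‖) ‖v‖ := (hd _ hn.le).hasDerivAt (Ici_mem_nhds hn)
    have h2 : HasFDerivAt (fun v : Plane => ‖v‖) (innerSL ℝ (‖v‖⁻¹ • v)) v := by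
      have h3 := (hasStrictFDerivAt_norm_sq v).hasFDerivAt.sqrt (by positivity)
      simp only [Real.sqrt_sq (norm_nonneg _)] at h3
      refine h3.congr_fderiv ?_
      ext w
      simp
      field_simp
    have := h1.comp_hasFDerivAt v h2
    refine this.congr_fderiv ?_
    ext w
    simp

theorem continuous_radial_grad (hc : ContinuousOn h' (Ici 0)) (h0 : h' 0 = 0) :
    Continuous fun v : Plane => h' ‖v‖ • (‖v‖⁻¹ • v) := by
  have hcn : Continuous fun v : Plane => h' ‖v‖ :=
    hc.comp_continuous continuous_norm fun v => norm_nonneg v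
  rw [continuous_iff_continuousAt]
  intro v
  by_cases hv : v = 0
  · subst hv
    rw [ContinuousAt, norm_zero, h0, zero_smul]
    have h1 : Tendsto (fun v : Plane => |h' ‖v‖|) (𝓝 0) (𝓝 0) := by
      have := (hcn.tendsto 0).abs
      simpa [h0] using this
    refine squeeze_zero_norm (fun v => ?_) h1
    rw [norm_smul, Real.norm_eq_abs, norm_smul, norm_inv, norm_norm]
    exact mul_le_of_le_one_right (abs_nonneg _) inv_mul_le_one
  · have : ‖v‖ ≠ 0 := norm_ne_zero_iff.2 hv
    exact hcn.continuousAt.smul ((continuous_norm.continuousAt.inv₀ this).smul continuousAt_id)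

theorem contDiff_radial (hd : ∀ s, 0 ≤ s → HasDerivWithinAt h (h' s) (Ici 0) s)
    (hc : ContinuousOn h' (Ici 0)) (h0 : h' 0 = 0) : ContDiff ℝ 1 fun v : Plane => h ‖v‖ := by
  rw [contDiff_one_iff_hasFDerivAt]
  exact ⟨_, (innerSL ℝ).continuous.comp (continuous_radial_grad hc h0),
    fun v => hasFDerivAt_radial hd h0 v⟩

theorem gradient_radial (hd : ∀ s, 0 ≤ s → HasDerivWithinAt h (h' s) (Ici 0) s) (h0 : h' 0 = 0)
    (v : Plane) : gradient (fun v : Plane => h ‖v‖) v = h' ‖v‖ • (‖v‖⁻¹ • v) := by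
  have := hasFDerivAt_radial hd h0 v
  refine HasGradientAt.gradient ?_
  rw [hasGradientAt_iff_hasFDerivAt]
  exact this

end Radial

/-! ### The chain rule in time -/

theorem AbsolutelyContinuousOnInterval.of_dist_le {X : Type*} [PseudoMetricSpace X] {f : ℝ → X}
    {m : ℝ → ℝ} {a b K : ℝ} (hm : AbsolutelyContinuousOnInterval m a b)
    (h : ∀ s ∈ uIcc a b, ∀ t ∈ uIcc a b, dist (f s) (f t) ≤ K * dist (m s) (m t)) :
    AbsolutelyContinuousOnInterval f a b := by
  have h0 := Tendsto.const_mul K hm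
  rw [mul_zero] at h0
  refine squeeze_zero' (.of_forall fun E => Finset.sum_nonneg fun _ _ => dist_nonneg) ?_ h0
  refine eventually_inf_principal.2 (.of_forall fun E hE => ?_)
  rw [Finset.mul_sum]
  exact Finset.sum_le_sum fun i hi => h _ (hE.1 i hi).1 _ (hE.1 i hi).2

/-- The chain rule for a `C¹` function along an absolutely continuous curve, with a `C¹` weight. -/
theorem integral_chain_time {E : Type*} [NormedAddCommGroup E] [NormedSpace ℝ E]
    [FiniteDimensional ℝ E] {w : ℝ → E} (hw : Integrable w) (y₀ : E) {Θ : E → ℝ}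
    (hΘ : ContDiff ℝ 1 Θ) {a b : ℝ} (hab : a ≤ b) {β β' : ℝ → ℝ}
    (hβ : ∀ t ∈ Icc a b, HasDerivAt β (β' t) t) (hβ' : ContinuousOn β' (Icc a b)) :
    ∫ t in a..b, (β' t * Θ (y₀ + ∫ τ in (0:ℝ)..t, w τ)
        + β t * fderiv ℝ Θ (y₀ + ∫ τ in (0:ℝ)..t, w τ) (w t))
      = β b * Θ (y₀ + ∫ τ in (0:ℝ)..b, w τ) - β a * Θ (y₀ + ∫ τ in (0:ℝ)..a, w τ) := by
  set y : ℝ → E := fun t => y₀ + ∫ τ in (0:ℝ)..t, w τ with hy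
  have hwi : ∀ s t, IntervalIntegrable w volume s t := fun s t => hw.intervalIntegrable
  have hwn : ∀ s t, IntervalIntegrable (fun τ => ‖w τ‖) volume s t := fun s t => (hwi s t).norm
  have hyd : ∀ s t, y s - y t = ∫ τ in t..s, w τ := by
    intro s t
    simp only [hy, add_sub_add_left_eq_sub]
    rw [intervalIntegral.integral_interval_sub_left (hwi _ _) (hwi _ _)]
  have hyc : Continuous y :=
    continuous_const.add (intervalIntegral.continuous_primitive hwi 0)
  have hm : AbsolutelyContinuousOnInterval (fun x => ∫ τ in a..x, ‖w τ‖) a b :=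
    (hwn a b).absolutelyContinuousOnInterval_intervalIntegral (by simp)
  have hΘd := hΘ.differentiable (by simp)
  obtain ⟨R, hR⟩ := (isCompact_uIcc.image hyc).isBounded.subset_closedBall (0 : E) (s := y '' uIcc a b)
  obtain ⟨K, hK⟩ : ∃ K : NNReal, LipschitzOnWith K Θ (closedBall 0 R) :=
    hΘ.contDiffOn.exists_lipschitzOnWith (by simp) (convex_closedBall _ _)
      (isCompact_closedBall _ _)
  have hΘy : AbsolutelyContinuousOnInterval (fun t => Θ (y t)) a b := by
    refine AbsolutelyContinuousOnInterval.of_dist_le (K := K) hm fun s hs t ht => ?_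
    have h1 := hK.dist_le_mul _ (hR (mem_image_of_mem y hs)) _
      (hR (mem_image_of_mem y ht))
    refine h1.trans (mul_le_mul_of_nonneg_left ?_ K.2)
    rw [dist_eq_norm, hyd, Real.dist_eq, intervalIntegral.integral_interval_sub_left (hwn _ _) (hwn _ _)]
    exact intervalIntegral.norm_integral_le_abs_integral_norm
  have hβac : AbsolutelyContinuousOnInterval β a b := by
    obtain ⟨C, hC⟩ := isCompact_Icc.exists_bound_of_continuousOn hβ'
    have hC' : ∀ t ∈ Icc a b, ‖β' t‖₊ ≤ C.toNNReal := fun t ht => by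
      rw [← NNReal.coe_le_coe, coe_nnnorm]; exact (hC t ht).trans (Real.le_coe_toNNReal C)
    have := (convex_Icc a b).lipschitzOnWith_of_nnnorm_hasDerivWithin_le
      (fun t ht => (hβ t ht).hasDerivWithinAt) hC'
    rw [← uIcc_of_le hab] at this
    exact this.absolutelyContinuousOnInterval
  rw [← hβac.integral_deriv_mul_eq_sub hΘy]
  refine intervalIntegral.integral_congr_ae ?_
  filter_upwards [LocallyIntegrable.ae_hasDerivAt_integral hw.locallyIntegrable] with t ht htab
  rw [uIoc_of_le hab] at htab
  have hyt : HasDerivAt y (w t) t := (ht 0).const_add y₀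
  have h1 := ((hΘd (y t)).hasFDerivAt.comp_hasDerivAt t hyt).deriv
  rw [(hβ t (Ioc_subset_Icc_self htab)).deriv]
  rw [Function.comp_def] at h1
  rw [h1]

/-! ### Dominated convergence in `L²` -/

theorem tendsto_eLpNorm_two_of_dominated {X ι : Type*} [MeasurableSpace X] {ν : Measure X}
    {V : Type*} [NormedAddCommGroup V] {l : Filter ι} [l.IsCountablyGenerated]
    {f : ι → X → V} {f₀ : X → V} {B : X → ℝ} (hB : MemLp B 2 ν)
    (hf : ∀ᶠ n in l, AEStronglyMeasurable (f n) ν) (hf₀ : AEStronglyMeasurable f₀ ν)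
    (hfB : ∀ᶠ n in l, ∀ᵐ x ∂ν, ‖f n x‖ ≤ B x) (hf₀B : ∀ᵐ x ∂ν, ‖f₀ x‖ ≤ B x)
    (hlim : ∀ᵐ x ∂ν, Tendsto (fun n => f n x) l (𝓝 (f₀ x))) :
    Tendsto (fun n => eLpNorm (f n - f₀) 2 ν) l (𝓝 0) := by
  have hmem : ∀ᶠ n in l, MemLp (f n - f₀) 2 ν := by
    filter_upwards [hf, hfB] with n hn hb
    exact (hB.mono hn (hb.mono fun x hx => hx.trans (le_abs_self _))).sub
      (hB.mono hf₀ (hf₀B.mono fun x hx => hx.trans (le_abs_self _)))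
  have key : Tendsto (fun n => ∫ x, ‖(f n - f₀) x‖ ^ 2 ∂ν) l (𝓝 (∫ x, (0 : ℝ) ∂ν)) := by
    refine tendsto_integral_filter_of_dominated_convergence (fun x => 4 * B x ^ 2) ?_ ?_
      (hB.integrable_sq.const_mul 4) ?_
    · filter_upwards [hf] with n hn
      exact (hn.sub hf₀).norm.pow 2
    · filter_upwards [hfB] with n hn
      filter_upwards [hn, hf₀B] with x h1 h2
      rw [Pi.sub_apply, Real.norm_of_nonneg (by positivity)]
      nlinarith [norm_sub_le (f n x) (f₀ x), norm_nonneg (f n x - f₀ x)]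
    · filter_upwards [hlim] with x hx
      have h5 : Tendsto (fun n => ‖f n x - f₀ x‖) l (𝓝 0) := by
        simpa using (hx.sub_const (f₀ x)).norm
      simpa using h5.pow 2
  rw [integral_zero] at key
  have h1 : Tendsto (fun n => ENNReal.ofReal (Real.sqrt (∫ x, ‖(f n - f₀) x‖ ^ 2 ∂ν))) l (𝓝 0) := by
    simpa using ENNReal.tendsto_ofReal ((Real.continuous_sqrt.tendsto 0).comp (by simpa using key))
  refine h1.congr' ?_
  filter_upwards [hmem] with n hn
  rw [hn.eLpNorm_eq_integral_rpow_norm (by simp) (by simp), Real.sqrt_eq_rpow]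
  simp

/-! ### The chain rule in space -/

theorem clm_comp_aestronglyMeasurable {X : Type*} [MeasurableSpace X] {ν : Measure X}
    {a : X → Plane →L[ℝ] ℝ} {b : X → Plane →L[ℝ] Plane}
    (ha : AEStronglyMeasurable a ν) (hb : AEStronglyMeasurable b ν) :
    AEStronglyMeasurable (fun x => (a x).comp (b x)) ν :=
  (isBoundedBilinearMap_comp (𝕜 := ℝ)).continuous.comp_aestronglyMeasurable (ha.prodMk hb)

theorem integral_chain_test {Θ : Plane → ℝ} (hΘ : ContDiff ℝ 1 Θ) {ζ : Plane → Plane}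
    (hζ : ContDiff ℝ ∞ ζ) {χ : Plane → ℝ} (hχ : ContDiff ℝ ∞ χ) (hc : HasCompactSupport χ)
    (hs : tsupport χ ⊆ Ω) (e : Plane) :
    ∫ x in Ω, fderiv ℝ χ x e * Θ (ζ x) = -∫ x in Ω, χ x * fderiv ℝ Θ (ζ x) (fderiv ℝ ζ x e) := by
  have hχc := continuous_fderiv_apply hχ e
  have hsup : Function.support (fun x => fderiv ℝ χ x e) ⊆ Ω :=
    (subset_tsupport _).trans ((tsupport_fderiv_apply_subset e).trans hs)
  have hcd : HasCompactSupport fun x => fderiv ℝ χ x e :=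
    hc.of_isClosed_subset (isClosed_tsupport _) (tsupport_fderiv_apply_subset e)
  have hΘζ : ContDiff ℝ 1 fun x => Θ (ζ x) := hΘ.comp (hζ.of_le (by simp))
  have hd : ∀ x, fderiv ℝ (fun x => Θ (ζ x)) x e = fderiv ℝ Θ (ζ x) (fderiv ℝ ζ x e) := fun x => by
    have := fderiv_comp x (hΘ.differentiable (by simp) (ζ x)) (hζ.differentiable (by simp) x)
    rw [Function.comp_def] at this
    rw [this]
    rfl
  rw [setIntegral_eq_integral_of_forall_compl_eq_zero, setIntegral_eq_integral_of_forall_compl_eq_zero]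
  · have hcd' : Continuous fun x => fderiv ℝ (fun x => Θ (ζ x)) x e :=
      (hΘζ.continuous_fderiv (by simp)).clm_apply continuous_const
    have := integral_mul_fderiv_eq_neg_fderiv_mul_of_integrable (μ := (volume : Measure Plane))
      (f := fun x => Θ (ζ x)) (g := χ) (v := e)
      ((hcd'.mul hχ.continuous).integrable_of_hasCompactSupport hc.mul_left)
      ((hΘζ.continuous.mul hχc).integrable_of_hasCompactSupport hcd.mul_left)
      ((hΘζ.continuous.mul hχ.continuous).integrable_of_hasCompactSupport hc.mul_left)
      (fun x _ => hΘζ.differentiable (by simp) x) (fun x _ => hχ.differentiable (by simp) x)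
    simp_rw [hd] at this
    simp_rw [mul_comm (fderiv ℝ χ _ e), mul_comm (χ _)]
    exact this
  · intro x hx
    have : χ x = 0 := image_eq_zero_of_notMem_tsupport fun h => hx (hs h)
    simp [this]
  · intro x hx
    have : fderiv ℝ χ x e = 0 := by
      by_contra h
      exact hx (hsup h)
    simp [this]

theorem isWeakGrad_comp_of_bounded
    (hf : IsFiniteMeasure vol(Ω)) {u : Plane → Plane} (hu : MemH10 Ω u)
    {Θ : Plane → ℝ} (hΘ : ContDiff ℝ 1 Θ) {K : ℝ} (hK : ∀ v, ‖fderiv ℝ Θ v‖ ≤ K) :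
    IsWeakGrad Ω (fun x => Θ (u x)) fun x => (fderiv ℝ Θ (u x)).comp (weakGrad Ω u x) := by
  have hK0 : 0 ≤ K := (norm_nonneg _).trans (hK 0)
  have hd := hΘ.differentiable (by simp)
  have hdc := hΘ.continuous_fderiv (by simp)
  have hlip : ∀ v w, ‖Θ v - Θ w‖ ≤ K * ‖v - w‖ := fun v w =>
    (convex_univ).norm_image_sub_le_of_norm_fderiv_le (fun x _ => hd x) (fun x _ => hK x)
      (mem_univ w) (mem_univ v)
  have hu2 := hu.memH1.memLp
  have hg2 := hu.memH1.memLp_grad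
  have mΘ : MemLp (fun x => Θ (u x)) 2 vol(Ω) := by
    have h0 : MemLp (fun x => Θ (u x) - Θ 0) 2 vol(Ω) :=
      hu2.of_le_mul (c := K)
        ((hΘ.continuous.comp_aestronglyMeasurable hu2.1).sub aestronglyMeasurable_const)
        (.of_forall fun x => by simpa using hlip (u x) 0)
    refine (h0.add (memLp_const (Θ 0))).ae_eq (.of_forall fun x => ?_)
    simp
  have mG : MemLp (fun x => (fderiv ℝ Θ (u x)).comp (weakGrad Ω u x)) 2 vol(Ω) :=
    hg2.of_le_mul (c := K)
      (clm_comp_aestronglyMeasurable (hdc.comp_aestronglyMeasurable hu2.1) hg2.1)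
      (.of_forall fun x => (ContinuousLinearMap.opNorm_comp_le _ _).trans
        (mul_le_mul_of_nonneg_right (hK _) (norm_nonneg _)))
  have hli : ∀ {E : Type} [NormedAddCommGroup E] {v : Plane → E}, MemLp v 2 vol(Ω) →
      LocallyIntegrableOn v Ω := fun hv =>
    IntegrableOn.locallyIntegrableOn (hv.integrable (by norm_num))
  refine ⟨hli mΘ, hli mG, fun χ hχ hc hs e => ?_⟩
  obtain ⟨ζ', hζ', h0', h1'⟩ := hu.approx
  have hm' : ∀ n, MemLp (ζ' n) 2 vol(Ω) := fun n =>
    ((hζ' n).1.continuous.memLp_of_hasCompactSupport (hζ' n).2.1).restrict Ω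
  obtain ⟨ns, hns, hae⟩ := (tendstoInMeasure_of_tendsto_eLpNorm (by simp) (fun n => (hm' n).1)
    hu2.1 h0').exists_seq_tendsto_ae
  obtain ⟨ζ, hζe⟩ : ∃ ζ, ζ = fun n => ζ' (ns n) := ⟨_, rfl⟩
  have hζ : ∀ n, ContDiff ℝ ∞ (ζ n) ∧ HasCompactSupport (ζ n) := fun n => by
    rw [hζe]; exact ⟨(hζ' _).1, (hζ' _).2.1⟩
  have h0 : Tendsto (fun n => eLpNorm (ζ n - u) 2 vol(Ω)) atTop (𝓝 0) := by
    rw [hζe]; exact h0'.comp hns.tendsto_atTop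
  have h1 : Tendsto (fun n => eLpNorm (fderiv ℝ (ζ n) - weakGrad Ω u) 2 vol(Ω))
      atTop (𝓝 0) := by
    rw [hζe]; exact h1'.comp hns.tendsto_atTop
  have hae : ∀ᵐ x ∂vol(Ω), Tendsto (fun n => ζ n x) atTop (𝓝 (u x)) := by
    rw [hζe]; exact hae
  have hm : ∀ n, MemLp (ζ n) 2 vol(Ω) := fun n =>
    ((hζ n).1.continuous.memLp_of_hasCompactSupport (hζ n).2).restrict Ω
  have hmd : ∀ n, MemLp (fderiv ℝ (ζ n)) 2 vol(Ω) := fun n =>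
    (((hζ n).1.continuous_fderiv (by simp)).memLp_of_hasCompactSupport
      ((hζ n).2.fderiv (𝕜 := ℝ))).restrict Ω
  have ae : MemLp (fun x => fderiv ℝ Θ (u x) (weakGrad Ω u x e)) 2 vol(Ω) :=
    (ContinuousLinearMap.apply ℝ ℝ e).comp_memLp' mG
  have aen : ∀ n, MemLp (fun x => fderiv ℝ Θ (ζ n x) (fderiv ℝ (ζ n) x e)) 2
      vol(Ω) := fun n => by
    have : MemLp (fun x => (fderiv ℝ Θ (ζ n x)).comp (fderiv ℝ (ζ n) x)) 2 vol(Ω) :=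
      (hmd n).of_le_mul (c := K)
        (clm_comp_aestronglyMeasurable (hdc.comp_aestronglyMeasurable (hm n).1) (hmd n).1)
        (.of_forall fun x => (ContinuousLinearMap.opNorm_comp_le _ _).trans
          (mul_le_mul_of_nonneg_right (hK _) (norm_nonneg _)))
    exact (ContinuousLinearMap.apply ℝ ℝ e).comp_memLp' this
  have mχ : MemLp χ 2 vol(Ω) :=
    (hχ.continuous.memLp_of_hasCompactSupport hc).restrict Ω
  have mχ' : MemLp (fun x => fderiv ℝ χ x e) 2 vol(Ω) :=
    ((continuous_fderiv_apply hχ e).memLp_of_hasCompactSupport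
      (hc.of_isClosed_subset (isClosed_tsupport _) (tsupport_fderiv_apply_subset e))).restrict Ω
  have mΘn : ∀ n, MemLp (fun x => Θ (ζ n x)) 2 vol(Ω) := fun n => by
    have h0 : MemLp (fun x => Θ (ζ n x) - Θ 0) 2 vol(Ω) :=
      (hm n).of_le_mul (c := K)
        ((hΘ.continuous.comp_aestronglyMeasurable (hm n).1).sub aestronglyMeasurable_const)
        (.of_forall fun x => by simpa using hlip (ζ n x) 0)
    refine (h0.add (memLp_const (Θ 0))).ae_eq (.of_forall fun x => ?_)
    simp
  have t1 : Tendsto (fun n => eLpNorm ((fun x => Θ (ζ n x)) - fun x => Θ (u x)) 2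
      vol(Ω)) atTop (𝓝 0) := by
    have h2 := ENNReal.Tendsto.const_mul (a := ENNReal.ofReal K) h0 (Or.inr ENNReal.ofReal_ne_top)
    rw [mul_zero] at h2
    exact tendsto_of_tendsto_of_tendsto_of_le_of_le tendsto_const_nhds h2 (fun _ => zero_le)
      fun n => eLpNorm_le_mul_eLpNorm_of_ae_le_mul (.of_forall fun x => hlip _ _) 2
  have t2 : Tendsto (fun n => eLpNorm ((fun x => fderiv ℝ Θ (ζ n x) (fderiv ℝ (ζ n) x e))
      - fun x => fderiv ℝ Θ (u x) (weakGrad Ω u x e)) 2 vol(Ω)) atTop (𝓝 0) := by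
    have h2 := ENNReal.Tendsto.const_mul (a := ENNReal.ofReal (K * ‖e‖)) h1
      (Or.inr ENNReal.ofReal_ne_top)
    rw [mul_zero] at h2
    have mixm : ∀ {v : Plane → Plane}, AEStronglyMeasurable v vol(Ω) →
        AEStronglyMeasurable (fun x => fderiv ℝ Θ (v x) (weakGrad Ω u x e)) vol(Ω) :=
      fun hv => (ContinuousLinearMap.apply ℝ ℝ e).continuous.comp_aestronglyMeasurable
        (clm_comp_aestronglyMeasurable (hdc.comp_aestronglyMeasurable hv) hg2.1)
    have mixb : ∀ v : Plane → Plane, ∀ x,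
        ‖fderiv ℝ Θ (v x) (weakGrad Ω u x e)‖ ≤ K * ‖e‖ * ‖weakGrad Ω u x‖ := fun v x =>
      calc _ ≤ ‖fderiv ℝ Θ (v x)‖ * ‖weakGrad Ω u x e‖ := ContinuousLinearMap.le_opNorm _ _
        _ ≤ K * (‖weakGrad Ω u x‖ * ‖e‖) :=
          mul_le_mul (hK _) (ContinuousLinearMap.le_opNorm _ _) (norm_nonneg _) hK0
        _ = _ := by ring
    have h3 : Tendsto (fun n => eLpNorm ((fun x => fderiv ℝ Θ (ζ n x) (weakGrad Ω u x e))
        - fun x => fderiv ℝ Θ (u x) (weakGrad Ω u x e)) 2 vol(Ω)) atTop (𝓝 0) :=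
      tendsto_eLpNorm_two_of_dominated (hg2.norm.const_mul (K * ‖e‖))
        (.of_forall fun n => mixm (hm n).1) (mixm hu2.1)
        (.of_forall fun n => Eventually.of_forall fun x => mixb (ζ n) x)
        (.of_forall fun x => mixb u x)
        (hae.mono fun x hx => by
          have h5 : Tendsto (fun n => fderiv ℝ Θ (ζ n x)) atTop (𝓝 (fderiv ℝ Θ (u x))) :=
            (hdc.tendsto _).comp hx
          exact ((ContinuousLinearMap.apply ℝ ℝ (weakGrad Ω u x e)).continuous.tendsto _).comp h5)
    have h4 := h2.add h3
    rw [add_zero] at h4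
    refine tendsto_of_tendsto_of_tendsto_of_le_of_le tendsto_const_nhds h4 (fun _ => zero_le)
      fun n => ?_
    have e1 : (fun x => fderiv ℝ Θ (ζ n x) (fderiv ℝ (ζ n) x e))
        - (fun x => fderiv ℝ Θ (u x) (weakGrad Ω u x e))
        = (fun x => fderiv ℝ Θ (ζ n x) ((fderiv ℝ (ζ n) x - weakGrad Ω u x) e))
          + ((fun x => fderiv ℝ Θ (ζ n x) (weakGrad Ω u x e))
            - fun x => fderiv ℝ Θ (u x) (weakGrad Ω u x e)) := by
      ext x; simp
    have e2 : (fun x => fderiv ℝ Θ (ζ n x) ((fderiv ℝ (ζ n) x - weakGrad Ω u x) e))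
        = (fun x => fderiv ℝ Θ (ζ n x) (fderiv ℝ (ζ n) x e))
          - fun x => fderiv ℝ Θ (ζ n x) (weakGrad Ω u x e) := by
      ext x; simp
    rw [e1]
    refine (eLpNorm_add_le (e2 ▸ (aen n).1.sub (mixm (hm n).1))
      ((mixm (hm n).1).sub (mixm hu2.1)) (by norm_num)).trans ?_
    refine add_le_add (eLpNorm_le_mul_eLpNorm_of_ae_le_mul (.of_forall fun x => ?_) 2) le_rfl
    calc _ ≤ ‖fderiv ℝ Θ (ζ n x)‖ * ‖(fderiv ℝ (ζ n) x - weakGrad Ω u x) e‖ :=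
          ContinuousLinearMap.le_opNorm _ _
      _ ≤ K * (‖(fderiv ℝ (ζ n) - weakGrad Ω u) x‖ * ‖e‖) :=
          mul_le_mul (hK _) (ContinuousLinearMap.le_opNorm _ _) (norm_nonneg _) hK0
      _ = _ := by ring
  have czero : ∀ h : Plane → ℝ, Tendsto (fun _ : ℕ => eLpNorm (h - h) 2 vol(Ω))
      atTop (𝓝 0) := fun h => by simp
  have l1 := tendsto_integral_mul_of_eLpNorm (l := atTop) (.of_forall fun _ : ℕ => mχ')
    (Eventually.of_forall mΘn) mχ' mΘ (czero _) t1
  have l2 := (tendsto_integral_mul_of_eLpNorm (l := atTop) (.of_forall fun _ : ℕ => mχ)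
    (Eventually.of_forall aen) mχ ae (czero _) t2).neg
  refine tendsto_nhds_unique l1 (l2.congr fun n => ?_)
  exact (integral_chain_test hΘ (hζ n).1 hχ hc hs e).symm

/-- A smooth truncation of the identity of `[0, ∞)`. -/
def trunc (k s : ℝ) : ℝ := ∫ r in (0 : ℝ)..s, max 0 (min 1 (2 - r / k))

theorem trunc_integrand_continuous (k : ℝ) : Continuous fun r : ℝ => max 0 (min 1 (2 - r / k)) := by
  fun_prop

theorem hasDerivAt_trunc (k s : ℝ) : HasDerivAt (trunc k) (max 0 (min 1 (2 - s / k))) s :=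
  (trunc_integrand_continuous k).integral_hasStrictDerivAt 0 s |>.hasDerivAt

theorem contDiff_trunc (k : ℝ) : ContDiff ℝ 1 (trunc k) := by
  rw [contDiff_one_iff_deriv]
  refine ⟨fun s => (hasDerivAt_trunc k s).differentiableAt, ?_⟩
  have : deriv (trunc k) = fun s => max 0 (min 1 (2 - s / k)) :=
    funext fun s => (hasDerivAt_trunc k s).deriv
  rw [this]
  exact trunc_integrand_continuous k

theorem trunc_eq {k s : ℝ} (hk : 0 < k) (h0 : 0 ≤ s) (hs : s ≤ k) : trunc k s = s := by
  have : trunc k s = ∫ r in (0 : ℝ)..s, (1 : ℝ) := by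
    refine intervalIntegral.integral_congr fun r hr => ?_
    rw [uIcc_of_le h0] at hr
    have h1 : r / k ≤ 1 := (div_le_one hk).2 (hr.2.trans hs)
    rw [min_eq_left (by linarith), max_eq_right zero_le_one]
  rw [this]
  simp

theorem trunc_mem {k s : ℝ} (h0 : 0 ≤ s) : 0 ≤ trunc k s ∧ trunc k s ≤ s := by
  refine ⟨intervalIntegral.integral_nonneg h0 fun r _ => le_max_left _ _, ?_⟩
  have : trunc k s ≤ ∫ r in (0 : ℝ)..s, (1 : ℝ) := by
    refine intervalIntegral.integral_mono_on h0
      ((trunc_integrand_continuous k).intervalIntegrable _ _) (by simp) fun r _ => ?_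
    exact max_le zero_le_one (min_le_left _ _)
  simpa using this

/-- The chain rule for a nonnegative coercive `C¹` function of an `H¹₀` map. -/
theorem isWeakGrad_comp (hf : IsFiniteMeasure vol(Ω))
    {u : Plane → Plane} (hu : MemH10 Ω u)
    {Θ : Plane → ℝ} (hΘ : ContDiff ℝ 1 Θ) (hΘ0 : ∀ v, 0 ≤ Θ v)
    (hco : Tendsto Θ (cocompact Plane) atTop)
    (hi : IntegrableOn (fun x => Θ (u x)) Ω)
    (hi' : IntegrableOn (fun x => ‖fderiv ℝ Θ (u x)‖ * ‖weakGrad Ω u x‖) Ω) :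
    IsWeakGrad Ω (fun x => Θ (u x)) fun x => (fderiv ℝ Θ (u x)).comp (weakGrad Ω u x) := by
  have hu2 := hu.memH1.memLp
  have hg2 := hu.memH1.memLp_grad
  have hd := hΘ.differentiable (by simp)
  have hdc := hΘ.continuous_fderiv (by simp)
  have mG : IntegrableOn (fun x => (fderiv ℝ Θ (u x)).comp (weakGrad Ω u x)) Ω :=
    hi'.mono' (clm_comp_aestronglyMeasurable (hdc.comp_aestronglyMeasurable hu2.1) hg2.1)
      (.of_forall fun x => ContinuousLinearMap.opNorm_comp_le _ _)
  refine ⟨hi.locallyIntegrableOn, mG.locallyIntegrableOn, fun χ hχ hc hs e => ?_⟩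
  have hder : ∀ (k : ℝ) v, fderiv ℝ (fun v => trunc k (Θ v)) v
      = max 0 (min 1 (2 - Θ v / k)) • fderiv ℝ Θ v := fun k v =>
    ((hasDerivAt_trunc k _).comp_hasFDerivAt v (hd v).hasFDerivAt).fderiv
  have hb : ∀ n : ℕ, ∃ K, ∀ v, ‖fderiv ℝ (fun v => trunc (n + 1) (Θ v)) v‖ ≤ K := by
    intro n
    have hn : (0 : ℝ) < n + 1 := by positivity
    obtain ⟨t, htc, ht⟩ := mem_cocompact.1 (hco.eventually_ge_atTop (2 * ((n : ℝ) + 1)))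
    obtain ⟨K, hK⟩ := htc.exists_bound_of_continuousOn hdc.continuousOn
    refine ⟨max K 0, fun v => ?_⟩
    rw [hder]
    by_cases hv : v ∈ t
    · rw [norm_smul, Real.norm_of_nonneg (le_max_left _ _)]
      refine (mul_le_of_le_one_left (norm_nonneg _) ?_).trans ((hK v hv).trans (le_max_left _ _))
      exact max_le zero_le_one (min_le_left _ _)
    · have h1 : 2 * ((n : ℝ) + 1) ≤ Θ v := ht hv
      have h2 : 2 - Θ v / (n + 1) ≤ 0 := by
        rw [sub_nonpos, le_div_iff₀ hn]; exact h1
      rw [max_eq_left ((min_le_right _ _).trans h2), zero_smul, norm_zero]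
      exact le_max_right _ _
  have key : ∀ n : ℕ, ∫ x in Ω, fderiv ℝ χ x e * trunc (n + 1) (Θ (u x))
      = -∫ x in Ω, χ x * (max 0 (min 1 (2 - Θ (u x) / (n + 1)))
        * fderiv ℝ Θ (u x) (weakGrad Ω u x e)) := by
    intro n
    obtain ⟨K, hK⟩ := hb n
    have := (isWeakGrad_comp_of_bounded hf hu ((contDiff_trunc (n + 1)).comp hΘ) hK).integral_eq
      χ hχ hc hs e
    simpa [Function.comp_def, hder] using this
  obtain ⟨C, hC⟩ := hc.exists_bound_of_continuous hχ.continuous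
  have hcd : HasCompactSupport fun x => fderiv ℝ χ x e :=
    hc.of_isClosed_subset (isClosed_tsupport _) (tsupport_fderiv_apply_subset e)
  obtain ⟨C', hC'⟩ := hcd.exists_bound_of_continuous (continuous_fderiv_apply hχ e)
  have hC0 : 0 ≤ C' := (norm_nonneg _).trans (hC' 0)
  have hC00 : 0 ≤ C := (norm_nonneg _).trans (hC 0)
  have hev : ∀ s : ℝ, ∀ᶠ n : ℕ in atTop, s ≤ (n : ℝ) + 1 := fun s => by
    filter_upwards [(tendsto_natCast_atTop_atTop (R := ℝ)).eventually_ge_atTop s] with n hn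
    linarith
  have aeu := hu2.1
  have l1 : Tendsto (fun n : ℕ => ∫ x in Ω, fderiv ℝ χ x e * trunc (n + 1) (Θ (u x))) atTop
      (𝓝 (∫ x in Ω, fderiv ℝ χ x e * Θ (u x))) := by
    refine tendsto_integral_of_dominated_convergence (fun x => C' * Θ (u x)) (fun n => ?_)
      (hi.const_mul C') (fun n => Eventually.of_forall fun x => ?_) (.of_forall fun x => ?_)
    · exact (continuous_fderiv_apply hχ e).aestronglyMeasurable.mul
        (((contDiff_trunc _).continuous.comp hΘ.continuous).comp_aestronglyMeasurable aeu)
    · rw [norm_mul, Real.norm_of_nonneg (trunc_mem (hΘ0 _)).1]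
      exact mul_le_mul (hC' x) (trunc_mem (hΘ0 _)).2 (trunc_mem (hΘ0 _)).1 hC0
    · refine tendsto_const_nhds.congr' ?_
      filter_upwards [hev (Θ (u x))] with n hn
      rw [trunc_eq (by positivity) (hΘ0 _) hn]
  have l2 : Tendsto (fun n : ℕ => -∫ x in Ω, χ x * (max 0 (min 1 (2 - Θ (u x) / (n + 1)))
        * fderiv ℝ Θ (u x) (weakGrad Ω u x e))) atTop
      (𝓝 (-∫ x in Ω, χ x * fderiv ℝ Θ (u x) (weakGrad Ω u x e))) := by
    have mh : AEStronglyMeasurable (fun x => fderiv ℝ Θ (u x) (weakGrad Ω u x e))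
        vol(Ω) :=
      (ContinuousLinearMap.apply ℝ ℝ e).continuous.comp_aestronglyMeasurable mG.1
    refine (tendsto_integral_of_dominated_convergence
      (fun x => C * ‖e‖ * (‖fderiv ℝ Θ (u x)‖ * ‖weakGrad Ω u x‖)) (fun n => ?_)
      (hi'.const_mul _) (fun n => Eventually.of_forall fun x => ?_) (.of_forall fun x => ?_)).neg
    · have hcc : Continuous fun v : Plane => max 0 (min 1 (2 - Θ v / ((n : ℝ) + 1))) :=
        (trunc_integrand_continuous _).comp hΘ.continuous
      exact hχ.continuous.aestronglyMeasurable.mul ((hcc.comp_aestronglyMeasurable aeu).mul mh)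
    · rw [norm_mul, norm_mul, Real.norm_of_nonneg (le_max_left _ _)]
      calc _ ≤ C * (1 * (‖fderiv ℝ Θ (u x)‖ * (‖weakGrad Ω u x‖ * ‖e‖))) := by
            refine mul_le_mul (hC x) (mul_le_mul (max_le zero_le_one (min_le_left _ _)) ?_
              (norm_nonneg _) zero_le_one) (by positivity) hC00
            exact (ContinuousLinearMap.le_opNorm _ _).trans
              (mul_le_mul_of_nonneg_left (ContinuousLinearMap.le_opNorm _ _) (norm_nonneg _))
        _ = _ := by ring
    · refine tendsto_const_nhds.congr' ?_
      filter_upwards [hev (Θ (u x))] with n hn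
      have : Θ (u x) / (n + 1) ≤ 1 := (div_le_one (by positivity)).2 hn
      rw [min_eq_left (by linarith), max_eq_right zero_le_one, one_mul]
  refine tendsto_nhds_unique l1 (l2.congr fun n => ?_)
  exact (key n).symm

/-! ### The potential and its phase function -/

/-- The unit vector in the direction of `v`, and `0` if `v = 0`. -/
def dirOf (v : Plane) : Plane := ‖v‖⁻¹ • v

theorem norm_dirOf_le (v : Plane) : ‖dirOf v‖ ≤ 1 := by
  rw [dirOf, norm_smul, norm_inv, norm_norm]
  exact inv_mul_le_one

theorem norm_dirOf {v : Plane} (hv : v ≠ 0) : ‖dirOf v‖ = 1 := by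
  rw [dirOf, norm_smul, norm_inv, norm_norm, inv_mul_cancel₀ (norm_ne_zero_iff.2 hv)]

theorem norm_smul_dirOf (v : Plane) : ‖v‖ • dirOf v = v := by
  by_cases hv : v = 0
  · simp [hv]
  · rw [dirOf, smul_smul, mul_inv_cancel₀ (norm_ne_zero_iff.2 hv), one_smul]

/-- `∫₀^{|v|} g`. -/
def phase (g : ℝ → ℝ) (v : Plane) : ℝ := ∫ s in (0 : ℝ)..‖v‖, g s

namespace IsAdmissiblePotential

variable {f g : ℝ → ℝ}

theorem hasDerivWithinAt_f (h : IsAdmissiblePotential f g) {s : ℝ} (hs : 0 ≤ s) :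
    HasDerivWithinAt f (derivWithin f (Ici 0) s) (Ici 0) s :=
  (h.f_smooth.differentiableOn (by simp) s hs).hasDerivWithinAt

theorem continuousOn_deriv (h : IsAdmissiblePotential f g) : ContinuousOn (derivWithin f (Ici 0)) (Ici 0) :=
  h.f_smooth.continuousOn_derivWithin (uniqueDiffOn_Ici 0) (by simp)

theorem contDiff_potential (h : IsAdmissiblePotential f g) : ContDiff ℝ 1 (potential f) :=
  contDiff_radial (fun _ hs => h.hasDerivWithinAt_f hs) h.continuousOn_deriv h.f_deriv_zero

theorem gradient_potential (h : IsAdmissiblePotential f g) (v : Plane) :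
    gradient (potential f) v = derivWithin f (Ici 0) ‖v‖ • dirOf v :=
  gradient_radial (fun _ hs => h.hasDerivWithinAt_f hs) h.f_deriv_zero v

theorem fderiv_potential (h : IsAdmissiblePotential f g) (v w : Plane) :
    fderiv ℝ (potential f) v w = inner ℝ (gradient (potential f) v) w := by
  have := (h.contDiff_potential.differentiable (by simp) v).hasGradientAt
  rw [hasGradientAt_iff_hasFDerivAt] at this
  rw [this.fderiv, InnerProductSpace.toDual_apply_apply]

theorem potential_eq (h : IsAdmissiblePotential f g) (v : Plane) : potential f v = g ‖v‖ ^ 2 / 2 := h.f_eq _ (norm_nonneg v)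

theorem potential_nonneg (h : IsAdmissiblePotential f g) (v : Plane) : 0 ≤ potential f v := by
  rw [h.potential_eq]; positivity

theorem g_norm_nonneg (h : IsAdmissiblePotential f g) (v : Plane) : 0 ≤ g ‖v‖ := h.g_nonneg _ (norm_nonneg v)

theorem continuousOn_g (h : IsAdmissiblePotential f g) : ContinuousOn g (Ici 0) := h.g_lipschitz.continuousOn

theorem continuous_g_max (h : IsAdmissiblePotential f g) : Continuous fun s => g (max 0 s) :=
  h.continuousOn_g.comp_continuous (by fun_prop) fun s => le_max_left 0 s

theorem continuous_g_norm (h : IsAdmissiblePotential f g) : Continuous fun v : Plane => g ‖v‖ :=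
  h.continuousOn_g.comp_continuous continuous_norm fun v => norm_nonneg v

theorem _root_.AnisoGL.integral_g_eq {s : ℝ} (hs : 0 ≤ s) :
    ∫ r in (0 : ℝ)..s, g r = ∫ r in (0 : ℝ)..s, g (max 0 r) := by
  refine intervalIntegral.integral_congr fun r hr => ?_
  rw [uIcc_of_le hs] at hr
  simp only [max_eq_right hr.1]

theorem hasDerivWithinAt_phase (h : IsAdmissiblePotential f g) {s : ℝ} (hs : 0 ≤ s) :
    HasDerivWithinAt (fun s => ∫ r in (0 : ℝ)..s, g r) (g s) (Ici 0) s := by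
  have h1 : HasDerivAt (fun s => ∫ r in (0 : ℝ)..s, g (max 0 r)) (g (max 0 s)) s :=
    (h.continuous_g_max.integral_hasStrictDerivAt 0 s).hasDerivAt
  rw [max_eq_right hs] at h1
  exact h1.hasDerivWithinAt.congr (fun r hr => integral_g_eq hr) (integral_g_eq hs)

theorem contDiff_phase (h : IsAdmissiblePotential f g) : ContDiff ℝ 1 (phase g) :=
  contDiff_radial (fun _ hs => h.hasDerivWithinAt_phase hs) h.continuousOn_g h.g_zero

theorem fderiv_phase (h : IsAdmissiblePotential f g) (v w : Plane) :
    fderiv ℝ (phase g) v w = g ‖v‖ * inner ℝ (dirOf v) w := by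
  have := (hasFDerivAt_radial (fun _ hs => h.hasDerivWithinAt_phase hs) h.g_zero v).fderiv
  change fderiv ℝ (phase g) v = _ at this
  rw [this, innerSL_apply_apply, inner_smul_left]
  rfl

theorem norm_fderiv_phase_le (h : IsAdmissiblePotential f g) (v : Plane) : ‖fderiv ℝ (phase g) v‖ ≤ g ‖v‖ := by
  refine ContinuousLinearMap.opNorm_le_bound _ (h.g_norm_nonneg v) fun w => ?_
  rw [h.fderiv_phase, norm_mul, Real.norm_of_nonneg (h.g_norm_nonneg v)]
  refine mul_le_mul_of_nonneg_left ?_ (h.g_norm_nonneg v)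
  exact (norm_inner_le_norm _ _).trans (mul_le_of_le_one_left (norm_nonneg _) (norm_dirOf_le v))

theorem g_mul_norm_dirOf_sq (h : IsAdmissiblePotential f g) (v : Plane) : g ‖v‖ * ‖dirOf v‖ ^ 2 = g ‖v‖ := by
  by_cases hv : v = 0
  · simp [hv, h.g_zero]
  · rw [norm_dirOf hv]; simp

theorem phase_nonneg (h : IsAdmissiblePotential f g) (v : Plane) : 0 ≤ phase g v :=
  intervalIntegral.integral_nonneg (norm_nonneg v) fun s hs => h.g_nonneg s hs.1

theorem exists_growth (h : IsAdmissiblePotential f g) : ∃ c : ℝ, 0 < c ∧ (∀ v : Plane, ‖v‖ ^ 2 ≤ 4 + c * potential f v) := by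
  obtain ⟨c₀, hc, hg⟩ := h.f_growth
  refine ⟨(2 * c₀ ^ 2)⁻¹, by positivity, fun v => ?_⟩
  by_cases hv : 2 ≤ ‖v‖
  · have h1 : 2 * c₀ ^ 2 * ‖v‖ ^ 2 ≤ potential f v := hg _ hv
    have h2 : ‖v‖ ^ 2 ≤ (2 * c₀ ^ 2)⁻¹ * potential f v := by
      rw [inv_mul_eq_div, le_div_iff₀ (by positivity)]; linarith
    linarith
  · have := h.potential_nonneg v
    have h3 : 0 ≤ (2 * c₀ ^ 2)⁻¹ * potential f v := by positivity
    nlinarith [norm_nonneg v, not_le.1 hv]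

theorem tendsto_potential (h : IsAdmissiblePotential f g) : Tendsto (potential f) (cocompact Plane) atTop := by
  obtain ⟨c, hc, hg⟩ := h.exists_growth
  have h1 : Tendsto (fun v : Plane => c⁻¹ * (‖v‖ ^ 2 - 4)) (cocompact Plane) atTop := by
    refine Tendsto.const_mul_atTop (by positivity) (tendsto_atTop_add_const_right _ _ ?_)
    exact (tendsto_pow_atTop two_ne_zero).comp (tendsto_norm_cocompact_atTop)
  refine tendsto_atTop_mono (fun v => ?_) h1
  rw [inv_mul_eq_div, div_le_iff₀ hc]
  linarith [hg v]

theorem tendsto_phase (h : IsAdmissiblePotential f g) : Tendsto (phase g) (cocompact Plane) atTop := by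
  obtain ⟨c₀, hc, hg⟩ := h.f_growth
  have hg2 : ∀ s, 2 ≤ s → c₀ ≤ g s := fun s hs => by
    have h1 := hg s hs
    rw [h.f_eq s (by linarith)] at h1
    have h2 := h.g_nonneg s (by linarith)
    have h3 : c₀ ^ 2 ≤ g s ^ 2 := by nlinarith [mul_le_mul_of_nonneg_left (show (4:ℝ) ≤ s ^ 2 by nlinarith) (sq_nonneg c₀)]
    exact (pow_le_pow_iff_left₀ hc.le h2 two_ne_zero).1 h3
  have hii : ∀ a b : ℝ, IntervalIntegrable (fun r => g (max 0 r)) volume a b := fun a b =>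
    h.continuous_g_max.intervalIntegrable _ _
  have h1 : Tendsto (fun v : Plane => c₀ * (‖v‖ - 2)) (cocompact Plane) atTop := by
    refine Tendsto.const_mul_atTop hc (tendsto_atTop_add_const_right _ _ ?_)
    exact tendsto_norm_cocompact_atTop
  refine tendsto_atTop_mono (fun v => ?_) h1
  by_cases hv : 2 ≤ ‖v‖
  · rw [phase, integral_g_eq (norm_nonneg v),
      ← intervalIntegral.integral_add_adjacent_intervals (hii 0 2) (hii 2 ‖v‖)]
    have h2 : 0 ≤ ∫ r in (0 : ℝ)..2, g (max 0 r) :=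
      intervalIntegral.integral_nonneg (by norm_num) fun s _ => h.g_nonneg _ (le_max_left _ _)
    have h3 : ∫ r in (2 : ℝ)..‖v‖, c₀ ≤ ∫ r in (2 : ℝ)..‖v‖, g (max 0 r) :=
      intervalIntegral.integral_mono_on hv (by simp) (hii _ _) fun r hr => by
        rw [max_eq_right (by linarith [hr.1])]; exact hg2 r hr.1
    rw [intervalIntegral.integral_const, smul_eq_mul] at h3
    linarith
  · have := h.phase_nonneg v
    nlinarith [not_le.1 hv]

end IsAdmissiblePotential

/-! ### Weak time derivatives -/

/-- The lemma of du Bois-Reymond. -/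
theorem eqOn_const_of_integral_deriv_smul_eq_zero {E : Type*} [NormedAddCommGroup E]
    [NormedSpace ℝ E] [CompleteSpace E] {S : ℝ} (hS : 0 < S) {r : ℝ → E}
    (hr : ContinuousOn r (Icc 0 S))
    (h : ∀ θ : ℝ → ℝ, ContDiff ℝ ∞ θ → HasCompactSupport θ → tsupport θ ⊆ Ioo 0 S →
      ∫ t in Ioo 0 S, deriv θ t • r t = 0) :
    ∀ t ∈ Icc 0 S, r t = r 0 := by
  have hri : IntegrableOn r (Ioo 0 S) := (hr.integrableOn_Icc).mono_set Ioo_subset_Icc_self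
  have bump : ∃ φ₀ : ℝ → ℝ, ContDiff ℝ ∞ φ₀ ∧ HasCompactSupport φ₀ ∧ tsupport φ₀ ⊆ Ioo 0 S ∧
      ∫ t, φ₀ t = 1 := by
    let b : ContDiffBump (S / 2) := ⟨S / 8, S / 4, by positivity, by linarith⟩
    refine ⟨b.normed volume, b.contDiff_normed, b.hasCompactSupport_normed, ?_,
      b.integral_normed⟩
    rw [b.tsupport_normed_eq, Real.closedBall_eq_Icc]
    intro t ht
    have h1 : b.rOut = S / 4 := rfl
    rw [h1] at ht
    constructor <;> [have := ht.1; have := ht.2] <;> linarith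
  obtain ⟨φ₀, h0, h0c, h0s, h01⟩ := bump
  obtain ⟨c, hc⟩ : ∃ c, c = ∫ t in Ioo 0 S, φ₀ t • r t := ⟨_, rfl⟩
  have hint : ∀ φ : ℝ → ℝ, ContDiff ℝ ∞ φ → IntegrableOn (fun t => φ t • r t) (Ioo 0 S) :=
    fun φ hφ => ((hφ.continuous.continuousOn.smul hr).integrableOn_Icc).mono_set Ioo_subset_Icc_self
  have key : ∀ φ : ℝ → ℝ, ContDiff ℝ ∞ φ → HasCompactSupport φ → tsupport φ ⊆ Ioo 0 S →
      ∫ t in Ioo 0 S, φ t • r t = (∫ t, φ t) • c := by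
    intro φ hφ hφc hφs
    obtain ⟨k, hk⟩ : ∃ k : ℝ → ℝ, k = fun t => φ t - (∫ t, φ t) * φ₀ t := ⟨_, rfl⟩
    have hkd : ContDiff ℝ ∞ k := by rw [hk]; exact hφ.sub (contDiff_const.mul h0)
    have hki : ∫ t, k t = 0 := by
      rw [hk, integral_sub (hφ.continuous.integrable_of_hasCompactSupport hφc)
        ((h0.continuous.integrable_of_hasCompactSupport h0c).const_mul _), integral_const_mul, h01]
      ring
    have hks : ∀ t, t ∉ tsupport φ ∪ tsupport φ₀ → k t = 0 := fun t ht => by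
      rw [mem_union, not_or] at ht
      rw [hk]
      simp [image_eq_zero_of_notMem_tsupport ht.1, image_eq_zero_of_notMem_tsupport ht.2]
    have hcomp : IsCompact (tsupport φ ∪ tsupport φ₀) := hφc.union h0c
    have hsub : tsupport φ ∪ tsupport φ₀ ⊆ Ioo 0 S := union_subset hφs h0s
    obtain ⟨a, b, ha, hb, hab⟩ : ∃ a b, 0 < a ∧ b < S ∧ tsupport φ ∪ tsupport φ₀ ⊆ Icc a b := by
      by_cases hne : (tsupport φ ∪ tsupport φ₀).Nonempty
      · have hm := hcomp.sInf_mem hne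
        have hM := hcomp.sSup_mem hne
        exact ⟨_, _, (hsub hm).1, (hsub hM).2, fun t ht =>
          ⟨csInf_le hcomp.bddBelow ht, le_csSup hcomp.bddAbove ht⟩⟩
      · rw [not_nonempty_iff_eq_empty] at hne
        exact ⟨S / 2, S / 2, by positivity, by linarith, by simp [hne]⟩
    have hk0 : ∀ t, t ∉ Icc a b → k t = 0 := fun t ht => hks t fun h => ht (hab h)
    obtain ⟨θ, hθ⟩ : ∃ θ : ℝ → ℝ, θ = fun t => ∫ s in (0 : ℝ)..t, k s := ⟨_, rfl⟩
    have hθd : ∀ t, HasDerivAt θ (k t) t := fun t => by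
      rw [hθ]; exact (hkd.continuous.integral_hasStrictDerivAt 0 t).hasDerivAt
    have hθ' : deriv θ = k := funext fun t => (hθd t).deriv
    have hθs : ContDiff ℝ ∞ θ := by
      rw [contDiff_infty_iff_deriv, hθ']
      exact ⟨fun t => (hθd t).differentiableAt, hkd⟩
    have hθ0 : ∀ t, t ∉ Icc a b → θ t = 0 := by
      intro t ht
      rw [mem_Icc, not_and_or, not_le, not_le] at ht
      rw [hθ]
      rcases ht with ht | ht
      · refine intervalIntegral.integral_zero_ae (.of_forall fun s hs => hk0 s ?_)
        rintro ⟨h1, -⟩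
        have : s ≤ max 0 t := hs.2
        rcases max_cases 0 t with ⟨h2, -⟩ | ⟨h2, -⟩ <;> rw [h2] at this <;> linarith
      · by_cases hb0 : b < 0
        · refine intervalIntegral.integral_zero_ae (.of_forall fun s hs => hk0 s ?_)
          rintro ⟨h1, h2⟩
          have : min 0 t < s := hs.1
          rcases min_cases 0 t with ⟨h3, -⟩ | ⟨h3, -⟩ <;> rw [h3] at this <;> linarith
        · have ht0 : 0 ≤ t := by linarith
          change ∫ s in (0 : ℝ)..t, k s = 0
          rw [intervalIntegral.integral_of_le ht0, ← hki]
          refine setIntegral_eq_integral_of_forall_compl_eq_zero fun s hs => hk0 s ?_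
          rintro ⟨h1, h2⟩
          exact hs ⟨by linarith, by linarith⟩
    have hts : tsupport θ ⊆ Icc a b :=
      closure_minimal (fun t ht => by by_contra hn; exact ht (hθ0 t hn)) isClosed_Icc
    have := h θ hθs (isCompact_Icc.of_isClosed_subset (isClosed_tsupport θ) hts)
      (hts.trans fun t ht => ⟨by linarith [ht.1], by linarith [ht.2]⟩)
    rw [hθ', hk] at this
    have e1 : ∀ t, (φ t - (∫ t, φ t) * φ₀ t) • r t = φ t • r t - (∫ t, φ t) • (φ₀ t • r t) :=
      fun t => by rw [sub_smul, smul_smul]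
    simp_rw [e1] at this
    have hi0 : IntegrableOn (fun t => (∫ t, φ t) • (φ₀ t • r t)) (Ioo 0 S) :=
      (hint φ₀ h0).smul _
    rw [integral_sub (hint φ hφ) hi0, integral_smul, ← hc, sub_eq_zero] at this
    exact this
  have hae : ∀ᵐ t ∂(volume : Measure ℝ), t ∈ Ioo 0 S → r t - c = 0 := by
    refine isOpen_Ioo.ae_eq_zero_of_integral_contDiff_smul_eq_zero
      (IntegrableOn.locallyIntegrableOn (hri.sub (integrableOn_const (by simp)))) fun φ hφ hφc hφs => ?_
    rw [← setIntegral_eq_integral_of_forall_compl_eq_zero (s := Ioo 0 S) fun t ht => by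
      rw [image_eq_zero_of_notMem_tsupport fun h' => ht (hφs h'), zero_smul]]
    simp_rw [smul_sub]
    have hφi := hφ.continuous.integrable_of_hasCompactSupport hφc (μ := (volume : Measure ℝ))
    rw [integral_sub (hint φ hφ) (hφi.smul_const c).integrableOn, key φ hφ hφc hφs,
      integral_smul_const, sub_eq_zero]
    congr 1
    exact (setIntegral_eq_integral_of_forall_compl_eq_zero fun t ht =>
      image_eq_zero_of_notMem_tsupport fun h' => ht (hφs h')).symm
  have hall : EqOn r (fun _ => c) (Icc 0 S) := by
    refine Measure.eqOn_Icc_of_ae_eq volume hS.ne ?_ hr continuousOn_const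
    rw [Filter.EventuallyEq, ← restrict_Ioo_eq_restrict_Icc, ae_restrict_iff' measurableSet_Ioo]
    filter_upwards [hae] with t ht hts
    exact sub_eq_zero.1 (ht hts)
  intro t ht
  rw [hall ht, hall ⟨le_rfl, hS.le⟩]

theorem integral_time_representation (hΩ : IsOpen Ω)
    (hfin : IsFiniteMeasure vol(Ω)) {S : ℝ} (hS : 0 < S) {a : ℝ → Plane → ℝ}
    {w : ℝ × Plane → ℝ} (hm : ∀ t ∈ Icc 0 S, MemLp (a t) 2 vol(Ω))
    (hc : ∀ t₀ ∈ Icc 0 S,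
      Tendsto (fun t => eLpNorm (a t - a t₀) 2 vol(Ω)) (𝓝[Icc 0 S] t₀) (𝓝 0))
    (ha : Integrable (uncurry a) (cylinderMeasure Ω S))
    (hw : Integrable w (volume.prod volume))
    (hw0 : ∀ t x, x ∉ Ω → w (t, x) = 0)
    (weak : ∀ ζ : ℝ × Plane → ℝ, ContDiff ℝ ∞ ζ → HasCompactSupport ζ →
      tsupport ζ ⊆ Ioo 0 S ×ˢ Ω →
      ∫ p, fderiv ℝ ζ p (1, 0) * a p.1 p.2 ∂(cylinderMeasure Ω S)
        = -∫ p, ζ p * w p ∂(cylinderMeasure Ω S))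
    (ht : t ∈ Icc 0 S) :
    a t =ᵐ[vol(Ω)] fun x => a 0 x + ∫ τ in (0 : ℝ)..t, w (τ, x) := by
  have hmi : ∀ t ∈ Icc 0 S, IntegrableOn (a t) Ω := fun t ht => (hm t ht).integrable (by norm_num)
  have hprim : ∀ t, 0 ≤ t → Integrable fun x => ∫ τ in (0 : ℝ)..t, w (τ, x) := by
    intro t ht
    simp_rw [intervalIntegral.integral_of_le ht]
    have : Integrable w ((volume.restrict (Ioc 0 t)).prod volume) := by
      refine hw.mono_measure ?_
      exact Measure.prod_mono Measure.restrict_le_self le_rfl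
    exact this.integral_prod_right
  have h0 : (0 : ℝ) ∈ Icc 0 S := ⟨le_rfl, hS.le⟩
  have main : ∀ χ : Plane → ℝ, ContDiff ℝ ∞ χ → HasCompactSupport χ → tsupport χ ⊆ Ω →
      ∫ x in Ω, χ x * (a t x - (a 0 x + ∫ τ in (0 : ℝ)..t, w (τ, x))) = 0 := by
    intro χ hχ hχc hχs
    obtain ⟨C, hC⟩ := hχc.exists_bound_of_continuous hχ.continuous
    have hFi : Integrable (fun p : ℝ × Plane => χ p.2 * w p) (volume.prod volume) :=
      hw.bdd_mul (c := C) (hχ.continuous.comp continuous_snd).aestronglyMeasurable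
        (.of_forall fun p => hC p.2)
    have hχi : ∀ {v : Plane → ℝ}, IntegrableOn v Ω → IntegrableOn (fun x => χ x * v x) Ω :=
      fun hv => hv.bdd_mul (c := C) hχ.continuous.aestronglyMeasurable
        (.of_forall fun p => hC p)
    obtain ⟨q, hq⟩ : ∃ q : ℝ → ℝ, q = fun t => ∫ x, χ x * w (t, x) := ⟨_, rfl⟩
    have hqi : Integrable q := by rw [hq]; exact hFi.integral_prod_left
    obtain ⟨p, hp⟩ : ∃ p : ℝ → ℝ, p = fun t => ∫ x in Ω, χ x * a t x := ⟨_, rfl⟩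
    have hpc : ContinuousOn p (Icc 0 S) := by
      intro t₀ ht₀
      rw [hp]
      have mχ : MemLp χ 2 vol(Ω) :=
        (hχ.continuous.memLp_of_hasCompactSupport hχc).restrict Ω
      exact tendsto_integral_mul_of_eLpNorm (.of_forall fun _ => mχ)
        (eventually_mem_nhdsWithin.mono fun t ht => hm t ht) mχ (hm t₀ ht₀)
        (by simpa using tendsto_const_nhds) (hc t₀ ht₀)
    have hQ : ∀ t ∈ Icc 0 S, ∫ τ in (0 : ℝ)..t, q τ
        = ∫ x in Ω, χ x * ∫ τ in (0 : ℝ)..t, w (τ, x) := by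
      intro t ht
      have e1 : ∫ x in Ω, χ x * ∫ τ in (0 : ℝ)..t, w (τ, x)
          = ∫ x, χ x * ∫ τ in (0 : ℝ)..t, w (τ, x) := by
        refine setIntegral_eq_integral_of_forall_compl_eq_zero fun x hx => ?_
        rw [image_eq_zero_of_notMem_tsupport fun h => hx (hχs h), zero_mul]
      rw [e1, hq]
      simp_rw [← intervalIntegral.integral_const_mul, intervalIntegral.integral_of_le ht.1]
      refine integral_integral_swap ?_
      exact hFi.mono_measure (Measure.prod_mono Measure.restrict_le_self le_rfl)
    have hQc : Continuous fun t => ∫ τ in (0 : ℝ)..t, q τ :=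
      intervalIntegral.continuous_primitive (fun _ _ => hqi.intervalIntegrable) 0
    have hconst := eqOn_const_of_integral_deriv_smul_eq_zero hS
      (r := fun t => p t - ∫ τ in (0 : ℝ)..t, q τ) (hpc.sub hQc.continuousOn) (by
      intro θ hθ hθc hθs
      obtain ⟨Cθ, hCθ⟩ := hθc.exists_bound_of_continuous hθ.continuous
      have hθ'c : Continuous (deriv θ) := hθ.continuous_deriv (by simp)
      obtain ⟨Cθ', hCθ'⟩ := (hθc.deriv).exists_bound_of_continuous hθ'c
      have hζ := weak (fun p => θ p.1 * χ p.2)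
        ((hθ.comp contDiff_fst).mul (hχ.comp contDiff_snd))
        ((hθc.prod hχc).of_isClosed_subset (isClosed_tsupport _) (closure_minimal (by
          intro p hp
          refine ⟨subset_tsupport _ fun h => hp ?_, subset_tsupport _ fun h => hp ?_⟩ <;> simp [h])
          ((isClosed_tsupport _).prod (isClosed_tsupport _))))
        ((closure_minimal (by
          intro p hp
          refine ⟨subset_tsupport _ fun h => hp ?_, subset_tsupport _ fun h => hp ?_⟩ <;> simp [h])
          ((isClosed_tsupport _).prod (isClosed_tsupport _))).trans (prod_mono hθs hχs))
      have hfd : ∀ p : ℝ × Plane, fderiv ℝ (fun p : ℝ × Plane => θ p.1 * χ p.2) p (1, 0)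
          = deriv θ p.1 * χ p.2 := by
        intro p
        have h1 : HasFDerivAt (fun p : ℝ × Plane => θ p.1)
            ((ContinuousLinearMap.fst ℝ ℝ Plane).smulRight (deriv θ p.1)) p := by
          have := ((hθ.differentiable (by simp) p.1).hasDerivAt.hasFDerivAt.comp p hasFDerivAt_fst)
          refine this.congr_fderiv ?_
          ext <;> simp
        have h2 : HasFDerivAt (fun p : ℝ × Plane => χ p.2)
            ((fderiv ℝ χ p.2).comp (ContinuousLinearMap.snd ℝ ℝ Plane)) p :=
          (hχ.differentiable (by simp) p.2).hasFDerivAt.comp p hasFDerivAt_snd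
        have h3 := (h1.mul h2).fderiv
        change fderiv ℝ (fun p : ℝ × Plane => θ p.1 * χ p.2) p = _ at h3
        rw [h3]
        simp [mul_comm]
      simp_rw [hfd] at hζ
      have i1 : Integrable (fun p : ℝ × Plane => deriv θ p.1 * χ p.2 * a p.1 p.2)
          (cylinderMeasure Ω S) :=
        ha.bdd_mul (c := Cθ' * C) ((hθ'c.comp continuous_fst).mul
          (hχ.continuous.comp continuous_snd)).aestronglyMeasurable
          (.of_forall fun p => by
            rw [norm_mul]
            exact mul_le_mul (hCθ' _) (hC _) (norm_nonneg _) ((norm_nonneg _).trans (hCθ' 0)))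
      have hwc : Integrable w (cylinderMeasure Ω S) :=
        hw.mono_measure (Measure.prod_mono Measure.restrict_le_self Measure.restrict_le_self)
      have i2 : Integrable (fun p : ℝ × Plane => θ p.1 * χ p.2 * w p) (cylinderMeasure Ω S) :=
        hwc.bdd_mul (c := Cθ * C) ((hθ.continuous.comp continuous_fst).mul
          (hχ.continuous.comp continuous_snd)).aestronglyMeasurable
          (.of_forall fun p => by
            rw [norm_mul]
            exact mul_le_mul (hCθ _) (hC _) (norm_nonneg _) ((norm_nonneg _).trans (hCθ 0)))
      unfold cylinderMeasure at hζ i1 i2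
      rw [integral_prod _ i1, integral_prod _ i2] at hζ
      have e2 : ∀ t, ∫ x in Ω, deriv θ t * χ x * a t x = deriv θ t * p t := fun t => by
        rw [hp]; simp_rw [mul_assoc]; rw [integral_const_mul]
      have e3 : ∀ t, ∫ x in Ω, θ t * χ x * w (t, x) = θ t * q t := fun t => by
        rw [hq]; simp_rw [mul_assoc]; rw [integral_const_mul]
        congr 1
        refine setIntegral_eq_integral_of_forall_compl_eq_zero fun x hx => ?_
        rw [hw0 t x hx, mul_zero]
      simp only [e2, e3] at hζ
      have hch := integral_chain_time hqi 0 (contDiff_id (𝕜 := ℝ) (E := ℝ) (n := 1)) hS.le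
        (β := θ) (β' := deriv θ) (fun t _ => (hθ.differentiable (by simp) t).hasDerivAt)
        hθ'c.continuousOn
      have hθ0 : θ 0 = 0 := image_eq_zero_of_notMem_tsupport fun h => lt_irrefl _ (hθs h).1
      have hθS : θ S = 0 := image_eq_zero_of_notMem_tsupport fun h => lt_irrefl _ (hθs h).2
      simp only [id, hθ0, hθS, zero_mul, sub_zero, zero_add, fderiv_id,
        ContinuousLinearMap.id_apply] at hch
      rw [intervalIntegral.integral_of_le hS.le, integral_Ioc_eq_integral_Ioo] at hch
      have j1 : IntegrableOn (fun t => deriv θ t * ∫ τ in (0 : ℝ)..t, q τ) (Ioo 0 S) :=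
        ((hθ'c.mul hQc).continuousOn.integrableOn_Icc).mono_set Ioo_subset_Icc_self
      have j2 : IntegrableOn (fun t => θ t * q t) (Ioo 0 S) :=
        (hqi.bdd_mul (c := Cθ) hθ.continuous.aestronglyMeasurable
          (Eventually.of_forall hCθ)).integrableOn
      have j3 : IntegrableOn (fun t => deriv θ t * p t) (Ioo 0 S) :=
        ((hθ'c.continuousOn.mul hpc).integrableOn_Icc).mono_set Ioo_subset_Icc_self
      rw [integral_add j1 j2] at hch
      simp only [smul_eq_mul, mul_sub]
      rw [integral_sub j3 j1]
      linarith) t ht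
    have hfinal : ∫ x in Ω, χ x * (a t x - (a 0 x + ∫ τ in (0 : ℝ)..t, w (τ, x)))
        = p t - p 0 - ∫ τ in (0 : ℝ)..t, q τ := by
      rw [hQ t ht, hp]
      have hd1 : IntegrableOn (fun x => χ x * a t x - χ x * a 0 x) Ω :=
        (hχi (hmi t ht)).sub (hχi (hmi 0 h0))
      simp only
      rw [← integral_sub (hχi (hmi t ht)) (hχi (hmi 0 h0)),
        ← integral_sub hd1 (hχi (hprim t ht.1).integrableOn)]
      refine integral_congr_ae (.of_forall fun x => ?_)
      simp only
      ring
    rw [hfinal]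
    simp only [intervalIntegral.integral_same, sub_zero] at hconst
    linarith
  have hloc : LocallyIntegrableOn (fun x => a t x - (a 0 x + ∫ τ in (0 : ℝ)..t, w (τ, x))) Ω :=
    IntegrableOn.locallyIntegrableOn
      ((hmi t ht).sub ((hmi 0 h0).add (hprim t ht.1).integrableOn))
  have hz : ∀ χ : Plane → ℝ, ContDiff ℝ ∞ χ → HasCompactSupport χ → tsupport χ ⊆ Ω →
      ∫ x, χ x • (a t x - (a 0 x + ∫ τ in (0 : ℝ)..t, w (τ, x))) = 0 := fun χ hχ hχc hχs => by
    refine Eq.trans ?_ (main χ hχ hχc hχs)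
    simp only [smul_eq_mul]
    symm
    apply setIntegral_eq_integral_of_forall_compl_eq_zero
    intro x hx
    rw [image_eq_zero_of_notMem_tsupport fun h => hx (hχs h), zero_mul]
  have := hΩ.ae_eq_zero_of_integral_contDiff_smul_eq_zero hloc hz
  rw [Filter.EventuallyEq, ae_restrict_iff' hΩ.measurableSet]
  filter_upwards [this] with x hx hxΩ
  exact sub_eq_zero.1 (hx hxΩ)

/-- A path in `L²` with a square integrable weak time derivative is almost everywhere the
primitive of that derivative. -/
theorem IsWeakTimeDeriv.exists_representation (hΩ : IsOpen Ω)
    (hfin : IsFiniteMeasure vol(Ω)) {S : ℝ} (hS : 0 < S) {u ut : ℝ → Plane → Plane}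
    (hm : ∀ t ∈ Icc 0 S, MemLp (u t) 2 vol(Ω))
    (hc : ∀ t₀ ∈ Icc 0 S,
      Tendsto (fun t => eLpNorm (u t - u t₀) 2 vol(Ω)) (𝓝[Icc 0 S] t₀) (𝓝 0))
    (h : IsWeakTimeDeriv Ω S u ut) :
    ∃ (W : ℝ × Plane → Plane) (u₀ : Plane → Plane), StronglyMeasurable W ∧ StronglyMeasurable u₀ ∧
      MemLp W 2 (volume.prod volume) ∧ Integrable W (volume.prod volume) ∧
      (∀ x, Integrable fun t => W (t, x)) ∧
      (∀ p, p ∉ Ioo 0 S ×ˢ Ω → W p = 0) ∧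
      W =ᵐ[cylinderMeasure Ω S] uncurry ut ∧ u₀ =ᵐ[vol(Ω)] u 0 ∧
      ∀ t ∈ Icc 0 S, u t =ᵐ[vol(Ω)] fun x => u₀ x + ∫ τ in (0 : ℝ)..t, W (τ, x) := by
  have hcyl : cylinderMeasure Ω S = (volume.prod volume).restrict (Ioo 0 S ×ˢ Ω) := by
    rw [cylinderMeasure, Measure.prod_restrict]
  have hms : MeasurableSet (Ioo 0 S ×ˢ Ω) := measurableSet_Ioo.prod hΩ.measurableSet
  have hcfin : IsFiniteMeasure (cylinderMeasure Ω S) := by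
    unfold cylinderMeasure; infer_instance
  obtain ⟨m, hm1, hm2⟩ := h.memLp_deriv.1
  have mm : MemLp m 2 (cylinderMeasure Ω S) := h.memLp_deriv.ae_eq hm2
  obtain ⟨W₁, hW₁⟩ : ∃ W₁, W₁ = indicator (Ioo 0 S ×ˢ Ω) m := ⟨_, rfl⟩
  have hW₁m : StronglyMeasurable W₁ := by rw [hW₁]; exact hm1.indicator hms
  have hW₁2 : MemLp W₁ 2 (volume.prod volume) := by
    rw [hW₁, memLp_indicator_iff_restrict hms, ← hcyl]; exact mm
  have hW₁i : Integrable W₁ (volume.prod volume) := by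
    rw [hW₁, integrable_indicator_iff hms, IntegrableOn, ← hcyl]
    exact mm.integrable (by norm_num)
  obtain ⟨A, hA⟩ : ∃ A : Set Plane, A = {x | Integrable fun t => W₁ (t, x)} := ⟨_, rfl⟩
  have hAm : MeasurableSet A := by
    rw [hA]
    exact measurableSet_integrable (f := fun x t => W₁ (t, x))
      (hW₁m.comp_measurable measurable_swap)
  have hAae : ∀ᵐ x : Plane, x ∈ A := by
    rw [hA]; exact hW₁i.prod_left_ae
  obtain ⟨W, hW⟩ : ∃ W, W = indicator (univ ×ˢ A) W₁ := ⟨_, rfl⟩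
  have hWW : W =ᵐ[volume.prod volume] W₁ := by
    have : ∀ᵐ p : ℝ × Plane ∂(volume.prod volume), p.2 ∈ A :=
      Measure.quasiMeasurePreserving_snd.ae hAae
    filter_upwards [this] with p hp
    rw [hW, indicator_of_mem (show p ∈ univ ×ˢ A from ⟨mem_univ _, hp⟩)]
  have hWm : StronglyMeasurable W := by
    rw [hW]; exact hW₁m.indicator (MeasurableSet.univ.prod hAm)
  have hWi := hW₁i.congr hWW.symm
  have hWx : ∀ x, Integrable fun t => W (t, x) := by
    intro x
    by_cases hx : x ∈ A
    · have : (fun t => W (t, x)) = fun t => W₁ (t, x) := by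
        ext1 t
        rw [hW, indicator_of_mem (show (t, x) ∈ univ ×ˢ A from ⟨mem_univ _, hx⟩)]
      rw [this]
      rw [hA] at hx
      exact hx
    · have : (fun t => W (t, x)) = fun t => 0 := by
        ext1 t
        rw [hW, indicator_of_notMem fun h => hx h.2]
      rw [this]
      exact integrable_zero _ _ _
  have hW0 : ∀ p, p ∉ Ioo 0 S ×ˢ Ω → W p = 0 := by
    intro p hp
    have : W₁ p = 0 := by rw [hW₁, indicator_of_notMem hp]
    rw [hW]
    by_cases hpA : p ∈ univ ×ˢ A
    · rw [indicator_of_mem hpA, this]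
    · rw [indicator_of_notMem hpA]
  have hWut : W =ᵐ[cylinderMeasure Ω S] uncurry ut := by
    have h1 : W =ᵐ[cylinderMeasure Ω S] W₁ := by rw [hcyl]; exact ae_restrict_of_ae hWW
    have h2 : W₁ =ᵐ[cylinderMeasure Ω S] m := by
      rw [hcyl, hW₁]
      exact indicator_ae_eq_restrict hms
    exact h1.trans (h2.trans hm2.symm)
  have h0 : (0 : ℝ) ∈ Icc 0 S := ⟨le_rfl, hS.le⟩
  obtain ⟨u₀, hu₀, hu₀'⟩ := (hm 0 h0).1
  refine ⟨W, u₀, hWm, hu₀, hW₁2.ae_eq hWW.symm, hWi, hWx, hW0, hWut, hu₀'.symm, fun t ht => ?_⟩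
  have key : ∀ i : Fin 2, (fun x => u t x i) =ᵐ[vol(Ω)]
      fun x => u 0 x i + ∫ τ in (0 : ℝ)..t, W (τ, x) i := by
    intro i
    let L : Plane →L[ℝ] ℝ := EuclideanSpace.proj i
    have hu1 : Integrable (uncurry u) (cylinderMeasure Ω S) :=
      h.memLp.integrable (by norm_num)
    have hut1 : Integrable (uncurry ut) (cylinderMeasure Ω S) :=
      h.memLp_deriv.integrable (by norm_num)
    refine integral_time_representation hΩ hfin hS (a := fun t x => L (u t x))
      (w := fun p => L (W p)) (fun t ht => L.comp_memLp' (hm t ht))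
      (fun t₀ ht₀ => tendsto_eLpNorm_clm_comp L (hc t₀ ht₀)) (L.integrable_comp hu1)
      (L.integrable_comp hWi)
      (fun t x hx => by simp only [hW0 (t, x) fun h => hx h.2, map_zero]) (fun ζ hζ hζc hζs => ?_) ht
    have e1 := congrArg L (h.integral_eq ζ hζ hζc hζs)
    have c1 : Continuous fun p => fderiv ℝ ζ p (1, 0) :=
      (hζ.continuous_fderiv (by simp)).clm_apply continuous_const
    have cs1 : HasCompactSupport fun p => fderiv ℝ ζ p (1, 0) :=
      (hζc.fderiv (𝕜 := ℝ)).of_isClosed_subset (isClosed_tsupport _) (closure_mono fun p hp => by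
        intro h'; exact hp (by simp [h']))
    obtain ⟨C1, hC1⟩ := cs1.exists_bound_of_continuous c1
    obtain ⟨C2, hC2⟩ := hζc.exists_bound_of_continuous hζ.continuous
    have i1 : Integrable (fun p : ℝ × Plane => (fderiv ℝ ζ p (1, 0)) • u p.1 p.2)
        (cylinderMeasure Ω S) :=
      hu1.bdd_smul C1 c1.aestronglyMeasurable (Eventually.of_forall hC1)
    have i2 : Integrable (fun p : ℝ × Plane => ζ p • ut p.1 p.2) (cylinderMeasure Ω S) :=
      hut1.bdd_smul C2 hζ.continuous.aestronglyMeasurable (Eventually.of_forall hC2)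
    rw [map_neg, ← L.integral_comp_comm i1, ← L.integral_comp_comm i2] at e1
    simp only [map_smul, smul_eq_mul] at e1
    rw [e1]
    congr 1
    refine integral_congr_ae ?_
    filter_upwards [hWut] with p hp
    simp only [hp, uncurry]
  filter_upwards [key 0, key 1, hu₀'] with x h1 h2 h3
  have hint : IntervalIntegrable (fun τ => W (τ, x)) volume 0 t := (hWx x).intervalIntegrable
  have hL : ∀ i : Fin 2, (∫ τ in (0 : ℝ)..t, W (τ, x)) i = ∫ τ in (0 : ℝ)..t, W (τ, x) i :=
    fun i => ((EuclideanSpace.proj i : Plane →L[ℝ] ℝ).intervalIntegral_comp_comm hint).symm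
  refine plane_ext ?_ ?_
  · rw [h1, PiLp.add_apply, hL, h3]
  · rw [h2, PiLp.add_apply, hL, h3]

/-! ### The Dirichlet part of the energy -/

theorem MemLp.ae_section {X Y E : Type*} [MeasurableSpace X] [MeasurableSpace Y]
    [NormedAddCommGroup E] {m : Measure X} {n : Measure Y} [SFinite n] [SFinite m] {F : X × Y → E}
    (h : MemLp F 2 (m.prod n)) : ∀ᵐ x ∂m, MemLp (fun y => F (x, y)) 2 n := by
  have h1 := (memLp_two_iff_integrable_sq_norm h.1).1 h
  filter_upwards [h1.prod_right_ae, h.1.prodMk_left] with x h2 h3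
  exact (memLp_two_iff_integrable_sq_norm h3).2 h2

/-- The operator `Δ + μ ∇ div` applied to second derivatives. -/
def ellOf (μ : ℝ) (B : Plane →L[ℝ] Plane →L[ℝ] Plane) : Plane :=
  lapOf B + μ • gradDivOf B

/-- The bilinear form of `-(Δ + μ ∇ div)`. -/
def dirForm (μ : ℝ) (A A' : Plane →L[ℝ] Plane) : ℝ :=
  ∑ i, ∑ k, A (stdVec i) k * A' (stdVec i) k + μ * ∑ k, ∑ j, A (stdVec j) j * A' (stdVec k) k

theorem dirForm_self (μ : ℝ) (A : Plane →L[ℝ] Plane) :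
    dirForm μ A A = frobSq A + μ * divOf A ^ 2 := by
  simp only [dirForm, frobSq, divOf, Fin.sum_univ_two, plane_norm_sq]
  ring

theorem dirForm_convex {μ : ℝ} (hμ : 0 ≤ μ) (A A' : Plane →L[ℝ] Plane) :
    (frobSq A + μ * divOf A ^ 2) / 2 - (frobSq A' + μ * divOf A' ^ 2) / 2
      ≤ dirForm μ A A - dirForm μ A A' := by
  simp only [dirForm, frobSq, divOf, Fin.sum_univ_two, plane_norm_sq]
  nlinarith [sq_nonneg (A (stdVec 0) 0 - A' (stdVec 0) 0), sq_nonneg (A (stdVec 0) 1 - A' (stdVec 0) 1),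
    sq_nonneg (A (stdVec 1) 0 - A' (stdVec 1) 0), sq_nonneg (A (stdVec 1) 1 - A' (stdVec 1) 1),
    mul_nonneg hμ (sq_nonneg (A (stdVec 0) 0 + A (stdVec 1) 1 - A' (stdVec 0) 0 - A' (stdVec 1) 1))]

theorem inner_ellOf (μ : ℝ) (B : Plane →L[ℝ] Plane →L[ℝ] Plane) (z : Plane) :
    inner ℝ (ellOf μ B) z = ∑ i, ∑ k, B (stdVec i) (stdVec i) k * z k
      + μ * ∑ k, ∑ j, B (stdVec k) (stdVec j) j * z k := by
  simp only [ellOf, lapOf, gradDivOf, divOf, Fin.sum_univ_two, plane_inner]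
  simp
  ring

/-- The entry `(k, i)` of a matrix, as a functional. -/
def entryL (i k : Fin 2) : (Plane →L[ℝ] Plane) →L[ℝ] ℝ :=
  (EuclideanSpace.proj k : Plane →L[ℝ] ℝ).comp (ContinuousLinearMap.apply ℝ Plane (stdVec i))

theorem entryL_apply (i k : Fin 2) (A : Plane →L[ℝ] Plane) : entryL i k A = A (stdVec i) k := rfl

theorem memLp_entry {X : Type*} [MeasurableSpace X] {ν : Measure X} {G : X → Plane →L[ℝ] Plane}
    (hG : MemLp G 2 ν) (i k : Fin 2) : MemLp (fun x => G x (stdVec i) k) 2 ν :=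
  (entryL i k).comp_memLp' hG

theorem memLp_hess {X : Type*} [MeasurableSpace X] {ν : Measure X}
    {B : X → Plane →L[ℝ] Plane →L[ℝ] Plane} (hB : MemLp B 2 ν) (i j : Fin 2) :
    MemLp (fun x => B x (stdVec i) (stdVec j)) 2 ν := by
  have hc : Continuous fun C : Plane →L[ℝ] Plane →L[ℝ] Plane => C (stdVec i) (stdVec j) :=
    (continuous_id.clm_apply continuous_const).clm_apply continuous_const
  refine MemLp.of_le_mul (F := Plane →L[ℝ] Plane →L[ℝ] Plane) hB (c := 1) (hc.comp_aestronglyMeasurable hB.1) (.of_forall fun x => ?_)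
  have h1 := (B x (stdVec i)).le_opNorm (stdVec j)
  have h2 := (B x).le_opNorm (stdVec i)
  rw [norm_stdVec, mul_one] at h1 h2
  rw [one_mul]
  exact h1.trans h2

theorem memLp_coord {X : Type*} [MeasurableSpace X] {ν : Measure X} {z : X → Plane}
    (hz : MemLp z 2 ν) (k : Fin 2) : MemLp (fun x => z x k) 2 ν :=
  (EuclideanSpace.proj k : Plane →L[ℝ] ℝ).comp_memLp' hz

theorem integrable_dirForm {X : Type*} [MeasurableSpace X] {ν : Measure X} (μ : ℝ)
    {G G' : X → Plane →L[ℝ] Plane} (hG : MemLp G 2 ν) (hG' : MemLp G' 2 ν) :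
    Integrable (fun x => dirForm μ (G x) (G' x)) ν := by
  refine Integrable.add (integrable_finsetSum _ fun i _ => integrable_finsetSum _ fun k _ => ?_)
    (Integrable.const_mul (integrable_finsetSum _ fun i _ => integrable_finsetSum _ fun k _ => ?_) _)
  · exact (memLp_entry hG i k).integrable_mul (memLp_entry hG' i k)
  · exact (memLp_entry hG k k).integrable_mul (memLp_entry hG' i i)

theorem integral_two_sums {X : Type*} [MeasurableSpace X] {ν : Measure X} (μ : ℝ)
    {f g : Fin 2 → Fin 2 → X → ℝ} (hf : ∀ i k, Integrable (f i k) ν)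
    (hg : ∀ i k, Integrable (g i k) ν) :
    ∫ x, (∑ i, ∑ k, f i k x + μ * ∑ i, ∑ k, g i k x) ∂ν
      = ∑ i, ∑ k, ∫ x, f i k x ∂ν + μ * ∑ i, ∑ k, ∫ x, g i k x ∂ν := by
  have h1 : ∀ {f : Fin 2 → Fin 2 → X → ℝ} (_ : ∀ i k, Integrable (f i k) ν),
      Integrable (fun x => ∑ i, ∑ k, f i k x) ν := fun hf =>
    integrable_finsetSum _ fun i _ => integrable_finsetSum _ fun k _ => hf i k
  have h2 : ∀ {f : Fin 2 → Fin 2 → X → ℝ} (_ : ∀ i k, Integrable (f i k) ν),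
      ∫ x, ∑ i, ∑ k, f i k x ∂ν = ∑ i, ∑ k, ∫ x, f i k x ∂ν := fun hf => by
    rw [integral_finsetSum _ fun i _ => integrable_finsetSum _ fun k _ => hf i k]
    exact Finset.sum_congr rfl fun i _ => integral_finsetSum _ fun k _ => hf i k
  rw [integral_add (h1 hf) ((h1 hg).const_mul μ), integral_const_mul, h2 hf, h2 hg]

theorem integral_inner_ellOf (μ : ℝ)
    {G : Plane → Plane →L[ℝ] Plane} {B : Plane → Plane →L[ℝ] Plane →L[ℝ] Plane}
    (hG : MemLp G 2 vol(Ω)) (hB : MemLp B 2 vol(Ω))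
    (h : IsWeakGrad Ω G B) {z : Plane → Plane} (hz : MemH10 Ω z) :
    ∫ x in Ω, inner ℝ (ellOf μ (B x)) (z x) = -∫ x in Ω, dirForm μ (G x) (weakGrad Ω z x) := by
  have mB : ∀ i j k, MemLp (fun x => B x (stdVec i) (stdVec j) k) 2 vol(Ω) :=
    fun i j k => memLp_coord (memLp_hess hB i j) k
  have mz := fun k => memLp_coord hz.memH1.memLp k
  have mG := fun i k => memLp_entry hG i k
  have mGz := fun i k => memLp_entry hz.memH1.memLp_grad i k
  have key : ∀ i j k l, ∫ x in Ω, B x (stdVec i) (stdVec j) k * z x l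
      = -∫ x in Ω, G x (stdVec j) k * weakGrad Ω z x (stdVec i) l := fun i j k l =>
    (h.isWeakDir hG hB (stdVec i) (entryL j k)).integral_mul_H10 hz (EuclideanSpace.proj l)
  have i1 : ∀ i j k l, Integrable (fun x => B x (stdVec i) (stdVec j) k * z x l)
    vol(Ω) := fun i j k l => (mB i j k).integrable_mul (mz l)
  have i2 : ∀ i j k l, Integrable (fun x => G x (stdVec j) k * weakGrad Ω z x (stdVec i) l)
    vol(Ω) := fun i j k l => (mG j k).integrable_mul (mGz i l)
  simp only [inner_ellOf, dirForm]
  rw [integral_two_sums μ (f := fun i k x => B x (stdVec i) (stdVec i) k * z x k)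
      (g := fun k j x => B x (stdVec k) (stdVec j) j * z x k) (fun i k => i1 i i k k)
      (fun k j => i1 k j j k),
    integral_two_sums μ (f := fun i k x => G x (stdVec i) k * weakGrad Ω z x (stdVec i) k)
      (g := fun k j x => G x (stdVec j) j * weakGrad Ω z x (stdVec k) k) (fun i k => i2 i i k k)
      (fun k j => i2 k j j k)]
  simp only [key, Finset.sum_neg_distrib]
  ring

/-- Half the Dirichlet integral with the anisotropic divergence term. -/
def dirichlet (Ω : Set Plane) (μ : ℝ) (v : Plane → Plane) : ℝ :=
  ∫ x in Ω, (frobSq (weakGrad Ω v x) + μ * divOf (weakGrad Ω v x) ^ 2) / 2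

theorem dirichlet_sub_le_inner (hΩ : IsOpen Ω) {μ : ℝ} (hμ : 0 ≤ μ)
    {v z : Plane → Plane} (hv : MemH10 Ω v) (hz : MemH10 Ω z)
    {G : Plane → Plane →L[ℝ] Plane} {B : Plane → Plane →L[ℝ] Plane →L[ℝ] Plane}
    (hG : IsWeakGrad Ω v G) (hB : MemLp B 2 vol(Ω)) (h : IsWeakGrad Ω G B) :
    dirichlet Ω μ v - dirichlet Ω μ z ≤ -∫ x in Ω, inner ℝ (ellOf μ (B x)) (v x - z x) := by
  have h' : IsWeakGrad Ω (weakGrad Ω v) B :=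
    h.congr hΩ (hG.weakGrad_ae_eq hΩ).symm (ae_eq_refl _)
  have hG2 := hv.memH1.memLp_grad
  have hz2 := hz.memH1.memLp_grad
  have mL : MemLp (fun x => ellOf μ (B x)) 2 vol(Ω) := by
    have hap : ∀ i j, MemLp (fun x => B x (stdVec i) (stdVec j)) 2 vol(Ω) :=
      memLp_hess hB
    have hdiv : ∀ i, MemLp (fun x => divOf (B x (stdVec i)) • stdVec i) 2 vol(Ω) := by
      intro i
      have : MemLp (fun x => divOf (B x (stdVec i))) 2 vol(Ω) :=
        memLp_finsetSum _ fun j _ => memLp_coord (hap i j) j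
      exact ((ContinuousLinearMap.id ℝ ℝ).smulRight (stdVec i)).comp_memLp' this
    exact (memLp_finsetSum _ fun i _ => hap i i).add
      ((memLp_finsetSum _ fun i _ => hdiv i).const_smul μ)
  have ii : ∀ {w : Plane → Plane}, MemLp w 2 vol(Ω) →
      Integrable (fun x => inner ℝ (ellOf μ (B x)) (w x)) vol(Ω) := fun hw => by
    simp only [plane_inner]
    exact ((memLp_coord mL 0).integrable_mul (memLp_coord hw 0)).add
      ((memLp_coord mL 1).integrable_mul (memLp_coord hw 1))
  have e1 : ∫ x in Ω, inner ℝ (ellOf μ (B x)) (v x - z x)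
      = -(∫ x in Ω, dirForm μ (weakGrad Ω v x) (weakGrad Ω v x))
        + ∫ x in Ω, dirForm μ (weakGrad Ω v x) (weakGrad Ω z x) := by
    simp only [inner_sub_right]
    rw [integral_sub (ii hv.memH1.memLp) (ii hz.memH1.memLp),
      integral_inner_ellOf μ hG2 hB h' hv, integral_inner_ellOf μ hG2 hB h' hz]
    ring
  rw [e1, neg_add, neg_neg, ← sub_eq_add_neg,
    ← integral_sub (integrable_dirForm μ hG2 hG2) (integrable_dirForm μ hG2 hz2), dirichlet, dirichlet]
  have hq : ∀ {A : Plane → Plane →L[ℝ] Plane}, MemLp A 2 vol(Ω) →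
      Integrable (fun x => (frobSq (A x) + μ * divOf (A x) ^ 2) / 2) vol(Ω) := fun hA => by
    simp only [← dirForm_self]
    exact (integrable_dirForm μ hA hA).div_const 2
  rw [← integral_sub (hq hG2) (hq hz2)]
  exact integral_mono ((hq hG2).sub (hq hz2))
    ((integrable_dirForm μ hG2 hG2).sub (integrable_dirForm μ hG2 hz2))
    fun x => dirForm_convex hμ _ _

theorem continuousOn_integral_mul {X V : Type*} [MeasurableSpace X] {ν : Measure X}
    [NormedAddCommGroup V] [NormedSpace ℝ V] {G : ℝ → X → V} {I : Set ℝ}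
    (hm : ∀ t ∈ I, MemLp (G t) 2 ν)
    (hc : ∀ t₀ ∈ I, Tendsto (fun t => eLpNorm (G t - G t₀) 2 ν) (𝓝[I] t₀) (𝓝 0))
    (L L' : V →L[ℝ] ℝ) : ContinuousOn (fun t => ∫ x, L (G t x) * L' (G t x) ∂ν) I :=
  fun t₀ ht₀ => tendsto_integral_mul_of_eLpNorm
    (eventually_mem_nhdsWithin.mono fun t ht => L.comp_memLp' (hm t ht))
    (eventually_mem_nhdsWithin.mono fun t ht => L'.comp_memLp' (hm t ht))
    (L.comp_memLp' (hm t₀ ht₀)) (L'.comp_memLp' (hm t₀ ht₀))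
    (tendsto_eLpNorm_clm_comp L (hc t₀ ht₀)) (tendsto_eLpNorm_clm_comp L' (hc t₀ ht₀))

theorem continuousOn_dirichlet (μ : ℝ) {u : ℝ → Plane → Plane} {I : Set ℝ}
    (hm : ∀ t ∈ I, MemLp (weakGrad Ω (u t)) 2 vol(Ω))
    (hc : ∀ t₀ ∈ I, Tendsto
      (fun t => eLpNorm (weakGrad Ω (u t) - weakGrad Ω (u t₀)) 2 vol(Ω)) (𝓝[I] t₀) (𝓝 0)) :
    ContinuousOn (fun t => dirichlet Ω μ (u t)) I := by
  have c := fun i k j l => continuousOn_integral_mul hm hc (entryL i k) (entryL j l)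
  have ii := fun t (ht : t ∈ I) i k j l => (memLp_entry (hm t ht) i k).integrable_mul (memLp_entry (hm t ht) j l)
  have : ContinuousOn (fun t => ((∑ i, ∑ k, ∫ x in Ω, entryL i k (weakGrad Ω (u t) x)
      * entryL i k (weakGrad Ω (u t) x)) + μ * (∑ k, ∑ j, ∫ x in Ω, entryL j j (weakGrad Ω (u t) x)
      * entryL k k (weakGrad Ω (u t) x))) / 2) I :=
    ((continuousOn_finsetSum _ fun i _ => continuousOn_finsetSum _ fun k _ => c _ _ _ _).add
      (continuousOn_const.mul
        (continuousOn_finsetSum _ fun i _ => continuousOn_finsetSum _ fun k _ => c _ _ _ _))).div_const 2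
  refine this.congr fun t ht => ?_
  simp only [dirichlet, ← dirForm_self, dirForm]
  rw [integral_div]
  congr 1
  exact integral_two_sums μ
    (f := fun i k x => weakGrad Ω (u t) x (stdVec i) k * weakGrad Ω (u t) x (stdVec i) k)
    (g := fun k j x => weakGrad Ω (u t) x (stdVec j) j * weakGrad Ω (u t) x (stdVec k) k)
    (fun i k => ii t ht i k i k) (fun k j => ii t ht j j k k)

/-! ### Steklov averages -/

theorem integrable_inner_of_memLp {X : Type*} [MeasurableSpace X] {ν : Measure X} {v w : X → Plane}
    (hv : MemLp v 2 ν) (hw : MemLp w 2 ν) : Integrable (fun x => inner ℝ (v x) (w x)) ν := by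
  simp only [plane_inner]
  exact ((memLp_coord hv 0).integrable_mul (memLp_coord hw 0)).add
    ((memLp_coord hv 1).integrable_mul (memLp_coord hw 1))

theorem integral_inner_shift {Λ W : ℝ × Plane → Plane} (hΛ : MemLp Λ 2 (volume.prod volume))
    (hWm : StronglyMeasurable W) (hW : MemLp W 2 (volume.prod volume)) :
    Continuous (fun σ : ℝ => ∫ p, inner ℝ (Λ p) (W (p.1 - σ, p.2)) ∂(volume.prod volume)) ∧
    ∀ h : ℝ, 0 ≤ h →
      Integrable (fun p : ℝ × Plane => ∫ σ in (0 : ℝ)..h, inner ℝ (Λ p) (W (p.1 - σ, p.2)))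
        (volume.prod volume) ∧
      ∫ p : ℝ × Plane, (∫ σ in (0 : ℝ)..h, inner ℝ (Λ p) (W (p.1 - σ, p.2))) ∂(volume.prod volume)
        = ∫ σ in (0 : ℝ)..h, (∫ p, inner ℝ (Λ p) (W (p.1 - σ, p.2)) ∂(volume.prod volume)) := by
  have hadd : ∀ (σ : ℝ) (p : ℝ × Plane), p + (-σ, 0) = (p.1 - σ, p.2) := fun σ p =>
    Prod.ext (by simp [sub_eq_add_neg]) (by simp)
  have mp : ∀ σ : ℝ, MeasurePreserving (fun p : ℝ × Plane => (p.1 - σ, p.2))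
      (volume.prod volume) (volume.prod volume) := fun σ => by
    have := measurePreserving_add_right (volume.prod volume) ((-σ, 0) : ℝ × Plane)
    simp only [hadd] at this
    exact this
  have mW : ∀ σ : ℝ, MemLp (fun p : ℝ × Plane => W (p.1 - σ, p.2)) 2 (volume.prod volume) :=
    fun σ => hW.comp_measurePreserving (mp σ)
  have e : ∀ σ : ℝ, ∫ p, inner ℝ (Λ p) (W (p.1 - σ, p.2)) ∂(volume.prod volume)
      = inner ℝ hΛ.toLp (translate (volume.prod volume) ((-σ, 0) : ℝ × Plane) hW.toLp) := by
    intro σ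
    rw [L2.inner_def]
    refine integral_congr_ae ?_
    have h3 := (mp σ).quasiMeasurePreserving.ae_eq_comp hW.coeFn_toLp
    filter_upwards [hΛ.coeFn_toLp, coeFn_translate (volume.prod volume) ((-σ, 0) : ℝ × Plane) hW.toLp, h3]
      with p h1 h2 h3
    rw [h1, h2, hadd]
    simp only [Function.comp_apply] at h3
    rw [h3]
  refine ⟨?_, fun h hh => ?_⟩
  · simp only [e]
    exact continuous_const.inner ((continuous_translate _ _).comp (by fun_prop))
  · have hK : Integrable (fun q : ℝ × (ℝ × Plane) => (inner ℝ (Λ q.2) (W (q.2.1 - q.1, q.2.2)) : ℝ))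
        ((volume.restrict (Ioc 0 h)).prod (volume.prod volume)) := by
      have hm : AEStronglyMeasurable
          (fun q : ℝ × (ℝ × Plane) => (inner ℝ (Λ q.2) (W (q.2.1 - q.1, q.2.2)) : ℝ))
          ((volume.restrict (Ioc 0 h)).prod (volume.prod volume)) :=
        hΛ.1.comp_snd.inner (hWm.comp_measurable (by fun_prop)).aestronglyMeasurable
      rw [integrable_prod_iff hm]
      refine ⟨Eventually.of_forall fun σ => integrable_inner_of_memLp hΛ (mW σ), ?_⟩
      refine (integrable_const ((∫ p, ‖Λ p‖ ^ 2 ∂(volume.prod volume)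
        + ∫ p, ‖W p‖ ^ 2 ∂(volume.prod volume)))).mono' hm.norm.integral_prod_right'
        (.of_forall fun σ => ?_)
      rw [Real.norm_of_nonneg (integral_nonneg fun _ => norm_nonneg _)]
      have h2 : ∫ p, ‖W p‖ ^ 2 ∂(volume.prod volume)
          = ∫ p : ℝ × Plane, ‖W (p.1 - σ, p.2)‖ ^ 2 ∂(volume.prod volume) := by
        have me : MeasurableEmbedding (fun p : ℝ × Plane => (p.1 - σ, p.2)) := by
          have := measurableEmbedding_addRight ((-σ, 0) : ℝ × Plane)
          simp only [hadd] at this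
          exact this
        exact ((mp σ).integral_comp me (fun p => ‖W p‖ ^ 2)).symm
      rw [h2, ← integral_add hΛ.norm.integrable_sq (mW σ).norm.integrable_sq]
      refine integral_mono (integrable_inner_of_memLp hΛ (mW σ)).norm
        (hΛ.norm.integrable_sq.add (mW σ).norm.integrable_sq) fun p => ?_
      have := norm_inner_le_norm (𝕜 := ℝ) (Λ p) (W (p.1 - σ, p.2))
      simp only
      nlinarith [sq_nonneg (‖Λ p‖ - ‖W (p.1 - σ, p.2)‖), sq_nonneg ‖Λ p‖,
        sq_nonneg ‖W (p.1 - σ, p.2)‖]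
    simp only [intervalIntegral.integral_of_le hh]
    exact ⟨hK.integral_prod_right, (integral_integral_swap hK).symm⟩

/-- A one-sided difference inequality integrates to the energy inequality. -/
theorem sub_le_of_diff_le (hΩ : MeasurableSet Ω) {S : ℝ} {Q : ℝ → ℝ}
    (hQ : ContinuousOn Q (Icc 0 S)) {u Lf : ℝ → Plane → Plane} {W : ℝ × Plane → Plane}
    {u₀ : Plane → Plane} (hWm : StronglyMeasurable W) (hW : MemLp W 2 (volume.prod volume))
    (hWx : ∀ x, Integrable fun t => W (t, x))
    (hu : ∀ t ∈ Icc 0 S, u t =ᵐ[vol(Ω)] fun x => u₀ x + ∫ τ in (0 : ℝ)..t, W (τ, x))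
    (hL : MemLp (uncurry Lf) 2 (cylinderMeasure Ω S))
    (hd : ∀ᵐ t ∂(volume.restrict (Ioo 0 S)), ∀ s ∈ Icc 0 S,
      Q t - Q s ≤ -∫ x in Ω, inner ℝ (Lf t x) (u t x - u s x))
    {a b : ℝ} (ha : 0 < a) (hab : a ≤ b) (hb : b ≤ S) :
    Q b - Q a ≤ -∫ t in a..b, ∫ x in Ω, inner ℝ (Lf t x) (W (t, x)) := by
  have hS : 0 ≤ S := ha.le.trans (hab.trans hb)
  have hsub : Ioo a b ⊆ Ioo 0 S := Ioo_subset_Ioo ha.le hb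
  have hms : MeasurableSet (Ioo a b ×ˢ Ω) := measurableSet_Ioo.prod hΩ
  obtain ⟨Λ, hΛ⟩ : ∃ Λ, Λ = indicator (Ioo a b ×ˢ Ω) (uncurry Lf) := ⟨_, rfl⟩
  have hΛ2 : MemLp Λ 2 (volume.prod volume) := by
    rw [hΛ, memLp_indicator_iff_restrict hms, ← Measure.prod_restrict]
    exact hL.mono_measure (Measure.prod_mono (Measure.restrict_mono hsub le_rfl) le_rfl)
  obtain ⟨c, hc⟩ : ∃ c : ℝ → ℝ, c = fun σ =>
    ∫ p, inner ℝ (Λ p) (W (p.1 - σ, p.2)) ∂(volume.prod volume) := ⟨_, rfl⟩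
  obtain ⟨hcc, hsw⟩ := integral_inner_shift hΛ2 hWm hW
  rw [← hc] at hcc
  classical
  have hΛx : ∀ t x, Λ (t, x) = if t ∈ Ioo a b ∧ x ∈ Ω then Lf t x else 0 := by
    intro t x
    rw [hΛ]
    simp only [indicator, mem_prod, uncurry]
  have hred : ∀ {k : ℝ × Plane → Plane},
      Integrable (fun p => (inner ℝ (Λ p) (k p) : ℝ)) (volume.prod volume) →
      ∫ p, inner ℝ (Λ p) (k p) ∂(volume.prod volume)
        = ∫ t in a..b, ∫ x in Ω, inner ℝ (Lf t x) (k (t, x)) ∧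
      IntervalIntegrable (fun t => ∫ x in Ω, inner ℝ (Lf t x) (k (t, x))) volume a b := by
    intro k hk
    have e1 : ∀ t ∈ Ioo a b, ∫ x, inner ℝ (Λ (t, x)) (k (t, x))
        = ∫ x in Ω, inner ℝ (Lf t x) (k (t, x)) := by
      intro t ht
      rw [← integral_indicator hΩ]
      refine integral_congr_ae (.of_forall fun x => ?_)
      simp only [hΛx, ht, true_and, indicator]
      split_ifs <;> simp
    have hi := hk.integral_prod_left
    constructor
    · rw [integral_prod _ hk, intervalIntegral.integral_of_le hab, integral_Ioc_eq_integral_Ioo,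
        ← setIntegral_congr_fun measurableSet_Ioo e1]
      refine (setIntegral_eq_integral_of_forall_compl_eq_zero fun t ht => ?_).symm
      simp [hΛx, ht]
    · rw [intervalIntegrable_iff_integrableOn_Ioo_of_le hab]
      exact hi.integrableOn.congr_fun e1 measurableSet_Ioo
  have hc0 : c 0 = ∫ t in a..b, ∫ x in Ω, inner ℝ (Lf t x) (W (t, x)) := by
    rw [hc]
    simp only [sub_zero]
    exact (hred (k := W) (integrable_inner_of_memLp hΛ2 hW)).1
  obtain ⟨q, hq⟩ : ∃ q : ℝ → ℝ, q = IccExtend hS (fun t : Icc 0 S => Q t) := ⟨_, rfl⟩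
  have hqc : Continuous q := by
    rw [hq]; exact (continuousOn_iff_continuous_domRestrict.1 hQ).Icc_extend'
  have hqQ : ∀ t ∈ Icc 0 S, q t = Q t := fun t ht => by
    rw [hq, IccExtend_of_mem _ _ ht]
  have hWint : ∀ t h x, ∫ σ in (0 : ℝ)..h, W (t - σ, x) = ∫ τ in (t - h)..t, W (τ, x) := fun t h x => by
    rw [intervalIntegral.integral_comp_sub_left (fun τ => W (τ, x)), sub_zero]
  have step : ∀ h ∈ Ioo 0 a,
      (∫ t in (b - h)..b, q t) - (∫ t in (a - h)..a, q t) + ∫ σ in (0 : ℝ)..h, c σ ≤ 0 := by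
    intro h hh
    obtain ⟨s1, s2⟩ := hsw h hh.1.le
    have e2 : ∀ p : ℝ × Plane, ∫ σ in (0 : ℝ)..h, inner ℝ (Λ p) (W (p.1 - σ, p.2))
        = inner ℝ (Λ p) (∫ τ in (p.1 - h)..p.1, W (τ, p.2)) := by
      intro p
      rw [← hWint]
      have hi : IntervalIntegrable (fun σ => W (p.1 - σ, p.2)) volume 0 h :=
        ((hWx p.2).comp_sub_left p.1).intervalIntegrable
      exact (innerSL ℝ (Λ p)).intervalIntegral_comp_comm hi
    simp only [e2] at s1 s2
    obtain ⟨r1, r2⟩ := hred s1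
    rw [r1] at s2
    have hqi : ∀ x y, IntervalIntegrable q volume x y := fun x y => hqc.intervalIntegrable x y
    have hle : ∫ t in a..b, (q t - q (t - h))
        ≤ ∫ t in a..b, -∫ x in Ω, inner ℝ (Lf t x) (∫ τ in (t - h)..t, W (τ, x)) := by
      refine intervalIntegral.integral_mono_ae_restrict hab
        ((hqi a b).sub ((hqc.comp (continuous_id.sub continuous_const)).intervalIntegrable a b)) r2.neg ?_
      rw [restrict_Ioo_eq_restrict_Icc.symm]
      filter_upwards [ae_restrict_of_ae_restrict_of_subset hsub hd, ae_restrict_mem measurableSet_Ioo]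
        with t ht htab
      have ht1 : t ∈ Icc 0 S := Ioo_subset_Icc_self (hsub htab)
      have ht2 : t - h ∈ Icc 0 S :=
        ⟨by linarith [hh.2, htab.1], by linarith [hh.1, ht1.2]⟩
      rw [hqQ t ht1, hqQ _ ht2]
      refine (ht _ ht2).trans (le_of_eq ?_)
      congr 1
      refine integral_congr_ae ?_
      filter_upwards [hu t ht1, hu _ ht2] with x h1 h2
      rw [h1, h2, add_sub_add_left_eq_sub, intervalIntegral.integral_interval_sub_left
        (hWx x).intervalIntegrable (hWx x).intervalIntegrable]
    have hqs : IntervalIntegrable (fun t => q (t - h)) volume a b :=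
      (hqc.comp (continuous_id.sub continuous_const)).intervalIntegrable a b
    rw [intervalIntegral.integral_neg, s2, intervalIntegral.integral_sub (hqi _ _) hqs,
      intervalIntegral.integral_comp_sub_right (fun t => q t)] at hle
    have i1 := intervalIntegral.integral_add_adjacent_intervals (hqi (a - h) a) (hqi a b)
    have i2 := intervalIntegral.integral_add_adjacent_intervals (hqi (a - h) (b - h)) (hqi (b - h) b)
    have hce : ∫ σ in (0 : ℝ)..h, c σ = ∫ σ in (0 : ℝ)..h,
        (∫ p, inner ℝ (Λ p) (W (p.1 - σ, p.2)) ∂(volume.prod volume)) := by rw [hc]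
    linarith
  have hder : HasDerivAt (fun h => (∫ t in (b - h)..b, q t) - (∫ t in (a - h)..a, q t)
      + ∫ σ in (0 : ℝ)..h, c σ) (q b - q a + c 0) 0 := by
    have d1 : ∀ x : ℝ, HasDerivAt (fun h => ∫ t in (x - h)..x, q t) (q x) 0 := fun x => by
      have h1 : HasDerivAt (fun y => ∫ t in y..x, q t) (-q (x - 0)) (x - 0) :=
        intervalIntegral.integral_hasDerivAt_left (hqc.intervalIntegrable _ _)
          (hqc.stronglyMeasurableAtFilter _ _) hqc.continuousAt
      have h2 := h1.comp (0 : ℝ) ((hasDerivAt_id (0 : ℝ)).const_sub x)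
      simpa [Function.comp_def] using h2
    exact ((d1 b).sub (d1 a)).add (hcc.integral_hasStrictDerivAt 0 0).hasDerivAt
  have hlim := hder.tendsto_slope_zero_right
  have hle : q b - q a + c 0 ≤ 0 := by
    refine le_of_tendsto hlim ?_
    filter_upwards [Ioo_mem_nhdsGT ha] with h hh
    have := step h hh
    simp only [zero_add, sub_zero, intervalIntegral.integral_same, add_zero, smul_eq_mul]
    exact mul_nonpos_of_nonneg_of_nonpos (inv_nonneg.2 hh.1.le) this
  rw [hqQ b ⟨ha.le.trans hab, hb⟩, hqQ a ⟨ha.le, hab.trans hb⟩, hc0] at hle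
  linarith

/-! ### Strong solutions: measurable representatives -/

/-- The primitive in time of `W` with initial value `u₀`. -/
def pathOf (u₀ : Plane → Plane) (W : ℝ × Plane → Plane) (p : ℝ × Plane) : Plane :=
  u₀ p.2 + ∫ τ in (0 : ℝ)..p.1, W (τ, p.2)

/-- A strong solution with jointly measurable representatives of its derivatives. -/
structure SolData (Ω : Set Plane) (S μ ε : ℝ) (f g : ℝ → ℝ) (u : ℝ → Plane → Plane)
    (u₀ : Plane → Plane) (W : ℝ × Plane → Plane) (Du : ℝ → Plane → Plane →L[ℝ] Plane)
    (D2 : ℝ → Plane → Plane →L[ℝ] Plane →L[ℝ] Plane) : Prop where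
  isOpen : IsOpen Ω
  finite : IsFiniteMeasure vol(Ω)
  S_pos : 0 < S
  μ_pos : 0 < μ
  ε_pos : 0 < ε
  pot : IsAdmissiblePotential f g
  memH10 : ∀ t ∈ Icc 0 S, MemH10 Ω (u t)
  continuous_grad : ∀ t₀ ∈ Icc 0 S,
    Tendsto (fun t => eLpNorm (weakGrad Ω (u t) - weakGrad Ω (u t₀)) 2 vol(Ω))
      (𝓝[Icc 0 S] t₀) (𝓝 0)
  meas_W : StronglyMeasurable W
  memLp_W : MemLp W 2 (volume.prod volume)
  integrable_W : ∀ x, Integrable fun t => W (t, x)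
  meas_init : StronglyMeasurable u₀
  init_le : ∀ᵐ x ∂vol(Ω), ‖u₀ x‖ ≤ 1
  rep : ∀ t ∈ Icc 0 S, u t =ᵐ[vol(Ω)] fun x => pathOf u₀ W (t, x)
  memLp_Du : MemLp (uncurry Du) 2 (cylinderMeasure Ω S)
  memLp_D2 : MemLp (uncurry D2) 2 (cylinderMeasure Ω S)
  weakGrad_Du : ∀ᵐ t ∂(volume.restrict (Ioo 0 S)),
    IsWeakGrad Ω (u t) (Du t) ∧ IsWeakGrad Ω (Du t) (D2 t)
  equation : ∀ᵐ p ∂(cylinderMeasure Ω S),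
    W p = ellOf μ (D2 p.1 p.2) - (ε ^ 2)⁻¹ • gradient (potential f) (pathOf u₀ W p)

theorem continuous_pathOf {u₀ : Plane → Plane} {W : ℝ × Plane → Plane}
    (hWx : ∀ x, Integrable fun t => W (t, x)) (x : Plane) :
    Continuous fun t => pathOf u₀ W (t, x) := by
  have := intervalIntegral.continuous_primitive
    (fun _ _ => (hWx x).intervalIntegrable : ∀ a b, IntervalIntegrable (fun t => W (t, x)) volume a b) 0
  exact (continuous_const (y := u₀ x)).add this

theorem stronglyMeasurable_pathOf {u₀ : Plane → Plane} {W : ℝ × Plane → Plane}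
    (hWx : ∀ x, Integrable fun t => W (t, x)) (hW : StronglyMeasurable W)
    (hu₀ : StronglyMeasurable u₀) : StronglyMeasurable (pathOf u₀ W) := by
  refine stronglyMeasurable_uncurry_of_continuous_of_stronglyMeasurable
    (u := fun t x => pathOf u₀ W (t, x)) (fun x => continuous_pathOf hWx x) fun t => ?_
  refine hu₀.add ?_
  have hsw : StronglyMeasurable fun q : Plane × ℝ => W (q.2, q.1) :=
    hW.comp_measurable measurable_swap
  simp only [intervalIntegral]
  exact hsw.integral_prod_right'.sub hsw.integral_prod_right'

theorem ae_cyl_of_ae_ae {S : ℝ} {E : Type*} [NormedAddCommGroup E]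
    {A B : ℝ × Plane → E} (hA : AEStronglyMeasurable A (cylinderMeasure Ω S))
    (hB : AEStronglyMeasurable B (cylinderMeasure Ω S))
    (h : ∀ᵐ t ∂(volume.restrict (Ioo 0 S)), ∀ᵐ x ∂vol(Ω), A (t, x) = B (t, x)) :
    A =ᵐ[cylinderMeasure Ω S] B := by
  obtain ⟨A', hA', hAA⟩ := hA
  obtain ⟨B', hB', hBB⟩ := hB
  have h1 := Measure.ae_ae_of_ae_prod hAA
  have h2 := Measure.ae_ae_of_ae_prod hBB
  have hms : MeasurableSet {p | A' p = B' p} := hA'.measurableSet_eq_fun hB'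
  have : ∀ᵐ p ∂(cylinderMeasure Ω S), p ∈ {p | A' p = B' p} := by
    unfold cylinderMeasure
    rw [Measure.ae_prod_mem_iff_ae_ae_mem hms]
    filter_upwards [h, h1, h2] with t a1 a2 a3
    filter_upwards [a1, a2, a3] with x b1 b2 b3
    exact b2.symm.trans (b1.trans b3)
  filter_upwards [hAA, hBB, this] with p a1 a2 a3
  rw [a1, a2]; exact a3

theorem lapOf_add_gradDivOf_eq (μ : ℝ) {w F : Plane} {B : Plane →L[ℝ] Plane →L[ℝ] Plane}
    (h : w - μ • gradDivOf B = lapOf B - F) : w = ellOf μ B - F := by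
  rw [ellOf, eq_sub_iff_add_eq]
  rw [sub_eq_sub_iff_add_eq_add] at h
  rw [h]

theorem IsStrongSolution.exists_solData (hΩ : IsSmoothBoundedDomain Ω)
    {S μ ε c₁ δ₀ : ℝ} (hS : 0 < S) (hμ : 0 < μ) (hε : 0 < ε) {f g φ : ℝ → ℝ}
    (hfg : IsAdmissiblePotential f g) {J U : Set Plane} {uin : Plane → Plane}
    {u ut : ℝ → Plane → Plane} (hin : IsWellPrepared Ω μ ε c₁ δ₀ f g φ J U uin)
    (h : IsStrongSolution Ω S μ ε f uin u ut) :
    ∃ u₀ W Du D2, SolData Ω S μ ε f g u u₀ W Du D2 ∧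
      W =ᵐ[cylinderMeasure Ω S] uncurry ut := by
  have hfin : IsFiniteMeasure vol(Ω) :=
    ⟨by rw [Measure.restrict_apply_univ]; exact hΩ.isBounded.measure_lt_top⟩
  obtain ⟨W, u₀, hWm, hu₀m, hW2, -, hWx, -, hWut, hu₀, hrep⟩ :=
    h.timeDeriv.exists_representation hΩ.isOpen hfin hS (fun t ht => (h.memH10 t ht).memH1.memLp)
      h.continuous_L2
  obtain ⟨Du, D2, hDu, hD2, hgr, heq⟩ := h.equation
  refine ⟨u₀, W, Du, D2, ⟨hΩ.isOpen, hfin, hS, hμ, hε, hfg, h.memH10, h.continuous_grad, hWm, hW2,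
    hWx, hu₀m, ?_, hrep, hDu, hD2, hgr, ?_⟩, hWut⟩
  · filter_upwards [hin.norm_le, hu₀, h.initial] with x h1 h2 h3
    rw [h2, h3]; exact h1
  · have hV : uncurry u =ᵐ[cylinderMeasure Ω S] pathOf u₀ W := by
      refine ae_cyl_of_ae_ae h.timeDeriv.memLp.1
        (stronglyMeasurable_pathOf hWx hWm hu₀m).aestronglyMeasurable ?_
      filter_upwards [ae_restrict_mem measurableSet_Ioo] with t ht
      exact hrep t (Ioo_subset_Icc_self ht)
    filter_upwards [hWut, hV, heq] with p h1 h2 h3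
    rw [h1]
    have h4 : u p.1 p.2 = pathOf u₀ W p := h2
    rw [← h4]
    exact lapOf_add_gradDivOf_eq μ h3

variable {S μ ε : ℝ} {f g : ℝ → ℝ} {u : ℝ → Plane → Plane}
  {u₀ : Plane → Plane} {W : ℝ × Plane → Plane} {Du : ℝ → Plane → Plane →L[ℝ] Plane}
  {D2 : ℝ → Plane → Plane →L[ℝ] Plane →L[ℝ] Plane} {K C R : ℝ} {ξ H : ℝ → Plane → Plane}
  {a : ℝ → Plane → ℝ}

namespace SolData

theorem meas_path (h : SolData Ω S μ ε f g u u₀ W Du D2) : StronglyMeasurable (pathOf u₀ W) :=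
  stronglyMeasurable_pathOf h.integrable_W h.meas_W h.meas_init

theorem meas_path_section (h : SolData Ω S μ ε f g u u₀ W Du D2) (t : ℝ) :
    StronglyMeasurable fun x => pathOf u₀ W (t, x) :=
  h.meas_path.comp_measurable measurable_prodMk_left

theorem memLp_W_cyl (h : SolData Ω S μ ε f g u u₀ W Du D2) :
    MemLp W 2 (cylinderMeasure Ω S) :=
  h.memLp_W.mono_measure (Measure.prod_mono Measure.restrict_le_self Measure.restrict_le_self)

theorem memLp_ell (h : SolData Ω S μ ε f g u u₀ W Du D2) :
    MemLp (fun p : ℝ × Plane => ellOf μ (D2 p.1 p.2)) 2 (cylinderMeasure Ω S) := by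
  have hap := memLp_hess h.memLp_D2
  have hdiv : ∀ i, MemLp (fun p => divOf (uncurry D2 p (stdVec i)) • stdVec i) 2
      (cylinderMeasure Ω S) := by
    intro i
    have : MemLp (fun p => divOf (uncurry D2 p (stdVec i))) 2 (cylinderMeasure Ω S) :=
      memLp_finsetSum _ fun j _ => memLp_coord (hap i j) j
    exact ((ContinuousLinearMap.id ℝ ℝ).smulRight (stdVec i)).comp_memLp' this
  exact (memLp_finsetSum _ fun i _ => hap i i).add
    ((memLp_finsetSum _ fun i _ => hdiv i).const_smul μ)

theorem memLp_gradF (h : SolData Ω S μ ε f g u u₀ W Du D2) :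
    MemLp (fun p => gradient (potential f) (pathOf u₀ W p)) 2 (cylinderMeasure Ω S) := by
  have h1 := ((h.memLp_ell.sub h.memLp_W_cyl).const_smul (ε ^ 2))
  refine h1.ae_eq ?_
  filter_upwards [h.equation] with p hp
  have : ε ^ 2 ≠ 0 := by have := h.ε_pos; positivity
  simp only [Pi.smul_apply, Pi.sub_apply]
  conv_lhs => rw [hp]
  rw [sub_sub_cancel, smul_smul, mul_inv_cancel₀ this, one_smul]

theorem exists_dominant (h : SolData Ω S μ ε f g u u₀ W Du D2) {Θ : Plane → ℝ}
    (hΘ : ContDiff ℝ 1 Θ) (hi : Integrable (fun p => fderiv ℝ Θ (pathOf u₀ W p) (W p))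
      (cylinderMeasure Ω S)) :
    ∃ M : Plane → ℝ, Integrable M vol(Ω) ∧
      ∀ᵐ x ∂vol(Ω), ∀ t ∈ Icc 0 S, Θ (pathOf u₀ W (t, x)) ≤ M x := by
  have hS := h.S_pos
  obtain ⟨C, hC⟩ := (isCompact_closedBall (0 : Plane) 1).exists_bound_of_continuousOn
    hΘ.continuous.continuousOn
  have := h.finite
  refine ⟨fun x => C + ∫ t in Ioo 0 S, ‖fderiv ℝ Θ (pathOf u₀ W (t, x)) (W (t, x))‖,
    (integrable_const C).add hi.norm.integral_prod_right, ?_⟩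
  filter_upwards [h.init_le, hi.prod_left_ae] with x hx hxi t ht
  have hch := integral_chain_time (h.integrable_W x) (u₀ x) hΘ ht.1 (β := fun _ => 1)
    (β' := fun _ => 0) (fun s _ => hasDerivAt_const s 1) continuousOn_const
  simp only [zero_mul, zero_add, one_mul, intervalIntegral.integral_same, add_zero] at hch
  have e1 : ∀ s, u₀ x + ∫ τ in (0 : ℝ)..s, W (τ, x) = pathOf u₀ W (s, x) := fun s => rfl
  simp only [e1] at hch
  have h1 : Θ (u₀ x) ≤ C := (le_abs_self _).trans (hC _ (by simpa using hx))
  have h2 : ∫ s in (0 : ℝ)..t, fderiv ℝ Θ (pathOf u₀ W (s, x)) (W (s, x))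
      ≤ ∫ s in Ioo 0 S, ‖fderiv ℝ Θ (pathOf u₀ W (s, x)) (W (s, x))‖ := by
    rw [intervalIntegral.integral_of_le ht.1, integral_Ioc_eq_integral_Ioo]
    refine (Real.le_norm_self _).trans ((norm_integral_le_integral_norm _).trans ?_)
    exact setIntegral_mono_set hxi.norm (.of_forall fun _ => norm_nonneg _)
      (Ioo_subset_Ioo_right ht.2).eventuallyLE
  linarith

theorem integrable_dF (h : SolData Ω S μ ε f g u u₀ W Du D2) :
    Integrable (fun p => fderiv ℝ (potential f) (pathOf u₀ W p) (W p)) (cylinderMeasure Ω S) := by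
  simp only [h.pot.fderiv_potential]
  exact integrable_inner_of_memLp h.memLp_gradF h.memLp_W_cyl

theorem exists_dominant_F (h : SolData Ω S μ ε f g u u₀ W Du D2) :
    ∃ M : Plane → ℝ, Integrable M vol(Ω) ∧
      ∀ᵐ x ∂vol(Ω), ∀ t ∈ Icc 0 S, potential f (pathOf u₀ W (t, x)) ≤ M x :=
  h.exists_dominant h.pot.contDiff_potential h.integrable_dF

theorem integrable_section (h : SolData Ω S μ ε f g u u₀ W Du D2) {Θ : Plane → ℝ}
    (hΘ : Continuous Θ) (hΘ0 : ∀ v, 0 ≤ Θ v) {M : Plane → ℝ} (hM : Integrable M vol(Ω))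
    (hle : ∀ᵐ x ∂vol(Ω), ∀ t ∈ Icc 0 S, Θ (pathOf u₀ W (t, x)) ≤ M x)
    (ht : t ∈ Icc 0 S) : IntegrableOn (fun x => Θ (pathOf u₀ W (t, x))) Ω :=
  hM.mono' (hΘ.comp_stronglyMeasurable (h.meas_path_section t)).aestronglyMeasurable
    (hle.mono fun x hx => by rw [Real.norm_of_nonneg (hΘ0 _)]; exact hx t ht)

theorem memLp_g_section (h : SolData Ω S μ ε f g u u₀ W Du D2) (ht : t ∈ Icc 0 S) :
    MemLp (fun x => g ‖pathOf u₀ W (t, x)‖) 2 vol(Ω) := by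
  obtain ⟨M, hM, hle⟩ := h.exists_dominant_F
  have := h.integrable_section h.pot.contDiff_potential.continuous h.pot.potential_nonneg hM hle ht
  rw [memLp_two_iff_integrable_sq
    (h.pot.continuous_g_norm.comp_stronglyMeasurable (h.meas_path_section t)).aestronglyMeasurable]
  refine (this.const_mul 2).congr (.of_forall fun x => ?_)
  simp only [h.pot.potential_eq]
  ring

theorem memLp_g (h : SolData Ω S μ ε f g u u₀ W Du D2) :
    MemLp (fun p => g ‖pathOf u₀ W p‖) 2 (cylinderMeasure Ω S) := by
  obtain ⟨M, hM, hle⟩ := h.exists_dominant_F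
  have hm := (h.pot.continuous_g_norm.comp_stronglyMeasurable h.meas_path).aestronglyMeasurable
    (μ := cylinderMeasure Ω S)
  rw [memLp_two_iff_integrable_sq hm]
  have hMp : Integrable (fun p : ℝ × Plane => 2 * M p.2) (cylinderMeasure Ω S) :=
    (hM.comp_snd (volume.restrict (Ioo 0 S))).const_mul 2
  refine hMp.mono' (hm.pow 2) ?_
  have h1 : ∀ᵐ p ∂(cylinderMeasure Ω S), ∀ t ∈ Icc 0 S, potential f (pathOf u₀ W (t, p.2)) ≤ M p.2 :=
    Measure.quasiMeasurePreserving_snd.ae hle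
  have h2 : ∀ᵐ p ∂(cylinderMeasure Ω S), p.1 ∈ Ioo 0 S :=
    Measure.quasiMeasurePreserving_fst.ae (ae_restrict_mem measurableSet_Ioo)
  filter_upwards [h1, h2] with p a1 a2
  rw [Real.norm_of_nonneg (by positivity)]
  have := a1 p.1 (Ioo_subset_Icc_self a2)
  rw [h.pot.potential_eq] at this
  simp only [Prod.mk.eta] at this
  linarith

theorem memLp_dphase (h : SolData Ω S μ ε f g u u₀ W Du D2) :
    MemLp (fun p => fderiv ℝ (phase g) (pathOf u₀ W p)) 2 (cylinderMeasure Ω S) :=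
  h.memLp_g.mono ((h.pot.contDiff_phase.continuous_fderiv (by simp)).comp_stronglyMeasurable
    h.meas_path).aestronglyMeasurable
    (.of_forall fun p => (h.pot.norm_fderiv_phase_le _).trans (le_abs_self _))

theorem memLp_dphase_section (h : SolData Ω S μ ε f g u u₀ W Du D2) (ht : t ∈ Icc 0 S) :
    MemLp (fun x => fderiv ℝ (phase g) (pathOf u₀ W (t, x))) 2 vol(Ω) :=
  (h.memLp_g_section ht).mono
    ((h.pot.contDiff_phase.continuous_fderiv (by simp)).comp_stronglyMeasurable
      (h.meas_path_section t)).aestronglyMeasurable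
    (.of_forall fun p => (h.pot.norm_fderiv_phase_le _).trans (le_abs_self _))

theorem integrable_apply_of_memLp {X : Type*} [MeasurableSpace X] {ν : Measure X}
    {A : X → Plane →L[ℝ] ℝ} {w : X → Plane} (hA : MemLp A 2 ν) (hw : MemLp w 2 ν) :
    Integrable (fun x => A x (w x)) ν := by
  have hm : AEStronglyMeasurable (fun x => A x (w x)) ν :=
    isBoundedBilinearMap_apply.continuous.comp_aestronglyMeasurable (hA.1.prodMk hw.1)
  exact (hA.norm.integrable_mul hw.norm).mono' hm
    (.of_forall fun x => (A x).le_opNorm _)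

theorem integrable_dphase (h : SolData Ω S μ ε f g u u₀ W Du D2) :
    Integrable (fun p => fderiv ℝ (phase g) (pathOf u₀ W p) (W p)) (cylinderMeasure Ω S) :=
  integrable_apply_of_memLp h.memLp_dphase h.memLp_W_cyl

theorem exists_dominant_phase (h : SolData Ω S μ ε f g u u₀ W Du D2) :
    ∃ M : Plane → ℝ, Integrable M vol(Ω) ∧
      ∀ᵐ x ∂vol(Ω), ∀ t ∈ Icc 0 S, phase g (pathOf u₀ W (t, x)) ≤ M x :=
  h.exists_dominant h.pot.contDiff_phase h.integrable_dphase

/-- The chain rule for the potential of the solution. -/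
theorem isWeakGrad_potential (h : SolData Ω S μ ε f g u u₀ W Du D2) (ht : t ∈ Icc 0 S)
    (hF : MemLp (fun x => gradient (potential f) (pathOf u₀ W (t, x))) 2 vol(Ω)) :
    IsWeakGrad Ω (fun x => potential f (u t x))
      fun x => (fderiv ℝ (potential f) (u t x)).comp (weakGrad Ω (u t) x) := by
  obtain ⟨M, hM, hle⟩ := h.exists_dominant_F
  have h1 := h.integrable_section h.pot.contDiff_potential.continuous h.pot.potential_nonneg hM hle ht
  refine isWeakGrad_comp h.finite (h.memH10 t ht) h.pot.contDiff_potential h.pot.potential_nonneg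
    h.pot.tendsto_potential (h1.congr ?_) ?_
  · filter_upwards [h.rep t ht] with x hx
    rw [hx]
  · refine (hF.norm.integrable_mul (h.memH10 t ht).memH1.memLp_grad.norm).congr ?_
    filter_upwards [h.rep t ht] with x hx
    rw [hx]
    simp only [Pi.mul_apply, gradient, LinearIsometryEquiv.norm_map]

theorem isWeakGrad_phase (h : SolData Ω S μ ε f g u u₀ W Du D2) (ht : t ∈ Icc 0 S) :
    IsWeakGrad Ω (psi g (u t))
      fun x => (fderiv ℝ (phase g) (u t x)).comp (weakGrad Ω (u t) x) := by
  obtain ⟨M, hM, hle⟩ := h.exists_dominant_phase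
  have h1 := h.integrable_section h.pot.contDiff_phase.continuous h.pot.phase_nonneg hM hle ht
  refine isWeakGrad_comp h.finite (h.memH10 t ht) h.pot.contDiff_phase h.pot.phase_nonneg
    h.pot.tendsto_phase (h1.congr ?_) ?_
  · filter_upwards [h.rep t ht] with x hx
    rw [hx]
  · refine ((h.memLp_dphase_section ht).norm.integrable_mul
      (h.memH10 t ht).memH1.memLp_grad.norm).congr ?_
    filter_upwards [h.rep t ht] with x hx
    rw [hx]
    rfl

end SolData

/-! ### Smooth time-dependent fields -/

section TimeDependent

variable {E : Type*} [NormedAddCommGroup E] [NormedSpace ℝ E] {S : ℝ} {η : ℝ → Plane → E}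

/-- Joint smoothness on `(0, S) × ℝ²`. -/
def SmoothField (S : ℝ) (η : ℝ → Plane → E) : Prop :=
  ContDiffOn ℝ ∞ (uncurry η) (Ioo 0 S ×ˢ univ)

/-- The partial derivative in time. -/
def dtime (η : ℝ → Plane → E) (t : ℝ) (x : Plane) : E := deriv (fun τ => η τ x) t

theorem isOpen_slab (S : ℝ) : IsOpen (Ioo (0 : ℝ) S ×ˢ (univ : Set Plane)) :=
  isOpen_Ioo.prod isOpen_univ

theorem SmoothField.contDiffAt (h : SmoothField S η) (ht : t ∈ Ioo 0 S) (x : Plane) :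
    ContDiffAt ℝ ∞ (uncurry η) (t, x) :=
  ContDiffOn.contDiffAt h ((isOpen_slab S).mem_nhds ⟨ht, mem_univ x⟩)

theorem SmoothField.hasFDerivAt (h : SmoothField S η) (ht : t ∈ Ioo 0 S) (x : Plane) :
    HasFDerivAt (uncurry η) (fderiv ℝ (uncurry η) (t, x)) (t, x) :=
  ((h.contDiffAt ht x).differentiableAt (by simp)).hasFDerivAt

theorem SmoothField.contDiff (h : SmoothField S η) (ht : t ∈ Ioo 0 S) :
    ContDiff ℝ ∞ (η t) := by
  rw [contDiff_iff_contDiffAt]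
  intro x
  exact (h.contDiffAt ht x).comp x (f := fun y => (t, y)) (contDiffAt_const.prodMk contDiffAt_id)

theorem SmoothField.hasFDerivAt_space (h : SmoothField S η) (ht : t ∈ Ioo 0 S) (x : Plane) :
    HasFDerivAt (η t) ((fderiv ℝ (uncurry η) (t, x)).comp
      (ContinuousLinearMap.inr ℝ ℝ Plane)) x :=
  (h.hasFDerivAt ht x).comp x (hasFDerivAt_prodMk_right t x)

theorem SmoothField.fderiv_eq (h : SmoothField S η) (ht : t ∈ Ioo 0 S) (x : Plane) :
    fderiv ℝ (η t) x = (fderiv ℝ (uncurry η) (t, x)).comp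
      (ContinuousLinearMap.inr ℝ ℝ Plane) :=
  (h.hasFDerivAt_space ht x).fderiv

theorem SmoothField.hasDerivAt_time' (h : SmoothField S η) (ht : t ∈ Ioo 0 S) (x : Plane) :
    HasDerivAt (fun τ => η τ x) (fderiv ℝ (uncurry η) (t, x) (1, 0)) t := by
  exact (h.hasFDerivAt ht x).comp_hasDerivAt t ((hasDerivAt_id t).prodMk (hasDerivAt_const t x))

theorem SmoothField.dtime_eq (h : SmoothField S η) (ht : t ∈ Ioo 0 S) (x : Plane) :
    dtime η t x = fderiv ℝ (uncurry η) (t, x) (1, 0) :=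
  (h.hasDerivAt_time' ht x).deriv

theorem SmoothField.hasDerivAt_time (h : SmoothField S η) (ht : t ∈ Ioo 0 S) (x : Plane) :
    HasDerivAt (fun τ => η τ x) (dtime η t x) t := by
  rw [h.dtime_eq ht]; exact h.hasDerivAt_time' ht x

theorem SmoothField.contDiffOn_fderiv (h : SmoothField S η) :
    ContDiffOn ℝ ∞ (fderiv ℝ (uncurry η)) (Ioo 0 S ×ˢ univ) :=
  ContDiffOn.fderiv_of_isOpen h (isOpen_slab S) (by simp)

theorem SmoothField.space (h : SmoothField S η) : SmoothField S fun t x => fderiv ℝ (η t) x := by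
  have h1 : ContDiffOn ℝ ∞ (fun p : ℝ × Plane => (fderiv ℝ (uncurry η) p).comp
      (ContinuousLinearMap.inr ℝ ℝ Plane)) (Ioo 0 S ×ˢ univ) :=
    h.contDiffOn_fderiv.clm_comp contDiffOn_const
  exact h1.congr fun p hp => h.fderiv_eq hp.1 p.2

theorem SmoothField.time (h : SmoothField S η) : SmoothField S (dtime η) := by
  have h1 : ContDiffOn ℝ ∞ (fun p : ℝ × Plane => fderiv ℝ (uncurry η) p (1, 0))
      (Ioo 0 S ×ˢ univ) := h.contDiffOn_fderiv.clm_apply contDiffOn_const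
  exact h1.congr fun p hp => h.dtime_eq hp.1 p.2

theorem SmoothField.hasDerivAt_fderiv (h : SmoothField S η) (ht : t ∈ Ioo 0 S) (x : Plane) :
    HasDerivAt (fun τ => fderiv ℝ (η τ) x) (fderiv ℝ (dtime η t) x) t := by
  have h1 := h.space.hasDerivAt_time ht x
  refine h1.congr_deriv ?_
  have hd := ((ContDiffOn.contDiffAt h.contDiffOn_fderiv
    ((isOpen_slab S).mem_nhds (show (t, x) ∈ Ioo 0 S ×ˢ univ from ⟨ht, mem_univ x⟩))).differentiableAt
    (by simp)).hasFDerivAt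
  have hsym : IsSymmSndFDerivAt ℝ (uncurry η) (t, x) :=
    (h.contDiffAt ht x).isSymmSndFDerivAt (by simpa using ENat.LEInfty.out)
  ext v
  have e1 : HasDerivAt (fun τ => fderiv ℝ (η τ) x v)
      (fderiv ℝ (fderiv ℝ (uncurry η)) (t, x) (1, 0) (0, v)) t := by
    have h2 : HasDerivAt (fun τ => fderiv ℝ (uncurry η) (τ, x))
        (fderiv ℝ (fderiv ℝ (uncurry η)) (t, x) (1, 0)) t :=
      hd.comp_hasDerivAt t ((hasDerivAt_id t).prodMk (hasDerivAt_const t x))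
    refine (h2.clm_apply (hasDerivAt_const t ((0, v) : ℝ × Plane))).congr_of_eventuallyEq ?_ |>.congr_deriv
      (by simp)
    filter_upwards [isOpen_Ioo.mem_nhds ht] with τ hτ
    rw [h.fderiv_eq hτ]
    simp
  have e2 : HasFDerivAt (dtime η t) (((ContinuousLinearMap.apply ℝ E ((1, 0) : ℝ × Plane)).comp
      (fderiv ℝ (fderiv ℝ (uncurry η)) (t, x))).comp (ContinuousLinearMap.inr ℝ ℝ Plane)) x := by
    have h2 : HasFDerivAt (fun y => fderiv ℝ (uncurry η) (t, y) (1, 0)) _ x :=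
      (ContinuousLinearMap.apply ℝ E ((1, 0) : ℝ × Plane)).hasFDerivAt.comp x
        (hd.comp x (hasFDerivAt_prodMk_right t x))
    refine h2.congr_of_eventuallyEq (.of_forall fun y => h.dtime_eq ht y)
  have e3 := (h1.clm_apply (hasDerivAt_const t v)).unique (by simpa using e1)
  simp only [add_zero, map_zero] at e3
  rw [e3, e2.fderiv]
  exact hsym _ _

theorem SmoothField.continuousOn (h : SmoothField S η) :
    ContinuousOn (uncurry η) (Ioo 0 S ×ˢ univ) := ContDiffOn.continuousOn h

theorem SmoothField.exists_bound (h : SmoothField S η) {Z : Set Plane} (hZ : IsCompact Z)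
    (h0 : ∀ t ∈ Ioo 0 S, ∀ x, x ∉ Z → η t x = 0) {α β : ℝ} (hα : 0 < α) (hβ : β < S) :
    ∃ C : ℝ, 0 ≤ C ∧ ∀ t ∈ Icc α β, ∀ x, ‖η t x‖ ≤ C := by
  have hsub : Icc α β ×ˢ Z ⊆ Ioo 0 S ×ˢ univ := fun p hp =>
    ⟨⟨hα.trans_le hp.1.1, hp.1.2.trans_lt hβ⟩, mem_univ _⟩
  obtain ⟨C, hC⟩ := (isCompact_Icc.prod hZ).exists_bound_of_continuousOn (h.continuousOn.mono hsub)
  refine ⟨max C 0, le_max_right _ _, fun t ht x => ?_⟩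
  by_cases hx : x ∈ Z
  · exact (hC (t, x) ⟨ht, hx⟩).trans (le_max_left _ _)
  · rw [h0 t ⟨hα.trans_le ht.1, ht.2.trans_lt hβ⟩ x hx, norm_zero]
    exact le_max_right _ _

theorem space_eq_zero {Z : Set Plane} (hs : ∀ t ∈ Ioo 0 S, tsupport (η t) ⊆ Z)
    (ht : t ∈ Ioo 0 S) {x : Plane} (hx : x ∉ Z) : fderiv ℝ (η t) x = 0 := by
  by_contra h
  exact hx (hs t ht (support_fderiv_subset ℝ h))

theorem time_eq_zero {Z : Set Plane} (hs : ∀ t ∈ Ioo 0 S, tsupport (η t) ⊆ Z)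
    (ht : t ∈ Ioo 0 S) {x : Plane} (hx : x ∉ Z) : dtime η t x = 0 := by
  have : (fun τ => η τ x) =ᶠ[𝓝 t] fun _ => 0 := by
    filter_upwards [isOpen_Ioo.mem_nhds ht] with τ hτ
    exact image_eq_zero_of_notMem_tsupport fun h => hx (hs τ hτ h)
  rw [dtime, this.deriv_eq, deriv_const]

theorem tsupport_subset_of_eq_zero {E' : Type*} [Zero E'] {v : Plane → E'} {Z : Set Plane}
    (hZ : IsClosed Z) (h : ∀ x, x ∉ Z → v x = 0) : tsupport v ⊆ Z :=
  closure_minimal (fun x hx => by by_contra hn; exact hx (h x hn)) hZ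

/-- Lebesgue measure on `(α, β) × Ω`. -/
def cyl (Ω : Set Plane) (α β : ℝ) : Measure (ℝ × Plane) :=
  (volume.restrict (Ioo α β)).prod vol(Ω)

theorem cyl_le {α β S : ℝ} (hα : 0 ≤ α) (hβ : β ≤ S) :
    cyl Ω α β ≤ cylinderMeasure Ω S :=
  Measure.prod_mono (Measure.restrict_mono (Ioo_subset_Ioo hα hβ) le_rfl) le_rfl

theorem ae_cyl_mem (Ω : Set Plane) (α β : ℝ) : ∀ᵐ p ∂(cyl Ω α β), p.1 ∈ Ioo α β :=
  Measure.quasiMeasurePreserving_fst.ae (ae_restrict_mem measurableSet_Ioo)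

theorem SmoothField.aestronglyMeasurable [SecondCountableTopologyEither (ℝ × Plane) E]
    (h : SmoothField S η)
    (hΩ : MeasurableSet Ω) {α β : ℝ} (hα : 0 ≤ α) (hβ : β ≤ S) :
    AEStronglyMeasurable (fun p : ℝ × Plane => η p.1 p.2) (cyl Ω α β) := by
  have hms : MeasurableSet (Ioo α β ×ˢ Ω) := measurableSet_Ioo.prod hΩ
  have := (h.continuousOn.mono (prod_mono (Ioo_subset_Ioo hα hβ) (subset_univ Ω))).aestronglyMeasurable
    (μ := volume.prod volume) hms
  rw [← Measure.prod_restrict] at this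
  exact this

end TimeDependent

theorem integral_weakGrad_apply {v : Plane → ℝ}
    {G : Plane → Plane →L[ℝ] ℝ} (h : IsWeakGrad Ω v G) {η : Plane → Plane} (hη : ContDiff ℝ ∞ η)
    (hc : HasCompactSupport η) (hs : tsupport η ⊆ Ω) :
    ∫ x in Ω, G x (η x) = -∫ x in Ω, divOf (fderiv ℝ η x) * v x := by
  have hi : ∀ i : Fin 2, ContDiff ℝ ∞ fun x => η x i := fun i => (contDiff_euclidean.1 hη) i
  have hsi : ∀ i : Fin 2, tsupport (fun x => η x i) ⊆ tsupport η := fun i =>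
    closure_mono fun x hx => by
      intro h0; exact hx (by simp [h0])
  have hci : ∀ i : Fin 2, HasCompactSupport fun x => η x i := fun i =>
    hc.of_isClosed_subset (isClosed_tsupport _) (hsi i)
  have hfd : ∀ (i : Fin 2) x w, fderiv ℝ (fun x => η x i) x w = fderiv ℝ η x w i := fun i x w => by
    have h1 := (hη.differentiable (by simp) x).hasFDerivAt
    have := ((EuclideanSpace.proj i : Plane →L[ℝ] ℝ).hasFDerivAt.comp x h1).fderiv
    change fderiv ℝ (fun x => η x i) x = _ at this
    rw [this]; rfl
  have hG : ∀ i : Fin 2, LocallyIntegrableOn (fun x => G x (stdVec i)) Ω := by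
    intro i x hx
    obtain ⟨s, hs, hi⟩ := h.locallyIntegrable_grad x hx
    exact ⟨s, hs, (ContinuousLinearMap.apply ℝ ℝ (stdVec i)).integrable_comp hi⟩
  have i1 : ∀ i : Fin 2, IntegrableOn (fun x => η x i * G x (stdVec i)) Ω := fun i =>
    integrableOn_test_smul (hG i) (hi i).continuous (hci i) ((hsi i).trans hs)
  have i2 : ∀ i : Fin 2, IntegrableOn (fun x => fderiv ℝ (fun x => η x i) x (stdVec i) * v x) Ω :=
    fun i => integrableOn_test_smul h.locallyIntegrable (continuous_fderiv_apply (hi i) _)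
      ((hci i).of_isClosed_subset (isClosed_tsupport _) (tsupport_fderiv_apply_subset _))
      ((tsupport_fderiv_apply_subset _).trans ((hsi i).trans hs))
  have key : ∀ i : Fin 2, ∫ x in Ω, fderiv ℝ (fun x => η x i) x (stdVec i) * v x
      = -∫ x in Ω, η x i * G x (stdVec i) := fun i =>
    h.integral_eq _ (hi i) (hci i) ((hsi i).trans hs) (stdVec i)
  have e1 : ∀ x, G x (η x) = η x 0 * G x (stdVec 0) + η x 1 * G x (stdVec 1) := fun x => by
    conv_lhs => rw [plane_expand (η x)]
    simp
  have e2 : ∀ x, divOf (fderiv ℝ η x) * v x = fderiv ℝ (fun x => η x 0) x (stdVec 0) * v x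
      + fderiv ℝ (fun x => η x 1) x (stdVec 1) * v x := fun x => by
    rw [hfd, hfd, divOf, Fin.sum_univ_two, add_mul]
  simp only [e1, e2]
  rw [integral_add (i1 0) (i1 1), integral_add (i2 0) (i2 1), key, key]
  ring

/-! ### Calibrations -/

/-- The fields used to estimate the modulated energy, with the pointwise inequality they satisfy. -/
structure IsCalibration (Ω : Set Plane) (S μ K C R : ℝ) (ξ H : ℝ → Plane → Plane)
    (a : ℝ → Plane → ℝ) : Prop where
  norm_le : ∀ t ∈ Icc 0 S, ∀ x, ‖ξ t x‖ ≤ 1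
  measurable : ∀ t ∈ Icc 0 S, Measurable (ξ t)
  continuous_time : ∀ x, ContinuousOn (fun t => ξ t x) (Icc 0 S)
  smooth_xi : SmoothField S ξ
  smooth_H : SmoothField S H
  smooth_a : SmoothField S a
  support : ∃ Z : Set Plane, IsCompact Z ∧ Z ⊆ Ω ∧ ∀ t ∈ Ioo 0 S,
    tsupport (ξ t) ⊆ Z ∧ tsupport (H t) ⊆ Z ∧ tsupport (a t) ⊆ Z
  support_a : ∀ t ∈ Ioo 0 S, tsupport (a t) ⊆ closedBall 0 R
  a_le : ∀ t ∈ Ioo 0 S, ∀ x, |a t x| ≤ K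
  H_le : ∀ t ∈ Ioo 0 S, ∀ x, ‖H t x‖ ≤ K
  grad_a_le : ∀ t ∈ Ioo 0 S, ∀ x, ‖fderiv ℝ (a t) x‖ ≤ K
  pointwise : ∀ t ∈ Ioo 0 S, ∀ x, ∀ (q : Plane →L[ℝ] Plane) (e : Plane) (G : ℝ), ‖e‖ ≤ 1 →
    G * ‖e‖ ^ 2 = G →
    (1 / 2) * divOf (fderiv ℝ (ξ t) x) ^ 2 * G ^ 2 + ‖q (H t x)‖ ^ 2 / 2
      - G * inner ℝ e (q (dtime ξ t x)) + stress μ (fderiv ℝ (H t) x) q (G ^ 2)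
      - μ * a t x * divOf q * divOf (perpL.comp q) ≤ C * modForm μ q G e (ξ t x)

/-! ### The evolution of the energies -/

/-- The divergence as a functional. -/
def divCLM : (Plane →L[ℝ] Plane) →L[ℝ] ℝ := entryL 0 0 + entryL 1 1

theorem divCLM_apply (A : Plane →L[ℝ] Plane) : divCLM A = divOf A := by
  simp only [divCLM, divOf, Fin.sum_univ_two]
  rfl

theorem SmoothField.clm {E E' : Type*} [NormedAddCommGroup E] [NormedSpace ℝ E]
    [NormedAddCommGroup E'] [NormedSpace ℝ E'] {S : ℝ} {η : ℝ → Plane → E} (h : SmoothField S η)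
    (L : E →L[ℝ] E') : SmoothField S fun t x => L (η t x) :=
  L.contDiff.comp_contDiffOn h

theorem SmoothField.div {S : ℝ} {η : ℝ → Plane → Plane} (h : SmoothField S η) :
    SmoothField S fun t x => divOf (fderiv ℝ (η t) x) := by
  have := h.space.clm divCLM
  simp only [divCLM_apply] at this
  exact this

theorem dualCLM_aestronglyMeasurable {X : Type*} [MeasurableSpace X] {ν : Measure X}
    {V V' : Type*} [NormedAddCommGroup V] [NormedSpace ℝ V] [NormedAddCommGroup V'] [NormedSpace ℝ V']
    {A : X → V →L[ℝ] V'} {w : X → V}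
    (hA : AEStronglyMeasurable A ν) (hw : AEStronglyMeasurable w ν) :
    AEStronglyMeasurable (fun x => A x (w x)) ν :=
  isBoundedBilinearMap_apply.continuous.comp_aestronglyMeasurable (hA.prodMk hw)

/-- `∫ ξ · ∇ψ[v]`. -/
def pairing (Ω : Set Plane) (g : ℝ → ℝ) (ξ v : Plane → Plane) : ℝ :=
  ∫ x in Ω, weakGrad Ω (psi g v) x (ξ x)

namespace SolData

theorem integrable_phase (h : SolData Ω S μ ε f g u u₀ W Du D2) :
    Integrable (fun p => phase g (pathOf u₀ W p)) (cylinderMeasure Ω S) := by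
  obtain ⟨M, hM, hle⟩ := h.exists_dominant_phase
  have hMp : Integrable (fun p : ℝ × Plane => M p.2) (cylinderMeasure Ω S) :=
    hM.comp_snd (volume.restrict (Ioo 0 S))
  refine hMp.mono' (h.pot.contDiff_phase.continuous.comp_stronglyMeasurable
    h.meas_path).aestronglyMeasurable ?_
  have h1 : ∀ᵐ p ∂(cylinderMeasure Ω S), ∀ t ∈ Icc 0 S, phase g (pathOf u₀ W (t, p.2)) ≤ M p.2 :=
    Measure.quasiMeasurePreserving_snd.ae hle
  filter_upwards [h1, ae_cyl_mem Ω 0 S] with p a1 a2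
  rw [Real.norm_of_nonneg (h.pot.phase_nonneg _)]
  exact a1 p.1 (Ioo_subset_Icc_self a2)

theorem grad_phase_ae (h : SolData Ω S μ ε f g u u₀ W Du D2) (ht : t ∈ Icc 0 S) :
    weakGrad Ω (psi g (u t)) =ᵐ[vol(Ω)]
      fun x => (fderiv ℝ (phase g) (pathOf u₀ W (t, x))).comp (weakGrad Ω (u t) x) := by
  filter_upwards [(h.isWeakGrad_phase ht).weakGrad_ae_eq h.isOpen, h.rep t ht] with x h1 h2
  rw [h1, h2]

theorem pairing_eq (h : SolData Ω S μ ε f g u u₀ W Du D2) (ht : t ∈ Icc 0 S)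
    {η : Plane → Plane} (hη : ContDiff ℝ ∞ η) (hc : HasCompactSupport η) (hs : tsupport η ⊆ Ω) :
    pairing Ω g η (u t) = -∫ x in Ω, divOf (fderiv ℝ η x) * phase g (pathOf u₀ W (t, x)) := by
  rw [pairing, integral_weakGrad_apply (h.isWeakGrad_phase ht).weakGrad hη hc hs]
  congr 1
  refine integral_congr_ae ?_
  filter_upwards [h.rep t ht] with x hx
  rw [show psi g (u t) x = phase g (u t x) from rfl, hx]

theorem pairing_eq_grad (h : SolData Ω S μ ε f g u u₀ W Du D2) (ht : t ∈ Icc 0 S)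
    (η : Plane → Plane) : pairing Ω g η (u t)
      = ∫ x in Ω, fderiv ℝ (phase g) (pathOf u₀ W (t, x)) (weakGrad Ω (u t) x (η x)) := by
  rw [pairing]
  refine integral_congr_ae ?_
  filter_upwards [h.grad_phase_ae ht] with x hx
  rw [hx]
  rfl

theorem integral_sub_eq (h : SolData Ω S μ ε f g u u₀ W Du D2) {Θ : Plane → ℝ}
    (hΘ : ContDiff ℝ 1 Θ) {α β : ℝ} (hαβ : α ≤ β)
    {w w' : ℝ → Plane → ℝ} (hw : ∀ x, ∀ t ∈ Icc α β, HasDerivAt (fun τ => w τ x) (w' t x) t)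
    (hw' : ∀ x, ContinuousOn (fun t => w' t x) (Icc α β))
    (i1 : Integrable (fun p : ℝ × Plane => w' p.1 p.2 * Θ (pathOf u₀ W p)) (cyl Ω α β))
    (i2 : Integrable (fun p : ℝ × Plane => w p.1 p.2 * fderiv ℝ Θ (pathOf u₀ W p) (W p)) (cyl Ω α β))
    (jα : IntegrableOn (fun x => w α x * Θ (pathOf u₀ W (α, x))) Ω)
    (jβ : IntegrableOn (fun x => w β x * Θ (pathOf u₀ W (β, x))) Ω) :
    (∫ x in Ω, w β x * Θ (pathOf u₀ W (β, x))) - ∫ x in Ω, w α x * Θ (pathOf u₀ W (α, x))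
      = (∫ p, w' p.1 p.2 * Θ (pathOf u₀ W p) ∂(cyl Ω α β))
        + ∫ p, w p.1 p.2 * fderiv ℝ Θ (pathOf u₀ W p) (W p) ∂(cyl Ω α β) := by
  have := h.finite
  rw [← integral_sub jβ jα, ← integral_add i1 i2]
  unfold cyl at i1 i2 ⊢
  have i3 : Integrable (fun p : ℝ × Plane => w' p.1 p.2 * Θ (pathOf u₀ W p)
      + w p.1 p.2 * fderiv ℝ Θ (pathOf u₀ W p) (W p))
      ((volume.restrict (Ioo α β)).prod vol(Ω)) := i1.add i2
  rw [integral_prod_symm _ i3]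
  refine integral_congr_ae (.of_forall fun x => ?_)
  have := integral_chain_time (h.integrable_W x) (u₀ x) hΘ hαβ (hw x) (hw' x)
  rw [intervalIntegral.integral_of_le hαβ, integral_Ioc_eq_integral_Ioo] at this
  exact this.symm

theorem pairing_sub (h : SolData Ω S μ ε f g u u₀ W Du D2) (hc : IsCalibration Ω S μ K C R ξ H a)
    {α β : ℝ} (hα : 0 < α) (hαβ : α ≤ β) (hβ : β < S) :
    Integrable (fun p => fderiv ℝ (phase g) (pathOf u₀ W p) (Du p.1 p.2 (dtime ξ p.1 p.2)))
      (cyl Ω α β) ∧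
    Integrable (fun p => divOf (fderiv ℝ (ξ p.1) p.2) * fderiv ℝ (phase g) (pathOf u₀ W p) (W p))
      (cyl Ω α β) ∧
    pairing Ω g (ξ β) (u β) - pairing Ω g (ξ α) (u α)
      = (∫ p, fderiv ℝ (phase g) (pathOf u₀ W p) (Du p.1 p.2 (dtime ξ p.1 p.2)) ∂(cyl Ω α β))
        - ∫ p, divOf (fderiv ℝ (ξ p.1) p.2) * fderiv ℝ (phase g) (pathOf u₀ W p) (W p)
            ∂(cyl Ω α β) := by
  obtain ⟨Z, hZ, hZΩ, hZs⟩ := hc.support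
  have hsξ : ∀ t ∈ Ioo 0 S, tsupport (ξ t) ⊆ Z := fun t ht => (hZs t ht).1
  have hsub : ∀ t ∈ Icc α β, t ∈ Ioo 0 S := fun t ht => ⟨hα.trans_le ht.1, ht.2.trans_lt hβ⟩
  have hsI : ∀ {t}, t ∈ Ioo 0 S → t ∈ Icc 0 S := fun ht => Ioo_subset_Icc_self ht
  have hΩm := h.isOpen.measurableSet
  have hle := cyl_le (Ω := Ω) hα.le hβ.le
  have hmem : ∀ᵐ p ∂(cyl Ω α β), p.1 ∈ Icc α β :=
    (ae_cyl_mem Ω α β).mono fun p hp => Ioo_subset_Icc_self hp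
  have st := hc.smooth_xi.time
  have hst : ∀ t ∈ Ioo 0 S, tsupport (dtime ξ t) ⊆ Z := fun t ht =>
    tsupport_subset_of_eq_zero hZ.isClosed fun x hx => time_eq_zero hsξ ht hx
  obtain ⟨B1, hB10, hB1⟩ := hc.smooth_xi.div.exists_bound hZ (fun t ht x hx => by
    rw [space_eq_zero hsξ ht hx, ← divCLM_apply, map_zero]) hα hβ
  obtain ⟨B2, hB20, hB2⟩ := st.div.exists_bound hZ (fun t ht x hx => by
    rw [space_eq_zero hst ht hx, ← divCLM_apply, map_zero]) hα hβ
  obtain ⟨B3, hB30, hB3⟩ := st.exists_bound hZ (fun t ht x hx => time_eq_zero hsξ ht hx) hα hβ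
  have m1 := hc.smooth_xi.div.aestronglyMeasurable hΩm hα.le hβ.le
  have m2 := st.div.aestronglyMeasurable hΩm hα.le hβ.le
  have m3 := st.aestronglyMeasurable hΩm hα.le hβ.le
  have mDu := h.memLp_Du.mono_measure hle
  have mΨ := h.memLp_dphase.mono_measure hle
  have mDuξ : MemLp (fun p : ℝ × Plane => Du p.1 p.2 (dtime ξ p.1 p.2)) 2 (cyl Ω α β) := by
    refine mDu.of_le_mul (c := B3) (dualCLM_aestronglyMeasurable mDu.1 m3) ?_
    filter_upwards [hmem] with p hp
    rw [mul_comm]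
    exact ((Du p.1 p.2).le_opNorm _).trans
      (mul_le_mul_of_nonneg_left (hB3 _ hp _) (norm_nonneg _))
  have j1 := integrable_apply_of_memLp mΨ mDuξ
  have j2 : Integrable (fun p => divOf (fderiv ℝ (ξ p.1) p.2)
      * fderiv ℝ (phase g) (pathOf u₀ W p) (W p)) (cyl Ω α β) :=
    (h.integrable_dphase.mono_measure hle).bdd_mul (c := B1) m1 (hmem.mono fun p hp => hB1 _ hp _)
  have j3 : Integrable (fun p : ℝ × Plane => divOf (fderiv ℝ (dtime ξ p.1) p.2)
      * phase g (pathOf u₀ W p)) (cyl Ω α β) :=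
    (h.integrable_phase.mono_measure hle).bdd_mul (c := B2) m2 (hmem.mono fun p hp => hB2 _ hp _)
  refine ⟨j1, j2, ?_⟩
  have hcd : ∀ {η : ℝ → Plane → Plane}, SmoothField S η → (∀ t ∈ Ioo 0 S, tsupport (η t) ⊆ Z) →
      ∀ t ∈ Ioo 0 S, pairing Ω g (η t) (u t)
        = -∫ x in Ω, divOf (fderiv ℝ (η t) x) * phase g (pathOf u₀ W (t, x)) := fun hη hs t ht =>
    h.pairing_eq (hsI ht) (hη.contDiff ht) (hZ.of_isClosed_subset (isClosed_tsupport _) (hs t ht))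
      ((hs t ht).trans hZΩ)
  have hαm : α ∈ Icc α β := ⟨le_rfl, hαβ⟩
  have hβm : β ∈ Icc α β := ⟨hαβ, le_rfl⟩
  obtain ⟨M, hM, hMle⟩ := h.exists_dominant_phase
  have js : ∀ t ∈ Icc α β, IntegrableOn (fun x => divOf (fderiv ℝ (ξ t) x)
      * phase g (pathOf u₀ W (t, x))) Ω := fun t ht =>
    (h.integrable_section h.pot.contDiff_phase.continuous h.pot.phase_nonneg hM hMle
      (hsI (hsub t ht))).bdd_mul (c := B1)
      (((hc.smooth_xi.div.contDiff (hsub t ht)).continuous).aestronglyMeasurable)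
      (.of_forall fun x => hB1 t ht x)
  have key := h.integral_sub_eq h.pot.contDiff_phase hαβ
    (w := fun t x => divOf (fderiv ℝ (ξ t) x)) (w' := fun t x => divOf (fderiv ℝ (dtime ξ t) x))
    (fun x t ht => by
      have := divCLM.hasFDerivAt.comp_hasDerivAt t (hc.smooth_xi.hasDerivAt_fderiv (hsub t ht) x)
      simp only [Function.comp_def, divCLM_apply] at this
      exact this)
    (fun x => by
      have := st.div.continuousOn.comp (f := fun t : ℝ => (t, x)) (s := Icc α β) (by fun_prop)
        (fun t ht => ⟨hsub t ht, mem_univ _⟩)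
      exact this)
    j3 j2 (js α hαm) (js β hβm)
  have e3 : ∫ p, divOf (fderiv ℝ (dtime ξ p.1) p.2) * phase g (pathOf u₀ W p) ∂(cyl Ω α β)
      = -∫ p, fderiv ℝ (phase g) (pathOf u₀ W p) (Du p.1 p.2 (dtime ξ p.1 p.2)) ∂(cyl Ω α β) := by
    have := h.finite
    unfold cyl at j1 j3 ⊢
    rw [integral_prod _ j3, integral_prod _ j1, ← integral_neg]
    refine integral_congr_ae ?_
    have hss : Ioo α β ⊆ Ioo 0 S := Ioo_subset_Ioo hα.le hβ.le
    filter_upwards [ae_restrict_mem measurableSet_Ioo,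
      ae_restrict_of_ae_restrict_of_subset hss h.weakGrad_Du] with t ht hDu
    have ht' := hss ht
    have e4 := hcd st hst t ht'
    rw [h.pairing_eq_grad (hsI ht')] at e4
    rw [← neg_eq_iff_eq_neg, ← e4]
    refine integral_congr_ae ?_
    filter_upwards [hDu.1.weakGrad_ae_eq h.isOpen] with x hx
    rw [hx]
  rw [hcd hc.smooth_xi hsξ β (hsub β hβm), hcd hc.smooth_xi hsξ α (hsub α hαm)]
  rw [e3] at key
  linarith

theorem integral_potential_sub (h : SolData Ω S μ ε f g u u₀ W Du D2)
    {α β : ℝ} (hα : 0 ≤ α) (hαβ : α ≤ β) (hβ : β ≤ S) :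
    (∫ x in Ω, potential f (pathOf u₀ W (β, x))) - ∫ x in Ω, potential f (pathOf u₀ W (α, x))
      = ∫ p, fderiv ℝ (potential f) (pathOf u₀ W p) (W p) ∂(cyl Ω α β) := by
  obtain ⟨M, hM, hMle⟩ := h.exists_dominant_F
  have js : ∀ t ∈ Icc α β, IntegrableOn (fun x => (1 : ℝ) * potential f (pathOf u₀ W (t, x))) Ω :=
    fun t ht => by
      simp only [one_mul]
      exact h.integrable_section h.pot.contDiff_potential.continuous h.pot.potential_nonneg hM hMle
        ⟨hα.trans ht.1, ht.2.trans hβ⟩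
  have key := h.integral_sub_eq h.pot.contDiff_potential hαβ (w := fun _ _ => 1)
    (w' := fun _ _ => 0) (fun x t _ => hasDerivAt_const t 1) (fun x => continuousOn_const)
    (by simp) (by simpa using h.integrable_dF.mono_measure (cyl_le hα hβ))
    (js α ⟨le_rfl, hαβ⟩) (js β ⟨hαβ, le_rfl⟩)
  simpa using key

theorem dirichlet_sub_le (h : SolData Ω S μ ε f g u u₀ W Du D2)
    {α β : ℝ} (hα : 0 < α) (hαβ : α ≤ β) (hβ : β ≤ S) :
    dirichlet Ω μ (u β) - dirichlet Ω μ (u α)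
      ≤ -∫ p, inner ℝ (ellOf μ (D2 p.1 p.2)) (W p) ∂(cyl Ω α β) := by
  have := h.finite
  have hQ : ContinuousOn (fun t => dirichlet Ω μ (u t)) (Icc 0 S) :=
    continuousOn_dirichlet μ (fun t ht => (h.memH10 t ht).memH1.memLp_grad) h.continuous_grad
  have key := sub_le_of_diff_le h.isOpen.measurableSet hQ (Lf := fun t x => ellOf μ (D2 t x))
    h.meas_W h.memLp_W h.integrable_W h.rep h.memLp_ell (by
      filter_upwards [h.weakGrad_Du, MemLp.ae_section (E := Plane →L[ℝ] Plane →L[ℝ] Plane) h.memLp_D2, ae_restrict_mem measurableSet_Ioo]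
        with t h1 h2 h3 s hs
      exact dirichlet_sub_le_inner h.isOpen h.μ_pos.le (h.memH10 t (Ioo_subset_Icc_self h3))
        (h.memH10 s hs) h1.1 h2 h1.2) hα hαβ hβ
  have hi : Integrable (fun p : ℝ × Plane => (inner ℝ (ellOf μ (D2 p.1 p.2)) (W p) : ℝ))
      (cyl Ω α β) :=
    (integrable_inner_of_memLp h.memLp_ell h.memLp_W_cyl).mono_measure (cyl_le hα.le hβ)
  unfold cyl at hi ⊢
  rw [integral_prod _ hi]
  rw [intervalIntegral.integral_of_le hαβ, integral_Ioc_eq_integral_Ioo] at key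
  exact key

theorem integrableOn_quad (h : SolData Ω S μ ε f g u u₀ W Du D2) (ht : t ∈ Icc 0 S) :
    IntegrableOn (fun x => (frobSq (weakGrad Ω (u t) x) + μ * divOf (weakGrad Ω (u t) x) ^ 2) / 2) Ω := by
  have hA := (h.memH10 t ht).memH1.memLp_grad
  simp only [← dirForm_self]
  exact (integrable_dirForm μ hA hA).div_const 2

theorem integrableOn_potential (h : SolData Ω S μ ε f g u u₀ W Du D2) (ht : t ∈ Icc 0 S) :
    IntegrableOn (fun x => potential f (pathOf u₀ W (t, x))) Ω := by
  obtain ⟨M, hM, hMle⟩ := h.exists_dominant_F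
  exact h.integrable_section h.pot.contDiff_potential.continuous h.pot.potential_nonneg hM hMle ht

theorem glDensity_ae (h : SolData Ω S μ ε f g u u₀ W Du D2) (ht : t ∈ Icc 0 S) :
    glDensity Ω μ ε f (u t) =ᵐ[vol(Ω)] fun x =>
      ε * ((frobSq (weakGrad Ω (u t) x) + μ * divOf (weakGrad Ω (u t) x) ^ 2) / 2)
        + ε⁻¹ * potential f (pathOf u₀ W (t, x)) := by
  filter_upwards [h.rep t ht] with x hx
  rw [glDensity, hx]
  ring

theorem integrableOn_glDensity (h : SolData Ω S μ ε f g u u₀ W Du D2) (ht : t ∈ Icc 0 S) :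
    IntegrableOn (glDensity Ω μ ε f (u t)) Ω :=
  Integrable.congr (((h.integrableOn_quad ht).const_mul ε).add
    ((h.integrableOn_potential ht).const_mul ε⁻¹)) (h.glDensity_ae ht).symm

theorem glEnergy_eq (h : SolData Ω S μ ε f g u u₀ W Du D2) (ht : t ∈ Icc 0 S) :
    glEnergy Ω μ ε f (u t)
      = ε * dirichlet Ω μ (u t) + ε⁻¹ * ∫ x in Ω, potential f (pathOf u₀ W (t, x)) := by
  rw [glEnergy, integral_congr_ae (h.glDensity_ae ht),
    integral_add ((h.integrableOn_quad ht).const_mul ε) ((h.integrableOn_potential ht).const_mul ε⁻¹),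
    integral_const_mul, integral_const_mul, dirichlet]

theorem integrableOn_pairing (h : SolData Ω S μ ε f g u u₀ W Du D2) (ht : t ∈ Icc 0 S)
    {η : Plane → Plane} (hη : Measurable η) (hle : ∀ x, ‖η x‖ ≤ 1) :
    IntegrableOn (fun x => weakGrad Ω (psi g (u t)) x (η x)) Ω := by
  have hg := (h.memH10 t ht).memH1.memLp_grad
  have hgη : MemLp (fun x => weakGrad Ω (u t) x (η x)) 2 vol(Ω) :=
    hg.of_le_mul (c := 1) (dualCLM_aestronglyMeasurable hg.1 hη.aestronglyMeasurable)
      (.of_forall fun x => by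
        rw [one_mul]
        exact ((weakGrad Ω (u t) x).le_opNorm _).trans
          (mul_le_of_le_one_right (norm_nonneg _) (hle x)))
  refine Integrable.congr (integrable_apply_of_memLp (h.memLp_dphase_section ht) hgη) ?_
  filter_upwards [h.grad_phase_ae ht] with x hx
  rw [hx]
  rfl

theorem integrableOn_modDensity (h : SolData Ω S μ ε f g u u₀ W Du D2) (ht : t ∈ Icc 0 S)
    {η : Plane → Plane} (hη : Measurable η) (hle : ∀ x, ‖η x‖ ≤ 1) :
    IntegrableOn (modDensity Ω μ ε f g η (u t)) Ω :=
  (h.integrableOn_glDensity ht).sub (h.integrableOn_pairing ht hη hle)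

theorem modEnergy_eq (h : SolData Ω S μ ε f g u u₀ W Du D2) (ht : t ∈ Icc 0 S)
    {η : Plane → Plane} (hη : Measurable η) (hle : ∀ x, ‖η x‖ ≤ 1) :
    modEnergy Ω μ ε f g η (u t) = glEnergy Ω μ ε f (u t) - pairing Ω g η (u t) :=
  integral_sub (h.integrableOn_glDensity ht) (h.integrableOn_pairing ht hη hle)

theorem glEnergy_sub_le (h : SolData Ω S μ ε f g u u₀ W Du D2)
    {α β : ℝ} (hα : 0 < α) (hαβ : α ≤ β) (hβ : β ≤ S) :
    glEnergy Ω μ ε f (u β) - glEnergy Ω μ ε f (u α) ≤ -∫ p, ε * ‖W p‖ ^ 2 ∂(cyl Ω α β) := by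
  have hε := h.ε_pos
  have hle := cyl_le (Ω := Ω) hα.le hβ
  rw [h.glEnergy_eq ⟨hα.le.trans hαβ, hβ⟩, h.glEnergy_eq ⟨hα.le, hαβ.trans hβ⟩]
  have h1 := mul_le_mul_of_nonneg_left (h.dirichlet_sub_le hα hαβ hβ) hε.le
  have h2 := h.integral_potential_sub hα.le hαβ hβ
  have i1 := (integrable_inner_of_memLp h.memLp_ell h.memLp_W_cyl).mono_measure hle
  have i2 := h.integrable_dF.mono_measure hle
  have h3 : ∫ p, ε * ‖W p‖ ^ 2 ∂(cyl Ω α β)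
      = ε * (∫ p, inner ℝ (ellOf μ (D2 p.1 p.2)) (W p) ∂(cyl Ω α β))
        - ε⁻¹ * ∫ p, fderiv ℝ (potential f) (pathOf u₀ W p) (W p) ∂(cyl Ω α β) := by
    rw [← integral_const_mul, ← integral_const_mul, ← integral_sub (i1.const_mul _) (i2.const_mul _)]
    refine integral_congr_ae ?_
    filter_upwards [ae_mono hle h.equation] with p hp
    rw [h.pot.fderiv_potential]
    have h4 : (inner ℝ (W p) (W p) : ℝ) = inner ℝ (ellOf μ (D2 p.1 p.2)) (W p)
        - (ε ^ 2)⁻¹ * inner ℝ (gradient (potential f) (pathOf u₀ W p)) (W p) := by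
      have h5 := congrArg (fun z => (inner ℝ z (W p) : ℝ)) hp
      simp only [inner_sub_left, real_inner_smul_left] at h5
      exact h5
    rw [real_inner_self_eq_norm_sq] at h4
    rw [h4]
    field_simp
  rw [h3]
  linear_combination h1 + ε⁻¹ * h2

theorem modEnergy_sub_le (h : SolData Ω S μ ε f g u u₀ W Du D2)
    (hc : IsCalibration Ω S μ K C R ξ H a)
    {α β : ℝ} (hα : 0 < α) (hαβ : α ≤ β) (hβ : β < S) :
    modEnergy Ω μ ε f g (ξ β) (u β) - modEnergy Ω μ ε f g (ξ α) (u α)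
      ≤ ∫ p, (-(ε * ‖W p‖ ^ 2)
        - fderiv ℝ (phase g) (pathOf u₀ W p) (Du p.1 p.2 (dtime ξ p.1 p.2))
        + divOf (fderiv ℝ (ξ p.1) p.2) * fderiv ℝ (phase g) (pathOf u₀ W p) (W p)) ∂(cyl Ω α β) := by
  have hβI : β ∈ Icc 0 S := ⟨hα.le.trans hαβ, hβ.le⟩
  have hαI : α ∈ Icc 0 S := ⟨hα.le, hαβ.trans hβ.le⟩
  obtain ⟨j1, j2, hp⟩ := h.pairing_sub hc hα hαβ hβ
  have i0 : Integrable (fun p => ε * ‖W p‖ ^ 2) (cyl Ω α β) :=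
    ((h.memLp_W_cyl.mono_measure (cyl_le hα.le hβ.le)).norm.integrable_sq).const_mul ε
  have i3 : Integrable (fun p => -(ε * ‖W p‖ ^ 2)
      - fderiv ℝ (phase g) (pathOf u₀ W p) (Du p.1 p.2 (dtime ξ p.1 p.2))) (cyl Ω α β) :=
    i0.neg.sub j1
  have hgl := h.glEnergy_sub_le hα hαβ hβ.le
  rw [h.modEnergy_eq hβI (hc.measurable β hβI) (hc.norm_le β hβI),
    h.modEnergy_eq hαI (hc.measurable α hαI) (hc.norm_le α hαI),
    integral_add i3 j2, integral_sub i0.fun_neg j1, integral_neg]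
  linarith

end SolData

/-! ### The stress identity and the rotation identity -/

/-- Integrable with vanishing integral over `Ω`. -/
def ZeroInt (Ω : Set Plane) (w : Plane → ℝ) : Prop := IntegrableOn w Ω ∧ ∫ x in Ω, w x = 0

theorem ZeroInt.add {w w' : Plane → ℝ} (h : ZeroInt Ω w) (h' : ZeroInt Ω w') :
    ZeroInt Ω fun x => w x + w' x :=
  ⟨h.1.add h'.1, by rw [integral_add h.1 h'.1, h.2, h'.2, add_zero]⟩

theorem ZeroInt.const_mul {w : Plane → ℝ} (h : ZeroInt Ω w) (c : ℝ) :
    ZeroInt Ω fun x => c * w x :=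
  ⟨Integrable.const_mul h.1 c, by rw [integral_const_mul, h.2, mul_zero]⟩

theorem ZeroInt.sum {ι : Type*} [Fintype ι] {w : ι → Plane → ℝ}
    (h : ∀ i, ZeroInt Ω (w i)) : ZeroInt Ω fun x => ∑ i, w i x :=
  ⟨integrable_finsetSum _ fun i _ => (h i).1, by
    rw [integral_finsetSum _ fun i _ => (h i).1]
    exact Finset.sum_eq_zero fun i _ => (h i).2⟩

theorem ZeroInt.congr_ae {w w' : Plane → ℝ} (h : ZeroInt Ω w)
    (he : w =ᵐ[vol(Ω)] w') : ZeroInt Ω w' :=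
  ⟨Integrable.congr h.1 he, by rw [← integral_congr_ae he, h.2]⟩

theorem IsWeakDir.zeroInt (hΩ : IsOpen Ω) {e : Plane}
    {a a' b b' : Plane → ℝ} (ha : IsWeakDir Ω e a a') (hb : IsWeakDir Ω e b b') {χ : Plane → ℝ}
    (hχ : ContDiff ℝ ∞ χ) (hc : HasCompactSupport χ) (hs : tsupport χ ⊆ Ω) :
    ZeroInt Ω fun x => χ x * (a' x * b x + a x * b' x) + fderiv ℝ χ x e * (a x * b x) := by
  obtain ⟨C, hC⟩ := hc.exists_bound_of_continuous hχ.continuous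
  have hχc := continuous_fderiv_apply hχ e
  obtain ⟨C', hC'⟩ := (hc.fderiv_apply (𝕜 := ℝ) e).exists_bound_of_continuous hχc
  have i1 : IntegrableOn (fun x => χ x * (a' x * b x + a x * b' x)) Ω :=
    ((ha.memLp'.integrable_mul hb.memLp).add (ha.memLp.integrable_mul hb.memLp')).bdd_mul (c := C)
      hχ.continuous.aestronglyMeasurable (Eventually.of_forall hC)
  have i2 : IntegrableOn (fun x => fderiv ℝ χ x e * (a x * b x)) Ω :=
    (ha.memLp.integrable_mul hb.memLp).bdd_mul (c := C')
      hχc.aestronglyMeasurable (Eventually.of_forall hC')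
  exact ⟨i1.add i2, by rw [integral_add i1 i2, ha.integral_product hΩ hb hχ hc hs, neg_add_cancel]⟩

theorem IsWeakGrad.hess_symm (hΩ : IsOpen Ω) {v : Plane → Plane}
    {G : Plane → Plane →L[ℝ] Plane} {B : Plane → Plane →L[ℝ] Plane →L[ℝ] Plane}
    (hv : MemLp v 2 vol(Ω)) (hG : MemLp G 2 vol(Ω))
    (hB : MemLp B 2 vol(Ω)) (h1 : IsWeakGrad Ω v G) (h2 : IsWeakGrad Ω G B)
    (k : Fin 2) : ∀ᵐ x ∂vol(Ω),
      B x (stdVec 0) (stdVec 1) k = B x (stdVec 1) (stdVec 0) k := by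
  have mB : ∀ i j, MemLp (fun x => B x (stdVec i) (stdVec j) k) 2 vol(Ω) :=
    fun i j => memLp_coord (memLp_hess hB i j) k
  have key : ∀ i j, ∀ ζ : Plane → ℝ, ContDiff ℝ ∞ ζ → HasCompactSupport ζ → tsupport ζ ⊆ Ω →
      ∫ x in Ω, ζ x * B x (stdVec i) (stdVec j) k
        = ∫ x in Ω, fderiv ℝ (fun y => fderiv ℝ ζ y (stdVec i)) x (stdVec j) * v x k := by
    intro i j ζ hζ hc hs
    have e1 := (h2.isWeakDir hG hB (stdVec i) (entryL j k)).integral_eq ζ hζ hc hs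
    have hζ' : ContDiff ℝ ∞ fun y => fderiv ℝ ζ y (stdVec i) :=
      (hζ.fderiv_right (by simp)).clm_apply contDiff_const
    have e2 := (h1.isWeakDir hv hG (stdVec j) (EuclideanSpace.proj k)).integral_eq _ hζ'
      (hc.fderiv_apply (𝕜 := ℝ) (stdVec i)) ((tsupport_fderiv_apply_subset _).trans hs)
    simp only [entryL_apply] at e1
    have e3 := e2.trans (congrArg Neg.neg e1)
    rw [neg_neg] at e3
    exact e3.symm
  have hint : ∀ i j (ζ : Plane → ℝ), ContDiff ℝ ∞ ζ → HasCompactSupport ζ →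
      IntegrableOn (fun x => ζ x * B x (stdVec i) (stdVec j) k) Ω := fun i j ζ hζ hc =>
    ((hζ.continuous.memLp_of_hasCompactSupport (p := 2) hc).restrict Ω).integrable_mul (mB i j)
  have hli : LocallyIntegrableOn (fun x => B x (stdVec 0) (stdVec 1) k
      - B x (stdVec 1) (stdVec 0) k) Ω :=
    locallyIntegrableOn_of_locallyIntegrable_restrict
      (((mB 0 1).sub (mB 1 0)).locallyIntegrable (by norm_num))
  have := hΩ.ae_eq_zero_of_integral_contDiff_smul_eq_zero hli fun ζ hζ hc hs => by
    have e0 : ∀ x, ζ x • (B x (stdVec 0) (stdVec 1) k - B x (stdVec 1) (stdVec 0) k)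
        = Ω.indicator (fun x => ζ x * B x (stdVec 0) (stdVec 1) k
          - ζ x * B x (stdVec 1) (stdVec 0) k) x := fun x => by
      by_cases hx : x ∈ Ω
      · rw [indicator_of_mem hx, smul_eq_mul, mul_sub]
      · rw [indicator_of_notMem hx, image_eq_zero_of_notMem_tsupport fun h => hx (hs h), zero_smul]
    simp only [e0]
    rw [integral_indicator hΩ.measurableSet, integral_sub (hint 0 1 ζ hζ hc) (hint 1 0 ζ hζ hc),
      key 0 1 ζ hζ hc hs, key 1 0 ζ hζ hc hs, ← integral_sub]
    · have hsym : ∀ x, fderiv ℝ (fun y => fderiv ℝ ζ y (stdVec 0)) x (stdVec 1)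
          = fderiv ℝ (fun y => fderiv ℝ ζ y (stdVec 1)) x (stdVec 0) := fun x => by
        have hd : DifferentiableAt ℝ (fderiv ℝ ζ) x :=
          (hζ.fderiv_right (m := ∞) (by simp)).differentiable (by simp) x
        have hap : ∀ w, fderiv ℝ (fun y => fderiv ℝ ζ y w) x = (fderiv ℝ (fderiv ℝ ζ) x).flip w :=
          fun w => by
            rw [fderiv_clm_apply hd (differentiableAt_const w)]
            simp
        rw [hap, hap]
        exact (hζ.contDiffAt.isSymmSndFDerivAt (by simpa using ENat.LEInfty.out)) _ _
      simp [hsym]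
    all_goals
      refine MemLp.integrable_mul (p := 2) (q := 2) (MemLp.restrict Ω ?_) (memLp_coord hv k)
      refine (continuous_fderiv_apply ((hζ.fderiv_right (by simp)).clm_apply contDiff_const)
        _).memLp_of_hasCompactSupport ?_
      exact (hc.fderiv_apply (𝕜 := ℝ) _).fderiv_apply (𝕜 := ℝ) _
  rw [ae_restrict_iff' hΩ.measurableSet]
  filter_upwards [this] with x hx hxΩ
  exact sub_eq_zero.1 (hx hxΩ)

theorem smooth_coord {H : Plane → Plane} (hH : ContDiff ℝ ∞ H)
    (hc : HasCompactSupport H) (hs : tsupport H ⊆ Ω) (i : Fin 2) :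
    ContDiff ℝ ∞ (fun x => H x i) ∧ HasCompactSupport (fun x => H x i) ∧
      tsupport (fun x => H x i) ⊆ Ω ∧
      ∀ x w, fderiv ℝ (fun x => H x i) x w = fderiv ℝ H x w i := by
  have hsi : tsupport (fun x => H x i) ⊆ tsupport H := closure_mono fun x hx => by
    intro h0; exact hx (by simp [h0])
  refine ⟨(contDiff_euclidean.1 hH) i, hc.of_isClosed_subset (isClosed_tsupport _) hsi,
    hsi.trans hs, fun x w => ?_⟩
  have h1 := (hH.differentiable (by simp) x).hasFDerivAt
  have := ((EuclideanSpace.proj i : Plane →L[ℝ] ℝ).hasFDerivAt.comp x h1).fderiv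
  change fderiv ℝ (fun x => H x i) x = _ at this
  rw [this]; rfl

theorem zeroInt_stress (hΩ : IsOpen Ω) {v : Plane → Plane} (μ : ℝ)
    {G : Plane → Plane →L[ℝ] Plane} {B : Plane → Plane →L[ℝ] Plane →L[ℝ] Plane}
    (hv : MemLp v 2 vol(Ω)) (hG : MemLp G 2 vol(Ω))
    (hB : MemLp B 2 vol(Ω)) (h1 : IsWeakGrad Ω v G) (h2 : IsWeakGrad Ω G B)
    {H : Plane → Plane} (hH : ContDiff ℝ ∞ H) (hc : HasCompactSupport H) (hs : tsupport H ⊆ Ω) :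
    ZeroInt Ω fun x => stress μ (fderiv ℝ H x) (G x) 0 - inner ℝ (G x (H x)) (ellOf μ (B x)) := by
  have hw : ∀ m i k, IsWeakDir Ω (stdVec m) (fun x => G x (stdVec i) k)
      (fun x => B x (stdVec m) (stdVec i) k) := fun m i k =>
    h2.isWeakDir hG hB (stdVec m) (entryL i k)
  have T : ∀ i m j k j' k', ZeroInt Ω fun x => H x i * (B x (stdVec m) (stdVec j) k
      * G x (stdVec j') k' + G x (stdVec j) k * B x (stdVec m) (stdVec j') k')
      + fderiv ℝ H x (stdVec m) i * (G x (stdVec j) k * G x (stdVec j') k') := by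
    intro i m j k j' k'
    obtain ⟨a1, a2, a3, a4⟩ := smooth_coord hH hc hs i
    have := (hw m j k).zeroInt hΩ (hw m j' k') a1 a2 a3
    simp only [a4] at this
    exact this
  have Z1 := ZeroInt.sum fun i => ZeroInt.sum fun j => ZeroInt.sum fun k => T i j j k i k
  have Z2 := ZeroInt.sum fun j => ZeroInt.sum fun i => ZeroInt.sum fun k => T j j i k i k
  have Z3 := ZeroInt.sum fun j => ZeroInt.sum fun k => ZeroInt.sum fun l => T j k j k l l
  have Z4 := ZeroInt.sum fun j => ZeroInt.sum fun l => ZeroInt.sum fun l' => T j j l l l' l'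
  have Z := (((Z1.const_mul (-1)).add (Z2.const_mul (1 / 2))).add (Z3.const_mul (-μ))).add
    (Z4.const_mul (μ / 2))
  refine Z.congr_ae ?_
  filter_upwards [h1.hess_symm hΩ hv hG hB h2 0, h1.hess_symm hΩ hv hG hB h2 1] with x s0 s1
  have eH : ∀ w : Plane, G x w = w 0 • G x (stdVec 0) + w 1 • G x (stdVec 1) := fun w => by
    conv_lhs => rw [plane_expand w]
    simp
  rw [real_inner_comm, inner_ellOf, stress]
  simp only [divOf, frobSq, Fin.sum_univ_two, ContinuousLinearMap.comp_apply]
  rw [eH (H x), eH (fderiv ℝ H x (stdVec 0)), eH (fderiv ℝ H x (stdVec 1))]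
  simp only [plane_inner, plane_norm_sq, PiLp.add_apply, PiLp.smul_apply, smul_eq_mul, s0, s1]
  ring

theorem zeroInt_rotation (hΩ : IsOpen Ω) {v : Plane → Plane} (μ : ℝ)
    {G : Plane → Plane →L[ℝ] Plane} {B : Plane → Plane →L[ℝ] Plane →L[ℝ] Plane}
    (hv : MemLp v 2 vol(Ω)) (hG : MemLp G 2 vol(Ω))
    (hB : MemLp B 2 vol(Ω)) (h1 : IsWeakGrad Ω v G) (h2 : IsWeakGrad Ω G B)
    {a : Plane → ℝ} (ha : ContDiff ℝ ∞ a) (hc : HasCompactSupport a) (hs : tsupport a ⊆ Ω) :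
    ZeroInt Ω fun x => a x * inner ℝ (ellOf μ (B x)) (perp (v x))
      + ∑ j, fderiv ℝ a x (stdVec j) * inner ℝ (perp (v x)) (G x (stdVec j))
      + μ * divOf (G x) * (fderiv ℝ a x (perp (v x)) + a x * divOf (perpL.comp (G x))) := by
  have hw : ∀ m i k, IsWeakDir Ω (stdVec m) (fun x => G x (stdVec i) k)
      (fun x => B x (stdVec m) (stdVec i) k) := fun m i k =>
    h2.isWeakDir hG hB (stdVec m) (entryL i k)
  have hw0 : ∀ m l, IsWeakDir Ω (stdVec m) (fun x => v x l) (fun x => G x (stdVec m) l) :=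
    fun m l => h1.isWeakDir hv hG (stdVec m) (EuclideanSpace.proj l)
  have T : ∀ m i k l, ZeroInt Ω fun x => a x * (B x (stdVec m) (stdVec i) k * v x l
      + G x (stdVec i) k * G x (stdVec m) l)
      + fderiv ℝ a x (stdVec m) * (G x (stdVec i) k * v x l) := fun m i k l =>
    (hw m i k).zeroInt hΩ (hw0 m l) ha hc hs
  have Z1 := ZeroInt.sum fun j => T j j 1 0
  have Z2 := ZeroInt.sum fun j => T j j 0 1
  have Z3 := ZeroInt.sum fun l => T 1 l l 0
  have Z4 := ZeroInt.sum fun l => T 0 l l 1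
  have Z := ((Z1.add (Z2.const_mul (-1))).add (Z3.const_mul μ)).add (Z4.const_mul (-μ))
  refine Z.congr_ae (.of_forall fun x => ?_)
  have ea : fderiv ℝ a x (perp (v x)) = -v x 1 * fderiv ℝ a x (stdVec 0)
      + v x 0 * fderiv ℝ a x (stdVec 1) := by
    conv_lhs => rw [plane_expand (perp (v x))]
    simp
  beta_reduce
  rw [inner_ellOf]
  simp only [divOf, Fin.sum_univ_two, ContinuousLinearMap.comp_apply, perpL_apply, ea,
    plane_inner, perp_zero_apply, perp_one_apply]
  ring

/-! ### Continuity in time and a priori bounds -/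

theorem le_of_antitone_interior {S : ℝ} {Φ : ℝ → ℝ} (hΦ : ContinuousOn Φ (Icc 0 S))
    (h : ∀ α β, 0 < α → α ≤ β → β < S → Φ β ≤ Φ α) {α β : ℝ} (hα : 0 ≤ α) (hαβ : α ≤ β)
    (hβ : β ≤ S) : Φ β ≤ Φ α := by
  have h1 : ∀ β, 0 < β → β < S → ∀ α ∈ Icc 0 β, Φ β ≤ Φ α := fun β hβ hβS α hα => by
    have hcl : α ∈ closure (Ioo 0 β) := by rwa [closure_Ioo hβ.ne]
    have hss : Ioo 0 β ⊆ Icc 0 S := fun x hx => ⟨hx.1.le, hx.2.le.trans hβS.le⟩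
    exact ContinuousWithinAt.closure_le hcl continuousWithinAt_const
      ((hΦ α ⟨hα.1, hα.2.trans hβS.le⟩).mono hss) fun y hy => h y β hy.1 hy.2.le hβS
  rcases eq_or_lt_of_le (hαβ.trans hβ) with h2 | h2
  · have : α = β := le_antisymm hαβ (h2 ▸ hβ)
    rw [this]
  · have hcl : β ∈ closure (Ioo α S) := by rw [closure_Ioo h2.ne]; exact ⟨hαβ, hβ⟩
    have hss : Ioo α S ⊆ Icc 0 S := fun x hx => ⟨hα.trans hx.1.le, hx.2.le⟩
    exact ContinuousWithinAt.closure_le hcl ((hΦ β ⟨hα.trans hαβ, hβ⟩).mono hss)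
      continuousWithinAt_const fun y hy => h1 y (hα.trans_lt hy.1) hy.2 α ⟨hα, hy.1.le⟩

theorem sub_le_integral_of_interior {S : ℝ} {E w : ℝ → ℝ} (hE : ContinuousOn E (Icc 0 S))
    (hw : IntegrableOn w (Ioo 0 S))
    (h : ∀ α β, 0 < α → α ≤ β → β < S → E β - E α ≤ ∫ t in α..β, w t) {α β : ℝ} (hα : 0 ≤ α)
    (hαβ : α ≤ β) (hβ : β ≤ S) : E β - E α ≤ ∫ t in α..β, w t := by
  have hS : 0 ≤ S := hα.trans (hαβ.trans hβ)
  have hwi : IntervalIntegrable w volume 0 S := by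
    rw [intervalIntegrable_iff_integrableOn_Ioo_of_le hS]; exact hw
  have hsub : ∀ a b, 0 ≤ a → a ≤ b → b ≤ S → IntervalIntegrable w volume a b :=
    fun a b ha hab hb => hwi.mono_set (by
      rw [uIcc_of_le hab, uIcc_of_le hS]; exact Icc_subset_Icc ha hb)
  have hsplit : ∀ a b, 0 ≤ a → a ≤ b → b ≤ S →
      (∫ t in (0 : ℝ)..b, w t) - ∫ t in (0 : ℝ)..a, w t = ∫ t in a..b, w t := fun a b ha hab hb => by
    rw [intervalIntegral.integral_interval_sub_left (hsub 0 b le_rfl (ha.trans hab) hb)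
      (hsub 0 a le_rfl ha (hab.trans hb))]
  have hc : ContinuousOn (fun t => ∫ s in (0 : ℝ)..t, w s) (Icc 0 S) := by
    have := intervalIntegral.continuousOn_primitive_interval' hwi left_mem_uIcc
    rwa [uIcc_of_le hS] at this
  have := le_of_antitone_interior (Φ := fun t => E t - ∫ s in (0 : ℝ)..t, w s) (hE.sub hc)
    (fun a b ha hab hb => by
      have h1 := h a b ha hab hb
      rw [← hsplit a b ha.le hab hb.le] at h1
      show E b - _ ≤ E a - _
      linarith) hα hαβ hβ
  rw [← hsplit α β hα hαβ hβ]
  linarith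

theorem sq_integral_le {w : ℝ → ℝ} (ht : 0 ≤ t) (hw : IntegrableOn w (Ioo 0 t))
    (hw2 : IntegrableOn (fun s => w s ^ 2) (Ioo 0 t)) :
    (∫ s in Ioo 0 t, w s) ^ 2 ≤ t * ∫ s in Ioo 0 t, w s ^ 2 := by
  rcases eq_or_lt_of_le ht with h0 | h0
  · simp [← h0]
  obtain ⟨m, hm⟩ : ∃ m, m = ∫ s in Ioo 0 t, w s := ⟨_, rfl⟩
  have h1 : 0 ≤ ∫ s in Ioo 0 t, (w s - m / t) ^ 2 := integral_nonneg fun s => sq_nonneg _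
  have hfin : IsFiniteMeasure (volume.restrict (Ioo 0 t)) :=
    ⟨by simp⟩
  have i1 : IntegrableOn (fun s => w s ^ 2 - 2 * (m / t) * w s) (Ioo 0 t) :=
    hw2.sub (hw.const_mul _)
  have e1 : ∫ s in Ioo 0 t, (w s - m / t) ^ 2
      = (∫ s in Ioo 0 t, w s ^ 2) - 2 * (m / t) * m + (m / t) ^ 2 * t := by
    have : ∀ s, (w s - m / t) ^ 2 = w s ^ 2 - 2 * (m / t) * w s + (m / t) ^ 2 := fun s => by ring
    simp only [this]
    rw [integral_add i1 (integrable_const _), integral_sub hw2 (hw.const_mul _), integral_const_mul,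
      ← hm, integral_const]
    simp [measureReal_def, ht, mul_comm]
  rw [e1] at h1
  rw [← hm]
  have e2 : t * ((∫ s in Ioo 0 t, w s ^ 2) - 2 * (m / t) * m + (m / t) ^ 2 * t)
      = t * (∫ s in Ioo 0 t, w s ^ 2) - m ^ 2 := by field_simp; ring
  have := mul_nonneg ht h1
  rw [e2] at this
  linarith

theorem integral_cyl [IsFiniteMeasure vol(Ω)] {E : Type*}
    [NormedAddCommGroup E] [NormedSpace ℝ E] {S : ℝ}
    {F : ℝ × Plane → E} (hF : Integrable F (cylinderMeasure Ω S)) {α β : ℝ} (hα : 0 ≤ α) (hαβ : α ≤ β)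
    (hβ : β ≤ S) : ∫ p, F p ∂(cyl Ω α β) = ∫ t in α..β, ∫ x in Ω, F (t, x) := by
  have hi := hF.mono_measure (cyl_le (Ω := Ω) hα hβ)
  unfold cyl at hi ⊢
  rw [integral_prod _ hi, intervalIntegral.integral_of_le hαβ, integral_Ioc_eq_integral_Ioo]

namespace SolData

theorem continuousOn_glEnergy (h : SolData Ω S μ ε f g u u₀ W Du D2) :
    ContinuousOn (fun t => glEnergy Ω μ ε f (u t)) (Icc 0 S) := by
  have h1 : ContinuousOn (fun t => dirichlet Ω μ (u t)) (Icc 0 S) :=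
    continuousOn_dirichlet μ (fun t ht => (h.memH10 t ht).memH1.memLp_grad) h.continuous_grad
  obtain ⟨M, hM, hle⟩ := h.exists_dominant_F
  have h2 : ContinuousOn (fun t => ∫ x in Ω, potential f (pathOf u₀ W (t, x))) (Icc 0 S) := by
    intro t₀ ht₀
    refine tendsto_integral_filter_of_dominated_convergence M ?_ ?_ hM ?_
    · exact Eventually.of_forall fun t => (h.pot.contDiff_potential.continuous.comp_stronglyMeasurable
        (h.meas_path_section t)).aestronglyMeasurable
    · filter_upwards [eventually_mem_nhdsWithin] with t ht
      filter_upwards [hle] with x hx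
      rw [Real.norm_of_nonneg (h.pot.potential_nonneg _)]
      exact hx t ht
    · exact Eventually.of_forall fun x => ((h.pot.contDiff_potential.continuous.comp
        (continuous_pathOf h.integrable_W x)).tendsto t₀).mono_left nhdsWithin_le_nhds
  refine ((h1.const_smul ε).add (h2.const_smul ε⁻¹)).congr fun t ht => ?_
  exact h.glEnergy_eq ht

theorem continuousOn_pairing (h : SolData Ω S μ ε f g u u₀ W Du D2)
    (hm : ∀ t ∈ Icc 0 S, Measurable (ξ t)) (hle : ∀ t ∈ Icc 0 S, ∀ x, ‖ξ t x‖ ≤ 1)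
    (hc : ∀ x, ContinuousOn (fun t => ξ t x) (Icc 0 S)) :
    ContinuousOn (fun t => pairing Ω g (ξ t) (u t)) (Icc 0 S) := by
  obtain ⟨M, hM, hMle⟩ := h.exists_dominant_F
  have hB : MemLp (fun x => √(2 * |M x|)) 2 vol(Ω) := by
    have hmM : AEStronglyMeasurable (fun x => √(2 * |M x|)) vol(Ω) :=
      Real.continuous_sqrt.comp_aestronglyMeasurable (hM.norm.1.const_mul 2)
    rw [memLp_two_iff_integrable_sq hmM]
    refine (hM.norm.const_mul 2).congr (.of_forall fun x => ?_)
    simp only [Real.norm_eq_abs]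
    rw [Real.sq_sqrt (by positivity)]
  have hA : ∀ i k : Fin 2, ∀ t ∈ Icc 0 S, AEStronglyMeasurable (fun x =>
      fderiv ℝ (phase g) (pathOf u₀ W (t, x)) (stdVec k) * ξ t x i) vol(Ω) := by
    intro i k t ht
    have a1 := ((h.pot.contDiff_phase.continuous_fderiv (by simp)).comp_stronglyMeasurable
      (h.meas_path_section t)).aestronglyMeasurable (μ := vol(Ω))
    exact ((ContinuousLinearMap.apply ℝ ℝ (stdVec k)).continuous.comp_aestronglyMeasurable a1).mul
      ((EuclideanSpace.proj i : Plane →L[ℝ] ℝ).continuous.comp_aestronglyMeasurable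
        (hm t ht).aestronglyMeasurable)
  have hbd : ∀ i k : Fin 2, ∀ t ∈ Icc 0 S, ∀ᵐ x ∂vol(Ω),
      ‖fderiv ℝ (phase g) (pathOf u₀ W (t, x)) (stdVec k) * ξ t x i‖ ≤ √(2 * |M x|) := by
    intro i k t ht
    filter_upwards [hMle] with x hx
    have b1 := hx t ht
    rw [h.pot.potential_eq] at b1
    have b2 : g ‖pathOf u₀ W (t, x)‖ ≤ √(2 * |M x|) :=
      Real.le_sqrt_of_sq_le (by linarith [le_abs_self (M x)])
    have b3 := ((fderiv ℝ (phase g) (pathOf u₀ W (t, x))).le_opNorm (stdVec k)).trans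
      (mul_le_mul_of_nonneg_right (h.pot.norm_fderiv_phase_le _) (norm_nonneg _))
    rw [norm_stdVec, mul_one] at b3
    have b4 : ‖ξ t x i‖ ≤ 1 := (PiLp.norm_apply_le (ξ t x) i).trans (hle t ht x)
    rw [norm_mul]
    exact (mul_le_of_le_one_right (norm_nonneg _) b4).trans (b3.trans b2)
  have hfm : ∀ i k : Fin 2, ∀ t ∈ Icc 0 S, MemLp (fun x =>
      fderiv ℝ (phase g) (pathOf u₀ W (t, x)) (stdVec k) * ξ t x i) 2 vol(Ω) :=
    fun i k t ht => hB.mono (hA i k t ht) (by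
      filter_upwards [hbd i k t ht] with x hx
      rw [Real.norm_of_nonneg (Real.sqrt_nonneg _)]; exact hx)
  have hgm : ∀ i k : Fin 2, ∀ t ∈ Icc 0 S, MemLp (fun x => weakGrad Ω (u t) x (stdVec i) k) 2
      vol(Ω) := fun i k t ht => memLp_entry (h.memH10 t ht).memH1.memLp_grad i k
  have hcont : ∀ i k : Fin 2, ContinuousOn (fun t => ∫ x in Ω,
      (fderiv ℝ (phase g) (pathOf u₀ W (t, x)) (stdVec k) * ξ t x i)
        * weakGrad Ω (u t) x (stdVec i) k) (Icc 0 S) := by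
    intro i k t₀ ht₀
    refine tendsto_integral_mul_of_eLpNorm (eventually_mem_nhdsWithin.mono (hfm i k))
      (eventually_mem_nhdsWithin.mono (hgm i k)) (hfm i k t₀ ht₀) (hgm i k t₀ ht₀) ?_
      (tendsto_eLpNorm_clm_comp (entryL i k) (h.continuous_grad t₀ ht₀))
    refine tendsto_eLpNorm_two_of_dominated hB (eventually_mem_nhdsWithin.mono (hA i k))
      (hA i k t₀ ht₀) (eventually_mem_nhdsWithin.mono (hbd i k)) (hbd i k t₀ ht₀)
      (.of_forall fun x => ?_)
    have c1 : Continuous fun t => fderiv ℝ (phase g) (pathOf u₀ W (t, x)) (stdVec k) :=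
      ((h.pot.contDiff_phase.continuous_fderiv (by simp)).comp
        (continuous_pathOf h.integrable_W x)).clm_apply continuous_const
    have c2 := (EuclideanSpace.proj i : Plane →L[ℝ] ℝ).continuous.continuousAt.comp_continuousWithinAt
      (hc x t₀ ht₀)
    exact (c1.continuousAt.continuousWithinAt.mul c2)
  have hsum : ContinuousOn (fun t => ∑ i, ∑ k, ∫ x in Ω,
      (fderiv ℝ (phase g) (pathOf u₀ W (t, x)) (stdVec k) * ξ t x i)
        * weakGrad Ω (u t) x (stdVec i) k) (Icc 0 S) :=
    continuousOn_finsetSum _ fun i _ => continuousOn_finsetSum _ fun k _ => hcont i k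
  refine hsum.congr fun t ht => ?_
  have ii : ∀ i k, Integrable (fun x => (fderiv ℝ (phase g) (pathOf u₀ W (t, x)) (stdVec k) * ξ t x i)
        * weakGrad Ω (u t) x (stdVec i) k) vol(Ω) := fun i k =>
    (hfm i k t ht).integrable_mul (hgm i k t ht)
  show pairing Ω g (ξ t) (u t) = _
  simp only [← integral_finsetSum _ fun k _ => ii _ k]
  rw [← integral_finsetSum _ fun i _ => integrable_finsetSum _ fun k _ => ii i k,
    h.pairing_eq_grad ht]
  congr 1
  funext x
  obtain ⟨q, hq⟩ : ∃ q, q = weakGrad Ω (u t) x := ⟨_, rfl⟩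
  rw [← hq]
  have e1 : q (ξ t x) = ξ t x 0 • q (stdVec 0) + ξ t x 1 • q (stdVec 1) := by
    conv_lhs => rw [plane_expand (ξ t x)]
    simp
  rw [e1, map_add, map_smul, map_smul]
  conv_lhs => rw [plane_expand (q (stdVec 0)), plane_expand (q (stdVec 1))]
  simp only [map_add, map_smul, smul_eq_mul, Fin.sum_univ_two]
  ring

theorem continuousOn_modEnergy (h : SolData Ω S μ ε f g u u₀ W Du D2)
    (hc : IsCalibration Ω S μ K C R ξ H a) :
    ContinuousOn (fun t => modEnergy Ω μ ε f g (ξ t) (u t)) (Icc 0 S) :=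
  (h.continuousOn_glEnergy.sub (h.continuousOn_pairing hc.measurable hc.norm_le
    hc.continuous_time)).congr fun t ht => h.modEnergy_eq ht (hc.measurable t ht) (hc.norm_le t ht)

theorem integrable_W_sq (h : SolData Ω S μ ε f g u u₀ W Du D2) :
    Integrable (fun p => ‖W p‖ ^ 2) (cylinderMeasure Ω S) := h.memLp_W_cyl.norm.integrable_sq

theorem glEnergy_add_le (h : SolData Ω S μ ε f g u u₀ W Du D2) (ht : t ∈ Icc 0 S) :
    glEnergy Ω μ ε f (u t) + ε * ∫ p, ‖W p‖ ^ 2 ∂(cyl Ω 0 t) ≤ glEnergy Ω μ ε f (u 0) := by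
  have := h.finite
  have hi : IntegrableOn (fun t => ∫ x in Ω, ‖W (t, x)‖ ^ 2) (Ioo 0 S) :=
    h.integrable_W_sq.integral_prod_left
  have key := sub_le_integral_of_interior h.continuousOn_glEnergy (hi.const_mul (-ε))
    (fun α β hα hαβ hβ => by
      have h1 := h.glEnergy_sub_le hα hαβ hβ.le
      rw [integral_const_mul, integral_cyl h.integrable_W_sq hα.le hαβ hβ.le] at h1
      rw [intervalIntegral.integral_const_mul]
      linarith) le_rfl ht.1 ht.2
  rw [intervalIntegral.integral_const_mul, ← integral_cyl h.integrable_W_sq le_rfl ht.1 ht.2] at key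
  linarith

theorem glEnergy_nonneg (h : SolData Ω S μ ε f g u u₀ W Du D2) (ht : t ∈ Icc 0 S) :
    ε⁻¹ * ∫ x in Ω, potential f (pathOf u₀ W (t, x)) ≤ glEnergy Ω μ ε f (u t) := by
  have hε := h.ε_pos
  have hμ := h.μ_pos
  rw [h.glEnergy_eq ht]
  have : 0 ≤ dirichlet Ω μ (u t) := integral_nonneg fun x => by
    have := frobSq_nonneg (weakGrad Ω (u t) x)
    positivity
  have := mul_nonneg hε.le this
  linarith

theorem integrable_path_sq (h : SolData Ω S μ ε f g u u₀ W Du D2) (ht : t ∈ Icc 0 S) :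
    IntegrableOn (fun x => ‖pathOf u₀ W (t, x)‖ ^ 2) Ω := by
  refine Integrable.congr (h.memH10 t ht).memH1.memLp.norm.integrable_sq ?_
  filter_upwards [h.rep t ht] with x hx
  rw [hx]

/-- The mass of the solution in a fixed ball is bounded uniformly in `ε`. -/
theorem mass_le (h : SolData Ω S μ ε f g u u₀ W Du D2) {c₁ c T : ℝ} (hc : 0 ≤ c)
    (hg : ∀ v : Plane, ‖v‖ ^ 2 ≤ 4 + c * potential f v) (hST : S ≤ T)
    (he : glEnergy Ω μ ε f (u 0) ≤ c₁) (ht : t ∈ Icc 0 S) (R : ℝ) :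
    ∫ x in Ω, (closedBall (0 : Plane) R).indicator 1 x * ‖pathOf u₀ W (t, x)‖ ^ 2
      ≤ 4 * volume.real (closedBall (0 : Plane) R) + (c + 2 * T) * c₁ := by
  have := h.finite
  have hε := h.ε_pos
  have hms : MeasurableSet (closedBall (0 : Plane) R) := measurableSet_closedBall
  have hsol := h.glEnergy_add_le ht
  have hW0 : 0 ≤ ∫ p, ‖W p‖ ^ 2 ∂(cyl Ω 0 t) := integral_nonneg fun p => sq_nonneg _
  have hF0 : 0 ≤ ∫ x in Ω, potential f (pathOf u₀ W (t, x)) :=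
    integral_nonneg fun x => h.pot.potential_nonneg _
  have hFle := h.glEnergy_nonneg ht
  have hFp : 0 ≤ ε⁻¹ * ∫ x in Ω, potential f (pathOf u₀ W (t, x)) := by positivity
  have hWp : 0 ≤ ε * ∫ p, ‖W p‖ ^ 2 ∂(cyl Ω 0 t) := by positivity
  have hc₁ : 0 ≤ c₁ := by linarith
  have hT : 0 ≤ T := h.S_pos.le.trans hST
  have h1 : ∀ x, (0 : ℝ) ≤ (closedBall (0 : Plane) R).indicator 1 x := fun x =>
    indicator_nonneg (fun _ _ => zero_le_one) x
  have h1' : ∀ x, (closedBall (0 : Plane) R).indicator (1 : Plane → ℝ) x ≤ 1 := fun x =>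
    indicator_le_self' (fun _ _ => zero_le_one) x
  have i1 : Integrable (fun x => (closedBall (0 : Plane) R).indicator (1 : Plane → ℝ) x)
      vol(Ω) := (integrable_const (1 : ℝ)).indicator hms
  have e1 : ∫ x in Ω, (closedBall (0 : Plane) R).indicator (1 : Plane → ℝ) x
      ≤ volume.real (closedBall (0 : Plane) R) := by
    rw [integral_indicator_one hms]
    exact ENNReal.toReal_mono measure_closedBall_lt_top.ne (Measure.restrict_le_self _)
  have i0 : Integrable (fun x => (closedBall (0 : Plane) R).indicator 1 x * ‖pathOf u₀ W (t, x)‖ ^ 2)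
      vol(Ω) :=
    (h.integrable_path_sq ht).bdd_mul (c := 1) i1.1 (.of_forall fun x => by
      rw [Real.norm_of_nonneg (h1 x)]; exact h1' x)
  rcases le_total ε 1 with hε1 | hε1
  · have iF := h.integrableOn_potential ht
    have h2 : ∫ x in Ω, (closedBall (0 : Plane) R).indicator 1 x * ‖pathOf u₀ W (t, x)‖ ^ 2
        ≤ ∫ x in Ω, (4 * (closedBall (0 : Plane) R).indicator 1 x
          + c * potential f (pathOf u₀ W (t, x))) := by
      refine integral_mono i0 ((i1.const_mul 4).add (iF.const_mul c)) fun x => ?_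
      have h3 := mul_le_mul_of_nonneg_left (hg (pathOf u₀ W (t, x))) (h1 x)
      have h4 := mul_le_of_le_one_left (mul_nonneg hc (h.pot.potential_nonneg (pathOf u₀ W (t, x)))) (h1' x)
      show _ * _ ≤ _ + _
      linarith
    rw [integral_add (i1.const_mul 4) (iF.const_mul c), integral_const_mul, integral_const_mul] at h2
    have h5 : ∫ x in Ω, potential f (pathOf u₀ W (t, x)) ≤ c₁ := by
      have h6 : ε⁻¹ * ∫ x in Ω, potential f (pathOf u₀ W (t, x)) ≤ c₁ := by linarith
      have h7 := mul_le_mul_of_nonneg_left h6 hε.le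
      rw [← mul_assoc, mul_inv_cancel₀ hε.ne', one_mul] at h7
      exact h7.trans (mul_le_of_le_one_left hc₁ hε1)
    have h8 := mul_le_mul_of_nonneg_left h5 hc
    have h9 : 0 ≤ 2 * T * c₁ := by positivity
    linarith
  · have hWi := h.integrable_W_sq.mono_measure (cyl_le (Ω := Ω) le_rfl ht.2)
    have hWx : ∀ᵐ x ∂vol(Ω), IntegrableOn (fun s => ‖W (s, x)‖ ^ 2) (Ioo 0 t) :=
      Integrable.prod_left_ae hWi
    have iI : Integrable (fun x => ∫ s in Ioo 0 t, ‖W (s, x)‖ ^ 2) vol(Ω) :=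
      Integrable.integral_prod_right hWi
    have h2 : ∫ x in Ω, (closedBall (0 : Plane) R).indicator 1 x * ‖pathOf u₀ W (t, x)‖ ^ 2
        ≤ ∫ x in Ω, (2 * (closedBall (0 : Plane) R).indicator 1 x
          + 2 * t * ∫ s in Ioo 0 t, ‖W (s, x)‖ ^ 2) := by
      refine integral_mono_ae i0 ((i1.const_mul 2).add (iI.const_mul (2 * t))) ?_
      filter_upwards [hWx, h.init_le] with x hx hx0
      have h3 : ‖pathOf u₀ W (t, x)‖ ≤ 1 + ∫ s in Ioo 0 t, ‖W (s, x)‖ := by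
        rw [pathOf, intervalIntegral.integral_of_le ht.1, integral_Ioc_eq_integral_Ioo]
        exact (norm_add_le _ _).trans (add_le_add hx0 (norm_integral_le_integral_norm _))
      have h4 := sq_integral_le ht.1 (h.integrable_W x).norm.integrableOn hx
      have h5 : ‖pathOf u₀ W (t, x)‖ ^ 2 ≤ 2 + 2 * t * ∫ s in Ioo 0 t, ‖W (s, x)‖ ^ 2 := by
        have h6 := pow_le_pow_left₀ (norm_nonneg _) h3 2
        have h7 := add_sq_le_two 1 (∫ s in Ioo 0 t, ‖W (s, x)‖)
        linarith
      have h8 : 0 ≤ 2 * t * ∫ s in Ioo 0 t, ‖W (s, x)‖ ^ 2 :=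
        mul_nonneg (by linarith [ht.1]) (integral_nonneg fun s => sq_nonneg _)
      have h9 := mul_le_mul_of_nonneg_left h5 (h1 x)
      have h10 := mul_le_of_le_one_left h8 (h1' x)
      show _ * _ ≤ _ + _
      linarith
    rw [integral_add (i1.const_mul 2) (iI.const_mul _), integral_const_mul, integral_const_mul] at h2
    have e2 : ∫ x in Ω, ∫ s in Ioo 0 t, ‖W (s, x)‖ ^ 2 = ∫ p, ‖W p‖ ^ 2 ∂(cyl Ω 0 t) :=
      (integral_prod_symm _ hWi).symm
    rw [e2] at h2
    have h5 : ∫ p, ‖W p‖ ^ 2 ∂(cyl Ω 0 t) ≤ c₁ := by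
      have : ε * ∫ p, ‖W p‖ ^ 2 ∂(cyl Ω 0 t) ≤ c₁ := by linarith
      exact (le_mul_of_one_le_left hW0 hε1).trans this
    have h6 : 2 * t * ∫ p, ‖W p‖ ^ 2 ∂(cyl Ω 0 t) ≤ 2 * T * c₁ := by
      have := ht.1
      have := ht.2
      gcongr
      linarith
    have h7 : 0 ≤ volume.real (closedBall (0 : Plane) R) := measureReal_nonneg
    have h8 : 0 ≤ c * c₁ := by positivity
    linarith

end SolData

/-! ### The differential inequality for the modulated energy -/

theorem gronwall_dissipation {S C k : ℝ} {E D : ℝ → ℝ} (hS : 0 < S) (hC : 0 ≤ C) (hk : 0 ≤ k)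
    (hE : ContinuousOn E (Icc 0 S)) (hE0 : ∀ t ∈ Icc 0 S, 0 ≤ E t) (hD : IntegrableOn D (Ioo 0 S))
    (hD0 : ∀ t, 0 ≤ D t)
    (h : ∀ α β, 0 < α → α ≤ β → β < S → E β - E α ≤ ∫ t in α..β, (C * E t + k - D t)) :
    (∀ t ∈ Icc 0 S, E t ≤ (E 0 + k * S) * Real.exp (C * S)) ∧
      ∫ t in Ioo 0 S, D t ≤ (E 0 + k * S) * Real.exp (C * S) := by
  have iE : IntegrableOn E (Ioo 0 S) := (hE.integrableOn_Icc).mono_set Ioo_subset_Icc_self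
  have iEi : IntervalIntegrable E volume 0 S := by
    rw [intervalIntegrable_iff_integrableOn_Ioo_of_le hS.le]; exact iE
  have iDi : IntervalIntegrable D volume 0 S := by
    rw [intervalIntegrable_iff_integrableOn_Ioo_of_le hS.le]; exact hD
  have hfin : IsFiniteMeasure (volume.restrict (Ioo 0 S)) := ⟨by simp⟩
  have hsub : ∀ {F : ℝ → ℝ}, IntervalIntegrable F volume 0 S → ∀ t ∈ Icc 0 S,
      IntervalIntegrable F volume 0 t := fun hF t ht => hF.mono_set (by
    rw [uIcc_of_le ht.1, uIcc_of_le hS.le]; exact Icc_subset_Icc_right ht.2)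
  have iw : IntegrableOn (fun t => C * E t + k - D t) (Ioo 0 S) :=
    ((iE.const_mul C).add (integrable_const k)).sub hD
  have key : ∀ t ∈ Icc 0 S, E t + ∫ s in (0 : ℝ)..t, D s
      ≤ E 0 + k * t + C * ∫ s in (0 : ℝ)..t, E s := fun t ht => by
    have h1 := sub_le_integral_of_interior hE iw h le_rfl ht.1 ht.2
    have j1 := (hsub iEi t ht).const_mul C
    have j2 : IntervalIntegrable (fun s => C * E s + k) volume 0 t :=
      j1.add intervalIntegrable_const
    rw [intervalIntegral.integral_sub j2 (hsub iDi t ht),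
      intervalIntegral.integral_add j1 intervalIntegrable_const, intervalIntegral.integral_const_mul,
      intervalIntegral.integral_const, smul_eq_mul] at h1
    linarith
  have hDn : ∀ t ∈ Icc 0 S, 0 ≤ ∫ s in (0 : ℝ)..t, D s := fun t ht =>
    intervalIntegral.integral_nonneg ht.1 fun s _ => hD0 s
  obtain ⟨A, hA⟩ : ∃ A, A = E 0 + k * S := ⟨_, rfl⟩
  have hIc : ContinuousOn (fun t => ∫ s in (0 : ℝ)..t, E s) (Icc 0 S) := by
    have := intervalIntegral.continuousOn_primitive_interval' iEi left_mem_uIcc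
    rwa [uIcc_of_le hS.le] at this
  have hder : ∀ t ∈ Ioo 0 S, HasDerivAt (fun t => Real.exp (-(C * t)) * (A + C * ∫ s in (0 : ℝ)..t, E s))
      (Real.exp (-(C * t)) * (C * (E t - (A + C * ∫ s in (0 : ℝ)..t, E s)))) t := fun t ht => by
    have h1 : HasDerivAt (fun t => ∫ s in (0 : ℝ)..t, E s) (E t) t := by
      refine intervalIntegral.integral_hasDerivAt_right (hsub iEi t (Ioo_subset_Icc_self ht)) ?_
        (hE.continuousAt (Icc_mem_nhds ht.1 ht.2))
      exact (hE.mono Ioo_subset_Icc_self).stronglyMeasurableAtFilter isOpen_Ioo t ht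
    have h2 : HasDerivAt (fun t => Real.exp (-(C * t))) (Real.exp (-(C * t)) * (-(C * 1))) t :=
      (((hasDerivAt_id t).const_mul C).neg).exp
    refine (h2.mul ((h1.const_mul C).const_add A)).congr_deriv ?_
    ring
  have hanti : AntitoneOn (fun t => Real.exp (-(C * t)) * (A + C * ∫ s in (0 : ℝ)..t, E s)) (Icc 0 S) := by
    refine antitoneOn_of_deriv_nonpos (convex_Icc 0 S) ?_ ?_ ?_
    · exact ContinuousOn.mul (by fun_prop) (continuousOn_const.add (hIc.const_smul C))
    · rw [interior_Icc]
      exact fun t ht => (hder t ht).differentiableAt.differentiableWithinAt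
    · rw [interior_Icc]
      intro t ht
      rw [(hder t ht).deriv]
      have h1 := key t (Ioo_subset_Icc_self ht)
      have h2 := hDn t (Ioo_subset_Icc_self ht)
      have h3 : k * t ≤ k * S := mul_le_mul_of_nonneg_left ht.2.le hk
      exact mul_nonpos_of_nonneg_of_nonpos (Real.exp_nonneg _)
        (mul_nonpos_of_nonneg_of_nonpos hC (by linarith))
  have hA0 : 0 ≤ A := by
    have := hE0 0 ⟨le_rfl, hS.le⟩
    rw [hA]; positivity
  have hbd : ∀ t ∈ Icc 0 S, A + C * ∫ s in (0 : ℝ)..t, E s ≤ A * Real.exp (C * S) := fun t ht => by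
    have h1 := hanti ⟨le_rfl, hS.le⟩ ht ht.1
    simp only [mul_zero, neg_zero, Real.exp_zero, intervalIntegral.integral_same, add_zero,
      one_mul] at h1
    have h2 := mul_le_mul_of_nonneg_left h1 (Real.exp_nonneg (C * t))
    rw [← mul_assoc, ← Real.exp_add, add_neg_cancel, Real.exp_zero, one_mul] at h2
    have h3 : Real.exp (C * t) ≤ Real.exp (C * S) :=
      Real.exp_le_exp.2 (mul_le_mul_of_nonneg_left ht.2 hC)
    nlinarith
  rw [← hA]
  constructor
  · intro t ht
    have h1 := key t ht
    have h2 := hDn t ht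
    have h3 : k * t ≤ k * S := mul_le_mul_of_nonneg_left ht.2 hk
    linarith [hbd t ht]
  · have hSm : S ∈ Icc 0 S := ⟨hS.le, le_rfl⟩
    have h1 := key S hSm
    have h2 := hE0 S hSm
    rw [intervalIntegral.integral_of_le hS.le, integral_Ioc_eq_integral_Ioo] at h1
    linarith [hbd S hSm]

theorem divOf_smul (r : ℝ) (q : Plane →L[ℝ] Plane) : divOf (r • q) = r * divOf q := by
  simp [divOf, Fin.sum_univ_two]; ring

theorem frobSq_smul (r : ℝ) (q : Plane →L[ℝ] Plane) : frobSq (r • q) = r ^ 2 * frobSq q := by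
  simp [frobSq, Fin.sum_univ_two, norm_smul, mul_pow]; ring

theorem stress_smul {μ r P : ℝ} (hr : r ≠ 0) (B q : Plane →L[ℝ] Plane) :
    stress μ B (r • q) P = r ^ 2 * stress μ B q (P / r ^ 2) := by
  have h1 : (r • q) ∘L B = r • (q ∘L B) := by ext; simp
  rw [stress, stress, h1, divOf_smul, divOf_smul, frobSq_smul]
  simp only [Fin.sum_univ_two, smul_apply, inner_smul_left, inner_smul_right,
    conj_trivial]
  field_simp

theorem norm_sub_projOnto_sq (v w : Plane) :
    ‖w - projOnto v w‖ ^ 2 ≤ ‖w‖ ^ 2 - (inner ℝ (dirOf v) w) ^ 2 := by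
  obtain ⟨c, hc⟩ : ∃ c, c = inner ℝ (dirOf v) w := ⟨_, rfl⟩
  have h1 : projOnto v w = c • dirOf v := by rw [hc, real_inner_comm]; rfl
  have h2 : ‖dirOf v‖ ^ 2 ≤ 1 := pow_le_one₀ (norm_nonneg _) (norm_dirOf_le v)
  rw [h1, norm_sub_sq_real, inner_smul_right, real_inner_comm, ← hc, norm_smul, mul_pow,
    Real.norm_eq_abs, sq_abs]
  nlinarith [sq_nonneg c]

theorem inner_perp_projOnto (v w : Plane) : inner ℝ (projOnto v w) (perp v) = 0 := by
  have h : inner ℝ (‖v‖⁻¹ • v) (perp v) = 0 := by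
    rw [real_inner_smul_left, inner_perp_self, mul_zero]
  rw [projOnto, real_inner_smul_left, h, mul_zero]

theorem neg_mul_le_of_sq_le {r d K N y : ℝ} (h : d ^ 2 * (r ^ 2 * N ^ 2) ≤ K ^ 2 * (r ^ 2 * N ^ 2)) :
    -(r ^ 2 * (d * (N * y))) ≤ (r * y) ^ 2 / 2 + K ^ 2 * r ^ 2 * N ^ 2 / 2 := by
  have h1 : (r * y + r * d * N) ^ 2 = (r * y) ^ 2 + 2 * (r ^ 2 * (d * (N * y)))
      + d ^ 2 * (r ^ 2 * N ^ 2) := by ring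
  linarith [sq_nonneg (r * y + r * d * N)]

theorem solution_pointwise {μ C K α δ r gv : ℝ} (hμ : 0 < μ) (hr : 0 < r) (hK : 0 ≤ K)
    (q B : Plane →L[ℝ] Plane) (D : Plane →L[ℝ] ℝ) (w V ξ H ξ' : Plane)
    (hg : gv * ‖dirOf V‖ ^ 2 = gv) (hξ : ‖ξ‖ ≤ 1) (hα : |α| ≤ K) (hD : ‖D‖ ≤ K)
    (hpt : ∀ (q : Plane →L[ℝ] Plane) (e : Plane) (G : ℝ), ‖e‖ ≤ 1 → G * ‖e‖ ^ 2 = G →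
      (1 / 2) * δ ^ 2 * G ^ 2 + ‖q H‖ ^ 2 / 2 - G * inner ℝ e (q ξ') + stress μ B q (G ^ 2)
        - μ * α * divOf q * divOf (perpL.comp q) ≤ C * modForm μ q G e ξ) :
    -(r ^ 2 * ‖w‖ ^ 2) - gv * inner ℝ (dirOf V) (q ξ') + δ * (gv * inner ℝ (dirOf V) w)
      + r ^ 2 * (stress μ B q (gv ^ 2 / (r ^ 2) ^ 2) - inner ℝ (q H) w)
      - r ^ 2 * (α * inner ℝ w (perp V) + ∑ j, D (stdVec j) * inner ℝ (perp V) (q (stdVec j))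
        + μ * divOf q * (D (perp V) + α * divOf (perpL.comp q)))
      ≤ (C + 1) * modForm μ (r • q) (gv / r) (dirOf V) ξ - (r ^ 2 / 2 * ‖w + q H‖ ^ 2
        + r ^ 2 / 4 * ‖w - projOnto V w‖ ^ 2) + (2 + μ) * K ^ 2 * r ^ 2 * ‖V‖ ^ 2 := by
  have hr0 := hr.ne'
  have hp := hpt (r • q) (dirOf V) (gv / r) (norm_dirOf_le V) (by rw [div_mul_eq_mul_div, hg])
  have hcomp : perpL.comp (r • q) = r • perpL.comp q := by ext; simp
  rw [stress_smul hr0, hcomp, divOf_smul, divOf_smul] at hp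
  simp only [smul_apply, norm_smul, inner_smul_right, Real.norm_eq_abs, mul_pow,
    sq_abs, div_pow] at hp
  have e1 : gv ^ 2 / r ^ 2 / r ^ 2 = gv ^ 2 / (r ^ 2) ^ 2 := by rw [div_div]; ring_nf
  have e2 : gv / r * (r * inner ℝ (dirOf V) (q ξ')) = gv * inner ℝ (dirOf V) (q ξ') := by field_simp
  rw [e1, e2] at hp
  obtain ⟨m, hm⟩ : ∃ m, m = modForm μ (r • q) (gv / r) (dirOf V) ξ := ⟨_, rfl⟩
  have hm0 : 0 ≤ m := hm ▸ modForm_nonneg hμ _ (norm_dirOf_le V) hξ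
  obtain ⟨Y, hY⟩ : ∃ Y, Y = ‖w - projOnto V w‖ := ⟨_, rfl⟩
  obtain ⟨c, hc⟩ : ∃ c, c = inner ℝ (dirOf V) w := ⟨_, rfl⟩
  rw [← hm] at hp ⊢
  rw [← hc, ← hY]
  have hw := norm_sub_projOnto_sq V w
  rw [← hc, ← hY] at hw
  have h0 : δ * (gv * c) ≤ r ^ 2 / 2 * c ^ 2 + 1 / 2 * δ ^ 2 * (gv ^ 2 / r ^ 2) := by
    have : r ^ 2 / 2 * c ^ 2 + 1 / 2 * δ ^ 2 * (gv ^ 2 / r ^ 2) - δ * (gv * c)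
        = (r * c - δ * gv / r) ^ 2 / 2 := by field_simp; ring
    nlinarith [sq_nonneg (r * c - δ * gv / r)]
  have hadd : ‖w + q H‖ ^ 2 = ‖w‖ ^ 2 + 2 * inner ℝ (q H) w + ‖q H‖ ^ 2 := by
    rw [norm_add_sq_real, real_inner_comm]
  have hr2 : 0 < r ^ 2 := by positivity
  have h2 : -(α * inner ℝ w (perp V)) ≤ Y ^ 2 / 4 + K ^ 2 * ‖V‖ ^ 2 := by
    have h3 : inner ℝ w (perp V) = inner ℝ (w - projOnto V w) (perp V) := by
      rw [inner_sub_left, inner_perp_projOnto, sub_zero]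
    have h4 : |inner ℝ w (perp V)| ≤ Y * ‖V‖ := by
      rw [h3, hY, ← norm_perp V]; exact abs_real_inner_le_norm _ _
    have h5 : |α * inner ℝ w (perp V)| ≤ K * (Y * ‖V‖) := by
      rw [abs_mul]; exact mul_le_mul hα h4 (abs_nonneg _) hK
    have h6 := (neg_le_abs _).trans h5
    nlinarith [sq_nonneg (Y / 2 - K * ‖V‖)]
  have h3 : -(r ^ 2 * ∑ j, D (stdVec j) * inner ℝ (perp V) (q (stdVec j)))
      - r ^ 2 * (μ * divOf q * D (perp V)) ≤ m + (1 + μ) * K ^ 2 * r ^ 2 * ‖V‖ ^ 2 := by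
    by_cases hV : V = 0
    · have : perp V = 0 := by rw [hV]; exact perpL.map_zero
      rw [this, hV]
      simp
      exact hm0
    · have hang := modForm_angular (μ := μ) (r • q) (G := gv / r) (norm_dirOf hV) hξ
      rw [← hm, divOf_smul] at hang
      simp only [smul_apply, inner_smul_right, Fin.sum_univ_two] at hang
      have hpV : ∀ z, inner ℝ (perp V) z = ‖V‖ * inner ℝ (perp (dirOf V)) z := fun z => by
        rw [← real_inner_smul_left, ← perp_smul, norm_smul_dirOf]
      have hDe : ∀ j, (D (stdVec j)) ^ 2 ≤ K ^ 2 := fun j => by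
        have h4 := D.le_opNorm (stdVec j)
        rw [norm_stdVec, mul_one] at h4
        exact sq_le_sq' (abs_le.1 (h4.trans hD)).1 (abs_le.1 (h4.trans hD)).2
      have hDV : (D (perp V)) ^ 2 ≤ K ^ 2 * ‖V‖ ^ 2 := by
        have h4 := D.le_opNorm (perp V)
        rw [norm_perp] at h4
        have h5 := h4.trans (mul_le_mul_of_nonneg_right hD (norm_nonneg V))
        rw [← mul_pow]
        exact sq_le_sq' (abs_le.1 h5).1 (abs_le.1 h5).2
      rw [Fin.sum_univ_two, hpV, hpV]
      obtain ⟨y0, hy0⟩ : ∃ y, y = inner ℝ (perp (dirOf V)) (q (stdVec 0)) := ⟨_, rfl⟩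
      obtain ⟨y1, hy1⟩ : ∃ y, y = inner ℝ (perp (dirOf V)) (q (stdVec 1)) := ⟨_, rfl⟩
      rw [← hy0, ← hy1] at hang ⊢
      have g : ∀ j y, -(r ^ 2 * (D (stdVec j) * (‖V‖ * y))) ≤ (r * y) ^ 2 / 2
          + K ^ 2 * r ^ 2 * ‖V‖ ^ 2 / 2 := fun j y => by
        have h4 := mul_le_mul_of_nonneg_right (hDe j) (by positivity : 0 ≤ r ^ 2 * ‖V‖ ^ 2)
        exact neg_mul_le_of_sq_le h4
      have g2 : -(r ^ 2 * (μ * divOf q * D (perp V))) ≤ μ / 2 * (r * divOf q) ^ 2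
          + μ * K ^ 2 * r ^ 2 * ‖V‖ ^ 2 / 2 := by
        have h4 := mul_le_mul_of_nonneg_left hDV (by positivity : 0 ≤ μ * r ^ 2)
        have h5 := mul_nonneg hμ.le (sq_nonneg (r * divOf q + r * D (perp V)))
        have h6 : μ * (r * divOf q + r * D (perp V)) ^ 2 = μ * (r * divOf q) ^ 2
            + 2 * (r ^ 2 * (μ * divOf q * D (perp V))) + μ * r ^ 2 * (D (perp V)) ^ 2 := by ring
        rw [h6] at h5
        linarith
      have g3 : 0 ≤ μ * K ^ 2 * r ^ 2 * ‖V‖ ^ 2 := by positivity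
      linarith [g 0 y0, g 1 y1]
  have h2' := mul_le_mul_of_nonneg_left h2 hr2.le
  have hw' := mul_le_mul_of_nonneg_left hw hr2.le
  rw [hadd]
  linarith

namespace SolData

theorem memLp_transport (h : SolData Ω S μ ε f g u u₀ W Du D2)
    (hc : IsCalibration Ω S μ K C R ξ H a) :
    MemLp (fun p => W p + Du p.1 p.2 (H p.1 p.2)) 2 (cylinderMeasure Ω S) := by
  have m := hc.smooth_H.aestronglyMeasurable h.isOpen.measurableSet (le_refl 0) (le_refl S)
  refine h.memLp_W_cyl.add (h.memLp_Du.of_le_mul (c := K)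
    (dualCLM_aestronglyMeasurable h.memLp_Du.1 m) ?_)
  filter_upwards [ae_cyl_mem Ω 0 S] with p hp
  rw [mul_comm]
  exact ((Du p.1 p.2).le_opNorm _).trans
    (mul_le_mul_of_nonneg_left (hc.H_le _ hp _) (norm_nonneg _))

theorem memLp_tangential (h : SolData Ω S μ ε f g u u₀ W Du D2) :
    MemLp (fun p => W p - projOnto (pathOf u₀ W p) (W p)) 2 (cylinderMeasure Ω S) := by
  have m1 : StronglyMeasurable fun p => ‖pathOf u₀ W p‖⁻¹ • pathOf u₀ W p :=
    ((h.meas_path.norm.measurable.inv).stronglyMeasurable).smul h.meas_path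
  have m2 : StronglyMeasurable fun p => W p - projOnto (pathOf u₀ W p) (W p) :=
    h.meas_W.sub (StronglyMeasurable.smul (f := fun p => inner ℝ (W p) (‖pathOf u₀ W p‖⁻¹ • pathOf u₀ W p))
      (h.meas_W.inner m1) m1)
  refine h.memLp_W_cyl.mono m2.aestronglyMeasurable (.of_forall fun p => ?_)
  have := norm_sub_projOnto_sq (pathOf u₀ W p) (W p)
  exact (sq_le_sq₀ (norm_nonneg _) (norm_nonneg _)).1
    (by linarith [sq_nonneg (inner ℝ (dirOf (pathOf u₀ W p)) (W p) : ℝ)])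

theorem integrable_dissipation (h : SolData Ω S μ ε f g u u₀ W Du D2)
    (hc : IsCalibration Ω S μ K C R ξ H a) :
    Integrable (fun p => ε / 2 * ‖W p + Du p.1 p.2 (H p.1 p.2)‖ ^ 2
      + ε / 4 * ‖W p - projOnto (pathOf u₀ W p) (W p)‖ ^ 2) (cylinderMeasure Ω S) :=
  ((h.memLp_transport hc).norm.integrable_sq.const_mul _).add
    (h.memLp_tangential.norm.integrable_sq.const_mul _)

theorem modDensity_ae (h : SolData Ω S μ ε f g u u₀ W Du D2) {t r : ℝ} (ht : t ∈ Icc 0 S)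
    (hr : r ≠ 0) (hrε : ε = r ^ 2) {G : Plane → Plane →L[ℝ] Plane} (hG : IsWeakGrad Ω (u t) G)
    (η : Plane → Plane) :
    modDensity Ω μ ε f g η (u t) =ᵐ[vol(Ω)] fun x =>
      modForm μ (r • G x) (g ‖pathOf u₀ W (t, x)‖ / r) (dirOf (pathOf u₀ W (t, x))) (η x) := by
  filter_upwards [h.glDensity_ae ht, h.grad_phase_ae ht, hG.weakGrad_ae_eq h.isOpen] with x h1 h2 h3
  rw [modDensity, h1, h2, h3, modForm, divOf_smul, frobSq_smul, ContinuousLinearMap.comp_apply,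
    h.pot.fderiv_phase, h.pot.potential_eq, smul_apply, inner_smul_right, hrε]
  field_simp
  ring

theorem zeroInt_potential (h : SolData Ω S μ ε f g u u₀ W Du D2) (ht : t ∈ Icc 0 S)
    (hF : MemLp (fun x => gradient (potential f) (pathOf u₀ W (t, x))) 2 vol(Ω))
    (hDu : IsWeakGrad Ω (u t) (Du t)) {η : Plane → Plane} (hη : ContDiff ℝ ∞ η)
    (hc : HasCompactSupport η) (hs : tsupport η ⊆ Ω) :
    ZeroInt Ω fun x => inner ℝ (Du t x (η x)) (gradient (potential f) (pathOf u₀ W (t, x)))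
      + divOf (fderiv ℝ η x) * potential f (pathOf u₀ W (t, x)) := by
  have hG := (h.memH10 t ht).memH1.memLp_grad
  have hae := hDu.weakGrad_ae_eq h.isOpen
  obtain ⟨C, hC⟩ := hc.exists_bound_of_continuous hη.continuous
  have m1 : MemLp (fun x => Du t x (η x)) 2 vol(Ω) := by
    refine MemLp.ae_eq (hae.mono fun x hx => by beta_reduce; rw [hx]) (MemLp.of_le_mul (c := C) hG
      (dualCLM_aestronglyMeasurable hG.1 hη.continuous.aestronglyMeasurable)
      (.of_forall fun x => ?_))
    rw [mul_comm]
    exact ((weakGrad Ω (u t) x).le_opNorm _).trans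
      (mul_le_mul_of_nonneg_left (hC x) (norm_nonneg _))
  have i1 : IntegrableOn (fun x => inner ℝ (Du t x (η x))
      (gradient (potential f) (pathOf u₀ W (t, x)))) Ω := integrable_inner_of_memLp m1 hF
  have hd : Continuous fun x => divOf (fderiv ℝ η x) := by
    simp only [← divCLM_apply]
    exact divCLM.continuous.comp (hη.continuous_fderiv (by simp))
  have hdc : HasCompactSupport fun x => divOf (fderiv ℝ η x) := by
    simp only [← divCLM_apply]
    exact (hc.fderiv (𝕜 := ℝ)).comp_left (map_zero divCLM)
  obtain ⟨C', hC'⟩ := hdc.exists_bound_of_continuous hd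
  have i2 : IntegrableOn (fun x => divOf (fderiv ℝ η x) * potential f (pathOf u₀ W (t, x))) Ω :=
    (h.integrableOn_potential ht).bdd_mul (c := C') hd.aestronglyMeasurable (Eventually.of_forall hC')
  refine ⟨i1.add i2, ?_⟩
  have key := integral_weakGrad_apply (h.isWeakGrad_potential ht hF) hη hc hs
  rw [integral_add i1 i2]
  have e1 : ∫ x in Ω, ((fderiv ℝ (potential f) (u t x)).comp (weakGrad Ω (u t) x)) (η x)
      = ∫ x in Ω, inner ℝ (Du t x (η x)) (gradient (potential f) (pathOf u₀ W (t, x))) := by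
    refine integral_congr_ae ?_
    filter_upwards [hae, h.rep t ht] with x h1 h2
    rw [ContinuousLinearMap.comp_apply, h.pot.fderiv_potential, h1, h2, real_inner_comm]
  have e2 : ∫ x in Ω, divOf (fderiv ℝ η x) * potential f (u t x)
      = ∫ x in Ω, divOf (fderiv ℝ η x) * potential f (pathOf u₀ W (t, x)) := by
    refine integral_congr_ae ?_
    filter_upwards [h.rep t ht] with x h2
    rw [h2]
  rw [e1, e2] at key
  rw [key, neg_add_cancel]

theorem ae_memLp_gradF (h : SolData Ω S μ ε f g u u₀ W Du D2) :
    ∀ᵐ t ∂(volume.restrict (Ioo 0 S)),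
      MemLp (fun x => gradient (potential f) (pathOf u₀ W (t, x))) 2 vol(Ω) := by
  have := h.finite
  exact MemLp.ae_section h.memLp_gradF

theorem ae_zeroInt (h : SolData Ω S μ ε f g u u₀ W Du D2)
    (hc : IsCalibration Ω S μ K C R ξ H a) : ∀ᵐ t ∂(volume.restrict (Ioo 0 S)),
    ZeroInt Ω (fun x => stress μ (fderiv ℝ (H t) x) (Du t x) (g ‖pathOf u₀ W (t, x)‖ ^ 2 / ε ^ 2)
      - inner ℝ (Du t x (H t x)) (W (t, x))) ∧
    ZeroInt Ω (fun x => a t x * inner ℝ (W (t, x)) (perp (pathOf u₀ W (t, x)))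
      + ∑ j, fderiv ℝ (a t) x (stdVec j) * inner ℝ (perp (pathOf u₀ W (t, x))) (Du t x (stdVec j))
      + μ * divOf (Du t x) * (fderiv ℝ (a t) x (perp (pathOf u₀ W (t, x)))
        + a t x * divOf (perpL.comp (Du t x)))) := by
  have := h.finite
  obtain ⟨Z, hZ, hZΩ, hZs⟩ := hc.support
  filter_upwards [h.weakGrad_Du, MemLp.ae_section (E := Plane →L[ℝ] Plane →L[ℝ] Plane) h.memLp_D2,
    MemLp.ae_section h.memLp_Du, h.ae_memLp_gradF, Measure.ae_ae_of_ae_prod h.equation,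
    ae_restrict_mem measurableSet_Ioo] with t hgr hD2 hDu hF heq ht
  have htI := Ioo_subset_Icc_self ht
  have hD2 : MemLp (D2 t) 2 vol(Ω) := hD2
  have hDu : MemLp (Du t) 2 vol(Ω) := hDu
  have hv := (h.memH10 t htI).memH1.memLp
  obtain ⟨-, s2, s3⟩ := hZs t ht
  have cH : HasCompactSupport (H t) := hZ.of_isClosed_subset (isClosed_tsupport _) s2
  have ca : HasCompactSupport (a t) := hZ.of_isClosed_subset (isClosed_tsupport _) s3
  have dH := hc.smooth_H.contDiff ht
  have z1 := zeroInt_stress h.isOpen μ hv hDu hD2 hgr.1 hgr.2 dH cH (s2.trans hZΩ)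
  have z2 := h.zeroInt_potential htI hF hgr.1 dH cH (s2.trans hZΩ)
  have z3 := zeroInt_rotation h.isOpen μ hv hDu hD2 hgr.1 hgr.2 (hc.smooth_a.contDiff ht) ca
    (s3.trans hZΩ)
  constructor
  · refine (z1.add (z2.const_mul (ε ^ 2)⁻¹)).congr_ae ?_
    filter_upwards [heq] with x hx
    rw [hx, h.pot.potential_eq, inner_sub_right, inner_smul_right, stress, stress]
    ring
  · refine z3.congr_ae ?_
    filter_upwards [heq, h.rep t htI] with x hx hr
    have hperp : inner ℝ (gradient (potential f) (pathOf u₀ W (t, x))) (perp (pathOf u₀ W (t, x)))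
        = (0 : ℝ) := by
      rw [h.pot.gradient_potential, real_inner_smul_left, dirOf, real_inner_smul_left,
        inner_perp_self, mul_zero, mul_zero]
    rw [hr, hx, inner_sub_left, real_inner_smul_left, hperp, mul_zero, sub_zero]

theorem rate_le (h : SolData Ω S μ ε f g u u₀ W Du D2)
    (hc : IsCalibration Ω S μ K C R ξ H a) (hK : 0 ≤ K) {α β : ℝ} (hα : 0 < α) (hαβ : α ≤ β)
    (hβ : β < S) : ∀ᵐ t ∂(volume.restrict (Ioo α β)),
    ∫ x in Ω, (-(ε * ‖W (t, x)‖ ^ 2)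
        - fderiv ℝ (phase g) (pathOf u₀ W (t, x)) (Du t x (dtime ξ t x))
        + divOf (fderiv ℝ (ξ t) x) * fderiv ℝ (phase g) (pathOf u₀ W (t, x)) (W (t, x)))
      ≤ (C + 1) * modEnergy Ω μ ε f g (ξ t) (u t) + (2 + μ) * K ^ 2 * ε
          * (∫ x in Ω, (closedBall (0 : Plane) R).indicator 1 x * ‖pathOf u₀ W (t, x)‖ ^ 2)
        - ∫ x in Ω, (ε / 2 * ‖W (t, x) + Du t x (H t x)‖ ^ 2
          + ε / 4 * ‖W (t, x) - projOnto (pathOf u₀ W (t, x)) (W (t, x))‖ ^ 2) := by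
  have := h.finite
  have hμ := h.μ_pos
  obtain ⟨r, hr, hrε⟩ : ∃ r, 0 < r ∧ ε = r ^ 2 :=
    ⟨√ε, Real.sqrt_pos.2 h.ε_pos, (Real.sq_sqrt h.ε_pos.le).symm⟩
  obtain ⟨j1, j2, -⟩ := h.pairing_sub hc hα hαβ hβ
  have j0 : Integrable (fun p => -(ε * ‖W p‖ ^ 2)) (cyl Ω α β) :=
    ((h.integrable_W_sq.mono_measure (cyl_le hα.le hβ.le)).const_mul ε).neg
  have j3 : Integrable (fun p => -(ε * ‖W p‖ ^ 2)
      - fderiv ℝ (phase g) (pathOf u₀ W p) (Du p.1 p.2 (dtime ξ p.1 p.2))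
      + divOf (fderiv ℝ (ξ p.1) p.2) * fderiv ℝ (phase g) (pathOf u₀ W p) (W p)) (cyl Ω α β) :=
    (j0.sub j1).add j2
  have hss : Ioo α β ⊆ Ioo 0 S := Ioo_subset_Ioo hα.le hβ.le
  filter_upwards [ae_restrict_of_ae_restrict_of_subset hss (h.ae_zeroInt hc),
    ae_restrict_of_ae_restrict_of_subset hss h.weakGrad_Du,
    ae_restrict_of_ae_restrict_of_subset hss (h.integrable_dissipation hc).prod_right_ae,
    j3.prod_right_ae, ae_restrict_mem measurableSet_Ioo] with t hz hgr hdis hj htαβ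
  have ht := hss htαβ
  have htI := Ioo_subset_Icc_self ht
  obtain ⟨z1, z2⟩ := hz
  have hZ := (z1.const_mul ε).add (z2.const_mul (-ε))
  have hm := h.integrableOn_modDensity htI (hc.measurable t htI) (hc.norm_le t htI)
  have hB1 : ∀ x, ‖(closedBall (0 : Plane) R).indicator (1 : Plane → ℝ) x‖ ≤ 1 := fun x => by
    rw [Real.norm_of_nonneg (indicator_nonneg (f := (1 : Plane → ℝ)) (fun _ _ => zero_le_one) x)]
    exact indicator_le_self' (fun _ _ => zero_le_one) x
  have hi : IntegrableOn (fun x => (closedBall (0 : Plane) R).indicator 1 x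
      * ‖pathOf u₀ W (t, x)‖ ^ 2) Ω :=
    (h.integrable_path_sq htI).bdd_mul (c := 1)
      ((measurable_const.indicator measurableSet_closedBall).aestronglyMeasurable)
      (Eventually.of_forall hB1)
  have e1 := integral_add hj hZ.1
  rw [hZ.2, add_zero] at e1
  rw [← e1]
  have i1 : Integrable (fun x => (C + 1) * modDensity Ω μ ε f g (ξ t) (u t) x + (2 + μ) * K ^ 2 * ε
      * ((closedBall (0 : Plane) R).indicator 1 x * ‖pathOf u₀ W (t, x)‖ ^ 2)) vol(Ω) :=
    (hm.const_mul _).add (hi.const_mul _)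
  have e2 : (C + 1) * modEnergy Ω μ ε f g (ξ t) (u t) + (2 + μ) * K ^ 2 * ε
          * (∫ x in Ω, (closedBall (0 : Plane) R).indicator 1 x * ‖pathOf u₀ W (t, x)‖ ^ 2)
        - (∫ x in Ω, (ε / 2 * ‖W (t, x) + Du t x (H t x)‖ ^ 2
          + ε / 4 * ‖W (t, x) - projOnto (pathOf u₀ W (t, x)) (W (t, x))‖ ^ 2))
      = ∫ x in Ω, ((C + 1) * modDensity Ω μ ε f g (ξ t) (u t) x + (2 + μ) * K ^ 2 * ε
        * ((closedBall (0 : Plane) R).indicator 1 x * ‖pathOf u₀ W (t, x)‖ ^ 2)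
        - (ε / 2 * ‖W (t, x) + Du t x (H t x)‖ ^ 2
          + ε / 4 * ‖W (t, x) - projOnto (pathOf u₀ W (t, x)) (W (t, x))‖ ^ 2)) := by
    rw [integral_sub i1 hdis, integral_add (hm.const_mul _) (hi.const_mul _), integral_const_mul,
      integral_const_mul, modEnergy]
  rw [e2]
  refine integral_mono_ae (hj.add hZ.1) (i1.sub hdis) ?_
  filter_upwards [h.modDensity_ae htI hr.ne' hrε hgr.1 (ξ t)] with x hx
  rw [hx]
  simp only [h.pot.fderiv_phase]
  by_cases hxR : x ∈ closedBall (0 : Plane) R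
  · have key := solution_pointwise hμ hr hK (Du t x) (fderiv ℝ (H t) x) (fderiv ℝ (a t) x) (W (t, x))
      (pathOf u₀ W (t, x)) (ξ t x) (H t x) (dtime ξ t x) (h.pot.g_mul_norm_dirOf_sq _)
      (hc.norm_le t htI x) (hc.a_le t ht x) (hc.grad_a_le t ht x) (hc.pointwise t ht x)
    rw [indicator_of_mem hxR, Pi.one_apply, hrε]
    linarith
  · have hsa := fun h1 => hxR (hc.support_a t ht h1)
    have ha0 : a t x = 0 := image_eq_zero_of_notMem_tsupport hsa
    have hda : fderiv ℝ (a t) x = 0 := by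
      by_contra h1
      exact hsa (support_fderiv_subset ℝ h1)
    have key := solution_pointwise (K := 0) hμ hr le_rfl (Du t x) (fderiv ℝ (H t) x)
      (fderiv ℝ (a t) x) (W (t, x)) (pathOf u₀ W (t, x)) (ξ t x) (H t x) (dtime ξ t x)
      (h.pot.g_mul_norm_dirOf_sq _) (hc.norm_le t htI x) (by rw [ha0]; simp) (by rw [hda]; simp)
      (hc.pointwise t ht x)
    rw [indicator_of_notMem hxR, hrε]
    linarith

/-- The stability estimate for the modulated energy. -/
theorem stability (h : SolData Ω S μ ε f g u u₀ W Du D2)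
    (hc : IsCalibration Ω S μ K C R ξ H a) (hK : 0 ≤ K) (hC : 0 ≤ C) {c₁ c T : ℝ} (hc0 : 0 ≤ c)
    (hg : ∀ v : Plane, ‖v‖ ^ 2 ≤ 4 + c * potential f v) (hST : S ≤ T)
    (he : glEnergy Ω μ ε f (u 0) ≤ c₁) (hE : modEnergy Ω μ ε f g (ξ 0) (u 0) ≤ c₁ * ε) {A : ℝ}
    (hA : A = c₁ + (2 + μ) * K ^ 2
      * (4 * volume.real (closedBall (0 : Plane) R) + (c + 2 * T) * c₁) * S) :
    (∀ t ∈ Icc 0 S, modEnergy Ω μ ε f g (ξ t) (u t) ≤ A * ε * Real.exp ((C + 1) * S)) ∧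
      ∫ p, (ε / 2 * ‖W p + Du p.1 p.2 (H p.1 p.2)‖ ^ 2
        + ε / 4 * ‖W p - projOnto (pathOf u₀ W p) (W p)‖ ^ 2) ∂(cylinderMeasure Ω S)
        ≤ A * ε * Real.exp ((C + 1) * S) := by
  have := h.finite
  have hμ := h.μ_pos
  have hε := h.ε_pos
  obtain ⟨M, hM⟩ : ∃ M, M = 4 * volume.real (closedBall (0 : Plane) R) + (c + 2 * T) * c₁ := ⟨_, rfl⟩
  have hmass := fun t (ht : t ∈ Icc 0 S) => h.mass_le hc0 hg hST he ht R
  rw [← hM] at hA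
  simp only [← hM] at hmass
  have hM0 : 0 ≤ M := (integral_nonneg fun x => mul_nonneg
    (indicator_nonneg (fun _ _ => zero_le_one) x) (sq_nonneg _)).trans
      (hmass 0 ⟨le_rfl, h.S_pos.le⟩)
  have hdis := h.integrable_dissipation hc
  have hDnn : ∀ p, 0 ≤ ε / 2 * ‖W p + Du p.1 p.2 (H p.1 p.2)‖ ^ 2
        + ε / 4 * ‖W p - projOnto (pathOf u₀ W p) (W p)‖ ^ 2 := fun p => by positivity
  have hEnn : ∀ t ∈ Icc 0 S, 0 ≤ modEnergy Ω μ ε f g (ξ t) (u t) := by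
    intro t ht
    refine integral_nonneg_of_ae ?_
    filter_upwards [h.modDensity_ae ht (Real.sqrt_pos.2 hε).ne' (Real.sq_sqrt hε.le).symm
      (h.memH10 t ht).memH1.hasWeakGrad (ξ t)] with x hx
    rw [hx]
    exact modForm_nonneg hμ _ (norm_dirOf_le _) (hc.norm_le t ht x)
  have key := gronwall_dissipation (k := (2 + μ) * K ^ 2 * ε * M)
    (D := fun t => ∫ x in Ω, (ε / 2 * ‖W (t, x) + Du t x (H t x)‖ ^ 2
          + ε / 4 * ‖W (t, x) - projOnto (pathOf u₀ W (t, x)) (W (t, x))‖ ^ 2))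
    h.S_pos (by linarith : 0 ≤ C + 1) (by positivity) (h.continuousOn_modEnergy hc) hEnn
    hdis.integral_prod_left (fun t => integral_nonneg fun x => hDnn (t, x)) (by
      intro α β hα hαβ hβ
      refine (h.modEnergy_sub_le hc hα hαβ hβ).trans ?_
      obtain ⟨j1, j2, -⟩ := h.pairing_sub hc hα hαβ hβ
      have j0 : Integrable (fun p => -(ε * ‖W p‖ ^ 2)) (cyl Ω α β) :=
        ((h.integrable_W_sq.mono_measure (cyl_le hα.le hβ.le)).const_mul ε).neg
      have j3 : Integrable (fun p => -(ε * ‖W p‖ ^ 2)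
          - fderiv ℝ (phase g) (pathOf u₀ W p) (Du p.1 p.2 (dtime ξ p.1 p.2))
          + divOf (fderiv ℝ (ξ p.1) p.2) * fderiv ℝ (phase g) (pathOf u₀ W p) (W p)) (cyl Ω α β) :=
        (j0.sub j1).add j2
      have hrate := h.rate_le hc hK hα hαβ hβ
      rw [intervalIntegral.integral_of_le hαβ, integral_Ioc_eq_integral_Ioo]
      unfold cyl at j3 ⊢
      rw [integral_prod _ j3]
      have hss : Ioo α β ⊆ Ioo 0 S := Ioo_subset_Ioo hα.le hβ.le
      have hfin : IsFiniteMeasure (volume.restrict (Ioo α β)) := ⟨by simp⟩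
      have iE : IntegrableOn (fun t => modEnergy Ω μ ε f g (ξ t) (u t)) (Ioo α β) :=
        ((h.continuousOn_modEnergy hc).integrableOn_Icc).mono_set
          (hss.trans Ioo_subset_Icc_self)
      refine integral_mono_ae j3.integral_prod_left (((iE.const_mul _).add (integrable_const _)).sub
        (hdis.integral_prod_left.mono_measure (Measure.restrict_mono hss le_rfl))) ?_
      filter_upwards [hrate, ae_restrict_mem measurableSet_Ioo] with t h1 h2
      refine h1.trans ?_
      have h3 := mul_le_mul_of_nonneg_left (hmass t (Ioo_subset_Icc_self (hss h2)))
        (by positivity : 0 ≤ (2 + μ) * K ^ 2 * ε)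
      show _ ≤ _ + _ - _
      linarith)
  have hle : (modEnergy Ω μ ε f g (ξ 0) (u 0) + (2 + μ) * K ^ 2 * ε * M * S)
      * Real.exp ((C + 1) * S) ≤ A * ε * Real.exp ((C + 1) * S) := by
    refine mul_le_mul_of_nonneg_right ?_ (Real.exp_nonneg _)
    rw [hA]
    linarith
  refine ⟨fun t ht => (key.1 t ht).trans hle, ?_⟩
  unfold cylinderMeasure at hdis ⊢
  rw [integral_prod _ hdis]
  exact key.2.trans hle

end SolData

/-! ### From calibrations to the stability estimate -/

theorem glDensity_congr (hΩ : IsOpen Ω) {μ ε : ℝ} {f : ℝ → ℝ} {v v' : Plane → Plane}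
    (h : v =ᵐ[vol(Ω)] v') :
    glDensity Ω μ ε f v =ᵐ[vol(Ω)] glDensity Ω μ ε f v' := by
  filter_upwards [h] with x hx
  rw [glDensity, glDensity, weakGrad_congr hΩ h, hx]

theorem modEnergy_congr (hΩ : IsOpen Ω) {μ ε : ℝ} {f g : ℝ → ℝ} {ξ v v' : Plane → Plane}
    (h : v =ᵐ[vol(Ω)] v') : modEnergy Ω μ ε f g ξ v = modEnergy Ω μ ε f g ξ v' := by
  have hψ : psi g v =ᵐ[vol(Ω)] psi g v' := by
    filter_upwards [h] with x hx
    simp only [psi, hx]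
  refine integral_congr_ae ?_
  filter_upwards [glDensity_congr hΩ (μ := μ) (ε := ε) (f := f) h] with x hx
  rw [modDensity, modDensity, hx, weakGrad_congr hΩ hψ]

theorem SolData.dissipation_eq {S μ ε : ℝ} {f g : ℝ → ℝ} {u ut : ℝ → Plane → Plane}
    {u₀ : Plane → Plane} {W : ℝ × Plane → Plane} {Du : ℝ → Plane → Plane →L[ℝ] Plane}
    {D2 : ℝ → Plane → Plane →L[ℝ] Plane →L[ℝ] Plane} {K C R : ℝ} {ξ H : ℝ → Plane → Plane}
    {a : ℝ → Plane → ℝ} (h : SolData Ω S μ ε f g u u₀ W Du D2)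
    (hW : W =ᵐ[cylinderMeasure Ω S] uncurry ut) (hc : IsCalibration Ω S μ K C R ξ H a) :
    Integrable (fun p => ‖W p + Du p.1 p.2 (H p.1 p.2)‖ ^ 2
      + ‖W p - projOnto (pathOf u₀ W p) (W p)‖ ^ 2) (cylinderMeasure Ω S) ∧
    dissipation Ω S H u ut = ENNReal.ofReal (∫ p, (‖W p + Du p.1 p.2 (H p.1 p.2)‖ ^ 2
      + ‖W p - projOnto (pathOf u₀ W p) (W p)‖ ^ 2) ∂(cylinderMeasure Ω S)) := by
  have := h.finite
  have hi : Integrable (fun p => ‖W p + Du p.1 p.2 (H p.1 p.2)‖ ^ 2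
      + ‖W p - projOnto (pathOf u₀ W p) (W p)‖ ^ 2) (cylinderMeasure Ω S) :=
    (h.memLp_transport hc).norm.integrable_sq.add h.memLp_tangential.norm.integrable_sq
  refine ⟨hi, ?_⟩
  rw [ofReal_integral_eq_lintegral_ofReal hi (.of_forall fun p => by positivity)]
  unfold cylinderMeasure at hi hW ⊢
  rw [lintegral_prod _ hi.1.aemeasurable.ennreal_ofReal, dissipation]
  refine lintegral_congr_ae ?_
  filter_upwards [Measure.ae_ae_of_ae_prod hW, h.weakGrad_Du, ae_restrict_mem measurableSet_Ioo]
    with t h1 h2 h3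
  refine lintegral_congr_ae ?_
  filter_upwards [h1, h2.1.weakGrad_ae_eq h.isOpen, h.rep t (Ioo_subset_Icc_self h3)] with x a1 a2 a3
  have a1 : W (t, x) = ut t x := a1
  rw [a2, a3, ← a1, ENNReal.ofReal_add (sq_nonneg _) (sq_nonneg _),
    ENNReal.ofReal_pow (norm_nonneg _), ENNReal.ofReal_pow (norm_nonneg _), ofReal_norm, ofReal_norm]

theorem quarter_le {ε x y : ℝ} (hε : 0 ≤ ε) (hx : 0 ≤ x) :
    ε / 4 * (x + y) ≤ ε / 2 * x + ε / 4 * y := by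
  have := mul_nonneg hε hx
  linarith

theorem SolData.stability_dissipation {S μ ε : ℝ} {f g : ℝ → ℝ}
    {u ut : ℝ → Plane → Plane}
    {u₀ : Plane → Plane} {W : ℝ × Plane → Plane} {Du : ℝ → Plane → Plane →L[ℝ] Plane}
    {D2 : ℝ → Plane → Plane →L[ℝ] Plane →L[ℝ] Plane} {K C R : ℝ} {ξ H : ℝ → Plane → Plane}
    {a : ℝ → Plane → ℝ} (h : SolData Ω S μ ε f g u u₀ W Du D2)
    (hW : W =ᵐ[cylinderMeasure Ω S] uncurry ut) (hc : IsCalibration Ω S μ K C R ξ H a)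
    (hK : 0 ≤ K) (hC : 0 ≤ C) {c₁ c T : ℝ} (hc0 : 0 ≤ c)
    (hg : ∀ v : Plane, ‖v‖ ^ 2 ≤ 4 + c * potential f v) (hST : S ≤ T)
    (he : glEnergy Ω μ ε f (u 0) ≤ c₁) (hE : modEnergy Ω μ ε f g (ξ 0) (u 0) ≤ c₁ * ε) {A : ℝ}
    (hA : A = c₁ + (2 + μ) * K ^ 2
      * (4 * volume.real (closedBall (0 : Plane) R) + (c + 2 * T) * c₁) * S) :
    (∀ t ∈ Icc 0 S, IntegrableOn (modDensity Ω μ ε f g (ξ t) (u t)) Ω) ∧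
      dissipation Ω S H u ut ≠ ⊤ ∧
      ∀ t ∈ Icc 0 S, ε⁻¹ * modEnergy Ω μ ε f g (ξ t) (u t) + (dissipation Ω S H u ut).toReal
        ≤ 5 * (A * Real.exp ((C + 1) * S)) := by
  have hε := h.ε_pos
  obtain ⟨h1, h2⟩ := h.stability hc hK hC hc0 hg hST he hE hA
  obtain ⟨hi, hd⟩ := h.dissipation_eq hW hc
  refine ⟨fun t ht => h.integrableOn_modDensity ht (hc.measurable t ht) (hc.norm_le t ht), ?_, ?_⟩
  · rw [hd]; exact ENNReal.ofReal_ne_top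
  intro t ht
  have h3 : ε⁻¹ * modEnergy Ω μ ε f g (ξ t) (u t) ≤ A * Real.exp ((C + 1) * S) := by
    rw [inv_mul_le_iff₀ hε]
    have := h1 t ht
    linarith
  have h4 : ε / 4 * ∫ p, (‖W p + Du p.1 p.2 (H p.1 p.2)‖ ^ 2
      + ‖W p - projOnto (pathOf u₀ W p) (W p)‖ ^ 2) ∂(cylinderMeasure Ω S)
      ≤ A * ε * Real.exp ((C + 1) * S) := by
    refine le_trans ?_ h2
    rw [← integral_const_mul]
    exact integral_mono (hi.const_mul _) (h.integrable_dissipation hc) fun p =>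
      quarter_le hε.le (sq_nonneg _)
  have h5 : ∫ p, (‖W p + Du p.1 p.2 (H p.1 p.2)‖ ^ 2
      + ‖W p - projOnto (pathOf u₀ W p) (W p)‖ ^ 2) ∂(cylinderMeasure Ω S)
      ≤ 4 * (A * Real.exp ((C + 1) * S)) := by
    have hε4 : 0 < ε / 4 := by positivity
    refine le_of_mul_le_mul_left (h4.trans_eq ?_) hε4
    ring
  have h6 : 0 ≤ ∫ p, (‖W p + Du p.1 p.2 (H p.1 p.2)‖ ^ 2
      + ‖W p - projOnto (pathOf u₀ W p) (W p)‖ ^ 2) ∂(cylinderMeasure Ω S) :=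
    integral_nonneg fun p => add_nonneg (sq_nonneg _) (sq_nonneg _)
  rw [hd, ENNReal.toReal_ofReal h6]
  linarith

theorem stability_of_calibration {T : ℝ} (hT : 0 < T) {γ : ℝ → ℝ → Plane} {U : ℝ → Set Plane}
    {δ₀ : ℝ} {φ : ℝ → ℝ} {η : ℝ → Plane → ℝ}
    {f g : ℝ → ℝ} (hfg : IsAdmissiblePotential f g) {μ : ℝ} (hμ : 0 < μ) {c₁ : ℝ} (hc₁ : 0 < c₁)
    {C K R : ℝ} (hC : 0 ≤ C) (hK : 0 ≤ K)
    (hcal : ∀ Ω : Set Plane, IsSmoothBoundedDomain Ω →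
      (∀ t ∈ Icc 0 T, ∀ x ∈ range (γ t), x ∈ Ω ∧ 4 * δ₀ ≤ infDist x (frontier Ω)) →
      ∀ S ∈ Ioc 0 T, ∃ a, IsCalibration Ω S μ K C R
        (fun t => xiField φ δ₀ (range (γ t)) (U t)) (fun t => curvField (η t) (range (γ t)) (U t)) a) :
    ∃ C : ℝ, 0 < C ∧
      ∀ Ω : Set Plane, IsSmoothBoundedDomain Ω →
      (∀ t ∈ Icc 0 T, ∀ x ∈ range (γ t), x ∈ Ω ∧ 4 * δ₀ ≤ infDist x (frontier Ω)) →
      ∀ ε : ℝ, 0 < ε → ∀ S ∈ Ioc 0 T,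
      ∀ (uin : Plane → Plane) (u ut : ℝ → Plane → Plane),
      IsWellPrepared Ω μ ε c₁ δ₀ f g φ (range (γ 0)) (U 0) uin →
      IsStrongSolution Ω S μ ε f uin u ut →
      (∀ t ∈ Icc 0 S,
        IntegrableOn (modDensity Ω μ ε f g (xiField φ δ₀ (range (γ t)) (U t)) (u t)) Ω) ∧
      dissipation Ω S (fun t => curvField (η t) (range (γ t)) (U t)) u ut ≠ ⊤ ∧
      ∀ t ∈ Icc 0 S,
        ε⁻¹ * modEnergy Ω μ ε f g (xiField φ δ₀ (range (γ t)) (U t)) (u t)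
          + (dissipation Ω S (fun t => curvField (η t) (range (γ t)) (U t)) u ut).toReal
          ≤ Real.exp ((1 + S) * C) := by
  obtain ⟨c, hc0, hg⟩ := hfg.exists_growth
  obtain ⟨B, hB⟩ : ∃ B, B = (2 + μ) * K ^ 2
      * (4 * volume.real (closedBall (0 : Plane) R) + (c + 2 * T) * c₁) := ⟨_, rfl⟩
  have hB0 : 0 ≤ B := by
    have : 0 ≤ volume.real (closedBall (0 : Plane) R) := measureReal_nonneg
    rw [hB]; positivity
  refine ⟨6 + c₁ + B + C, by positivity, ?_⟩
  intro Ω hΩ hdist ε hε S hS uin u ut hin hsol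
  obtain ⟨a, hc⟩ := hcal Ω hΩ hdist S hS
  obtain ⟨u₀, W, Du, D2, h, hW⟩ := hsol.exists_solData hΩ hS.1 hμ hε hfg hin
  have hgl : glEnergy Ω μ ε f (u 0) ≤ c₁ := by
    have : glEnergy Ω μ ε f (u 0) = glEnergy Ω μ ε f uin :=
      integral_congr_ae (glDensity_congr hΩ.isOpen hsol.initial)
    rw [this]; exact hin.energy_le
  have hE : modEnergy Ω μ ε f g (xiField φ δ₀ (range (γ 0)) (U 0)) (u 0) ≤ c₁ * ε := by
    rw [modEnergy_congr hΩ.isOpen hsol.initial]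
    have h1 := hin.modEnergy_le
    have h2 : 0 ≤ ∫ x in thickening δ₀ (range (γ 0)), |psi g uin x - (U 0).indicator 1 x|
        * |sdist (range (γ 0)) (U 0) x| := integral_nonneg fun x => by positivity
    linarith
  obtain ⟨h1, h2, h3⟩ := h.stability_dissipation hW hc hK hC hc0.le hg hS.2 hgl hE
    (A := c₁ + B * S) (by rw [hB])
  refine ⟨h1, h2, fun t ht => (h3 t ht).trans ?_⟩
  have h7 : c₁ + B * S ≤ Real.exp (c₁ + B * S) := by linarith [Real.add_one_le_exp (c₁ + B * S)]
  have h8 : (5 : ℝ) ≤ Real.exp 5 := by linarith [Real.add_one_le_exp (5 : ℝ)]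
  have h9 : 5 * ((c₁ + B * S) * Real.exp ((C + 1) * S)) ≤ Real.exp ((1 + S) * (6 + c₁ + B + C)) := by
    have hS0 := hS.1.le
    calc 5 * ((c₁ + B * S) * Real.exp ((C + 1) * S))
        ≤ Real.exp 5 * (Real.exp (c₁ + B * S) * Real.exp ((C + 1) * S)) := by gcongr
      _ = Real.exp (5 + (c₁ + B * S + (C + 1) * S)) := by simp only [Real.exp_add]
      _ ≤ _ := Real.exp_le_exp.2 (by nlinarith [mul_nonneg hS0 hc₁.le, mul_nonneg hS0 hC])
  exact h9

/-! ### The nearest-point projection -/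

variable {r r₀ δ₀ T : ℝ} {x : Plane}

section Projection

variable {J : Set Plane}

theorem HasSmoothProjection.spec (h : HasSmoothProjection J r₀) (hx : x ∈ thickening r₀ J) :
    nearestPt J x ∈ J ∧ dist x (nearestPt J x) = infDist x J := by
  have hex : ∃ y ∈ J, dist x y = infDist x J := (h.unique x hx).exists
  unfold nearestPt
  rw [dif_pos hex]
  exact hex.choose_spec

theorem HasSmoothProjection.eq (h : HasSmoothProjection J r₀) {x y : Plane} (hx : x ∈ thickening r₀ J)
    (hy : y ∈ J) (hd : dist x y = infDist x J) : nearestPt J x = y :=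
  (h.unique x hx).unique (h.spec hx) ⟨hy, hd⟩

theorem HasSmoothProjection.fix (h : HasSmoothProjection J r₀) (hr : 0 < r₀) {y : Plane} (hy : y ∈ J) :
    nearestPt J y = y :=
  h.eq (self_subset_thickening hr J hy) hy (by rw [dist_self, infDist_zero_of_mem hy])

theorem HasSmoothProjection.contDiffAt (h : HasSmoothProjection J r₀)
    (hx : x ∈ thickening r₀ J) : ContDiffAt ℝ ∞ (nearestPt J) x :=
  h.smooth.contDiffAt (isOpen_thickening.mem_nhds hx)

theorem HasSmoothProjection.hasFDerivAt (h : HasSmoothProjection J r₀)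
    (hx : x ∈ thickening r₀ J) : HasFDerivAt (nearestPt J) (fderiv ℝ (nearestPt J) x) x :=
  ((h.contDiffAt hx).differentiableAt (by simp)).hasFDerivAt

theorem HasSmoothProjection.inner_fderiv (h : HasSmoothProjection J r₀)
    (hx : x ∈ thickening r₀ J) (v : Plane) :
    inner ℝ (x - nearestPt J x) (fderiv ℝ (nearestPt J) x v) = 0 := by
  have hl : HasDerivAt (fun s : ℝ => x + s • v) v 0 := by
    simpa using ((hasDerivAt_id (0 : ℝ)).smul_const v).const_add x
  have h0 : x + (0 : ℝ) • v = x := by simp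
  have hP : HasDerivAt (fun s : ℝ => nearestPt J (x + s • v)) (fderiv ℝ (nearestPt J) x v) 0 := by
    have h1 := h.hasFDerivAt hx
    rw [← h0] at h1
    have h2 := h1.comp_hasDerivAt (0 : ℝ) hl
    rw [h0] at h2
    exact h2
  have hq := (hP.const_sub x).norm_sq
  rw [h0] at hq
  have hmin : IsLocalMin (fun s : ℝ => ‖x - nearestPt J (x + s • v)‖ ^ 2) 0 := by
    have hmem : ∀ᶠ s in 𝓝 (0 : ℝ), x + s • v ∈ thickening r₀ J :=
      hl.continuousAt.eventually (by beta_reduce; rw [h0]; exact isOpen_thickening.mem_nhds hx)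
    filter_upwards [hmem] with s hs
    rw [h0]
    refine pow_le_pow_left₀ (norm_nonneg _) ?_ 2
    rw [← dist_eq_norm, ← dist_eq_norm, (h.spec hx).2]
    exact infDist_le_dist_of_mem (h.spec hs).1
  have := hmin.hasDerivAt_eq_zero hq
  rw [inner_neg_right] at this
  linarith

theorem HasSmoothProjection.fderiv_symm (h : HasSmoothProjection J r₀)
    (hx : x ∈ thickening r₀ J) (v w : Plane) :
    inner ℝ (fderiv ℝ (nearestPt J) x v) w = inner ℝ (fderiv ℝ (nearestPt J) x w) v := by
  have hq : ContDiffAt ℝ ∞ (fun y => ‖y - nearestPt J y‖ ^ 2 / 2) x :=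
    ((contDiffAt_id.sub (h.contDiffAt hx)).norm_sq ℝ).div_const 2
  have hd : ∀ y ∈ thickening r₀ J, fderiv ℝ (fun y => ‖y - nearestPt J y‖ ^ 2 / 2) y
      = innerSL ℝ (y - nearestPt J y) := fun y hy => by
    have h1 := (((hasFDerivAt_id y).sub (h.hasFDerivAt hy)).norm_sq.mul_const (2⁻¹ : ℝ)).fderiv
    simp only [id, Pi.sub_apply, ← div_eq_mul_inv] at h1
    rw [h1]
    ext z
    have := h.inner_fderiv hy z
    simp only [smul_apply, ContinuousLinearMap.comp_apply, sub_apply,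
      ContinuousLinearMap.id_apply, innerSL_apply_apply, inner_sub_right, this, smul_eq_mul]
    ring
  have hsym := hq.isSymmSndFDerivAt (by simpa using ENat.LEInfty.out) v w
  have he : fderiv ℝ (fun y => ‖y - nearestPt J y‖ ^ 2 / 2) =ᶠ[𝓝 x]
      fun y => innerSL ℝ (y - nearestPt J y) :=
    Filter.eventuallyEq_of_mem (isOpen_thickening.mem_nhds hx) hd
  have h2 : fderiv ℝ (fun y => innerSL ℝ (y - nearestPt J y)) x
      = (innerSL ℝ).comp (ContinuousLinearMap.id ℝ Plane - fderiv ℝ (nearestPt J) x) :=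
    ((innerSL ℝ (E := Plane)).hasFDerivAt.comp x ((hasFDerivAt_id x).sub (h.hasFDerivAt hx))).fderiv
  rw [he.fderiv_eq, h2] at hsym
  simp only [ContinuousLinearMap.comp_apply, sub_apply,
      ContinuousLinearMap.id_apply, innerSL_apply_apply, inner_sub_left] at hsym
  rw [real_inner_comm v w] at hsym
  linarith

theorem HasSmoothProjection.fderiv_normal (h : HasSmoothProjection J r₀)
    (hx : x ∈ thickening r₀ J) : fderiv ℝ (nearestPt J) x (x - nearestPt J x) = 0 := by
  refine ext_inner_right ℝ fun w => ?_
  rw [h.fderiv_symm hx, inner_zero_left, real_inner_comm, h.inner_fderiv hx]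

theorem HasSmoothProjection.fderiv_idem (h : HasSmoothProjection J r₀) (hr : 0 < r₀) {y : Plane}
    (hy : y ∈ J) (v : Plane) : fderiv ℝ (nearestPt J) y (fderiv ℝ (nearestPt J) y v)
      = fderiv ℝ (nearestPt J) y v := by
  have hy' : y ∈ thickening r₀ J := self_subset_thickening hr J hy
  have h1 := h.hasFDerivAt hy'
  have h2 : HasFDerivAt (nearestPt J) (fderiv ℝ (nearestPt J) y) (nearestPt J y) := by
    rwa [h.fix hr hy]
  have h3 := h2.comp y h1
  have h4 : nearestPt J ∘ nearestPt J =ᶠ[𝓝 y] nearestPt J := by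
    filter_upwards [isOpen_thickening.mem_nhds hy'] with x hx
    exact h.fix hr (h.spec hx).1
  have h5 := (h1.congr_of_eventuallyEq h4).unique h3
  exact (congrArg (fun A : Plane →L[ℝ] Plane => A v) h5).symm

theorem HasSmoothProjection.fderiv_perp (h : HasSmoothProjection J r₀) (hr : 0 < r₀)
    (hJ : interior J = ∅) {y n : Plane} (hy : y ∈ J) (hn : ‖n‖ = 1)
    (ht : fderiv ℝ (nearestPt J) y (perp n) = perp n) : fderiv ℝ (nearestPt J) y n = 0 := by
  have hy' : y ∈ thickening r₀ J := self_subset_thickening hr J hy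
  obtain ⟨A, hA⟩ : ∃ A, A = fderiv ℝ (nearestPt J) y := ⟨_, rfl⟩
  have hid := h.fderiv_idem hr hy n
  have hsy := h.fderiv_symm hy' n (perp n)
  rw [ht, real_inner_comm, real_inner_comm n, inner_perp_self] at hsy
  obtain ⟨c, hc⟩ : ∃ c : ℝ, c = inner ℝ n (fderiv ℝ (nearestPt J) y n) := ⟨_, rfl⟩
  have h1 : fderiv ℝ (nearestPt J) y n = c • n := by
    have := frame_expand hn (fderiv ℝ (nearestPt J) y n)
    rw [hsy, zero_smul, add_zero, ← hc] at this
    exact this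
  have hn0 : n ≠ 0 := by intro h0; rw [h0, norm_zero] at hn; exact zero_ne_one hn
  rw [h1, map_smul, h1, smul_smul] at hid
  have hcc : c * c = c := smul_left_injective ℝ hn0 hid
  have hc01 : c = 0 ∨ c = 1 := by
    have : c * (c - 1) = 0 := by linarith
    rcases mul_eq_zero.1 this with h2 | h2
    · exact Or.inl h2
    · exact Or.inr (by linarith)
  rcases hc01 with h2 | h2
  · rw [h1, h2, zero_smul]
  · exfalso
    have hI : fderiv ℝ (nearestPt J) y = ContinuousLinearMap.id ℝ Plane := by
      ext1 v
      rw [frame_expand hn v, map_add, map_smul, map_smul, h1, h2, ht, one_smul]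
      rfl
    have hs : HasStrictFDerivAt (nearestPt J) (ContinuousLinearMap.id ℝ Plane) y := by
      rw [← hI]; exact (h.contDiffAt hy').hasStrictFDerivAt (by simp)
    have hmap := hs.map_nhds_eq_of_surj (by
      rw [LinearMap.range_eq_top]; exact fun v => ⟨v, rfl⟩)
    rw [h.fix hr hy] at hmap
    have hJn : J ∈ 𝓝 y := by
      rw [← hmap, mem_map]
      filter_upwards [isOpen_thickening.mem_nhds hy'] with x hx
      exact (h.spec hx).1
    have := mem_interior_iff_mem_nhds.2 hJn
    rw [hJ] at this
    exact this

/-- The normal segments are the fibres of the projection, up to the radius of the tube. -/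
theorem HasSmoothProjection.eq_of_normal (h : HasSmoothProjection J r₀) {y n : Plane}
    (hy : y ∈ J) (hn : ‖n‖ = 1) (hker : fderiv ℝ (nearestPt J) y n = 0)
    (hpr : ∀ v, inner ℝ v (fderiv ℝ (nearestPt J) y v) ≤ ‖v‖ ^ 2)
    (hr0 : 0 ≤ r) (hr : r < r₀) : nearestPt J (y + r • n) = y := by
  have hmem : ∀ s : ℝ, |s| < r₀ → y + s • n ∈ thickening r₀ J := fun s hs => by
    rw [mem_thickening_iff]
    exact ⟨y, hy, by rw [dist_eq_norm, add_sub_cancel_left, norm_smul, hn, mul_one]; exact hs⟩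
  have hr₀ : 0 < r₀ := hr0.trans_lt hr
  obtain ⟨e, he⟩ : ∃ e : ℝ → Plane, e = fun s => nearestPt J (y + s • n) - y := ⟨_, rfl⟩
  have hline : ∀ s : ℝ, HasDerivAt (fun s : ℝ => y + s • n) n s := fun s => by
    simpa using ((hasDerivAt_id s).smul_const n).const_add y
  have hed : ∀ s : ℝ, |s| < r₀ → HasDerivAt e (fderiv ℝ (nearestPt J) (y + s • n) n) s := fun s hs => by
    rw [he]
    exact ((h.hasFDerivAt (hmem s hs)).comp_hasDerivAt s (hline s)).sub_const y
  have he0 : e 0 = 0 := by rw [he]; simp [h.fix hr₀ hy]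
  have hode : ∀ s : ℝ, |s| < r₀ → s • fderiv ℝ (nearestPt J) (y + s • n) n
      = fderiv ℝ (nearestPt J) (y + s • n) (e s) := fun s hs => by
    have h1 := h.fderiv_normal (hmem s hs)
    have h2 : y + s • n - nearestPt J (y + s • n) = s • n - e s := by rw [he]; beta_reduce; abel
    rw [h2, map_sub, map_smul, sub_eq_zero] at h1
    exact h1
  have habs : ∀ s ∈ Icc 0 r, |s| < r₀ := fun s hs => by
    rw [abs_of_nonneg hs.1]; exact hs.2.trans_lt hr
  obtain ⟨L, hL⟩ : ∃ L : ℝ, ∀ s ∈ Icc 0 r, ‖fderiv ℝ (nearestPt J) (y + s • n)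
      - fderiv ℝ (nearestPt J) y‖ ≤ L * s := by
    have hcd : ContDiffOn ℝ 1 (fun s : ℝ => fderiv ℝ (nearestPt J) (y + s • n)) (Icc 0 r) :=
      (((h.smooth.fderiv_of_isOpen isOpen_thickening (m := 1) (by norm_cast)).comp
        (s := Icc 0 r) (f := fun s : ℝ => y + s • n) (by fun_prop) fun s hs => hmem s (habs s hs)))
    obtain ⟨L, hL⟩ := hcd.exists_lipschitzOnWith one_ne_zero (convex_Icc 0 r) isCompact_Icc
    refine ⟨L, fun s hs => ?_⟩
    have := hL.dist_le_mul s hs 0 ⟨le_rfl, hr0⟩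
    rwa [dist_eq_norm, Real.dist_eq, sub_zero, abs_of_nonneg hs.1, zero_smul, add_zero] at this
  obtain ⟨E, hE⟩ : ∃ E, E = dslope e 0 := ⟨_, rfl⟩
  have hE0 : E 0 = 0 := by
    have := (hed 0 (by simpa using hr₀)).deriv
    rw [hE, dslope_same, this, zero_smul, add_zero, hker]
  have hEs : ∀ s, s ≠ 0 → E s = s⁻¹ • e s := fun s hs => by
    rw [hE, dslope_of_ne _ hs, slope_def_module, he0, sub_zero, sub_zero]
  have hEd : ∀ s ∈ Ioo 0 r, HasDerivAt E (s⁻¹ • (fderiv ℝ (nearestPt J) (y + s • n) (E s) - E s)) s := by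
    intro s hs
    have hs0 := hs.1.ne'
    have h1 := (hasDerivAt_inv hs0).smul (hed s (habs s (Ioo_subset_Icc_self hs)))
    have h2 : HasDerivAt E (s⁻¹ • fderiv ℝ (nearestPt J) (y + s • n) n + -(s ^ 2)⁻¹ • e s) s := by
      refine h1.congr_of_eventuallyEq ?_
      filter_upwards [isOpen_ne.mem_nhds hs0] with z hz
      exact hEs z hz
    refine h2.congr_deriv ?_
    have h3 := hode s (habs s (Ioo_subset_Icc_self hs))
    have h4 : fderiv ℝ (nearestPt J) (y + s • n) n = fderiv ℝ (nearestPt J) (y + s • n) (E s) := by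
      rw [hEs s hs0, map_smul, ← h3, smul_smul, inv_mul_cancel₀ hs0, one_smul]
    rw [h4, smul_sub, hEs s hs0, smul_smul, sub_eq_add_neg, neg_smul, sq, mul_inv]
  have hEc : ContinuousOn E (Icc 0 r) := by
    intro s hs
    rcases eq_or_ne s 0 with h0 | h0
    · rw [h0, hE]
      exact (continuousAt_dslope_same.2 (hed 0 (by simpa using hr₀)).differentiableAt).continuousWithinAt
    · rw [hE]
      exact ((continuousAt_dslope_of_ne h0).2 (hed s (habs s hs)).continuousAt).continuousWithinAt
  have hanti : AntitoneOn (fun s => Real.exp (-(2 * L * s)) * ‖E s‖ ^ 2) (Icc 0 r) := by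
    have hd : ∀ s ∈ Ioo 0 r, HasDerivAt (fun s => Real.exp (-(2 * L * s)) * ‖E s‖ ^ 2)
        (Real.exp (-(2 * L * s)) * (2 * (inner ℝ (E s)
          (s⁻¹ • (fderiv ℝ (nearestPt J) (y + s • n) (E s) - E s)) - L * ‖E s‖ ^ 2))) s := fun s hs => by
      have h1 : HasDerivAt (fun s => Real.exp (-(2 * L * s))) (Real.exp (-(2 * L * s)) * (-(2 * L * 1))) s :=
        (((hasDerivAt_id s).const_mul (2 * L)).neg).exp
      refine (h1.mul (hEd s hs).norm_sq).congr_deriv ?_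
      ring
    refine antitoneOn_of_deriv_nonpos (convex_Icc 0 r) ?_ ?_ ?_
    · exact ContinuousOn.mul (by fun_prop) (hEc.norm.pow 2)
    · rw [interior_Icc]
      exact fun s hs => (hd s hs).differentiableAt.differentiableWithinAt
    · rw [interior_Icc]
      intro s hs
      rw [(hd s hs).deriv]
      refine mul_nonpos_of_nonneg_of_nonpos (Real.exp_nonneg _) ?_
      have hs0 := hs.1
      have h1 := hpr (E s)
      have h2 : inner ℝ (E s) ((fderiv ℝ (nearestPt J) (y + s • n) - fderiv ℝ (nearestPt J) y) (E s))
          ≤ L * s * ‖E s‖ ^ 2 := by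
        refine (real_inner_le_norm _ _).trans ?_
        have h3 := (ContinuousLinearMap.le_opNorm (fderiv ℝ (nearestPt J) (y + s • n)
          - fderiv ℝ (nearestPt J) y) (E s)).trans (mul_le_mul_of_nonneg_right
            (hL s (Ioo_subset_Icc_self hs)) (norm_nonneg _))
        have h4 := mul_le_mul_of_nonneg_left h3 (norm_nonneg (E s))
        linarith
      rw [sub_apply, inner_sub_right] at h2
      rw [real_inner_smul_right, inner_sub_right, real_inner_self_eq_norm_sq]
      have h5 : inner ℝ (E s) (fderiv ℝ (nearestPt J) (y + s • n) (E s)) - ‖E s‖ ^ 2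
          ≤ L * s * ‖E s‖ ^ 2 := by linarith
      have h6 := mul_le_mul_of_nonneg_left h5 (inv_nonneg.2 hs0.le)
      have h7 : s⁻¹ * (L * s * ‖E s‖ ^ 2) = L * ‖E s‖ ^ 2 := by field_simp
      linarith
  have hle := hanti ⟨le_rfl, hr0⟩ ⟨hr0, le_rfl⟩ hr0
  simp only [hE0, norm_zero, ne_eq, OfNat.ofNat_ne_zero, not_false_eq_true, zero_pow, mul_zero] at hle
  have hEr : E r = 0 := by
    have h1 : ‖E r‖ ^ 2 ≤ 0 := by
      by_contra hcon
      push Not at hcon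
      exact absurd hle (not_le.2 (mul_pos (Real.exp_pos _) hcon))
    exact norm_eq_zero.1 (pow_eq_zero_iff two_ne_zero |>.1 (le_antisymm h1 (sq_nonneg _)))
  have her : e r = 0 := by
    rcases eq_or_ne r 0 with h0 | h0
    · rw [h0, he0]
    · rw [hEs r h0, smul_eq_zero] at hEr
      exact hEr.resolve_left (inv_ne_zero h0)
  rw [he] at her
  exact sub_eq_zero.1 her

end Projection

/-! ### Normal coordinates around a closed curve -/

/-- A plane curve with a unit normal field, a smooth nearest-point projection on the tube of
radius `r₀` around it, and an enclosed domain. -/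
structure NormalTube (c N : ℝ → Plane) (U : Set Plane) (r₀ : ℝ) : Prop where
  pos : 0 < r₀
  differentiable : Differentiable ℝ c
  immersed : ∀ s, deriv c s ≠ 0
  norm_normal : ∀ s, ‖N s‖ = 1
  inner_normal : ∀ s, inner ℝ (N s) (deriv c s) = 0
  proj : HasSmoothProjection (range c) r₀
  dom : IsEnclosedDomain U (range c)

namespace NormalTube

variable {c N : ℝ → Plane} {U : Set Plane}

theorem neg (h : NormalTube c N U r₀) : NormalTube c (fun s => -N s) U r₀ :=
  { h with
    norm_normal := fun s => by rw [norm_neg, h.norm_normal]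
    inner_normal := fun s => by rw [inner_neg_left, h.inner_normal, neg_zero] }

theorem mem_tube (h : NormalTube c N U r₀) (s : ℝ) (hr : |r| < r₀) :
    c s + r • N s ∈ thickening r₀ (range c) := by
  rw [mem_thickening_iff]
  exact ⟨c s, mem_range_self s, by
    rw [dist_eq_norm, add_sub_cancel_left, norm_smul, h.norm_normal, mul_one]; exact hr⟩

theorem tangent_eq (h : NormalTube c N U r₀) (s : ℝ) :
    deriv c s = inner ℝ (perp (N s)) (deriv c s) • perp (N s) := by
  have := frame_expand (h.norm_normal s) (deriv c s)
  rwa [h.inner_normal, zero_smul, zero_add] at this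

theorem fderiv_tangent (h : NormalTube c N U r₀) (s : ℝ) :
    fderiv ℝ (nearestPt (range c)) (c s) (perp (N s)) = perp (N s) := by
  have h1 := (h.proj.hasFDerivAt (self_subset_thickening h.pos _ (mem_range_self s))).comp_hasDerivAt s
    (h.differentiable s).hasDerivAt
  have h2 : nearestPt (range c) ∘ c = c := funext fun s => h.proj.fix h.pos (mem_range_self s)
  rw [h2] at h1
  have h3 := h1.unique (h.differentiable s).hasDerivAt
  have hne : inner ℝ (perp (N s)) (deriv c s) ≠ 0 := fun h0 => by
    have := h.tangent_eq s
    rw [h0, zero_smul] at this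
    exact h.immersed s this
  rw [h.tangent_eq s, map_smul] at h3
  exact smul_right_injective _ hne h3

theorem interior_curve (h : NormalTube c N U r₀) : interior (range c) = ∅ := by
  rw [← h.dom.frontier_eq, ← frontier_compl]
  exact interior_frontier h.dom.isOpen.isClosed_compl

theorem proj_of_nonneg (h : NormalTube c N U r₀) (s : ℝ) (hr0 : 0 ≤ r) (hr : r < r₀) :
    nearestPt (range c) (c s + r • N s) = c s := by
  have hker := h.proj.fderiv_perp h.pos h.interior_curve (mem_range_self s) (h.norm_normal s)
    (h.fderiv_tangent s)
  refine h.proj.eq_of_normal (mem_range_self s) (h.norm_normal s) hker (fun v => ?_) hr0 hr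
  have h1 : fderiv ℝ (nearestPt (range c)) (c s) v = inner ℝ (perp (N s)) v • perp (N s) := by
    conv_lhs => rw [frame_expand (h.norm_normal s) v]
    rw [map_add, map_smul, map_smul, hker, h.fderiv_tangent, smul_zero, zero_add]
  rw [h1, real_inner_smul_right, frame_norm_sq (h.norm_normal s) v]
  have h2 := sq_nonneg (inner ℝ (N s) v : ℝ)
  have h3 : (inner ℝ (perp (N s)) v : ℝ) * inner ℝ v (perp (N s)) = inner ℝ (perp (N s)) v ^ 2 := by
    rw [real_inner_comm (perp (N s)) v, sq]
  linarith

theorem proj_eq (h : NormalTube c N U r₀) (s : ℝ) (hr : |r| < r₀) :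
    nearestPt (range c) (c s + r • N s) = c s := by
  rcases le_total 0 r with h0 | h0
  · exact h.proj_of_nonneg s h0 ((le_abs_self r).trans_lt hr)
  · have := h.neg.proj_of_nonneg s (neg_nonneg.2 h0) ((neg_le_abs r).trans_lt hr)
    rwa [smul_neg, neg_smul, neg_neg] at this

theorem infDist_eq (h : NormalTube c N U r₀) (s : ℝ) (hr : |r| < r₀) :
    infDist (c s + r • N s) (range c) = |r| := by
  have := (h.proj.spec (h.mem_tube s hr)).2
  rw [h.proj_eq s hr, dist_eq_norm, add_sub_cancel_left, norm_smul, h.norm_normal, mul_one] at this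
  exact this.symm

theorem speed_ne_zero (h : NormalTube c N U r₀) (s : ℝ) : inner ℝ (perp (N s)) (deriv c s) ≠ (0 : ℝ) := by
  intro h0
  have := h.tangent_eq s
  rw [h0, zero_smul] at this
  exact h.immersed s this

theorem exists_coord (h : NormalTube c N U r₀) (hx : infDist x (range c) < r₀) :
    ∃ s r, |r| = infDist x (range c) ∧ x = c s + r • N s := by
  have hxt : x ∈ thickening r₀ (range c) := by
    rwa [mem_thickening_iff_infDist_lt (range_nonempty c)]
  obtain ⟨⟨s, hs⟩, hd⟩ := h.proj.spec hxt
  rw [← hs] at hd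
  have hq := ((h.differentiable s).hasDerivAt.const_sub x).norm_sq
  have hmin : IsLocalMin (fun s : ℝ => ‖x - c s‖ ^ 2) s := by
    refine Eventually.of_forall fun s' => pow_le_pow_left₀ (norm_nonneg _) ?_ 2
    rw [← dist_eq_norm, ← dist_eq_norm, hd]
    exact infDist_le_dist_of_mem (mem_range_self s')
  have h0 := hmin.hasDerivAt_eq_zero hq
  rw [inner_neg_right, h.tangent_eq s, real_inner_smul_right] at h0
  have h1 : inner ℝ (x - c s) (perp (N s)) = (0 : ℝ) := by
    have : inner ℝ (perp (N s)) (deriv c s) * inner ℝ (x - c s) (perp (N s)) = (0 : ℝ) := by linarith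
    exact (mul_eq_zero.1 this).resolve_left (h.speed_ne_zero s)
  have h2 := frame_expand (h.norm_normal s) (x - c s)
  rw [real_inner_comm _ (perp (N s)), h1, zero_smul, add_zero] at h2
  refine ⟨s, inner ℝ (N s) (x - c s), ?_, ?_⟩
  · rw [← hd, dist_eq_norm]
    conv_rhs => rw [h2]
    rw [norm_smul, h.norm_normal, mul_one, Real.norm_eq_abs]
  · rw [← h2]; abel

theorem disjoint_dom (h : NormalTube c N U r₀) (s : ℝ) : c s ∉ U := fun hs => by
  have h1 : c s ∈ frontier U := by rw [h.dom.frontier_eq]; exact mem_range_self s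
  rw [h.dom.isOpen.frontier_eq] at h1
  exact h1.2 hs

theorem side_subset (h : NormalTube c N U r₀) (hN : Continuous N) :
    (∀ s, ∀ r, 0 < r → r < r₀ → c s + r • N s ∈ U) ∨
      (∀ s, ∀ r, 0 < r → r < r₀ → c s + r • N s ∉ U) := by
  obtain ⟨A, hA⟩ : ∃ A, A = (fun p : ℝ × ℝ => c p.1 + p.2 • N p.1) '' (univ ×ˢ Ioo 0 r₀) := ⟨_, rfl⟩
  have hpre : IsPreconnected A := by
    rw [hA]
    refine (isPreconnected_univ.prod isPreconnected_Ioo).image _ (Continuous.continuousOn ?_)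
    exact (h.differentiable.continuous.comp continuous_fst).add
      (continuous_snd.smul (hN.comp continuous_fst))
  have hmem : ∀ s r, 0 < r → r < r₀ → c s + r • N s ∈ A := fun s r h0 h1 => by
    rw [hA]; exact ⟨(s, r), ⟨mem_univ _, h0, h1⟩, rfl⟩
  have hsub : A ⊆ U ∪ (closure U)ᶜ := by
    rw [hA]
    rintro _ ⟨⟨s, r⟩, ⟨-, h0, h1⟩, rfl⟩
    by_cases hU : c s + r • N s ∈ U
    · exact Or.inl hU
    · refine Or.inr fun hcl => ?_
      have h2 : c s + r • N s ∈ frontier U := by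
        rw [h.dom.isOpen.frontier_eq]; exact ⟨hcl, hU⟩
      rw [h.dom.frontier_eq] at h2
      have h3 := h.infDist_eq s (r := r) (by rw [abs_of_pos h0]; exact h1)
      rw [infDist_zero_of_mem h2, abs_of_pos h0] at h3
      exact h0.ne h3
  rcases hpre.subset_or_subset h.dom.isOpen isClosed_closure.isOpen_compl
    (disjoint_compl_right.mono_left subset_closure) hsub with h1 | h1
  · exact Or.inl fun s r h2 h3 => h1 (hmem s r h2 h3)
  · exact Or.inr fun s r h2 h3 hU => h1 (hmem s r h2 h3) (subset_closure hU)

/-- Exactly one side of the curve lies in the enclosed domain. -/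
theorem orientation (h : NormalTube c N U r₀) (hN : Continuous N) :
    (∀ s r, 0 < r → r < r₀ → c s + r • N s ∈ U ∧ c s - r • N s ∉ U) ∨
      (∀ s r, 0 < r → r < r₀ → c s - r • N s ∈ U ∧ c s + r • N s ∉ U) := by
  have hm := h.neg.side_subset hN.neg
  simp only [smul_neg, ← sub_eq_add_neg] at hm
  rcases h.side_subset hN with hp | hp <;> rcases hm with hm | hm
  · exfalso
    have hopen : IsOpen (closure U) := by
      rw [closure_eq_self_union_frontier, h.dom.frontier_eq, isOpen_iff_mem_nhds]
      rintro x (hx | ⟨s₀, rfl⟩)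
      · exact mem_of_superset (h.dom.isOpen.mem_nhds hx) subset_union_left
      · refine mem_of_superset (ball_mem_nhds (c s₀) h.pos) fun y hy => ?_
        obtain ⟨s, r, hr, rfl⟩ := h.exists_coord
          ((infDist_le_dist_of_mem (mem_range_self s₀)).trans_lt (mem_ball.1 hy))
        have hr' : |r| < r₀ := by
          rw [hr]; exact (infDist_le_dist_of_mem (mem_range_self s₀)).trans_lt (mem_ball.1 hy)
        rcases lt_trichotomy r 0 with h0 | h0 | h0
        · left
          have := hm s (-r) (neg_pos.2 h0) (by rwa [abs_of_neg h0] at hr')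
          rwa [neg_smul, sub_neg_eq_add] at this
        · right; rw [h0, zero_smul, add_zero]; exact mem_range_self s
        · left; exact hp s r h0 (by rwa [abs_of_pos h0] at hr')
    have huniv : closure U = univ := by
      refine IsClopen.eq_univ ⟨isClosed_closure, hopen⟩ ?_
      exact h.dom.isConnected.nonempty.mono subset_closure
    have hb := h.dom.isBounded.closure
    rw [huniv] at hb
    exact NormedSpace.unbounded_univ ℝ Plane hb
  · exact Or.inl fun s r h0 h1 => ⟨hp s r h0 h1, hm s r h0 h1⟩
  · exact Or.inr fun s r h0 h1 => ⟨hm s r h0 h1, hp s r h0 h1⟩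
  · exfalso
    have h1 : c 0 ∈ frontier U := by rw [h.dom.frontier_eq]; exact mem_range_self 0
    obtain ⟨x, hx, hxd⟩ := Metric.mem_closure_iff.1 h1.1 r₀ h.pos
    rw [dist_comm] at hxd
    have hlt := (infDist_le_dist_of_mem (mem_range_self 0)).trans_lt hxd
    obtain ⟨s, r, hr, rfl⟩ := h.exists_coord hlt
    rw [← hr] at hlt
    rcases lt_trichotomy r 0 with h0 | h0 | h0
    · refine hm s (-r) (neg_pos.2 h0) (by rwa [abs_of_neg h0] at hlt) ?_
      rwa [neg_smul, sub_neg_eq_add]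
    · rw [h0, zero_smul, add_zero] at hx
      exact h.disjoint_dom s hx
    · exact hp s r h0 (by rwa [abs_of_pos h0] at hlt) hx

end NormalTube

theorem IsEnclosedDomain.sdist_sub_le {J U : Set Plane} (h : IsEnclosedDomain U J) (x y : Plane) :
    sdist J U x - sdist J U y ≤ dist x y := by
  unfold sdist
  have hxy := infDist_le_infDist_add_dist (s := J) (x := x) (y := y)
  have hyx := infDist_le_infDist_add_dist (s := J) (x := y) (y := x)
  rw [dist_comm] at hyx
  have h0 := infDist_nonneg (x := x) (s := J)
  have h1 := infDist_nonneg (x := y) (s := J)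
  have hd := dist_nonneg (x := x) (y := y)
  split_ifs with hx hy hy
  · linarith
  · obtain ⟨z, hz, hzJ⟩ : ∃ z ∈ segment ℝ x y, z ∈ frontier U := by
      by_contra! hcon
      rcases (convex_segment x y).isPreconnected.subset_or_subset h.isOpen
        isClosed_closure.isOpen_compl (disjoint_compl_right.mono_left subset_closure)
        (fun z hz => by
          by_cases hzU : z ∈ U
          · exact Or.inl hzU
          · refine Or.inr fun hcl => hcon z hz ?_
            rw [h.isOpen.frontier_eq]
            exact ⟨hcl, hzU⟩) with h1 | h1
      · exact hy (h1 (right_mem_segment ℝ x y))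
      · exact h1 (left_mem_segment ℝ x y) (subset_closure hx)
    rw [h.frontier_eq] at hzJ
    have h2 := infDist_le_dist_of_mem (x := x) hzJ
    have h3 := infDist_le_dist_of_mem (x := y) hzJ
    have h4 := dist_add_dist_of_mem_segment hz
    rw [dist_comm y] at h3
    linarith
  · linarith
  · linarith

/-- A normal tube whose normal points into the enclosed domain. -/
structure InnerTube (c N : ℝ → Plane) (U : Set Plane) (r₀ : ℝ) : Prop extends NormalTube c N U r₀ where
  inward : ∀ s r, 0 < r → r < r₀ → c s + r • N s ∈ U ∧ c s - r • N s ∉ U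

namespace InnerTube

variable {c N : ℝ → Plane} {U : Set Plane}

theorem sdist_eq (h : InnerTube c N U r₀) (s : ℝ) (hr : |r| < r₀) :
    sdist (range c) U (c s + r • N s) = r := by
  unfold sdist
  rw [h.infDist_eq s hr]
  rcases lt_trichotomy r 0 with h0 | h0 | h0
  · rw [abs_of_neg h0] at hr ⊢
    have := (h.inward s (-r) (neg_pos.2 h0) hr).2
    rw [neg_smul, sub_neg_eq_add] at this
    rw [if_neg this, neg_neg]
  · rw [h0]; simp
  · rw [abs_of_pos h0] at hr ⊢
    rw [if_pos (h.inward s r h0 hr).1]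

theorem hasFDerivAt_sdist (h : InnerTube c N U r₀) (s : ℝ) (hr : |r| < r₀) :
    HasFDerivAt (sdist (range c) U) (innerSL ℝ (N s)) (c s + r • N s) := by
  obtain ⟨ρ, hρ1, hρ2⟩ := exists_between hr
  have hρ : |ρ| < r₀ := by rwa [abs_of_pos ((abs_nonneg r).trans_lt hρ1)]
  have hρ' : |-ρ| < r₀ := by rwa [abs_neg]
  have hlt := abs_lt.1 hρ1
  have key : ∀ a : ℝ, 0 < a → ∀ σ : ℝ, σ ^ 2 = 1 → HasFDerivAt (fun y => ‖y - (c s + r • N s - (σ * a) • N s)‖)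
      (σ • innerSL ℝ (N s)) (c s + r • N s) := fun a ha σ hσ => by
    have h1 := ((hasFDerivAt_id (𝕜 := ℝ) (c s + r • N s)).sub_const (c s + r • N s - (σ * a) • N s)).norm_sq
    have h2 : c s + r • N s - (c s + r • N s - (σ * a) • N s) = (σ * a) • N s := by abel
    have h4 : ‖(σ * a) • N s‖ = a := by
      rw [norm_smul, h.norm_normal, mul_one, Real.norm_eq_abs, abs_mul, abs_of_pos ha]
      have h5 : |σ| = 1 := by rcases sq_eq_sq_iff_eq_or_eq_neg.1 (hσ.trans (one_pow 2).symm) with h6 | h6 <;> simp [h6]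
      rw [h5, one_mul]
    have h3 := h1.sqrt (by simp only [id]; rw [h2, h4]; positivity)
    simp only [id, Real.sqrt_sq (norm_nonneg _)] at h3
    rw [h2, h4] at h3
    refine h3.congr_fderiv ?_
    ext v
    simp only [smul_apply, ContinuousLinearMap.comp_apply, ContinuousLinearMap.id_apply,
      innerSL_apply_apply, real_inner_smul_left, smul_eq_mul, nsmul_eq_mul]
    field_simp
    push_cast
    ring
  have hlo : HasFDerivAt (fun y => ρ - ‖y - (c s + r • N s - (-1 * (ρ - r)) • N s)‖) (innerSL ℝ (N s))
      (c s + r • N s) := by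
    simpa using (key (ρ - r) (by linarith) (-1) (by norm_num)).const_sub ρ
  have hhi : HasFDerivAt (fun y => -ρ + ‖y - (c s + r • N s - (1 * (ρ + r)) • N s)‖) (innerSL ℝ (N s))
      (c s + r • N s) := by
    simpa using (key (ρ + r) (by linarith) 1 (by norm_num)).const_add (-ρ)
  have e1 : c s + r • N s - (-1 * (ρ - r)) • N s = c s + ρ • N s := by module
  have e2 : c s + r • N s - (1 * (ρ + r)) • N s = c s + (-ρ) • N s := by module
  rw [e1] at hlo
  rw [e2] at hhi
  have l1 : ∀ y, ρ - ‖y - (c s + ρ • N s)‖ ≤ sdist (range c) U y := fun y => by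
    have := h.dom.sdist_sub_le (c s + ρ • N s) y
    rw [h.sdist_eq s hρ, dist_comm, dist_eq_norm] at this
    linarith
  have l2 : ∀ y, sdist (range c) U y ≤ -ρ + ‖y - (c s + (-ρ) • N s)‖ := fun y => by
    have := h.dom.sdist_sub_le y (c s + (-ρ) • N s)
    rw [h.sdist_eq s hρ', dist_eq_norm] at this
    linarith
  have v1 : ρ - ‖c s + r • N s - (c s + ρ • N s)‖ = r := by
    have : c s + r • N s - (c s + ρ • N s) = (r - ρ) • N s := by module
    rw [this, norm_smul, h.norm_normal, mul_one, Real.norm_eq_abs, abs_of_neg (by linarith)]; ring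
  have v2 : -ρ + ‖c s + r • N s - (c s + (-ρ) • N s)‖ = r := by
    have : c s + r • N s - (c s + (-ρ) • N s) = (r + ρ) • N s := by module
    rw [this, norm_smul, h.norm_normal, mul_one, Real.norm_eq_abs, abs_of_pos (by linarith)]; ring
  rw [hasFDerivAt_iff_isLittleO] at hlo hhi ⊢
  have hsum := hlo.norm_left.add hhi.norm_left
  refine (Asymptotics.IsBigO.of_bound 1 (.of_forall fun y => ?_)).trans_isLittleO hsum
  rw [h.sdist_eq s hr]
  simp only [v1, v2, one_mul]
  have a1 := l1 y
  have a2 := l2 y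
  obtain ⟨w, hw⟩ : ∃ w : ℝ, w = innerSL ℝ (N s) (y - (c s + r • N s)) := ⟨_, rfl⟩
  rw [← hw]
  simp only [Real.norm_eq_abs]
  refine le_trans ?_ (le_abs_self _)
  rw [abs_le]
  have b1 := neg_abs_le (ρ - ‖y - (c s + ρ • N s)‖ - r - w)
  have b2 := le_abs_self (-ρ + ‖y - (c s + (-ρ) • N s)‖ - r - w)
  have b3 := abs_nonneg (ρ - ‖y - (c s + ρ • N s)‖ - r - w)
  have b4 := abs_nonneg (-ρ + ‖y - (c s + (-ρ) • N s)‖ - r - w)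
  constructor <;> linarith

theorem gradient_sdist (h : InnerTube c N U r₀) (s : ℝ) (hr : |r| < r₀) :
    gradient (sdist (range c) U) (c s + r • N s) = N s := by
  refine HasGradientAt.gradient ?_
  rw [hasGradientAt_iff_hasFDerivAt]
  exact h.hasFDerivAt_sdist s hr

/-- Normal coordinates are non-degenerate throughout the tube. -/
theorem jacobian_ne_zero (h : InnerTube c N U r₀) (s : ℝ) {r w : ℝ} (hr : |r| < r₀)
    (hN : HasDerivAt N (w • perp (N s)) s) : inner ℝ (perp (N s)) (deriv c s) + r * w ≠ 0 := by
  intro h0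
  have h1 : HasDerivAt (fun s' => c s' + r • N s') (0 : Plane) s := by
    refine ((h.differentiable s).hasDerivAt.add (hN.const_smul r)).congr_deriv ?_
    conv_lhs => rw [h.tangent_eq s]
    rw [smul_smul, ← add_smul, h0, zero_smul]
  have h2 := (h.proj.hasFDerivAt (h.mem_tube s hr)).comp_hasDerivAt s h1
  rw [map_zero] at h2
  have h3 : nearestPt (range c) ∘ (fun s' => c s' + r • N s') = c := funext fun s' => h.proj_eq s' hr
  rw [h3] at h2
  exact h.immersed s h2.deriv

end InnerTube

/-! ### Smooth fields along an evolving curve -/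

section CurveField

variable {E : Type*} [NormedAddCommGroup E] [NormedSpace ℝ E] {h : ℝ → ℝ → E}

/-- Smooth functions of time and of the curve parameter. -/
def CurveField (T : ℝ) (h : ℝ → ℝ → E) : Prop :=
  ContDiffOn ℝ ∞ (uncurry h) (Icc 0 T ×ˢ univ)

/-- Derivative along the curve. -/
def dcurve (h : ℝ → ℝ → E) (t s : ℝ) : E := deriv (h t) s

/-- Time derivative at a fixed parameter. -/
def dclock (T : ℝ) (h : ℝ → ℝ → E) (t s : ℝ) : E :=
  derivWithin (fun t' => h t' s) (Icc 0 T) t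

theorem CurveField.hasDerivAt' (hh : CurveField T h) (ht : t ∈ Icc 0 T) (s : ℝ) :
    HasDerivAt (h t) (fderivWithin ℝ (uncurry h) (Icc 0 T ×ˢ univ) (t, s) (0, 1)) s := by
  have h1 := ((hh (t, s) ⟨ht, mem_univ s⟩).differentiableWithinAt (by simp)).hasFDerivWithinAt
  have h2 : HasDerivWithinAt (fun s' : ℝ => (t, s')) ((0 : ℝ), (1 : ℝ)) univ s :=
    ((hasDerivAt_const s t).prodMk (hasDerivAt_id s)).hasDerivWithinAt
  exact (h1.comp_hasDerivWithinAt s h2 fun s' _ => ⟨ht, mem_univ s'⟩).hasDerivAt univ_mem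

theorem CurveField.hasDerivAt (hh : CurveField T h) (ht : t ∈ Icc 0 T) (s : ℝ) :
    HasDerivAt (h t) (dcurve h t s) s :=
  (hh.hasDerivAt' ht s).differentiableAt.hasDerivAt

theorem CurveField.hasDerivWithinAt_time' (hh : CurveField T h) (ht : t ∈ Icc 0 T) (s : ℝ) :
    HasDerivWithinAt (fun t' => h t' s)
      (fderivWithin ℝ (uncurry h) (Icc 0 T ×ˢ univ) (t, s) (1, 0)) (Icc 0 T) t := by
  have h1 := ((hh (t, s) ⟨ht, mem_univ s⟩).differentiableWithinAt (by simp)).hasFDerivWithinAt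
  have h2 : HasDerivWithinAt (fun t' : ℝ => (t', s)) ((1 : ℝ), (0 : ℝ)) (Icc 0 T) t :=
    ((hasDerivAt_id t).prodMk (hasDerivAt_const t s)).hasDerivWithinAt
  have h3 : MapsTo (fun t' : ℝ => (t', s)) (Icc 0 T) (Icc 0 T ×ˢ univ) := fun t' ht' => ⟨ht', mem_univ s⟩
  exact h1.comp_hasDerivWithinAt t h2 h3

theorem CurveField.hasDerivAt_time (hh : CurveField T h) (ht : t ∈ Ioo 0 T) (s : ℝ) :
    HasDerivAt (fun t' => h t' s) (dclock T h t s) t :=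
  (hh.hasDerivWithinAt_time' (Ioo_subset_Icc_self ht) s).differentiableWithinAt.hasDerivWithinAt.hasDerivAt
    (Icc_mem_nhds ht.1 ht.2)

theorem CurveField.contDiffOn_fderivWithin (hT : 0 < T) (hh : CurveField T h) :
    ContDiffOn ℝ ∞ (fderivWithin ℝ (uncurry h) (Icc 0 T ×ˢ univ)) (Icc 0 T ×ˢ univ) :=
  hh.fderivWithin ((uniqueDiffOn_Icc hT).prod uniqueDiffOn_univ) (by norm_cast)

theorem CurveField.dcurve (hT : 0 < T) (hh : CurveField T h) : CurveField T (dcurve h) :=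
  ((hh.contDiffOn_fderivWithin hT).clm_apply contDiffOn_const).congr fun p hp =>
    (hh.hasDerivAt' hp.1 p.2).deriv

theorem CurveField.dclock (hT : 0 < T) (hh : CurveField T h) : CurveField T (dclock T h) :=
  ((hh.contDiffOn_fderivWithin hT).clm_apply contDiffOn_const).congr fun p hp =>
    (hh.hasDerivWithinAt_time' hp.1 p.2).derivWithin (uniqueDiffOn_Icc hT p.1 hp.1)

theorem CurveField.contDiffAt (hh : CurveField T h) (ht : t ∈ Ioo 0 T) (s : ℝ) :
    ContDiffAt ℝ ∞ (uncurry h) (t, s) :=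
  ContDiffOn.contDiffAt hh (prod_mem_nhds (Icc_mem_nhds ht.1 ht.2) univ_mem)

theorem CurveField.dcurve_eq (hh : CurveField T h) (ht : t ∈ Ioo 0 T) (s : ℝ) :
    AnisoGL.dcurve h t s = fderiv ℝ (uncurry h) (t, s) (0, 1) := by
  rw [← fderivWithin_of_mem_nhds (s := Icc 0 T ×ˢ univ)
    (prod_mem_nhds (Icc_mem_nhds ht.1 ht.2) univ_mem)]
  exact (hh.hasDerivAt' (Ioo_subset_Icc_self ht) s).deriv

theorem CurveField.dclock_eq (hh : CurveField T h) (ht : t ∈ Ioo 0 T) (s : ℝ) :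
    AnisoGL.dclock T h t s = fderiv ℝ (uncurry h) (t, s) (1, 0) := by
  rw [← fderivWithin_of_mem_nhds (s := Icc 0 T ×ˢ univ)
    (prod_mem_nhds (Icc_mem_nhds ht.1 ht.2) univ_mem)]
  exact (hh.hasDerivWithinAt_time' (Ioo_subset_Icc_self ht) s).derivWithin
    (uniqueDiffOn_Icc (ht.1.trans ht.2) t (Ioo_subset_Icc_self ht))

/-- Time and curve derivatives commute. -/
theorem CurveField.dclock_dcurve (hh : CurveField T h) (ht : t ∈ Ioo 0 T) (s : ℝ) :
    AnisoGL.dclock T (AnisoGL.dcurve h) t s = AnisoGL.dcurve (AnisoGL.dclock T h) t s := by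
  have hT := ht.1.trans ht.2
  have hd : HasFDerivAt (fderiv ℝ (uncurry h))
      (fderiv ℝ (fderiv ℝ (uncurry h)) (t, s)) (t, s) :=
    (((hh.contDiffAt ht s).fderiv_right (m := ∞) (by norm_cast)).differentiableAt (by simp)).hasFDerivAt
  have hsym := (hh.contDiffAt ht s).isSymmSndFDerivAt (by simpa using ENat.LEInfty.out) (1, 0) (0, 1)
  have h1 : HasFDerivAt (uncurry (AnisoGL.dcurve h))
      ((fderiv ℝ (fderiv ℝ (uncurry h)) (t, s)).flip (0, 1)) (t, s) := by
    refine (hd.clm_apply (hasFDerivAt_const ((0 : ℝ), (1 : ℝ)) (t, s))).congr_fderiv (by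
      ext <;> simp) |>.congr_of_eventuallyEq ?_
    filter_upwards [prod_mem_nhds (Ioo_mem_nhds ht.1 ht.2) univ_mem] with p hp
    exact hh.dcurve_eq hp.1 p.2
  have h2 : HasFDerivAt (uncurry (AnisoGL.dclock T h))
      ((fderiv ℝ (fderiv ℝ (uncurry h)) (t, s)).flip (1, 0)) (t, s) := by
    refine (hd.clm_apply (hasFDerivAt_const ((1 : ℝ), (0 : ℝ)) (t, s))).congr_fderiv (by
      ext <;> simp) |>.congr_of_eventuallyEq ?_
    filter_upwards [prod_mem_nhds (Ioo_mem_nhds ht.1 ht.2) univ_mem] with p hp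
    exact hh.dclock_eq hp.1 p.2
  rw [(hh.dcurve hT).dclock_eq ht, (hh.dclock hT).dcurve_eq ht, h1.fderiv, h2.fderiv]
  exact hsym

theorem CurveField.continuous (hh : CurveField T h) (ht : t ∈ Icc 0 T) : Continuous (h t) :=
  continuous_iff_continuousAt.2 fun s => (hh.hasDerivAt ht s).continuousAt

theorem CurveField.exists_bound (hh : CurveField T h) :
    ∃ K : ℝ, ∀ t ∈ Icc 0 T, ∀ s ∈ Icc (0 : ℝ) 1, ‖h t s‖ ≤ K := by
  obtain ⟨K, hK⟩ := (isCompact_Icc.prod isCompact_Icc).exists_bound_of_continuousOn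
    (ContDiffOn.continuousOn (hh.mono (prod_mono_right (subset_univ (Icc (0 : ℝ) 1)))))
  exact ⟨K, fun t ht s hs => hK (t, s) ⟨ht, hs⟩⟩

end CurveField

/-! ### Orientation of an evolving curve -/

/-- The unit normal `σ perp(c') / |c'|`. -/
def unitNormal (σ : ℝ) (γ : ℝ → ℝ → Plane) (t s : ℝ) : Plane :=
  (σ * ‖dcurve γ t s‖⁻¹) • perp (dcurve γ t s)

section Orientation

variable {γ : ℝ → ℝ → Plane} {U : ℝ → Set Plane}

theorem IsEvolvingCurve.curveField_normal (h : IsEvolvingCurve T γ) (hT : 0 < T) (σ : ℝ) :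
    CurveField T (unitNormal σ γ) := by
  have h1 : CurveField T (dcurve γ) := CurveField.dcurve hT h.smooth
  have h2 : ContDiffOn ℝ ∞ (fun p : ℝ × ℝ => perp (dcurve γ p.1 p.2)) (Icc 0 T ×ˢ univ) :=
    (perpL.contDiff.comp_contDiffOn h1)
  refine ContDiffOn.smul (f := fun p : ℝ × ℝ => σ * ‖dcurve γ p.1 p.2‖⁻¹) ?_ h2
  refine contDiffOn_const.mul (ContDiffOn.inv ?_ fun p hp => norm_ne_zero_iff.2 (h.immersed p.1 hp.1 p.2))
  exact ContDiffOn.norm ℝ h1 fun p hp => h.immersed p.1 hp.1 p.2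

theorem IsEvolvingCurve.normalTube (h : IsEvolvingCurve T γ) {σ : ℝ} (hσ : |σ| = 1)
    (ht : t ∈ Icc 0 T) (hU : IsEnclosedDomain (U t) (range (γ t))) (hr : 0 < r₀)
    (hp : HasSmoothProjection (range (γ t)) r₀) : NormalTube (γ t) (unitNormal σ γ t) (U t) r₀ where
  pos := hr
  differentiable := fun s => (CurveField.hasDerivAt h.smooth ht s).differentiableAt
  immersed := h.immersed t ht
  norm_normal := fun s => by
    rw [unitNormal, norm_smul, norm_perp, Real.norm_eq_abs, abs_mul, hσ, one_mul,
      abs_of_nonneg (inv_nonneg.2 (norm_nonneg _))]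
    exact inv_mul_cancel₀ (norm_ne_zero_iff.2 (h.immersed t ht s))
  inner_normal := fun s => by
    rw [unitNormal, real_inner_smul_left, real_inner_comm]
    change _ * inner ℝ (dcurve γ t s) (perp (dcurve γ t s)) = 0
    rw [inner_perp_self, mul_zero]
  proj := hp
  dom := hU

/-- To the right of a rightmost point of the curve lies the exterior. -/
theorem IsEnclosedDomain.notMem_right {V J : Set Plane} (h : IsEnclosedDomain V J) {p : Plane}
    (hp : ∀ q ∈ J, q 0 ≤ p 0) (hr : 0 < r) : p + r • stdVec 0 ∉ V := by
  intro hV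
  have he : ∀ a : ℝ, (p + a • stdVec 0) 0 = p 0 + a := fun a => by simp [stdVec]
  have hpre : IsPreconnected ((fun a : ℝ => p + a • stdVec 0) '' Ioi 0) :=
    isPreconnected_Ioi.image _ (by fun_prop)
  have hsub : (fun a : ℝ => p + a • stdVec 0) '' Ioi 0 ⊆ V ∪ (closure V)ᶜ := by
    rintro _ ⟨a, ha, rfl⟩
    beta_reduce
    by_cases hx : p + a • stdVec 0 ∈ V
    · exact Or.inl hx
    · refine Or.inr fun hcl => ?_
      have h1 : p + a • stdVec 0 ∈ J := by
        rw [← h.frontier_eq, h.isOpen.frontier_eq]; exact ⟨hcl, hx⟩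
      have h2 := hp _ h1
      rw [he] at h2
      have : (0 : ℝ) < a := ha
      linarith
  rcases hpre.subset_or_subset h.isOpen isClosed_closure.isOpen_compl
    (disjoint_compl_right.mono_left subset_closure) hsub with h1 | h1
  · obtain ⟨R, hR⟩ := h.isBounded.exists_norm_le
    have h2 := hR _ (h1 ⟨|R| + |p 0| + 1, by rw [mem_Ioi]; positivity, rfl⟩)
    have h3 := (PiLp.norm_apply_le (p + (|R| + |p 0| + 1) • stdVec 0) 0).trans h2
    rw [he, Real.norm_eq_abs] at h3
    have h4 := le_abs_self (p 0 + (|R| + |p 0| + 1))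
    have h5 := neg_abs_le (p 0)
    have h6 := le_abs_self R
    linarith
  · exact h1 ⟨r, hr, rfl⟩ (subset_closure hV)

theorem IsEvolvingCurve.range_eq (h : IsEvolvingCurve T γ) (ht : t ∈ Icc 0 T) :
    range (γ t) = γ t '' Icc 0 1 := by
  refine Subset.antisymm ?_ (image_subset_range _ _)
  rintro _ ⟨s, rfl⟩
  refine ⟨Int.fract s, ⟨Int.fract_nonneg s, (Int.fract_lt_one s).le⟩, ?_⟩
  have := (h.periodic t ht).sub_int_mul_eq (x := s) ⌊s⌋
  rwa [mul_one] at this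

theorem perp_of_apply_zero {v : Plane} (hv : v 0 = 0) : perp v = (-v 1) • stdVec 0 := by
  ext i
  fin_cases i
  · simp [perp, stdVec]
  · simp [perp, stdVec, hv]

theorem IsEvolvingCurve.inward_of_rightmost (h : IsEvolvingCurve T γ) (ht : t ∈ Icc 0 T)
    (hT : 0 < T) (hU : IsEnclosedDomain (U t) (range (γ t))) (hr : 0 < r₀)
    (hp : HasSmoothProjection (range (γ t)) r₀) {σ : ℝ} (hσ : σ = 1 ∨ σ = -1) {s : ℝ}
    (hmax : ∀ s' ∈ Icc (0 : ℝ) 1, γ t s' 0 ≤ γ t s 0) (hpos : 0 ≤ σ * dcurve γ t s 1) :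
    InnerTube (γ t) (unitNormal σ γ t) (U t) r₀ ∧ 0 < σ * dcurve γ t s 1 := by
  have hσ1 : |σ| = 1 := by rcases hσ with h1 | h1 <;> simp [h1]
  have htube := h.normalTube hσ1 ht hU hr hp
  have hmax' : ∀ q ∈ range (γ t), q 0 ≤ γ t s 0 := by
    rw [h.range_eq ht]
    rintro _ ⟨s', hs', rfl⟩
    exact hmax s' hs'
  have hγ := CurveField.hasDerivAt h.smooth ht s
  have h0 : dcurve γ t s 0 = 0 := by
    have h1 : HasDerivAt (fun s' => γ t s' 0) (dcurve γ t s 0) s :=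
      (EuclideanSpace.proj (𝕜 := ℝ) (0 : Fin 2)).hasFDerivAt.comp_hasDerivAt s hγ
    exact IsLocalMax.hasDerivAt_eq_zero
      (.of_forall fun s' => hmax' _ (mem_range_self s')) h1
  have hne : dcurve γ t s 1 ≠ 0 := fun h1 => h.immersed t ht s (by
    change dcurve γ t s = 0
    ext i
    fin_cases i
    · exact h0
    · exact h1)
  have hpos' : 0 < σ * dcurve γ t s 1 := lt_of_le_of_ne hpos (Ne.symm (mul_ne_zero
    (by intro h1; rw [h1, abs_zero] at hσ1; exact zero_ne_one hσ1) hne))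
  refine ⟨{ htube with inward := ?_ }, hpos'⟩
  rcases htube.orientation ((h.curveField_normal hT σ).continuous ht) with h1 | h1
  · exact h1
  · exfalso
    have h2 := (h1 s (r₀ / 2) (by linarith) (by linarith)).1
    have h3 : γ t s - (r₀ / 2) • unitNormal σ γ t s = γ t s
        + (r₀ / 2 * (‖dcurve γ t s‖⁻¹ * (σ * dcurve γ t s 1))) • stdVec 0 := by
      rw [unitNormal, perp_of_apply_zero h0]
      module
    rw [h3] at h2
    refine hU.notMem_right hmax' ?_ h2
    have := norm_pos_iff.2 (h.immersed t ht s)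
    have h4 : 0 < ‖dcurve γ t s‖⁻¹ := inv_pos.2 this
    positivity

/-- The orientation of an evolving closed curve does not change. -/
theorem IsEvolvingCurve.exists_orientation (h : IsEvolvingCurve T γ) (hT : 0 < T)
    (hU : ∀ t ∈ Icc 0 T, IsEnclosedDomain (U t) (range (γ t))) (hr : 0 < r₀)
    (hp : ∀ t ∈ Icc 0 T, HasSmoothProjection (range (γ t)) r₀) :
    ∃ σ : ℝ, ∀ t ∈ Icc 0 T, InnerTube (γ t) (unitNormal σ γ t) (U t) r₀ := by
  have hγc : ContinuousOn (uncurry γ) (Icc 0 T ×ˢ Icc (0 : ℝ) 1) :=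
    (ContDiffOn.continuousOn h.smooth).mono (prod_mono_right (subset_univ _))
  have hdc : ContinuousOn (uncurry (dcurve γ)) (Icc 0 T ×ˢ Icc (0 : ℝ) 1) :=
    (ContDiffOn.continuousOn (CurveField.dcurve hT h.smooth)).mono (prod_mono_right (subset_univ _))
  obtain ⟨A, hA⟩ : ∃ A : ℝ → Set (ℝ × ℝ), A = fun σ => {p ∈ Icc 0 T ×ˢ Icc (0 : ℝ) 1 |
    (∀ s' ∈ Icc (0 : ℝ) 1, γ p.1 s' 0 ≤ γ p.1 p.2 0) ∧ 0 ≤ σ * dcurve γ p.1 p.2 1} := ⟨_, rfl⟩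
  have hproj0 : ∀ i : Fin 2, Continuous fun v : Plane => v i := fun i => by fun_prop
  have hclosed : ∀ σ, IsCompact (A σ) := fun σ => by
    have hK : IsCompact (Icc 0 T ×ˢ Icc (0 : ℝ) 1) := isCompact_Icc.prod isCompact_Icc
    refine hK.of_isClosed_subset ?_ (by rw [hA]; exact sep_subset _ _)
    have h1 : A σ = (⋂ s' ∈ Icc (0 : ℝ) 1, {p ∈ Icc 0 T ×ˢ Icc (0 : ℝ) 1 |
        γ p.1 s' 0 ≤ γ p.1 p.2 0}) ∩ {p ∈ Icc 0 T ×ˢ Icc (0 : ℝ) 1 | 0 ≤ σ * dcurve γ p.1 p.2 1} := by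
      rw [hA]
      ext p
      simp only [mem_ofPred_eq, mem_inter_iff, mem_iInter]
      exact ⟨fun ⟨h2, h3, h4⟩ => ⟨fun s' hs' => ⟨h2, h3 s' hs'⟩, h2, h4⟩,
        fun ⟨h2, h3, h4⟩ => ⟨h3, fun s' hs' => (h2 s' hs').2, h4⟩⟩
    rw [h1]
    refine IsClosed.inter (isClosed_biInter fun s' hs' => ?_) ?_
    · refine hK.isClosed.isClosed_le ?_ ((hproj0 0).comp_continuousOn hγc)
      exact (hproj0 0).comp_continuousOn (hγc.comp (f := fun p : ℝ × ℝ => (p.1, s'))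
        (by fun_prop) fun p hp => ⟨hp.1, hs'⟩)
    · exact hK.isClosed.isClosed_le continuousOn_const
        (continuousOn_const.mul ((hproj0 1).comp_continuousOn hdc))
  have hcover : ∀ t ∈ Icc 0 T, ∃ s, (t, s) ∈ A 1 ∨ (t, s) ∈ A (-1) := fun t ht => by
    obtain ⟨s, hs, hmax⟩ := isCompact_Icc.exists_isMaxOn (nonempty_Icc.2 zero_le_one)
      (((hproj0 0).comp (CurveField.continuous h.smooth ht)).continuousOn (s := Icc (0 : ℝ) 1))
    rw [hA]
    refine ⟨s, ?_⟩
    rcases le_total 0 (dcurve γ t s 1) with h1 | h1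
    · exact Or.inl ⟨⟨ht, hs⟩, fun s' hs' => hmax hs', by rwa [one_mul]⟩
    · exact Or.inr ⟨⟨ht, hs⟩, fun s' hs' => hmax hs', by beta_reduce; linarith⟩
  have hin : ∀ σ : ℝ, (σ = 1 ∨ σ = -1) → ∀ p ∈ A σ, InnerTube (γ p.1) (unitNormal σ γ p.1) (U p.1) r₀ := by
    intro σ hσ p hpA
    rw [hA] at hpA
    exact (h.inward_of_rightmost hpA.1.1 hT (hU _ hpA.1.1) hr (hp _ hpA.1.1) hσ hpA.2.1 hpA.2.2).1
  have hdisj : ∀ t, ¬ (t ∈ Prod.fst '' A 1 ∧ t ∈ Prod.fst '' A (-1)) := by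
    rintro t ⟨⟨p, hp1, rfl⟩, ⟨q, hq1, hqp⟩⟩
    have h1 := hin 1 (Or.inl rfl) p hp1
    have h2 := hin (-1) (Or.inr rfl) q hq1
    rw [hqp] at h2
    have h3 := (h1.inward 0 (r₀ / 2) (by linarith) (by linarith)).1
    have h4 := (h2.inward 0 (r₀ / 2) (by linarith) (by linarith)).2
    refine h4 ?_
    convert h3 using 1
    simp only [unitNormal]
    module
  have hconn := isPreconnected_closed_iff.1 (isPreconnected_Icc (a := (0 : ℝ)) (b := T))
    (Prod.fst '' A 1) (Prod.fst '' A (-1)) ((hclosed 1).image continuous_fst).isClosed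
    ((hclosed (-1)).image continuous_fst).isClosed (fun t ht => by
      obtain ⟨s, h1 | h1⟩ := hcover t ht
      · exact Or.inl ⟨_, h1, rfl⟩
      · exact Or.inr ⟨_, h1, rfl⟩)
  by_cases hex : (Icc 0 T ∩ Prod.fst '' A (-1)).Nonempty
  · refine ⟨-1, fun t ht => ?_⟩
    obtain ⟨s, h1 | h1⟩ := hcover t ht
    · obtain ⟨t', -, ht'⟩ := hconn ⟨t, ht, _, h1, rfl⟩ hex
      exact (hdisj t' ht').elim
    · exact hin _ (Or.inr rfl) _ h1
  · refine ⟨1, fun t ht => ?_⟩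
    obtain ⟨s, h1 | h1⟩ := hcover t ht
    · exact hin _ (Or.inl rfl) _ h1
    · exact (hex ⟨t, ht, _, h1, rfl⟩).elim

end Orientation

/-! ### Kinematics of a curve moving by curvature -/

/-- Component of the tangent along `perp N`. -/
def speed (γ N : ℝ → ℝ → Plane) (t s : ℝ) : ℝ := inner ℝ (perp (N t s)) (dcurve γ t s)

/-- Turning rate of the normal. -/
def turn (N : ℝ → ℝ → Plane) (t s : ℝ) : ℝ := inner ℝ (perp (N t s)) (dcurve N t s)

/-- Curvature in the direction of the normal. -/
def curv (γ N : ℝ → ℝ → Plane) (t s : ℝ) : ℝ := -turn N t s / speed γ N t s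

/-- Normal coordinates `(t, s, r) ↦ γ(t, s) + r N(t, s)`. -/
def chart (γ N : ℝ → ℝ → Plane) (p : ℝ × ℝ × ℝ) : Plane :=
  γ p.1 p.2.1 + p.2.2 • N p.1 p.2.1

/-- A closed curve moving by curve-shortening flow, its inner unit normal and the domain it
encloses, with a smooth nearest-point projection on the tube of radius `r₀`. -/
structure MovingTube (T r₀ : ℝ) (γ N : ℝ → ℝ → Plane) (U : ℝ → Set Plane) : Prop where
  pos : 0 < T
  curve : IsEvolvingCurve T γ
  normal : CurveField T N
  periodic : ∀ t ∈ Icc 0 T, Function.Periodic (N t) 1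
  tube : ∀ t ∈ Icc 0 T, InnerTube (γ t) (N t) (U t) r₀
  flow : ∀ t ∈ Ioo 0 T, ∀ s, inner ℝ (N t s) (dclock T γ t s) = curv γ N t s

theorem perp_unit_normal {n v : Plane} (hn : ‖n‖ = 1) (h : inner ℝ n v = (0 : ℝ)) :
    v = (inner ℝ (perp n) v : ℝ) • perp n := by
  have := frame_expand hn v
  rwa [h, zero_smul, zero_add] at this

theorem inner_deriv_eq_zero_of_norm_eq_one {n : ℝ → Plane} {n' : Plane} {s : ℝ} (hn : ∀ᶠ s' in 𝓝 s, ‖n s'‖ = 1)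
    (h : HasDerivAt n n' s) : inner ℝ (n s) n' = (0 : ℝ) := by
  have h1 := h.norm_sq
  have h2 : HasDerivAt (fun s' => ‖n s'‖ ^ 2) 0 s :=
    (hasDerivAt_const s (1 : ℝ)).congr_of_eventuallyEq (hn.mono fun s' hs' => by simp [hs'])
  have := h1.unique h2
  linarith

namespace MovingTube

variable {γ N : ℝ → ℝ → Plane} {U : ℝ → Set Plane}

theorem norm_normal (m : MovingTube T r₀ γ N U) (ht : t ∈ Icc 0 T) (s : ℝ) : ‖N t s‖ = 1 :=
  (m.tube t ht).norm_normal s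

theorem hasDerivAt_curve (m : MovingTube T r₀ γ N U) (ht : t ∈ Icc 0 T) (s : ℝ) :
    HasDerivAt (γ t) (speed γ N t s • perp (N t s)) s := by
  have h1 := (m.tube t ht).tangent_eq s
  exact (CurveField.hasDerivAt m.curve.smooth ht s).congr_deriv h1

theorem hasDerivAt_normal (m : MovingTube T r₀ γ N U) (ht : t ∈ Icc 0 T) (s : ℝ) :
    HasDerivAt (N t) (turn N t s • perp (N t s)) s := by
  have h1 := m.normal.hasDerivAt ht s
  exact h1.congr_deriv (perp_unit_normal (m.norm_normal ht s)
    (inner_deriv_eq_zero_of_norm_eq_one (Eventually.of_forall (m.norm_normal ht)) h1))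

theorem inner_normal_self (m : MovingTube T r₀ γ N U) (ht : t ∈ Icc 0 T) (s : ℝ) :
    inner ℝ (N t s) (N t s) = (1 : ℝ) := by
  rw [real_inner_self_eq_norm_sq, m.norm_normal ht, one_pow]

theorem speed_ne_zero (m : MovingTube T r₀ γ N U) (ht : t ∈ Icc 0 T) (s : ℝ) :
    speed γ N t s ≠ 0 := (m.tube t ht).speed_ne_zero s

theorem jacobian_ne_zero (m : MovingTube T r₀ γ N U) (ht : t ∈ Icc 0 T) (s : ℝ)
    (hr : |r| < r₀) : speed γ N t s + r * turn N t s ≠ 0 :=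
  (m.tube t ht).jacobian_ne_zero s hr (m.hasDerivAt_normal ht s)

theorem smooth_perp (m : MovingTube T r₀ γ N U) : CurveField T fun t s => perp (N t s) :=
  perpL.contDiff.comp_contDiffOn m.normal

theorem smooth_speed (m : MovingTube T r₀ γ N U) : CurveField T (speed γ N) :=
  m.smooth_perp.inner ℝ (CurveField.dcurve m.pos m.curve.smooth)

theorem smooth_turn (m : MovingTube T r₀ γ N U) : CurveField T (turn N) :=
  m.smooth_perp.inner ℝ (m.normal.dcurve m.pos)

theorem smooth_curv (m : MovingTube T r₀ γ N U) : CurveField T (curv γ N) :=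
  m.smooth_turn.neg.div m.smooth_speed fun p hp => m.speed_ne_zero hp.1 p.2

theorem hasDerivAt_clock_curve (m : MovingTube T r₀ γ N U) (ht : t ∈ Ioo 0 T) (s : ℝ) :
    HasDerivAt (fun t' => γ t' s) (curv γ N t s • N t s
      + (inner ℝ (perp (N t s)) (dclock T γ t s) : ℝ) • perp (N t s)) t := by
  rw [← m.flow t ht s, ← frame_expand (m.norm_normal (Ioo_subset_Icc_self ht) s)]
  exact CurveField.hasDerivAt_time m.curve.smooth ht s

theorem hasDerivAt_clock_normal (m : MovingTube T r₀ γ N U) (ht : t ∈ Ioo 0 T) (s : ℝ) :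
    HasDerivAt (fun t' => N t' s) ((inner ℝ (perp (N t s)) (dclock T N t s) : ℝ) • perp (N t s)) t := by
  have h1 := m.normal.hasDerivAt_time ht s
  refine h1.congr_deriv (perp_unit_normal (m.norm_normal (Ioo_subset_Icc_self ht) s)
    (inner_deriv_eq_zero_of_norm_eq_one (n := fun t' => N t' s) ?_ h1))
  filter_upwards [isOpen_Ioo.mem_nhds ht] with t' ht'
  exact m.norm_normal (Ioo_subset_Icc_self ht') s

/-- Evolution of the normal along the flow. -/
theorem dcurve_curv (m : MovingTube T r₀ γ N U) (ht : t ∈ Ioo 0 T) (s : ℝ) :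
    dcurve (curv γ N) t s - (inner ℝ (perp (N t s)) (dclock T γ t s) : ℝ) * turn N t s
      = -(speed γ N t s * inner ℝ (perp (N t s)) (dclock T N t s)) := by
  have ht' := Ioo_subset_Icc_self ht
  have hcs : CurveField T (dclock T γ) := CurveField.dclock m.pos m.curve.smooth
  have hcd : CurveField T (dcurve γ) := CurveField.dcurve m.pos m.curve.smooth
  have e1 : HasDerivAt (fun s' => inner ℝ (N t s') (dclock T γ t s')) (dcurve (curv γ N) t s) s :=
    (m.smooth_curv.hasDerivAt ht' s).congr_of_eventuallyEq (.of_forall fun s' => m.flow t ht s')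
  have e2 := (m.hasDerivAt_normal ht' s).inner ℝ (hcs.hasDerivAt ht' s)
  have e3 := e1.unique e2
  have e4 : HasDerivAt (fun t' => inner ℝ (N t' s) (dcurve γ t' s)) 0 t := by
    refine (hasDerivAt_const t (0 : ℝ)).congr_of_eventuallyEq ?_
    filter_upwards [isOpen_Ioo.mem_nhds ht] with t' ht'
    exact (m.tube t' (Ioo_subset_Icc_self ht')).inner_normal s
  have e5 := (m.hasDerivAt_clock_normal ht s).inner ℝ (hcd.hasDerivAt_time ht s)
  have e6 := e4.unique e5
  rw [CurveField.dclock_dcurve m.curve.smooth ht s] at e6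
  rw [real_inner_smul_left] at e3 e6
  rw [e3]
  change (0 : ℝ) = inner ℝ (N t s) (dcurve (dclock T γ) t s)
    + inner ℝ (perp (N t s)) (dclock T N t s) * speed γ N t s at e6
  linarith

theorem exists_coord (m : MovingTube T r₀ γ N U) (ht : t ∈ Icc 0 T)
    (hx : infDist x (range (γ t)) < r₀) :
    ∃ s ∈ Icc (0 : ℝ) 1, ∃ r, |r| = infDist x (range (γ t)) ∧ x = chart γ N (t, s, r) := by
  obtain ⟨s, r, hr, hx⟩ := (m.tube t ht).exists_coord hx
  refine ⟨Int.fract s, ⟨Int.fract_nonneg s, (Int.fract_lt_one s).le⟩, r, hr, ?_⟩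
  have h1 := (m.curve.periodic t ht).sub_int_mul_eq (x := s) ⌊s⌋
  have h2 := (m.periodic t ht).sub_int_mul_eq (x := s) ⌊s⌋
  rw [mul_one] at h1 h2
  rw [chart, ← Int.self_sub_floor, h1, h2]
  exact hx

end MovingTube

theorem IsEvolvingCurve.exists_movingTube {T r₀ : ℝ} {γ : ℝ → ℝ → Plane} {U : ℝ → Set Plane}
    (h : IsEvolvingCurve T γ) (hT : 0 < T) (hflow : IsCurveShortening T γ)
    (hU : ∀ t ∈ Icc 0 T, IsEnclosedDomain (U t) (range (γ t))) (hr : 0 < r₀)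
    (hp : ∀ t ∈ Icc 0 T, HasSmoothProjection (range (γ t)) r₀) :
    ∃ N, MovingTube T r₀ γ N U := by
  obtain ⟨σ, hσ⟩ := h.exists_orientation hT hU hr hp
  have hN := h.curveField_normal hT σ
  refine ⟨unitNormal σ γ, hT, h, hN, fun t ht s => ?_, hσ, fun t ht s => ?_⟩
  · have h1 : dcurve γ t (s + 1) = dcurve γ t s := by
      rw [dcurve, ← deriv_comp_add_const, funext (h.periodic t ht), dcurve]
    simp only [unitNormal, h1]
  · have ht' := Ioo_subset_Icc_self ht
    obtain ⟨N, hNN⟩ : ∃ N, N = unitNormal σ γ := ⟨_, rfl⟩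
    rw [← hNN] at hN hσ ⊢
    have hn : ∀ s, ‖N t s‖ = 1 := (hσ t ht').norm_normal
    have hγd : ∀ s, dcurve γ t s = speed γ N t s • perp (N t s) := (hσ t ht').tangent_eq
    have hℓ : speed γ N t s ≠ 0 := (hσ t ht').speed_ne_zero s
    have hf := hflow t ht' s
    change inner ℝ (dclock T γ t s) (perp (dcurve γ t s)) = inner ℝ ((‖dcurve γ t s‖ ^ 2)⁻¹ •
      dcurve (dcurve γ) t s) (perp (dcurve γ t s)) at hf
    have hnorm : ‖dcurve γ t s‖ ^ 2 = speed γ N t s ^ 2 := by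
      rw [hγd, norm_smul, norm_perp, hn, mul_one, Real.norm_eq_abs, sq_abs]
    have e1 : HasDerivAt (fun s' => inner ℝ (N t s') (dcurve γ t s')) 0 s :=
      (hasDerivAt_const s (0 : ℝ)).congr_of_eventuallyEq
        (.of_forall fun s' => (hσ t ht').inner_normal s')
    have hNs := hN.hasDerivAt ht' s
    have hNt := perp_unit_normal (hn s)
      (inner_deriv_eq_zero_of_norm_eq_one (Eventually.of_forall hn) hNs)
    have hd : CurveField T (dcurve γ) := CurveField.dcurve hT h.smooth
    have e2 := e1.unique (hNs.inner ℝ (hd.hasDerivAt ht' s))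
    rw [hNt, real_inner_smul_left] at e2
    change (0 : ℝ) = inner ℝ (N t s) (dcurve (dcurve γ) t s) + turn N t s * speed γ N t s at e2
    rw [hnorm, real_inner_smul_left, real_inner_comm, real_inner_comm _ (dcurve (dcurve γ) t s),
      hγd s, perp_smul, perp_perp, real_inner_smul_left, real_inner_smul_left, inner_neg_left,
      inner_neg_left] at hf
    rw [curv]
    have h3 : inner ℝ (N t s) (dcurve (dcurve γ) t s) = -(turn N t s * speed γ N t s) := by linarith
    rw [h3] at hf
    field_simp at hf ⊢
    linarith

/-! ### Fields given in normal coordinates -/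

/-- The domain of the normal coordinates. -/
def chartDomain (T r₀ : ℝ) : Set (ℝ × ℝ × ℝ) := Icc 0 T ×ˢ univ ×ˢ Ioo (-r₀) r₀

theorem chartDomain_mem_nhds {T r₀ t s r : ℝ} (ht : t ∈ Ioo 0 T) (hr : |r| < r₀) :
    chartDomain T r₀ ∈ 𝓝 (t, s, r) :=
  prod_mem_nhds (Icc_mem_nhds ht.1 ht.2) (prod_mem_nhds univ_mem (Ioo_mem_nhds (abs_lt.1 hr).1 (abs_lt.1 hr).2))

section

variable {E : Type*} [NormedAddCommGroup E] [NormedSpace ℝ E] {γ N : ℝ → ℝ → Plane}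
  {U : ℝ → Set Plane} {F : ℝ → Plane → E} {h : ℝ × ℝ × ℝ → E}

/-- The compact tube of radius `ρ` in space-time. -/
def spaceTimeTube (T ρ : ℝ) (γ : ℝ → ℝ → Plane) : Set (ℝ × Plane) :=
  {p | p.1 ∈ Icc 0 T ∧ infDist p.2 (range (γ p.1)) ≤ ρ}

theorem CurveField.chart {f : ℝ → ℝ → E} (hf : CurveField T f) (r₀ : ℝ) :
    ContDiffOn ℝ ∞ (fun p : ℝ × ℝ × ℝ => f p.1 p.2.1) (chartDomain T r₀) :=
  ContDiffOn.comp hf (f := fun p : ℝ × ℝ × ℝ => (p.1, p.2.1)) (by fun_prop)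
    fun p hp => ⟨hp.1, mem_univ p.2.1⟩

namespace MovingTube

theorem contDiffOn_chart (m : MovingTube T r₀ γ N U) :
    ContDiffOn ℝ ∞ (chart γ N) (chartDomain T r₀) := by
  have h3 : ContDiffOn ℝ ∞ (fun p : ℝ × ℝ × ℝ => p.2.2) (chartDomain T r₀) := by fun_prop
  exact (CurveField.chart m.curve.smooth r₀).add (h3.smul (m.normal.chart r₀))

theorem smooth_inv_jacobian (m : MovingTube T r₀ γ N U) :
    ContDiffOn ℝ ∞ (fun p : ℝ × ℝ × ℝ => (speed γ N p.1 p.2.1 + p.2.2 * turn N p.1 p.2.1)⁻¹)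
      (chartDomain T r₀) :=
  ((m.smooth_speed.chart r₀).add (ContDiffOn.mul (by fun_prop) (m.smooth_turn.chart r₀))).inv fun p hp =>
    m.jacobian_ne_zero hp.1 p.2.1 (abs_lt.2 hp.2.2)

theorem infDist_chart (m : MovingTube T r₀ γ N U) (ht : t ∈ Icc 0 T) (s : ℝ)
    (hr : |r| < r₀) : infDist (chart γ N (t, s, r)) (range (γ t)) = |r| :=
  (m.tube t ht).infDist_eq s hr

theorem spaceTimeTube_eq (m : MovingTube T r₀ γ N U) {ρ : ℝ} (hρ : ρ < r₀) :
    spaceTimeTube T ρ γ = (fun p : ℝ × ℝ × ℝ => (p.1, chart γ N p)) '' (Icc 0 T ×ˢ Icc 0 1 ×ˢ Icc (-ρ) ρ) := by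
  ext ⟨t, x⟩
  constructor
  · rintro ⟨ht, hx⟩
    change infDist x (range (γ t)) ≤ ρ at hx
    change t ∈ Icc 0 T at ht
    obtain ⟨s, hs, r, hr, rfl⟩ := m.exists_coord ht (hx.trans_lt hρ)
    exact ⟨(t, s, r), ⟨ht, hs, abs_le.1 (hr.trans_le hx)⟩, rfl⟩
  · rintro ⟨⟨t', s, r⟩, ⟨ht, hs, hr⟩, he⟩
    obtain ⟨rfl, rfl⟩ := Prod.ext_iff.1 he
    exact ⟨ht, (m.infDist_chart ht s ((abs_le.2 hr).trans_lt hρ)).trans_le (abs_le.2 hr)⟩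

theorem continuousOn_chart_box (m : MovingTube T r₀ γ N U) {ρ : ℝ} (hρ : ρ < r₀) :
    ContinuousOn (fun p : ℝ × ℝ × ℝ => (p.1, chart γ N p)) (Icc 0 T ×ˢ Icc 0 1 ×ˢ Icc (-ρ) ρ) :=
  continuousOn_fst.prodMk (m.contDiffOn_chart.continuousOn.mono
    (prod_mono_right (prod_mono (subset_univ _) (Icc_subset_Ioo (by linarith) hρ))))

theorem isCompact_box (T ρ : ℝ) : IsCompact (Icc 0 T ×ˢ Icc (0 : ℝ) 1 ×ˢ Icc (-ρ) ρ) :=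
  isCompact_Icc.prod (isCompact_Icc.prod isCompact_Icc)

theorem isCompact_spaceTimeTube (m : MovingTube T r₀ γ N U) {ρ : ℝ} (hρ : ρ < r₀) :
    IsCompact (spaceTimeTube T ρ γ) := by
  rw [m.spaceTimeTube_eq hρ]
  exact (isCompact_box T ρ).image_of_continuousOn (m.continuousOn_chart_box hρ)

theorem mem_nhds_of_infDist {E : Type*} [NormedAddCommGroup E] {F : ℝ → Plane → E} (m : MovingTube T r₀ γ N U) {ρ : ℝ} (hρ : ρ < r₀)
    (h0 : ∀ t ∈ Ioo 0 T, ∀ x, ρ < infDist x (range (γ t)) → F t x = 0) (ht : t ∈ Ioo 0 T)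
    (hx : ρ < infDist x (range (γ t))) :
    uncurry F =ᶠ[𝓝 (t, x)] fun _ => 0 := by
  have h1 : (spaceTimeTube T ρ γ)ᶜ ∈ 𝓝 (t, x) :=
    (m.isCompact_spaceTimeTube hρ).isClosed.isOpen_compl.mem_nhds fun h2 => not_lt.2 h2.2 hx
  filter_upwards [h1, prod_mem_nhds (Ioo_mem_nhds ht.1 ht.2) univ_mem] with p hp1 hp2
  refine h0 p.1 hp2.1 p.2 ?_
  by_contra hcon
  exact hp1 ⟨Ioo_subset_Icc_self hp2.1, not_lt.1 hcon⟩

theorem hasDerivAt_chart_s (m : MovingTube T r₀ γ N U) (ht : t ∈ Icc 0 T) (s r : ℝ) :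
    HasDerivAt (fun s' => chart γ N (t, s', r))
      ((speed γ N t s + r * turn N t s) • perp (N t s)) s := by
  refine ((m.hasDerivAt_curve ht s).add ((m.hasDerivAt_normal ht s).const_smul r)).congr_deriv ?_
  module

theorem hasDerivAt_chart_r (t s r : ℝ) : HasDerivAt (fun r' => chart γ N (t, s, r')) (N t s) r := by
  exact (((hasDerivAt_id r).smul_const (N t s)).const_add (γ t s)).congr_deriv (one_smul ℝ _)

theorem hasDerivAt_chart_t (m : MovingTube T r₀ γ N U) (ht : t ∈ Ioo 0 T) (s r : ℝ) :
    HasDerivAt (fun t' => chart γ N (t', s, r)) (curv γ N t s • N t s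
      + ((inner ℝ (perp (N t s)) (dclock T γ t s) : ℝ)
        + r * inner ℝ (perp (N t s)) (dclock T N t s)) • perp (N t s)) t := by
  refine ((m.hasDerivAt_clock_curve ht s).add ((m.hasDerivAt_clock_normal ht s).const_smul r)).congr_deriv ?_
  module

/-- A function that is smooth in normal coordinates is smooth. -/
theorem contDiffAt (m : MovingTube T r₀ γ N U) (hh : ContDiffOn ℝ ∞ h (chartDomain T r₀))
    (hF : ∀ t ∈ Ioo 0 T, ∀ s r, |r| < r₀ → F t (chart γ N (t, s, r)) = h (t, s, r))
    (ht : t ∈ Ioo 0 T) (s : ℝ) (hr : |r| < r₀) :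
    ContDiffAt ℝ ∞ (uncurry F) (t, chart γ N (t, s, r)) := by
  have hnh := chartDomain_mem_nhds (s := s) ht hr
  have ht' := Ioo_subset_Icc_self ht
  have hc : ContDiffAt ℝ ∞ (fun p : ℝ × ℝ × ℝ => (p.1, chart γ N p)) (t, s, r) :=
    contDiffAt_fst.prodMk (m.contDiffOn_chart.contDiffAt hnh)
  have hcd : HasFDerivAt (chart γ N) (fderiv ℝ (chart γ N) (t, s, r)) (t, s, r) :=
    ((m.contDiffOn_chart.contDiffAt hnh).differentiableAt (by simp)).hasFDerivAt
  obtain ⟨D, hD⟩ : ∃ D, D = fderiv ℝ (chart γ N) (t, s, r) := ⟨_, rfl⟩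
  rw [← hD] at hcd
  have hDs : D (0, 1, 0) = (speed γ N t s + r * turn N t s) • perp (N t s) := by
    have h1 := hcd.comp_hasDerivAt s ((hasDerivAt_const s t).prodMk
      ((hasDerivAt_id s).prodMk (hasDerivAt_const s r)))
    exact h1.unique (m.hasDerivAt_chart_s ht' s r)
  have hDr : D (0, 0, 1) = N t s := by
    have h1 := hcd.comp_hasDerivAt r ((hasDerivAt_const r t).prodMk
      ((hasDerivAt_const r s).prodMk (hasDerivAt_id r)))
    exact h1.unique (hasDerivAt_chart_r t s r)
  have hfd : HasFDerivAt (fun p : ℝ × ℝ × ℝ => (p.1, chart γ N p))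
      ((ContinuousLinearMap.fst ℝ ℝ (ℝ × ℝ)).prod D) (t, s, r) := hasFDerivAt_fst.prodMk hcd
  obtain ⟨A, hA⟩ : ∃ A, A = (ContinuousLinearMap.fst ℝ ℝ (ℝ × ℝ)).prod D := ⟨_, rfl⟩
  rw [← hA] at hfd
  have hinj : Function.Injective A := by
    rw [injective_iff_map_eq_zero]
    rintro ⟨a, b, c⟩ h0
    rw [hA, ContinuousLinearMap.prod_apply, Prod.mk_eq_zero] at h0
    have ha : a = 0 := h0.1
    have h1 : D (a, b, c) = b • D (0, 1, 0) + c • D (0, 0, 1) := by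
      rw [← map_smul, ← map_smul, ← map_add, ha]
      simp
    rw [hDs, hDr, h0.2] at h1
    have hnn := m.inner_normal_self ht' s
    have hc : c = 0 := by
      have h2 := congrArg (fun v => inner ℝ (N t s) v) h1
      simp only [inner_zero_right, inner_add_right, real_inner_smul_right, inner_perp_self, mul_zero,
        zero_add, hnn, mul_one] at h2
      exact h2.symm
    have hb : b = 0 := by
      have h2 := congrArg (fun v => inner ℝ (perp (N t s)) v) h1
      simp only [inner_zero_right, inner_add_right, real_inner_smul_right, inner_perp_perp, hnn,
        hc, zero_mul, add_zero, mul_one] at h2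
      exact (mul_eq_zero.1 h2.symm).resolve_right (m.jacobian_ne_zero ht' s hr)
    rw [ha, hb, hc]
    rfl
  obtain ⟨e, he⟩ : ∃ e : (ℝ × ℝ × ℝ) ≃L[ℝ] (ℝ × Plane), (e : (ℝ × ℝ × ℝ) →L[ℝ] (ℝ × Plane)) = A := by
    refine ⟨(LinearMap.linearEquivOfInjective (A : (ℝ × ℝ × ℝ) →ₗ[ℝ] (ℝ × Plane)) hinj
      (by simp)).toContinuousLinearEquiv, ?_⟩
    ext v <;> rfl
  rw [← he] at hfd
  have hinv := hc.to_localInverse hfd (by simp)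
  have hfix := hc.localInverse_apply_image hfd (by simp)
  have hright : ∀ᶠ y in 𝓝 (t, chart γ N (t, s, r)), (fun p : ℝ × ℝ × ℝ => (p.1, chart γ N p))
      (hc.localInverse hfd (by simp) y) = y :=
    (hc.hasStrictFDerivAt' hfd (by simp)).eventually_right_inverse
  have hcomp : ContDiffAt ℝ ∞ (h ∘ hc.localInverse hfd (by simp)) (t, chart γ N (t, s, r)) := by
    refine ContDiffAt.comp _ ?_ hinv
    rw [show hc.localInverse hfd (by simp) (t, chart γ N (t, s, r)) = (t, s, r) from hfix]
    exact hh.contDiffAt hnh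
  refine hcomp.congr_of_eventuallyEq ?_
  have hmem : ∀ᶠ y in 𝓝 (t, chart γ N (t, s, r)), hc.localInverse hfd (by simp) y
      ∈ Ioo 0 T ×ˢ (univ : Set ℝ) ×ˢ Ioo (-r₀) r₀ := by
    refine hinv.continuousAt.eventually ?_
    rw [show hc.localInverse hfd (by simp) (t, chart γ N (t, s, r)) = (t, s, r) from hfix]
    exact (isOpen_Ioo.prod (isOpen_univ.prod isOpen_Ioo)).mem_nhds ⟨ht, mem_univ _, abs_lt.1 hr⟩
  filter_upwards [hright, hmem] with y hy1 hy2
  have h3 := hF _ hy2.1 (hc.localInverse hfd (by simp) y).2.1 _ (abs_lt.2 hy2.2.2)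
  conv_lhs => rw [← hy1]
  exact h3

theorem smoothField (m : MovingTube T r₀ γ N U) (hh : ContDiffOn ℝ ∞ h (chartDomain T r₀))
    (hF : ∀ t ∈ Ioo 0 T, ∀ s r, |r| < r₀ → F t (chart γ N (t, s, r)) = h (t, s, r)) {ρ : ℝ} (hρ : ρ < r₀)
    (h0 : ∀ t ∈ Ioo 0 T, ∀ x, ρ < infDist x (range (γ t)) → F t x = 0) : SmoothField T F := by
  rintro ⟨t, x⟩ ⟨ht, -⟩
  refine ContDiffAt.contDiffWithinAt ?_
  change t ∈ Ioo 0 T at ht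
  by_cases hx : infDist x (range (γ t)) < r₀
  · obtain ⟨s, -, r, hr, rfl⟩ := m.exists_coord (Ioo_subset_Icc_self ht) hx
    exact m.contDiffAt hh hF ht s (hr.trans_lt hx)
  · exact contDiffAt_const.congr_of_eventuallyEq
      (m.mem_nhds_of_infDist hρ h0 ht (hρ.trans_le (not_lt.1 hx)))

theorem fderiv_eq_zero (m : MovingTube T r₀ γ N U) {ρ : ℝ} (hρ : ρ < r₀)
    (h0 : ∀ t ∈ Ioo 0 T, ∀ x, ρ < infDist x (range (γ t)) → F t x = 0) (ht : t ∈ Ioo 0 T)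
    (hx : ρ < infDist x (range (γ t))) : fderiv ℝ (F t) x = 0 := by
  have h1 : F t =ᶠ[𝓝 x] fun _ => 0 :=
    ((continuous_const.prodMk continuous_id).tendsto' x (t, x) rfl).eventually
      (m.mem_nhds_of_infDist hρ h0 ht hx)
  rw [h1.fderiv_eq]
  exact fderiv_const_apply 0

theorem dtime_eq_zero (m : MovingTube T r₀ γ N U) {ρ : ℝ} (hρ : ρ < r₀)
    (h0 : ∀ t ∈ Ioo 0 T, ∀ x, ρ < infDist x (range (γ t)) → F t x = 0) (ht : t ∈ Ioo 0 T)
    (hx : ρ < infDist x (range (γ t))) : dtime F t x = 0 := by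
  have h1 : (fun t' => F t' x) =ᶠ[𝓝 t] fun _ => 0 :=
    ((continuous_id.prodMk continuous_const).tendsto' t (t, x) rfl).eventually
      (m.mem_nhds_of_infDist hρ h0 ht hx)
  rw [dtime, h1.deriv_eq, deriv_const]

/-- The spatial derivative in normal coordinates. -/
theorem fderiv_chart (m : MovingTube T r₀ γ N U) (ht : t ∈ Ioo 0 T) (s : ℝ)
    (hr : |r| < r₀) (hFd : DifferentiableAt ℝ (F t) (chart γ N (t, s, r)))
    (hF : ∀ s r, |r| < r₀ → F t (chart γ N (t, s, r)) = h (t, s, r))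
    {hs hr' : E} (h1 : HasDerivAt (fun s' => h (t, s', r)) hs s)
    (h2 : HasDerivAt (fun r' => h (t, s, r')) hr' r) (v : Plane) :
    fderiv ℝ (F t) (chart γ N (t, s, r)) v = (inner ℝ (N t s) v : ℝ) • hr'
      + ((inner ℝ (perp (N t s)) v : ℝ) * (speed γ N t s + r * turn N t s)⁻¹) • hs := by
  have ht' := Ioo_subset_Icc_self ht
  have hJ := m.jacobian_ne_zero ht' s hr
  have e1 : fderiv ℝ (F t) (chart γ N (t, s, r)) ((speed γ N t s + r * turn N t s) • perp (N t s)) = hs := by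
    have h3 := hFd.hasFDerivAt.comp_hasDerivAt s (m.hasDerivAt_chart_s ht' s r)
    have h4 : F t ∘ (fun s' => chart γ N (t, s', r)) = fun s' => h (t, s', r) :=
      funext fun s' => hF s' r hr
    rw [h4] at h3
    exact h3.unique h1
  have e2 : fderiv ℝ (F t) (chart γ N (t, s, r)) (N t s) = hr' := by
    have h3 := hFd.hasFDerivAt.comp_hasDerivAt r (hasDerivAt_chart_r t s r)
    refine h3.unique (h2.congr_of_eventuallyEq ?_)
    filter_upwards [Ioo_mem_nhds (abs_lt.1 hr).1 (abs_lt.1 hr).2] with r' hr'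
    exact hF s r' (abs_lt.2 hr')
  conv_lhs => rw [frame_expand (m.norm_normal ht' s) v]
  rw [map_add, map_smul, e2, ← e1, map_smul, map_smul, smul_smul, mul_assoc, inv_mul_cancel₀ hJ, mul_one]

/-- The time derivative in normal coordinates. -/
theorem dtime_chart (m : MovingTube T r₀ γ N U) (ht : t ∈ Ioo 0 T) (s : ℝ)
    (hr : |r| < r₀) (hFd : DifferentiableAt ℝ (uncurry F) (t, chart γ N (t, s, r)))
    (hF : ∀ t ∈ Ioo 0 T, ∀ s r, |r| < r₀ → F t (chart γ N (t, s, r)) = h (t, s, r))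
    {h_t : E} (h1 : HasDerivAt (fun t' => h (t', s, r)) h_t t) :
    dtime F t (chart γ N (t, s, r)) = h_t - fderiv ℝ (F t) (chart γ N (t, s, r)) (curv γ N t s • N t s
      + ((inner ℝ (perp (N t s)) (dclock T γ t s) : ℝ)
        + r * inner ℝ (perp (N t s)) (dclock T N t s)) • perp (N t s)) := by
  obtain ⟨v, hv⟩ : ∃ v, v = curv γ N t s • N t s
      + ((inner ℝ (perp (N t s)) (dclock T γ t s) : ℝ)
        + r * inner ℝ (perp (N t s)) (dclock T N t s)) • perp (N t s) := ⟨_, rfl⟩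
  have hct := m.hasDerivAt_chart_t ht s r
  rw [← hv] at hct ⊢
  have hd := hFd.hasFDerivAt
  obtain ⟨D, hD⟩ : ∃ D, D = fderiv ℝ (uncurry F) (t, chart γ N (t, s, r)) := ⟨_, rfl⟩
  rw [← hD] at hd
  have e1 : dtime F t (chart γ N (t, s, r)) = D (1, 0) :=
    (hd.comp_hasDerivAt (f := fun t' => (t', chart γ N (t, s, r))) t
      ((hasDerivAt_id t).prodMk (hasDerivAt_const t (chart γ N (t, s, r))))).deriv
  have e2 : fderiv ℝ (F t) (chart γ N (t, s, r)) = D.comp (ContinuousLinearMap.inr ℝ ℝ Plane) :=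
    (hd.comp (chart γ N (t, s, r)) (hasFDerivAt_prodMk_right t (chart γ N (t, s, r)))).fderiv
  have e3 : D (1, v) = h_t := by
    have h3 := hd.comp_hasDerivAt t ((hasDerivAt_id t).prodMk hct)
    refine h3.unique (h1.congr_of_eventuallyEq ?_)
    filter_upwards [Ioo_mem_nhds ht.1 ht.2] with t' ht'
    exact hF t' ht' s r hr
  rw [e1, e2, ← e3, ContinuousLinearMap.comp_apply, ContinuousLinearMap.inr_apply, ← map_sub]
  simp

/-- A function that is continuous in normal coordinates and vanishes off the tube is continuous. -/
theorem continuousOn (m : MovingTube T r₀ γ N U) {ρ : ℝ} (hρ : ρ < r₀)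
    (hh : ContDiffOn ℝ ∞ h (chartDomain T r₀))
    (hF : ∀ t ∈ Icc 0 T, ∀ s r, |r| < r₀ → F t (chart γ N (t, s, r)) = h (t, s, r))
    (h0 : ∀ t ∈ Icc 0 T, ∀ x, ρ < infDist x (range (γ t)) → F t x = 0) :
    ContinuousOn (uncurry F) (Icc 0 T ×ˢ univ) := by
  obtain ⟨ρ', h1, h2⟩ := exists_between hρ
  have hbox : ∀ p ∈ Icc 0 T ×ˢ Icc (0 : ℝ) 1 ×ˢ Icc (-ρ') ρ',
      p ∈ chartDomain T r₀ := fun p hp =>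
    ⟨hp.1, mem_univ _, Icc_subset_Ioo (by linarith) h2 hp.2.2⟩
  have hK : ContinuousOn (uncurry F) (spaceTimeTube T ρ' γ) := by
    rw [continuousOn_iff_isClosed]
    intro A hA
    refine ⟨(fun p : ℝ × ℝ × ℝ => (p.1, chart γ N p)) ''
      ((Icc 0 T ×ˢ Icc 0 1 ×ˢ Icc (-ρ') ρ') ∩ h ⁻¹' A), ?_, ?_⟩
    · refine IsCompact.isClosed (IsCompact.image_of_continuousOn ?_
        ((m.continuousOn_chart_box h2).mono inter_subset_left))
      exact (isCompact_box T ρ').of_isClosed_subset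
        ((hh.continuousOn.mono hbox).preimage_isClosed_of_isClosed (isCompact_box T ρ').isClosed hA)
        inter_subset_left
    · have hval : ∀ p ∈ Icc 0 T ×ˢ Icc (0 : ℝ) 1 ×ˢ Icc (-ρ') ρ', uncurry F (p.1, chart γ N p) = h p :=
        fun p hp => hF p.1 hp.1 p.2.1 p.2.2 (abs_lt.2 (hbox p hp).2.2)
      rw [m.spaceTimeTube_eq h2]
      ext q
      constructor
      · rintro ⟨hq, p, hp, rfl⟩
        refine ⟨⟨p, ⟨hp, ?_⟩, rfl⟩, p, hp, rfl⟩
        rw [mem_preimage, ← hval p hp]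
        exact hq
      · rintro ⟨⟨p, ⟨hp, hpA⟩, rfl⟩, hq⟩
        refine ⟨?_, hq⟩
        rw [mem_preimage, hval p hp]
        exact hpA
  rintro ⟨t, x⟩ ⟨ht, -⟩
  by_cases hx : infDist x (range (γ t)) ≤ ρ
  · obtain ⟨s, -, r, hr, hxr⟩ := m.exists_coord ht (hx.trans_lt hρ)
    have hd : dist x (γ t s) < ρ' := by
      rw [hxr, chart, dist_eq_norm, add_sub_cancel_left, norm_smul, m.norm_normal ht, mul_one, Real.norm_eq_abs, hr]
      exact hx.trans_lt h1
    have hc : ContinuousWithinAt (fun p : ℝ × Plane => dist p.2 (γ p.1 s)) (Icc 0 T ×ˢ univ) (t, x) := by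
      have h3 : ContinuousOn (fun p : ℝ × Plane => γ p.1 s) (Icc 0 T ×ˢ univ) :=
        (ContDiffOn.continuousOn m.curve.smooth).comp (f := fun p : ℝ × Plane => (p.1, s))
          (by fun_prop) fun p hp => ⟨hp.1, mem_univ s⟩
      exact (continuous_dist.comp_continuousOn (continuousOn_snd.prodMk h3)) (t, x) ⟨ht, mem_univ x⟩
    refine (hK (t, x) ⟨ht, hx.trans h1.le⟩).mono_of_mem_nhdsWithin ?_
    filter_upwards [hc.eventually (Iio_mem_nhds hd), self_mem_nhdsWithin] with p hp1 hp2
    exact ⟨hp2.1, (infDist_le_dist_of_mem (mem_range_self s)).trans (le_of_lt hp1)⟩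
  · have h3 : uncurry F =ᶠ[𝓝[Icc 0 T ×ˢ univ] (t, x)] fun _ => 0 := by
      have h4 : (spaceTimeTube T ρ γ)ᶜ ∈ 𝓝 (t, x) :=
        (m.isCompact_spaceTimeTube hρ).isClosed.isOpen_compl.mem_nhds fun h5 => hx h5.2
      filter_upwards [mem_nhdsWithin_of_mem_nhds h4, self_mem_nhdsWithin] with p hp1 hp2
      refine h0 p.1 hp2.1 p.2 ?_
      by_contra hcon
      exact hp1 ⟨hp2.1, not_lt.1 hcon⟩
    exact continuousWithinAt_const.congr_of_eventuallyEq h3 (h0 t ht x (not_le.1 hx))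

theorem exists_bound_chart (m : MovingTube T r₀ γ N U) {ρ : ℝ} (hρ : ρ < r₀)
    (hh : ContDiffOn ℝ ∞ h (chartDomain T r₀)) :
    ∃ K : ℝ, 0 ≤ K ∧ ∀ t ∈ Ioo 0 T, ∀ s ∈ Icc (0 : ℝ) 1, ∀ r, |r| ≤ ρ →
      ‖h (t, s, r)‖ ≤ K ∧ ‖fderiv ℝ h (t, s, r)‖ ≤ K := by
  have hbox : ∀ p ∈ Icc 0 T ×ˢ Icc (0 : ℝ) 1 ×ˢ Icc (-ρ) ρ, p ∈ chartDomain T r₀ := fun p hp =>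
    ⟨hp.1, mem_univ _, Icc_subset_Ioo (by linarith) hρ hp.2.2⟩
  have hu : UniqueDiffOn ℝ (chartDomain T r₀) := (uniqueDiffOn_Icc m.pos).prod
    (uniqueDiffOn_univ.prod (uniqueDiffOn_Ioo (-r₀) r₀))
  obtain ⟨K₁, h1⟩ := (isCompact_box T ρ).exists_bound_of_continuousOn (hh.continuousOn.mono hbox)
  obtain ⟨K₂, h2⟩ := (isCompact_box T ρ).exists_bound_of_continuousOn
    ((hh.continuousOn_fderivWithin hu (by simp)).mono hbox)
  refine ⟨max (max K₁ K₂) 0, le_max_right _ _, fun t ht s hs r hr => ?_⟩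
  have hp : (t, s, r) ∈ Icc 0 T ×ˢ Icc (0 : ℝ) 1 ×ˢ Icc (-ρ) ρ :=
    ⟨Ioo_subset_Icc_self ht, hs, abs_le.1 hr⟩
  have h3 := h2 _ hp
  rw [fderivWithin_of_mem_nhds (chartDomain_mem_nhds ht (hr.trans_lt hρ))] at h3
  exact ⟨(h1 _ hp).trans ((le_max_left _ _).trans (le_max_left _ _)),
    h3.trans ((le_max_right _ _).trans (le_max_left _ _))⟩

/-- Uniform bounds for a field that is smooth in normal coordinates and vanishes off the tube. -/
theorem exists_bound (m : MovingTube T r₀ γ N U) (hh : ContDiffOn ℝ ∞ h (chartDomain T r₀))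
    (hF : ∀ t ∈ Ioo 0 T, ∀ s r, |r| < r₀ → F t (chart γ N (t, s, r)) = h (t, s, r)) {ρ : ℝ}
    (hρ : ρ < r₀)
    (h0 : ∀ t ∈ Ioo 0 T, ∀ x, ρ < infDist x (range (γ t)) → F t x = 0) :
    ∃ K : ℝ, 0 ≤ K ∧ ∀ t ∈ Ioo 0 T, ∀ x, ‖F t x‖ ≤ K ∧ ‖fderiv ℝ (F t) x‖ ≤ K := by
  obtain ⟨K, hK0, hK⟩ := m.exists_bound_chart hρ hh
  obtain ⟨L, hL0, hL⟩ := m.exists_bound_chart hρ m.smooth_inv_jacobian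
  refine ⟨K + L * K, by positivity, fun t ht x => ?_⟩
  by_cases hx : infDist x (range (γ t)) ≤ ρ
  · obtain ⟨s, hs, r, hr, rfl⟩ := m.exists_coord (Ioo_subset_Icc_self ht) (hx.trans_lt hρ)
    have hrρ : |r| ≤ ρ := hr.trans_le hx
    have hr₀ := hrρ.trans_lt hρ
    obtain ⟨b1, b2⟩ := hK t ht s hs r hrρ
    have b3 := (hL t ht s hs r hrρ).1
    refine ⟨?_, ContinuousLinearMap.opNorm_le_bound _ (by positivity) fun v => ?_⟩
    · rw [hF t ht s r hr₀]
      have : 0 ≤ L * K := by positivity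
      linarith
    · have hd : HasFDerivAt h (fderiv ℝ h (t, s, r)) (t, s, r) :=
        ((hh.contDiffAt (chartDomain_mem_nhds ht hr₀)).differentiableAt (by simp)).hasFDerivAt
      have hs1 := hd.comp_hasDerivAt s ((hasDerivAt_const s t).prodMk
        ((hasDerivAt_id s).prodMk (hasDerivAt_const s r)))
      have hr1 := hd.comp_hasDerivAt r ((hasDerivAt_const r t).prodMk
        ((hasDerivAt_const r s).prodMk (hasDerivAt_id r)))
      have hFd : DifferentiableAt ℝ (F t) (chart γ N (t, s, r)) :=
        ((m.smoothField hh hF hρ h0).contDiff ht).differentiable (by simp) _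
      rw [m.fderiv_chart ht s hr₀ hFd (hF t ht) hs1 hr1 v]
      have hn := m.norm_normal (Ioo_subset_Icc_self ht) s
      have n1 : ‖fderiv ℝ h (t, s, r) (0, 1, 0)‖ ≤ K := by
        refine ((fderiv ℝ h (t, s, r)).le_opNorm _).trans ?_
        simpa using b2
      have n2 : ‖fderiv ℝ h (t, s, r) (0, 0, 1)‖ ≤ K := by
        refine ((fderiv ℝ h (t, s, r)).le_opNorm _).trans ?_
        simpa using b2
      have n3 : |(inner ℝ (N t s) v : ℝ)| ≤ ‖v‖ := by
        simpa [hn] using abs_real_inner_le_norm (N t s) v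
      have n4 : |(inner ℝ (perp (N t s)) v : ℝ)| ≤ ‖v‖ := by
        simpa [hn, norm_perp] using abs_real_inner_le_norm (perp (N t s)) v
      refine (norm_add_le _ _).trans ?_
      rw [norm_smul, norm_smul, Real.norm_eq_abs, norm_mul, Real.norm_eq_abs]
      have m1 := mul_le_mul n3 n2 (norm_nonneg _) (norm_nonneg v)
      have m2 := mul_le_mul (mul_le_mul n4 b3 (norm_nonneg _) (norm_nonneg v)) n1 (norm_nonneg _)
        (by positivity)
      linarith
  · rw [h0 t ht x (not_le.1 hx), m.fderiv_eq_zero hρ h0 ht (not_le.1 hx), norm_zero, norm_zero]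
    exact ⟨by positivity, by positivity⟩

end MovingTube

end

/-! ### The cut-off profile -/

section Profile

variable {φ : ℝ → ℝ}

theorem IsProfile.nonneg (h : IsProfile φ) (r : ℝ) : 0 ≤ φ r := by
  rcases lt_or_ge |r| 1 with h1 | h1
  · exact (h.pos r h1).le
  · exact (h.zero r h1).ge

theorem IsProfile.apply_abs (h : IsProfile φ) (r : ℝ) : φ |r| = φ r := by
  rcases abs_choice r with h1 | h1
  · rw [h1]
  · rw [h1, h.even]

theorem IsProfile.le_sub (h : IsProfile φ) (hr : |r| ≤ 1) : φ r ≤ 1 - r ^ 2 / 8 := by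
  rcases le_total |r| (1 / 2) with h1 | h1
  · have := (h.bounds r h1).2
    linarith [sq_nonneg r]
  · have h2 := h.antitone (show (1 / 2 : ℝ) ∈ Icc 0 1 by norm_num) ⟨abs_nonneg r, hr⟩ h1
    rw [h.apply_abs] at h2
    have h3 := (h.bounds (1 / 2) (by norm_num)).2
    have h4 : r ^ 2 ≤ 1 := by rw [← sq_abs]; exact pow_le_one₀ (abs_nonneg r) hr
    linarith

theorem IsProfile.le_one (h : IsProfile φ) (r : ℝ) : φ r ≤ 1 := by
  rcases le_total |r| 1 with h1 | h1
  · have := h.le_sub h1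
    linarith [sq_nonneg r]
  · rw [h.zero r h1]; exact zero_le_one

theorem IsProfile.one_sub_le (h : IsProfile φ) (r : ℝ) : 1 - φ r ≤ 2 * |r| := by
  rcases le_total |r| (1 / 2) with h1 | h1
  · have h2 := (h.bounds r h1).1
    have h3 := mul_le_mul_of_nonneg_right h1 (abs_nonneg r)
    rw [← sq, sq_abs] at h3
    linarith
  · linarith [h.nonneg r]

theorem IsProfile.hasDerivAt (h : IsProfile φ) (r : ℝ) : HasDerivAt φ (deriv φ r) r :=
  (h.smooth.differentiable (by simp) r).hasDerivAt

theorem IsProfile.deriv_eq_zero (h : IsProfile φ) (hr : 1 ≤ |r|) : deriv φ r = 0 :=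
  IsLocalMin.deriv_eq_zero (.of_forall fun r' => by rw [h.zero r hr]; exact h.nonneg r')

theorem IsProfile.exists_deriv_bound (h : IsProfile φ) : ∃ M : ℝ, 0 ≤ M ∧ ∀ r, |deriv φ r| ≤ M * |r| := by
  have h0 : deriv φ 0 = 0 := IsLocalMax.deriv_eq_zero (.of_forall fun r => by
    have := (h.bounds 0 (by norm_num)).1
    linarith [h.le_one r])
  have hs : ContDiff ℝ ∞ (deriv φ) := (contDiff_infty_iff_deriv.1 h.smooth).2
  obtain ⟨M, hM⟩ := isCompact_Icc.exists_bound_of_continuousOn (s := Icc (-1 : ℝ) 1)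
    (hs.continuous_deriv (by simp)).continuousOn
  have hM0 : 0 ≤ M := (norm_nonneg _).trans (hM 0 (by norm_num))
  refine ⟨M, hM0, fun r => ?_⟩
  rcases le_total |r| 1 with h1 | h1
  · have := (convex_Icc (-1 : ℝ) 1).norm_image_sub_le_of_norm_deriv_le
      (fun x _ => hs.differentiable (by simp) x) hM (show (0 : ℝ) ∈ Icc (-1) 1 by norm_num) (abs_le.1 h1)
    rwa [h0, sub_zero, sub_zero] at this
  · rw [h.deriv_eq_zero h1, abs_zero]; positivity

end Profile

theorem abs_sdist (J U : Set Plane) (x : Plane) : |sdist J U x| = infDist x J := by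
  unfold sdist
  split_ifs
  · exact abs_of_nonneg infDist_nonneg
  · rw [abs_neg, abs_of_nonneg infDist_nonneg]

/-! ### The calibration fields in normal coordinates -/

/-- The field `ξ` of a moving curve. -/
def movingXi (φ : ℝ → ℝ) (δ₀ : ℝ) (γ : ℝ → ℝ → Plane) (U : ℝ → Set Plane) (t : ℝ) :
    Plane → Plane := xiField φ δ₀ (range (γ t)) (U t)

/-- The field `H` of a moving curve. -/
def movingCurv (η : ℝ → Plane → ℝ) (γ : ℝ → ℝ → Plane) (U : ℝ → Set Plane) (t : ℝ) :
    Plane → Plane := curvField (η t) (range (γ t)) (U t)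

/-- A localized extension of the arc-length derivative of the curvature. -/
def curvSlope (φ : ℝ → ℝ) (δ₀ : ℝ) (η : ℝ → Plane → ℝ) (γ : ℝ → ℝ → Plane)
    (U : ℝ → Set Plane) (t : ℝ) (x : Plane) : ℝ :=
  φ (sdist (range (γ t)) (U t) x / δ₀) *
    inner ℝ (gradient (sdist (range (γ t)) (U t)) x)
      (fderiv ℝ (movingCurv η γ U t) (nearestPt (range (γ t)) x)
        (perp (gradient (sdist (range (γ t)) (U t)) x)))

namespace MovingTube

variable {γ N : ℝ → ℝ → Plane} {U : ℝ → Set Plane} {φ : ℝ → ℝ} {η : ℝ → Plane → ℝ}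

theorem sdist_chart (m : MovingTube T r₀ γ N U) (ht : t ∈ Icc 0 T) (s : ℝ)
    (hr : |r| < r₀) : sdist (range (γ t)) (U t) (chart γ N (t, s, r)) = r :=
  (m.tube t ht).sdist_eq s hr

theorem gradient_chart (m : MovingTube T r₀ γ N U) (ht : t ∈ Icc 0 T) (s : ℝ)
    (hr : |r| < r₀) : gradient (sdist (range (γ t)) (U t)) (chart γ N (t, s, r)) = N t s :=
  (m.tube t ht).gradient_sdist s hr

theorem chart_zero (t s : ℝ) : chart γ N (t, s, 0) = γ t s := by simp [chart]

theorem nearestPt_chart (m : MovingTube T r₀ γ N U) (ht : t ∈ Icc 0 T) (s : ℝ)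
    (hr : |r| < r₀) : nearestPt (range (γ t)) (chart γ N (t, s, r)) = chart γ N (t, s, 0) := by
  rw [chart_zero]
  exact (m.tube t ht).proj_eq s hr

/-- The Laplacian of the signed distance is minus the curvature on the curve. -/
theorem laplacian_sdist (m : MovingTube T r₀ γ N U) (hr₀ : 0 < r₀) (ht : t ∈ Ioo 0 T) (s : ℝ) :
    Laplacian.laplacian (sdist (range (γ t)) (U t)) (chart γ N (t, s, 0)) = -curv γ N t s := by
  have ht' := Ioo_subset_Icc_self ht
  have h0 : |(0 : ℝ)| < r₀ := by rwa [abs_zero]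
  have hG : ∀ t ∈ Ioo 0 T, ∀ s r, |r| < r₀ → (fun t => gradient (sdist (range (γ t)) (U t))) t
      (chart γ N (t, s, r)) = (fun p : ℝ × ℝ × ℝ => N p.1 p.2.1) (t, s, r) :=
    fun t ht s r hr => m.gradient_chart (Ioo_subset_Icc_self ht) s hr
  have hGd : DifferentiableAt ℝ (gradient (sdist (range (γ t)) (U t))) (chart γ N (t, s, 0)) := by
    have h1 := ((m.contDiffAt (m.normal.chart r₀) hG ht s h0).differentiableAt (by simp)).hasFDerivAt
    exact (h1.comp (chart γ N (t, s, 0)) (hasFDerivAt_prodMk_right t (chart γ N (t, s, 0)))).differentiableAt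
  have hfd := m.fderiv_chart (F := fun t => gradient (sdist (range (γ t)) (U t)))
    (h := fun p : ℝ × ℝ × ℝ => N p.1 p.2.1) ht s h0 hGd (hG t ht) (m.hasDerivAt_normal ht' s) (hasDerivAt_const (0 : ℝ) (N t s))
  have he : fderiv ℝ (sdist (range (γ t)) (U t)) =ᶠ[𝓝 (chart γ N (t, s, 0))]
      fun y => innerSL ℝ (gradient (sdist (range (γ t)) (U t)) y) := by
    filter_upwards [isOpen_thickening.mem_nhds ((m.tube t ht').mem_tube s h0)] with y hy
    rw [mem_thickening_iff_infDist_lt (range_nonempty _)] at hy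
    obtain ⟨s', -, r, hr, rfl⟩ := m.exists_coord ht' hy
    rw [← hr] at hy
    rw [m.gradient_chart ht' s' hy]
    exact ((m.tube t ht').hasFDerivAt_sdist s' hy).fderiv
  have hdd : fderiv ℝ (fderiv ℝ (sdist (range (γ t)) (U t))) (chart γ N (t, s, 0))
      = (innerSL ℝ).comp (fderiv ℝ (gradient (sdist (range (γ t)) (U t))) (chart γ N (t, s, 0))) := by
    rw [he.fderiv_eq]
    exact ((innerSL ℝ (E := Plane)).hasFDerivAt.comp _ hGd.hasFDerivAt).fderiv
  have hL : Laplacian.laplacian (sdist (range (γ t)) (U t)) (chart γ N (t, s, 0))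
      = divOf (fderiv ℝ (gradient (sdist (range (γ t)) (U t))) (chart γ N (t, s, 0))) := by
    rw [InnerProductSpace.laplacian_eq_iteratedFDeriv_orthonormalBasis _ (EuclideanSpace.basisFun (Fin 2) ℝ)]
    simp only [iteratedFDeriv_two_apply]
    rw [hdd]
    simp [divOf, stdVec, EuclideanSpace.inner_single_right]
  have hn := m.norm_normal ht' s
  rw [hL, divOf_frame hn, hfd, hfd, curv]
  simp only [smul_zero, zero_add, real_inner_smul_right, inner_perp_self, inner_perp_perp,
    m.inner_normal_self ht' s, mul_zero, zero_mul,
    add_zero, mul_one, one_mul, neg_div, neg_neg]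
  rw [div_eq_inv_mul]

theorem movingXi_chart (m : MovingTube T (4 * δ₀) γ N U) (ht : t ∈ Icc 0 T) (s : ℝ)
    (hr : |r| < 4 * δ₀) : movingXi φ δ₀ γ U t (chart γ N (t, s, r)) = φ (r / δ₀) • N t s := by
  rw [movingXi, xiField, m.sdist_chart ht s hr, m.gradient_chart ht s hr]

theorem smooth_profile_chart (hφ : IsProfile φ) (T r₀ δ₀ : ℝ) :
    ContDiffOn ℝ ∞ (fun p : ℝ × ℝ × ℝ => φ (p.2.2 / δ₀)) (chartDomain T r₀) :=
  hφ.smooth.comp_contDiffOn (by fun_prop)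

theorem smooth_xi_chart (m : MovingTube T r₀ γ N U) (hφ : IsProfile φ) (δ₀ : ℝ) :
    ContDiffOn ℝ ∞ (fun p : ℝ × ℝ × ℝ => φ (p.2.2 / δ₀) • N p.1 p.2.1) (chartDomain T r₀) :=
  (smooth_profile_chart hφ T r₀ δ₀).smul (m.normal.chart r₀)

theorem profile_sdist_eq_zero (hφ : IsProfile φ) (hδ : 0 < δ₀) {J V : Set Plane}
    (hx : δ₀ ≤ infDist x J) : φ (sdist J V x / δ₀) = 0 :=
  hφ.zero _ (by rwa [abs_div, abs_sdist, abs_of_pos hδ, one_le_div hδ])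

theorem movingXi_eq_zero (hφ : IsProfile φ) (hδ : 0 < δ₀)
    (hx : δ₀ ≤ infDist x (range (γ t))) : movingXi φ δ₀ γ U t x = 0 := by
  rw [movingXi, xiField, profile_sdist_eq_zero hφ hδ hx, zero_smul]

theorem movingCurv_chart (m : MovingTube T (4 * δ₀) γ N U) (hδ : 0 < δ₀) (ht : t ∈ Ioo 0 T)
    (s : ℝ) (hr : |r| < 4 * δ₀) : movingCurv η γ U t (chart γ N (t, s, r))
      = (curv γ N t s * η t (chart γ N (t, s, r))) • N t s := by
  have ht' := Ioo_subset_Icc_self ht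
  rw [movingCurv, curvField, m.nearestPt_chart ht' s hr, m.gradient_chart ht' s hr,
    m.laplacian_sdist (by linarith) ht s, neg_neg]

theorem smooth_curv_chart (m : MovingTube T (4 * δ₀) γ N U) (hη : IsCutoff T δ₀ γ η) :
    ContDiffOn ℝ ∞ (fun p : ℝ × ℝ × ℝ => (curv γ N p.1 p.2.1 * η p.1 (chart γ N p)) • N p.1 p.2.1)
      (chartDomain T (4 * δ₀)) :=
  ((m.smooth_curv.chart _).mul (hη.smooth.comp (contDiffOn_fst.prodMk m.contDiffOn_chart)
    fun _ hp => ⟨hp.1, mem_univ _⟩)).smul (m.normal.chart _)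

theorem movingCurv_eq_zero (hη : IsCutoff T δ₀ γ η) (ht : t ∈ Icc 0 T)
    (hx : 2 * δ₀ ≤ infDist x (range (γ t))) : movingCurv η γ U t x = 0 := by
  have h1 : η t x = 0 := image_eq_zero_of_notMem_tsupport fun h2 => by
    have h3 := hη.support t ht h2
    rw [mem_thickening_iff_infDist_lt (range_nonempty _)] at h3
    linarith
  rw [movingCurv, curvField, h1, mul_zero, zero_smul]

theorem smoothField_curv (m : MovingTube T (4 * δ₀) γ N U) (hδ : 0 < δ₀) (hη : IsCutoff T δ₀ γ η) :
    SmoothField T (movingCurv η γ U) :=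
  m.smoothField (m.smooth_curv_chart hη) (fun _ ht s _ hr => m.movingCurv_chart hδ ht s hr)
    (by linarith : 2 * δ₀ < 4 * δ₀) fun _ ht _ hx => movingCurv_eq_zero hη (Ioo_subset_Icc_self ht) hx.le

theorem smoothField_xi (m : MovingTube T (4 * δ₀) γ N U) (hδ : 0 < δ₀) (hφ : IsProfile φ) :
    SmoothField T (movingXi φ δ₀ γ U) :=
  m.smoothField (m.smooth_xi_chart hφ δ₀) (fun _ ht s _ hr => m.movingXi_chart (Ioo_subset_Icc_self ht) s hr)
    (by linarith : δ₀ < 4 * δ₀) fun _ _ _ hx => movingXi_eq_zero hφ hδ hx.le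

theorem fderiv_movingCurv (m : MovingTube T (4 * δ₀) γ N U) (hδ : 0 < δ₀) (hη : IsCutoff T δ₀ γ η)
    (ht : t ∈ Ioo 0 T) (s : ℝ) (hr : |r| < δ₀) (v : Plane) :
    fderiv ℝ (movingCurv η γ U t) (chart γ N (t, s, r)) v
      = ((inner ℝ (perp (N t s)) v : ℝ) * (speed γ N t s + r * turn N t s)⁻¹) •
        (dcurve (curv γ N) t s • N t s + (curv γ N t s * turn N t s) • perp (N t s)) := by
  have ht' := Ioo_subset_Icc_self ht
  have hr4 : |r| < 4 * δ₀ := by linarith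
  have h1 : ∀ s r, |r| < δ₀ → η t (chart γ N (t, s, r)) = 1 := fun s r hr => by
    refine hη.one t ht' _ ?_
    rw [mem_thickening_iff_infDist_lt (range_nonempty _), m.infDist_chart ht' s (by linarith)]
    exact hr
  have hs : HasDerivAt (fun s' => (curv γ N t s' * η t (chart γ N (t, s', r))) • N t s')
      (dcurve (curv γ N) t s • N t s + (curv γ N t s * turn N t s) • perp (N t s)) s := by
    have h2 := (m.smooth_curv.hasDerivAt ht' s).smul (m.hasDerivAt_normal ht' s)
    refine (h2.congr_of_eventuallyEq (.of_forall fun s' => ?_)).congr_deriv ?_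
    · simp [h1 s' r hr]
    · rw [smul_smul, add_comm]
  have hr' : HasDerivAt (fun r' => (curv γ N t s * η t (chart γ N (t, s, r'))) • N t s) 0 r := by
    refine (hasDerivAt_const r (curv γ N t s • N t s)).congr_of_eventuallyEq ?_
    filter_upwards [Ioo_mem_nhds (abs_lt.1 hr).1 (abs_lt.1 hr).2] with r' hr'
    rw [h1 s r' (abs_lt.2 hr'), mul_one]
  rw [m.fderiv_chart (h := fun p : ℝ × ℝ × ℝ => (curv γ N p.1 p.2.1 * η p.1 (chart γ N p)) • N p.1 p.2.1)
    ht s hr4 (((m.smoothField_curv hδ hη).contDiff ht).differentiable (by simp) _)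
    (fun s r hr => m.movingCurv_chart hδ ht s hr) hs hr' v, smul_zero, zero_add]

theorem curvSlope_chart (m : MovingTube T (4 * δ₀) γ N U) (hδ : 0 < δ₀) (hη : IsCutoff T δ₀ γ η)
    (ht : t ∈ Ioo 0 T) (s : ℝ) (hr : |r| < 4 * δ₀) :
    curvSlope φ δ₀ η γ U t (chart γ N (t, s, r))
      = φ (r / δ₀) * (dcurve (curv γ N) t s * (speed γ N t s)⁻¹) := by
  have ht' := Ioo_subset_Icc_self ht
  have hnn := m.inner_normal_self ht' s
  rw [curvSlope, m.sdist_chart ht' s hr, m.gradient_chart ht' s hr, m.nearestPt_chart ht' s hr,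
    m.fderiv_movingCurv hδ hη ht s (by rwa [abs_zero]), inner_perp_perp, hnn]
  simp only [real_inner_smul_right, inner_add_right, inner_perp_self, hnn]
  ring

theorem smooth_slope_chart (m : MovingTube T r₀ γ N U) (hφ : IsProfile φ) (δ₀ : ℝ) :
    ContDiffOn ℝ ∞ (fun p : ℝ × ℝ × ℝ => φ (p.2.2 / δ₀)
      * (dcurve (curv γ N) p.1 p.2.1 * (speed γ N p.1 p.2.1)⁻¹)) (chartDomain T r₀) :=
  (smooth_profile_chart hφ T r₀ δ₀).mul (((m.smooth_curv.dcurve m.pos).chart r₀).mul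
    ((m.smooth_speed.chart r₀).inv fun p hp => m.speed_ne_zero hp.1 p.2.1))

theorem curvSlope_eq_zero (hφ : IsProfile φ) (hδ : 0 < δ₀)
    (hx : δ₀ ≤ infDist x (range (γ t))) : curvSlope φ δ₀ η γ U t x = 0 := by
  rw [curvSlope, profile_sdist_eq_zero hφ hδ hx, zero_mul]

theorem smoothField_slope (m : MovingTube T (4 * δ₀) γ N U) (hδ : 0 < δ₀) (hφ : IsProfile φ)
    (hη : IsCutoff T δ₀ γ η) : SmoothField T (curvSlope φ δ₀ η γ U) :=
  m.smoothField (m.smooth_slope_chart hφ δ₀) (fun _ ht s _ hr => m.curvSlope_chart hδ hη ht s hr)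
    (by linarith : δ₀ < 4 * δ₀) fun _ _ _ hx => curvSlope_eq_zero hφ hδ hx.le

theorem fderiv_movingXi (m : MovingTube T (4 * δ₀) γ N U) (hδ : 0 < δ₀) (hφ : IsProfile φ)
    (ht : t ∈ Ioo 0 T) (s : ℝ) (hr : |r| < 4 * δ₀) (v : Plane) :
    fderiv ℝ (movingXi φ δ₀ γ U t) (chart γ N (t, s, r)) v
      = (inner ℝ (N t s) v : ℝ) • (deriv φ (r / δ₀) / δ₀) • N t s
        + ((inner ℝ (perp (N t s)) v : ℝ) * (speed γ N t s + r * turn N t s)⁻¹) •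
          φ (r / δ₀) • turn N t s • perp (N t s) := by
  have ht' := Ioo_subset_Icc_self ht
  have hr' : HasDerivAt (fun r' => φ (r' / δ₀) • N t s) ((deriv φ (r / δ₀) / δ₀) • N t s) r := by
    have h1 := (hφ.hasDerivAt (r / δ₀)).comp r ((hasDerivAt_id r).div_const δ₀)
    exact (h1.smul_const (N t s)).congr_deriv (by rw [mul_one_div])
  exact m.fderiv_chart (h := fun p : ℝ × ℝ × ℝ => φ (p.2.2 / δ₀) • N p.1 p.2.1) ht s hr
    (((m.smoothField_xi hδ hφ).contDiff ht).differentiable (by simp) _)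
    (fun s r hr => m.movingXi_chart ht' s hr) ((m.hasDerivAt_normal ht' s).fun_const_smul (φ (r / δ₀))) hr' v

theorem divOf_movingXi (m : MovingTube T (4 * δ₀) γ N U) (hδ : 0 < δ₀) (hφ : IsProfile φ)
    (ht : t ∈ Ioo 0 T) (s : ℝ) (hr : |r| < 4 * δ₀) :
    divOf (fderiv ℝ (movingXi φ δ₀ γ U t) (chart γ N (t, s, r))) = deriv φ (r / δ₀) / δ₀
      + φ (r / δ₀) * (turn N t s * (speed γ N t s + r * turn N t s)⁻¹) := by
  have ht' := Ioo_subset_Icc_self ht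
  have hn := m.norm_normal ht' s
  have hnn := m.inner_normal_self ht' s
  rw [divOf_frame hn, m.fderiv_movingXi hδ hφ ht s hr, m.fderiv_movingXi hδ hφ ht s hr]
  simp only [inner_add_right, real_inner_smul_right, inner_perp_perp, inner_perp_self, inner_perp_self_left, hnn]
  ring

theorem dtime_movingXi (m : MovingTube T (4 * δ₀) γ N U) (hδ : 0 < δ₀) (hφ : IsProfile φ)
    (ht : t ∈ Ioo 0 T) (s : ℝ) (hr : |r| < 4 * δ₀) :
    dtime (movingXi φ δ₀ γ U) t (chart γ N (t, s, r))
      = -(deriv φ (r / δ₀) / δ₀ * curv γ N t s) • N t s - (φ (r / δ₀) * (dcurve (curv γ N) t s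
        * (speed γ N t s + r * turn N t s)⁻¹)) • perp (N t s) := by
  have ht' := Ioo_subset_Icc_self ht
  have hnn := m.inner_normal_self ht' s
  have hJ := m.jacobian_ne_zero ht' s hr
  have hk := m.dcurve_curv ht s
  rw [m.dtime_chart (h := fun p : ℝ × ℝ × ℝ => φ (p.2.2 / δ₀) • N p.1 p.2.1) ht s hr
    (((m.smoothField_xi hδ hφ).contDiffAt ht _).differentiableAt (by simp))
    (fun t ht s r hr => m.movingXi_chart (Ioo_subset_Icc_self ht) s hr)
    ((m.hasDerivAt_clock_normal ht s).fun_const_smul (φ (r / δ₀))), m.fderiv_movingXi hδ hφ ht s hr]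
  simp only [inner_add_right, real_inner_smul_right, inner_perp_perp, inner_perp_self, inner_perp_self_left, hnn]
  have h1 : dcurve (curv γ N) t s * (speed γ N t s + r * turn N t s)⁻¹
      = ((inner ℝ (perp (N t s)) (dclock T γ t s) : ℝ) + r * inner ℝ (perp (N t s)) (dclock T N t s))
        * (speed γ N t s + r * turn N t s)⁻¹ * turn N t s - inner ℝ (perp (N t s)) (dclock T N t s) := by
    field_simp
    linarith
  rw [h1]
  module

/-- Uniform bounds for the geometry of the tube. -/
theorem exists_geometry_bound (m : MovingTube T (4 * δ₀) γ N U) (hδ : 0 < δ₀) : ∃ B : ℝ, 1 ≤ B ∧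
    ∀ t ∈ Ioo 0 T, ∀ s ∈ Icc (0 : ℝ) 1, ∀ r, |r| < δ₀ → |curv γ N t s| ≤ B ∧
      |dcurve (curv γ N) t s| ≤ B ∧ |turn N t s| ≤ B ∧
      |(speed γ N t s + r * turn N t s)⁻¹| ≤ B ∧ |(speed γ N t s)⁻¹| ≤ B := by
  obtain ⟨B₁, h1⟩ := m.smooth_curv.exists_bound
  obtain ⟨B₂, h2⟩ := (m.smooth_curv.dcurve m.pos).exists_bound
  obtain ⟨B₃, h3⟩ := m.smooth_turn.exists_bound
  obtain ⟨B₄, h40, h4⟩ := m.exists_bound_chart (by linarith : δ₀ < 4 * δ₀) m.smooth_inv_jacobian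
  refine ⟨1 + |B₁| + |B₂| + |B₃| + B₄, by linarith [abs_nonneg B₁, abs_nonneg B₂, abs_nonneg B₃],
    fun t ht s hs r hr => ?_⟩
  have ht' := Ioo_subset_Icc_self ht
  have e1 := h1 t ht' s hs
  have e2 := h2 t ht' s hs
  have e3 := h3 t ht' s hs
  have e4 := (h4 t ht s hs r hr.le).1
  have e5 := (h4 t ht s hs 0 (by rw [abs_zero]; exact hδ.le)).1
  simp only [zero_mul, add_zero] at e5
  rw [Real.norm_eq_abs] at e1 e2 e3 e4 e5
  have a1 := abs_nonneg B₁
  have a2 := abs_nonneg B₂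
  have a3 := abs_nonneg B₃
  have b1 := le_abs_self B₁
  have b2 := le_abs_self B₂
  have b3 := le_abs_self B₃
  refine ⟨?_, ?_, ?_, ?_, ?_⟩ <;> linarith

end MovingTube

/-! ### The calibration of a moving curve -/

theorem geometry_estimates {B M δ k k' w l r p : ℝ} (hB : 1 ≤ B) (hδ : 0 < δ) (hδ1 : δ < 1) (hM : 0 ≤ M)
    (hk : |k| ≤ B) (hk' : |k'| ≤ B) (hw : |w| ≤ B) (hJ : |(l + r * w)⁻¹| ≤ B) (hl : |l⁻¹| ≤ B)
    (hJ0 : l + r * w ≠ 0) (hl0 : l ≠ 0) (hkw : k = -w / l) (hp0 : 0 ≤ p) (hp1 : p ≤ 1)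
    (hp : 1 - p ≤ 2 * |r / δ|) {p' : ℝ} (hp' : |p'| ≤ M * |r / δ|) {K : ℝ} (hK : 9 * B ^ 4 + 3 * M / δ ≤ K) :
    |k| ≤ K ∧ |w * (l + r * w)⁻¹| ≤ K ∧ |k' * (l + r * w)⁻¹| ≤ K ∧ |p * (k' * l⁻¹)| ≤ K ∧
      |k + w * (l + r * w)⁻¹| ≤ K * (|r| / (3 * δ)) ∧ |p' / δ| ≤ K * (|r| / (3 * δ)) ∧
      |k' * (l + r * w)⁻¹ - p * (k' * l⁻¹)| ≤ K * (|r| / (3 * δ)) := by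
  obtain ⟨D, hD⟩ : ∃ D, D = l + r * w := ⟨_, rfl⟩
  rw [← hD] at hJ hJ0 ⊢
  have hB0 : 0 ≤ B := by linarith
  have hMδ : 0 ≤ 3 * M / δ := by positivity
  have e2 : B ≤ B ^ 2 := le_self_pow₀ hB two_ne_zero
  have e4 : B ^ 2 ≤ B ^ 4 := pow_le_pow_right₀ hB (by norm_num)
  have hB4 : 0 ≤ B ^ 4 := by positivity
  have hmul : ∀ {a b A A' : ℝ}, |a| ≤ A → |b| ≤ A' → |a * b| ≤ A * A' := fun {a b A A'} ha hb => by
    rw [abs_mul]; exact mul_le_mul ha hb (abs_nonneg _) ((abs_nonneg _).trans ha)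
  have hr0 := abs_nonneg r
  obtain ⟨z, hz⟩ : ∃ z, z = |r| / (3 * δ) := ⟨_, rfl⟩
  have hz0 : 0 ≤ z := by rw [hz]; positivity
  have hrz : |r| = 3 * δ * z := by rw [hz]; field_simp
  have hrδ : |r / δ| = 3 * z := by rw [abs_div, abs_of_pos hδ, hz]; field_simp
  have hrz' : |r| ≤ 3 * z := by
    rw [hrz]
    have := mul_le_mul_of_nonneg_right hδ1.le hz0
    linarith
  have hwl : |w * l⁻¹ * (w * D⁻¹)| ≤ B * B * (B * B) := hmul (hmul hw hl) (hmul hw hJ)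
  have hkl : |k' * l⁻¹ * (w * D⁻¹)| ≤ B * B * (B * B) := hmul (hmul hk' hl) (hmul hw hJ)
  have f4 : B * B * (B * B) = B ^ 4 := by ring
  have hk'l := hmul hk' hl
  have hKz : (9 * B ^ 4 + 3 * M / δ) * z ≤ K * z := mul_le_mul_of_nonneg_right hK hz0
  have hMz : 0 ≤ 3 * M / δ * z := mul_nonneg hMδ hz0
  have hBz : 0 ≤ B ^ 4 * z := mul_nonneg hB4 hz0
  rw [← hz]
  refine ⟨by linarith, ?_, ?_, ?_, ?_, ?_, ?_⟩
  · refine (hmul hw hJ).trans ?_; rw [← sq]; linarith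
  · refine (hmul hk' hJ).trans ?_; rw [← sq]; linarith
  · refine (hmul (show |p| ≤ 1 by rwa [abs_of_nonneg hp0]) hk'l).trans ?_; rw [← sq, one_mul]; linarith
  · have h1 : k + w * D⁻¹ = -(r * (w * l⁻¹ * (w * D⁻¹))) := by
      rw [hkw]; field_simp; rw [hD]; ring
    rw [h1, abs_neg]
    refine (hmul hrz' hwl).trans ?_
    rw [f4]; linarith
  · rw [abs_div, abs_of_pos hδ]
    rw [hrδ] at hp'
    have h1 : |p'| / δ ≤ 3 * M / δ * z := by
      rw [div_mul_eq_mul_div]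
      gcongr
      linarith
    linarith
  · have h1 : k' * D⁻¹ - p * (k' * l⁻¹)
        = -(r * (k' * l⁻¹ * (w * D⁻¹))) + (1 - p) * (k' * l⁻¹) := by
      field_simp; rw [hD]; ring
    rw [h1]
    refine (abs_add_le _ _).trans ?_
    rw [abs_neg]
    have h2 := hmul hrz' hkl
    have h3 := hmul (show |1 - p| ≤ 6 * z by rw [abs_of_nonneg (by linarith)]; linarith) hk'l
    have h4 : 6 * z * (B * B) ≤ 6 * z * B ^ 4 := by
      rw [← sq]; exact mul_le_mul_of_nonneg_left e4 (by linarith)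
    rw [f4] at h2
    linarith

namespace MovingTube

variable {γ N : ℝ → ℝ → Plane} {U : ℝ → Set Plane} {φ : ℝ → ℝ} {η : ℝ → Plane → ℝ}

/-- A constant bounding all the geometric quantities entering the pointwise estimate. -/
theorem exists_pointwise (m : MovingTube T (4 * δ₀) γ N U) (hδ : δ₀ ∈ Ioo (0 : ℝ) 1) (hφ : IsProfile φ)
    (hη : IsCutoff T δ₀ γ η) {μ : ℝ} (hμ : 0 < μ) : ∃ K : ℝ, 1 ≤ K ∧ ∀ t ∈ Ioo 0 T, ∀ x,
      |curvSlope φ δ₀ η γ U t x| ≤ K ∧ ‖movingCurv η γ U t x‖ ≤ K ∧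
      ‖fderiv ℝ (curvSlope φ δ₀ η γ U t) x‖ ≤ K ∧
      ∀ (q : Plane →L[ℝ] Plane) (e : Plane) (G : ℝ), ‖e‖ ≤ 1 → G * ‖e‖ ^ 2 = G →
      (1 / 2) * divOf (fderiv ℝ (movingXi φ δ₀ γ U t) x) ^ 2 * G ^ 2 + ‖q (movingCurv η γ U t x)‖ ^ 2 / 2
      - G * inner ℝ e (q (dtime (movingXi φ δ₀ γ U) t x))
      + stress μ (fderiv ℝ (movingCurv η γ U t) x) q (G ^ 2)
      - μ * curvSlope φ δ₀ η γ U t x * divOf q * divOf (perpL.comp q)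
        ≤ 100 * K ^ 2 * (1 + μ) * modForm μ q G e (movingXi φ δ₀ γ U t x) := by
  obtain ⟨hδ0, hδ1⟩ := hδ
  have h14 : δ₀ < 4 * δ₀ := by linarith
  have h24 : 2 * δ₀ < 4 * δ₀ := by linarith
  obtain ⟨B, hB1, hB⟩ := m.exists_geometry_bound hδ0
  obtain ⟨M, hM0, hM⟩ := hφ.exists_deriv_bound
  obtain ⟨KH, hKH0, hKH⟩ := m.exists_bound (m.smooth_curv_chart hη)
    (fun t ht s r hr => m.movingCurv_chart hδ0 ht s hr) h24
    fun t ht x hx => movingCurv_eq_zero hη (Ioo_subset_Icc_self ht) hx.le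
  obtain ⟨Ka, hKa0, hKa⟩ := m.exists_bound (m.smooth_slope_chart hφ δ₀)
    (fun t ht s r hr => m.curvSlope_chart hδ0 hη ht s hr) h14
    fun t ht x hx => curvSlope_eq_zero hφ hδ0 hx.le
  have hB4 : 1 ≤ B ^ 4 := one_le_pow₀ hB1
  have hMδ : 0 ≤ 3 * M / δ₀ := by positivity
  refine ⟨9 * B ^ 4 + 3 * M / δ₀ + KH + Ka, by linarith, fun t ht x => ⟨?_, ?_, ?_, fun q e G he hGe => ?_⟩⟩
  · have := (hKa t ht x).1; rw [Real.norm_eq_abs] at this; linarith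
  · linarith [(hKH t ht x).1]
  · linarith [(hKa t ht x).2]
  have ht' := Ioo_subset_Icc_self ht
  rcases lt_or_ge (infDist x (range (γ t))) δ₀ with hx | hx
  · obtain ⟨s, hs, r, hr, rfl⟩ := m.exists_coord ht' (hx.trans h14)
    rw [← hr] at hx
    have hr4 := hx.trans h14
    obtain ⟨b1, b2, b3, b4, b5⟩ := hB t ht s hs r hx
    have hrδ : |r / δ₀| ≤ 1 := by rw [abs_div, abs_of_pos hδ0, div_le_one hδ0]; exact hx.le
    obtain ⟨c1, c2, c3, c4, c5, c6, c7⟩ := geometry_estimates hB1 hδ0 hδ1 hM0 b1 b2 b3 b4 b5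
      (m.jacobian_ne_zero ht' s hr4) (m.speed_ne_zero ht' s) rfl (hφ.nonneg (r / δ₀)) (hφ.le_one (r / δ₀))
      (hφ.one_sub_le (r / δ₀)) (hM (r / δ₀)) (K := 9 * B ^ 4 + 3 * M / δ₀ + KH + Ka) (by linarith)
    have hβ : (|r| / (3 * δ₀)) ^ 2 ≤ 1 - φ (r / δ₀) := by
      have h1 := hφ.le_sub hrδ
      have h2 : (|r| / (3 * δ₀)) ^ 2 = (r / δ₀) ^ 2 / 9 := by rw [div_pow, sq_abs]; field_simp; norm_num
      rw [h2]
      linarith [sq_nonneg (r / δ₀)]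
    have key := near_pointwise q hμ (by linarith) (by ring : φ (r / δ₀) = 1 - (1 - φ (r / δ₀)))
      (by linarith [hφ.le_one (r / δ₀)]) (by linarith [hφ.nonneg (r / δ₀)]) hβ (m.norm_normal ht' s) he hGe
      c1 c2 c3 c4 c5 c6 c7 (B := fderiv ℝ (movingCurv η γ U t) (chart γ N (t, s, r))) (fun v => by
        rw [m.fderiv_movingCurv hδ0 hη ht s hx]
        module)
    have hη1 : η t (chart γ N (t, s, r)) = 1 := by
      refine hη.one t ht' _ ?_
      rw [mem_thickening_iff_infDist_lt (range_nonempty _), m.infDist_chart ht' s hr4]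
      exact hx
    rw [m.divOf_movingXi hδ0 hφ ht s hr4, m.dtime_movingXi hδ0 hφ ht s hr4,
      m.movingXi_chart ht' s hr4, m.curvSlope_chart hδ0 hη ht s hr4, m.movingCurv_chart hδ0 ht s hr4,
      hη1, mul_one]
    exact key
  · have hxi := movingXi_eq_zero (U := U) hφ hδ0 hx
    have hsl := curvSlope_eq_zero (U := U) (η := η) hφ hδ0 hx
    have hz : divOf (fderiv ℝ (movingXi φ δ₀ γ U t) x) = 0 ∧ dtime (movingXi φ δ₀ γ U) t x = 0 := by
      rcases hx.lt_or_eq with hx | hx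
      · have h0 : ∀ t ∈ Ioo 0 T, ∀ x, δ₀ < infDist x (range (γ t)) → movingXi φ δ₀ γ U t x = 0 :=
          fun t _ x hx => movingXi_eq_zero hφ hδ0 hx.le
        rw [m.fderiv_eq_zero h14 h0 ht hx, m.dtime_eq_zero h14 h0 ht hx]
        exact ⟨by simp [divOf], rfl⟩
      · obtain ⟨s, hs, r, hr, rfl⟩ := m.exists_coord ht' (hx.symm.trans_lt h14)
        have hr4 : |r| < 4 * δ₀ := by rw [hr, ← hx]; exact h14
        have hrδ : 1 ≤ |r / δ₀| := by rw [abs_div, abs_of_pos hδ0, hr, ← hx, div_self hδ0.ne']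
        have h1 := m.divOf_movingXi hδ0 hφ ht s hr4
        have h2 := m.dtime_movingXi hδ0 hφ ht s hr4
        rw [hφ.zero _ hrδ, hφ.deriv_eq_zero hrδ] at h1 h2
        simp only [zero_div, zero_mul, add_zero, zero_smul, sub_zero, neg_zero] at h1 h2
        exact ⟨h1, h2⟩
    have key := far_pointwise (μ := μ) (K := 9 * B ^ 4 + 3 * M / δ₀ + KH + Ka) (G := G) (e := e)
      (H := movingCurv η γ U t x) (fderiv ℝ (movingCurv η γ U t) x) q hμ (by linarith)
      (by linarith [(hKH t ht x).1]) (by linarith [(hKH t ht x).2])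
    rw [hz.1, hz.2, hxi, hsl, map_zero, inner_zero_right]
    linarith

/-- The compact tube swept out by the moving curve. -/
theorem infDist_le_subset (m : MovingTube T (4 * δ₀) γ N U) (hδ : 0 < δ₀)
    (hΩ : IsOpen Ω)
    (hd : ∀ t ∈ Icc 0 T, ∀ x ∈ range (γ t), x ∈ Ω ∧ 4 * δ₀ ≤ infDist x (frontier Ω)) :
    Prod.snd '' spaceTimeTube T (2 * δ₀) γ ⊆ Ω := by
  rintro _ ⟨⟨t, x⟩, ⟨ht, hx⟩, rfl⟩
  change infDist x (range (γ t)) ≤ 2 * δ₀ at hx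
  change t ∈ Icc 0 T at ht
  obtain ⟨s, -, r, hr, hxr⟩ := m.exists_coord ht (by linarith)
  obtain ⟨hyΩ, hyd⟩ := hd t ht _ (mem_range_self s)
  have hxy : dist (γ t s) x ≤ 2 * δ₀ := by
    rw [hxr, chart, dist_comm, dist_eq_norm, add_sub_cancel_left, norm_smul, m.norm_normal ht, mul_one,
      Real.norm_eq_abs, hr]
    exact hx
  by_contra hxΩ
  rcases (convex_segment (γ t s) x).isPreconnected.subset_or_subset hΩ
    isClosed_closure.isOpen_compl (disjoint_compl_right.mono_left subset_closure)
    (fun z hz => by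
      by_cases hzU : z ∈ Ω
      · exact Or.inl hzU
      · refine Or.inr fun hcl => ?_
        have h1 : z ∈ frontier Ω := by rw [hΩ.frontier_eq]; exact ⟨hcl, hzU⟩
        have h2 := infDist_le_dist_of_mem (x := γ t s) h1
        have h3 := dist_add_dist_of_mem_segment hz
        linarith [dist_nonneg (x := z) (y := x)]) with h1 | h1
  · exact hxΩ (h1 (right_mem_segment ℝ _ _))
  · exact h1 (left_mem_segment ℝ _ _) (subset_closure hyΩ)

theorem exists_isCalibration (m : MovingTube T (4 * δ₀) γ N U) (hδ : δ₀ ∈ Ioo (0 : ℝ) 1) (hφ : IsProfile φ)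
    (hη : IsCutoff T δ₀ γ η) {μ : ℝ} (hμ : 0 < μ) : ∃ C K R : ℝ, 0 ≤ C ∧ 0 ≤ K ∧
      ∀ Ω : Set Plane, IsSmoothBoundedDomain Ω →
      (∀ t ∈ Icc 0 T, ∀ x ∈ range (γ t), x ∈ Ω ∧ 4 * δ₀ ≤ infDist x (frontier Ω)) →
      ∀ S ∈ Ioc 0 T, ∃ a, IsCalibration Ω S μ K C R (movingXi φ δ₀ γ U) (movingCurv η γ U) a := by
  have hδ0 := hδ.1
  obtain ⟨K, hK1, hK⟩ := m.exists_pointwise hδ hφ hη hμ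
  have hZ : IsCompact (Prod.snd '' spaceTimeTube T (2 * δ₀) γ) :=
    (m.isCompact_spaceTimeTube (by linarith)).image continuous_snd
  obtain ⟨R, hR⟩ := hZ.isBounded.subset_closedBall 0
  have hcont : ContinuousOn (uncurry (movingXi φ δ₀ γ U)) (Icc 0 T ×ˢ univ) :=
    m.continuousOn (by linarith : δ₀ < 4 * δ₀) (m.smooth_xi_chart hφ δ₀)
      (fun t ht s r hr => m.movingXi_chart ht s hr) fun t _ x hx => movingXi_eq_zero hφ hδ0 hx.le
  refine ⟨100 * K ^ 2 * (1 + μ), K, R, by positivity, by linarith, fun Ω hΩ hd S hS =>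
    ⟨curvSlope φ δ₀ η γ U, ?_⟩⟩
  have hI : Ioo 0 S ⊆ Ioo 0 T := Ioo_subset_Ioo_right hS.2
  have hJ : Icc 0 S ⊆ Icc 0 T := Icc_subset_Icc_right hS.2
  have hmono : ∀ {E : Type} [NormedAddCommGroup E] [NormedSpace ℝ E] {F : ℝ → Plane → E},
      SmoothField T F → SmoothField S F := fun hF => ContDiffOn.mono hF (prod_mono_left hI)
  have hout : ∀ t ∈ Ioo 0 T, ∀ x, x ∉ Prod.snd '' spaceTimeTube T (2 * δ₀) γ →
      2 * δ₀ < infDist x (range (γ t)) := fun t ht x hx => by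
    by_contra hcon
    exact hx ⟨(t, x), ⟨Ioo_subset_Icc_self ht, not_lt.1 hcon⟩, rfl⟩
  have hsupp : ∀ t ∈ Ioo 0 S, tsupport (curvSlope φ δ₀ η γ U t)
      ⊆ Prod.snd '' spaceTimeTube T (2 * δ₀) γ := fun t ht =>
    tsupport_subset_of_eq_zero hZ.isClosed fun x hx =>
      curvSlope_eq_zero hφ hδ0 (by linarith [hout t (hI ht) x hx])
  exact
    { norm_le := fun t ht x => by
        rcases lt_or_ge (infDist x (range (γ t))) δ₀ with hx | hx
        · obtain ⟨s, -, r, hr, rfl⟩ := m.exists_coord (hJ ht) (by linarith)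
          have h1 := m.movingXi_chart (φ := φ) (hJ ht) s (r := r) (by linarith)
          rw [h1, norm_smul, m.norm_normal (hJ ht), mul_one, Real.norm_eq_abs, abs_of_nonneg (hφ.nonneg _)]
          exact hφ.le_one _
        · rw [movingXi_eq_zero hφ hδ0 hx, norm_zero]; exact zero_le_one
      measurable := fun t ht => Continuous.measurable (continuousOn_univ.1
        (hcont.comp (f := fun x => (t, x)) (by fun_prop) fun x _ => ⟨hJ ht, mem_univ x⟩))
      continuous_time := fun x => hcont.comp (f := fun t => (t, x)) (by fun_prop)
        fun t ht => ⟨hJ ht, mem_univ x⟩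
      smooth_xi := hmono (m.smoothField_xi hδ0 hφ)
      smooth_H := hmono (m.smoothField_curv hδ0 hη)
      smooth_a := hmono (m.smoothField_slope hδ0 hφ hη)
      support := ⟨_, hZ, m.infDist_le_subset hδ0 hΩ.isOpen hd, fun t ht =>
        ⟨tsupport_subset_of_eq_zero hZ.isClosed fun x hx =>
          movingXi_eq_zero hφ hδ0 (by linarith [hout t (hI ht) x hx]),
        tsupport_subset_of_eq_zero hZ.isClosed fun x hx =>
          movingCurv_eq_zero hη (hJ (Ioo_subset_Icc_self ht)) (hout t (hI ht) x hx).le,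
        hsupp t ht⟩⟩
      support_a := fun t ht => (hsupp t ht).trans hR
      a_le := fun t ht x => (hK t (hI ht) x).1
      H_le := fun t ht x => (hK t (hI ht) x).2.1
      grad_a_le := fun t ht x => (hK t (hI ht) x).2.2.1
      pointwise := fun t ht x => (hK t (hI ht) x).2.2.2 }

end MovingTube

end

end AnisoGL

open AnisoGL in
theorem mainTheorem3
    (T : ℝ) (hT : 0 < T)
    (γ : ℝ → ℝ → Plane) (hγ : IsEvolvingCurve T γ) (hflow : IsCurveShortening T γ)
    (U : ℝ → Set Plane) (hU : ∀ t ∈ Icc 0 T, IsEnclosedDomain (U t) (range (γ t)))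
    (δ₀ : ℝ) (hδ₀ : δ₀ ∈ Ioo (0 : ℝ) 1)
    (hproj : ∀ t ∈ Icc 0 T, HasSmoothProjection (range (γ t)) (4 * δ₀))
    (φ : ℝ → ℝ) (hφ : IsProfile φ)
    (η : ℝ → Plane → ℝ) (hη : IsCutoff T δ₀ γ η)
    (f g : ℝ → ℝ) (hfg : IsAdmissiblePotential f g)
    (μ : ℝ) (hμ : 0 < μ) (c₁ : ℝ) (hc₁ : 0 < c₁) :
    ∃ C : ℝ, 0 < C ∧
      ∀ Ω : Set Plane, IsSmoothBoundedDomain Ω →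
      (∀ t ∈ Icc 0 T, ∀ x ∈ range (γ t), x ∈ Ω ∧ 4 * δ₀ ≤ infDist x (frontier Ω)) →
      ∀ ε : ℝ, 0 < ε → ∀ S ∈ Ioc 0 T,
      ∀ (uin : Plane → Plane) (u ut : ℝ → Plane → Plane),
      IsWellPrepared Ω μ ε c₁ δ₀ f g φ (range (γ 0)) (U 0) uin →
      IsStrongSolution Ω S μ ε f uin u ut →
      (∀ t ∈ Icc 0 S,
        IntegrableOn (modDensity Ω μ ε f g (xiField φ δ₀ (range (γ t)) (U t)) (u t)) Ω) ∧
      dissipation Ω S (fun t => curvField (η t) (range (γ t)) (U t)) u ut ≠ ⊤ ∧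
      ∀ t ∈ Icc 0 S,
        ε⁻¹ * modEnergy Ω μ ε f g (xiField φ δ₀ (range (γ t)) (U t)) (u t)
          + (dissipation Ω S (fun t => curvField (η t) (range (γ t)) (U t)) u ut).toReal
          ≤ Real.exp ((1 + S) * C) := by
  have h4 : 0 < 4 * δ₀ := by linarith [hδ₀.1]
  obtain ⟨N, m⟩ := hγ.exists_movingTube hT hflow hU h4 hproj
  obtain ⟨C, K, R, hC, hK, hcal⟩ := m.exists_isCalibration hδ₀ hφ hη hμ
  exact stability_of_calibration hT hfg hμ hc₁ hC hK hcal
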